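/- Let $k$ be an algebraically closed field of arbitrary characteristic, let $n\ge 2$ and $g\ge n+3$ be integers, and let $E\subset\mathbb P^{g-1}_k$ be an elliptic normal curve, i.e. a smooth curve of genus $1$ embedded by the complete linear system of a line bundle of degree $g$. Let $\Lambda\subset\mathbb P^{g-1}$ be a quasi-transverse $n$-secant $(n-1)$-plane to $E$: a linear subspace of dimension $n-1$ that meets $E$ in exactly $n$ points, such that at each of these points $p$ the tangent line $T_pE$ meets $\Lambda$ only in $p$. For a linear subspace $M\subset\Lambda$ let the pointing bundle $N_{E\to M}\subset N_E$ be the subbundle of rank $\dim M+1$ of the normal bundle of $E$ that is generically the kernel of the map from $N_E$ to the normal sheaf of the projection of $E$ from $M$ (that is, generically spanned by the directions pointing towards $M$). For a vector bundle $V$ on $E$, a subbundle $F\subset V$ and $p\in E$ let $V[p\to F]=\ker\bigl(V\to V|_p/F|_p\bigr)\otimes\mathcal O_E(p)$ be the positive elementary modification, and for a point $x\in\Lambda$ write $[p\to x]$ for $[p\to N_{E\to x}]$. For a rational curve $R\subset\Lambda$ of degree $n-1$ that passes through the points $p_1,\dots,p_n$ of $E\cap\Lambda$, let $$N_{E\to\Lambda}[\rightsquigarrow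 R]=N_{E\to\Lambda}[p_1\to x_1]\cdots[p_n\to x_n],$$ where $x_i$ is any point of the tangent line $T_{p_i}R$ different from $p_i$ (the result does not depend on the choice). Then for a general triple $(R,q,y)$, consisting of a rational curve $R\subset\Lambda$ of degree $n-1$ through $E\cap\Lambda$, a point $q\in R$ and a point $y\in E$ (i.e. for all triples in a nonempty Zariski-open subset of the irreducible parameter space of such triples), the modified pointing bundle $$N_{E\to\Lambda}[\rightsquigarrow R][y\to q]$$ is a stable vector bundle on $E$ of slope $g+3+\frac1n$. -/

import Mathlib

/-!
Smooth projective curves over an algebraically closed field `k` are described by their function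
fields `K` (finitely generated field extensions of transcendence degree one).  The points of the
curve are the nontrivial valuation rings of `K` that contain `k`; the ring attached to a point is
the local ring of the curve there.  A vector bundle is described by its generic fibre `V`, a
finite-dimensional `K`-vector space, and by its stalks, which are lattices in `V` over the local
rings.  Subbundles (saturated subsheaves) correspond to the `K`-subspaces of `V`.
-/

noncomputable section

namespace Pointing

/-- `K` is the function field of a curve over `k`. -/
def IsFunctionFieldOfCurve (k K : Type*) [Field k] [Field K] [Algebra k K] : Prop :=
  ∃ x : K, Transcendental k x ∧ FiniteDimensional (IntermediateField.adjoin k {x}) K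

/-- A point of the smooth projective curve with function field `K`, given by its local ring. -/
structure Place (k K : Type*) [Field k] [Field K] [Algebra k K] where
  ring : ValuationSubring K
  algebraMap_mem : ∀ c : k, algebraMap k K c ∈ ring
  ne_top : ring ≠ ⊤

/-- A family of submodules over all local rings of the curve, inside a `K`-vector space `V`
(the generic fibre).  It is a vector bundle when `Stalks.IsVectorBundle` holds. -/
structure Stalks (k K V : Type*) [Field k] [Field K] [Algebra k K]
    [AddCommGroup V] [Module K V] where
  stalk : ∀ P : Place k K, Submodule P.ring V

namespace Stalks

variable {k K V : Type*} [Field k] [Field K] [Algebra k K] [AddCommGroup V] [Module K V]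

/-- Every stalk is a lattice, and all but finitely many stalks are spanned by one and the same
basis of the generic fibre. -/
def IsVectorBundle (B : Stalks k K V) : Prop :=
  (∀ P, (B.stalk P).FG ∧ Submodule.span K (B.stalk P : Set V) = ⊤) ∧
  ∃ b : Module.Basis (Fin (Module.finrank K V)) K V,
    {P : Place k K | B.stalk P ≠ Submodule.span P.ring (Set.range b)}.Finite

/-- The generalized index `[M : N]` of two lattices, that is
`length (M / (M ∩ N)) - length (N / (M ∩ N))`. -/
def relLength {R M : Type*} [CommRing R] [AddCommGroup M] [Module R M]
    (N₁ N₂ : Submodule R M) : ℤ :=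
  ((Module.length R (N₁ ⧸ (N₁ ⊓ N₂).submoduleOf N₁)).toNat : ℤ) -
    ((Module.length R (N₂ ⧸ (N₁ ⊓ N₂).submoduleOf N₂)).toNat : ℤ)

/-- The degree: compare the stalks with the trivial bundle spanned by a basis of the generic fibre.
(By the product formula the choice of the basis does not matter.) -/
def deg [FiniteDimensional K V] (B : Stalks k K V) : ℤ :=
  ∑ᶠ P : Place k K,
    relLength (B.stalk P) (Submodule.span P.ring (Set.range (Module.finBasis K V)))

/-- The slope, degree divided by rank. -/
def slope [FiniteDimensional K V] (B : Stalks k K V) : ℚ :=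
  (B.deg : ℚ) / (Module.finrank K V : ℚ)

/-- The subbundle with generic fibre `W`. -/
def sub (B : Stalks k K V) (W : Submodule K V) : Stalks k K W where
  stalk P := (B.stalk P).comap (W.subtype.restrictScalars P.ring)

/-- A stable vector bundle: every proper nonzero subbundle has strictly smaller slope. -/
def IsStable [FiniteDimensional K V] (B : Stalks k K V) : Prop :=
  B.IsVectorBundle ∧ 0 < Module.finrank K V ∧
    ∀ W : Submodule K V, W ≠ ⊥ → W ≠ ⊤ → (B.sub W).slope < B.slope

/-- The global sections of a line bundle with generic fibre `K`. -/
def globalSections (L : Stalks k K K) : Submodule k K where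
  carrier := {f | ∀ P, f ∈ L.stalk P}
  add_mem' hf hg P := add_mem (hf P) (hg P)
  zero_mem' P := zero_mem _
  smul_mem' c f hf P := by
    have h := (L.stalk P).smul_mem (⟨algebraMap k K c, P.algebraMap_mem c⟩ : P.ring) (hf P)
    rw [Algebra.smul_def]
    exact h

open Classical in
/-- The negative modification of `B` along the reduced divisor `D` towards the subbundles with
generic fibre `F P` (for `P ∈ D`): the sections of `B` whose value at `P` lies in the fibre of
that subbundle. -/
def negModification (B : Stalks k K V) (D : Set (Place k K))
    (F : Place k K → Submodule K V) : Stalks k K V where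
  stalk P := if P ∈ D then
      ((F P).restrictScalars P.ring ⊓ B.stalk P) ⊔ IsLocalRing.maximalIdeal P.ring • B.stalk P
    else B.stalk P

open Classical in
/-- The twist `B(D)` by a reduced divisor `D`: simple poles are allowed along `D`. -/
def twist (B : Stalks k K V) (D : Set (Place k K)) : Stalks k K V where
  stalk P := if P ∈ D then
      { carrier := {v | ∀ m ∈ IsLocalRing.maximalIdeal P.ring, m • v ∈ B.stalk P}
        add_mem' := fun hv hw m hm => by rw [smul_add]; exact add_mem (hv m hm) (hw m hm)
        zero_mem' := fun m _ => by rw [smul_zero]; exact zero_mem _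
        smul_mem' := fun c v hv m hm => by
          rw [smul_comm]; exact (B.stalk P).smul_mem c (hv m hm) }
    else B.stalk P

/-- The positive modification `B[P → F P : P ∈ D]`: the negative one, twisted by `D`. -/
def posModification (B : Stalks k K V) (D : Set (Place k K))
    (F : Place k K → Submodule K V) : Stalks k K V :=
  (B.negModification D F).twist D

end Stalks

/-- The curve with function field `K` has genus `p`:  `p` is the maximum of
`deg L - h⁰(L) + 1` over all line bundles `L`. -/
def HasGenus (k K : Type*) [Field k] [Field K] [Algebra k K] (p : ℤ) : Prop :=
  IsGreatest {x : ℤ | ∃ L : Stalks k K K, L.IsVectorBundle ∧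
    x = L.deg - (Module.finrank k L.globalSections : ℤ) + 1} p

section Embedded

variable {k K : Type*} [Field k] [Field K] [Algebra k K] {g : ℕ}

/-- `γ` are the homogeneous coordinates (at the generic point) of an elliptic normal curve of
degree `g` in `ℙ^{g-1}`: a curve of genus one, embedded by a basis of the space of
sections of a line bundle of degree `g`. -/
def IsEllipticNormalCurve (k : Type*) {K : Type*} [Field k] [Field K] [Algebra k K] {g : ℕ}
    (γ : Fin g → K) : Prop :=
  IsFunctionFieldOfCurve k K ∧ HasGenus k K 1 ∧
    ∃ L : Stalks k K K, L.IsVectorBundle ∧ L.deg = g ∧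
      LinearIndependent k γ ∧ Submodule.span k (Set.range γ) = L.globalSections

/-- The fibre at `P`, as a subspace of `k^g`, of the subbundle of the trivial bundle of rank `g`
that has generic fibre `W`: the reductions at `P` of the elements of `W` regular at `P`. -/
def fibreAt (W : Submodule K (Fin g → K)) (P : Place k K) : Submodule k (Fin g → k) where
  carrier := {v | ∃ w ∈ W, ∀ i, P.ring.valuation (w i - algebraMap k K (v i)) < 1}
  add_mem' := by
    rintro v v' ⟨w, hw, h⟩ ⟨w', hw', h'⟩
    refine ⟨w + w', add_mem hw hw', fun i => ?_⟩
    have e : (w + w') i - algebraMap k K ((v + v') i) =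
        (w i - algebraMap k K (v i)) + (w' i - algebraMap k K (v' i)) := by
      simp only [Pi.add_apply, map_add]; ring
    rw [e]
    exact Valuation.map_add_lt _ (h i) (h' i)
  zero_mem' := ⟨0, zero_mem _, fun i => by simp⟩
  smul_mem' := by
    rintro c v ⟨w, hw, h⟩
    refine ⟨algebraMap k K c • w, W.smul_mem _ hw, fun i => ?_⟩
    have e : (algebraMap k K c • w) i - algebraMap k K ((c • v) i) =
        algebraMap k K c * (w i - algebraMap k K (v i)) := by
      simp only [Pi.smul_apply, smul_eq_mul, map_mul]; ring
    rw [e, map_mul]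
    exact mul_lt_one_of_nonneg_of_lt_one_right
      ((P.ring.valuation_le_one_iff _).2 (P.algebraMap_mem c)) zero_le' (h i)

/-- The affine tangent line (a two-dimensional space) at the generic point: the span of `γ` and
of its derivatives. -/
def genericTangent (k : Type*) {K : Type*} [Field k] [Field K] [Algebra k K] {g : ℕ}
    (γ : Fin g → K) : Submodule K (Fin g → K) :=
  Submodule.span K ({γ} ∪ Set.range fun (D : Derivation k K K) (i : Fin g) => D (γ i))

/-- The point of `ℙ^{g-1}` under `P`, as a line in `k^g`. -/
def pointAt (γ : Fin g → K) (P : Place k K) : Submodule k (Fin g → k) :=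
  fibreAt (Submodule.span K {γ}) P

/-- The tangent line of the embedded curve at `P`, as a plane in `k^g`. -/
def tangentAt (γ : Fin g → K) (P : Place k K) : Submodule k (Fin g → k) :=
  fibreAt (genericTangent k γ) P

/-- The generic fibre of the normal bundle `N_E`.  (It is really `Hom (K ∙ γ, K^g / T)` where `T`
is the generic affine tangent line; a homomorphism is identified with its value at `γ`.) -/
abbrev NormalSpace (k : Type*) {K : Type*} [Field k] [Field K] [Algebra k K] {g : ℕ}
    (γ : Fin g → K) : Type _ :=
  (Fin g → K) ⧸ genericTangent k γ

/-- The normal bundle `N_E`.  By the Euler sequence, `N_E(-1)` is the quotient of the trivial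
bundle of rank `g` by the affine tangent lines, so its stalk at `P` is spanned by the classes of the
coordinate vectors.  The stalk at `P` of `N_E = Hom (𝒪(-1), N_E(-1))` consists of the
homomorphisms that send the sections `a γ` of `𝒪(-1)` regular at `P` to this stalk. -/
def normalBundle (γ : Fin g → K) : Stalks k K (NormalSpace k γ) where
  stalk P :=
    { carrier := {v | ∀ a : K, (∀ i, a * γ i ∈ P.ring) →
        a • v ∈ Submodule.span P.ring (Set.range fun i : Fin g =>
          (genericTangent k γ).mkQ (Pi.single i 1))}
      add_mem' := fun hv hw a ha => by rw [smul_add]; exact add_mem (hv a ha) (hw a ha)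
      zero_mem' := fun a _ => by rw [smul_zero]; exact zero_mem _
      smul_mem' := fun c v hv a ha => by
        rw [smul_comm]; exact Submodule.smul_mem _ c (hv a ha) }

/-- The generic fibre of the pointing bundle `N_{E → Λ}`: the kernel of the map from normal vectors
of `E` to normal vectors of the projection of `E` from `Λ`, which is the image of `Λ`. -/
def pointingSpace (γ : Fin g → K) (Λ : Submodule k (Fin g → k)) :
    Submodule K (NormalSpace k γ) :=
  (Submodule.span K ((fun v : Fin g → k => fun i => algebraMap k K (v i)) '' Λ)).map
    (genericTangent k γ).mkQ

/-- The pointing bundle `N_{E → Λ}`, a subbundle of the normal bundle. -/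
def pointingBundle (γ : Fin g → K) (Λ : Submodule k (Fin g → k)) :
    Stalks k K (pointingSpace γ Λ) :=
  (normalBundle γ).sub (pointingSpace γ Λ)

/-- The points of `E ∩ Λ`. -/
def secantPoints (γ : Fin g → K) (Λ : Submodule k (Fin g → k)) : Set (Place k K) :=
  {P | pointAt γ P ≤ Λ}

/-- `Λ` (a linear subspace of `k^g` of dimension `n`) is a quasi-transverse `n`-secant
`(n-1)`-plane: it meets `E` in `n` points, and at each of them the tangent line
of `E` meets `Λ` only in the point itself. -/
structure IsQuasiTransverseSecant (γ : Fin g → K) (n : ℕ) (Λ : Submodule k (Fin g → k)) :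
    Prop where
  finrank_eq : Module.finrank k Λ = n
  finite : (secantPoints γ Λ).Finite
  ncard_eq : (secantPoints γ Λ).ncard = n
  transverse : ∀ P ∈ secantPoints γ Λ, tangentAt γ P ⊓ Λ = pointAt γ P

/-- The value at `s = (s₀, s₁)` of the parametrized rational curve
`∑ j < n, s₀ ^ j * s₁ ^ (n - 1 - j) • a j` of degree `n - 1`. -/
def curveValue {n : ℕ} (a : Fin n → Fin g → k) (s : Fin 2 → k) : Fin g → k :=
  ∑ j : Fin n, (s 0 ^ (j : ℕ) * s 1 ^ (n - 1 - (j : ℕ))) • a j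

/-- The tangent line of that curve at the parameter `s` (as a plane in `k^g`), spanned by the value
and by the two partial derivatives. -/
def curveTangent {n : ℕ} (a : Fin n → Fin g → k) (s : Fin 2 → k) : Submodule k (Fin g → k) :=
  Submodule.span k {curveValue a s,
    ∑ j : Fin n, (((j : ℕ) : k) * s 0 ^ ((j : ℕ) - 1) * s 1 ^ (n - 1 - (j : ℕ))) • a j,
    ∑ j : Fin n, (((n - 1 - (j : ℕ) : ℕ) : k) * s 0 ^ (j : ℕ) * s 1 ^ (n - 1 - (j : ℕ) - 1)) • a j}

/-- The coefficients `a` define a rational curve `R ⊂ Λ` of degree `n - 1` through the points of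
`E ∩ Λ`.  (When these are `n` points spanning `Λ ≅ ℙ^{n-1}`, such an `R` spans `Λ`, so that
the parametrization has no base points and `R` is a rational normal curve.) -/
def IsRationalCurveThrough (γ : Fin g → K) (Λ : Submodule k (Fin g → k)) {n : ℕ}
    (a : Fin n → Fin g → k) : Prop :=
  (∀ j, a j ∈ Λ) ∧
    ∀ P ∈ secantPoints γ Λ, ∃ s : Fin 2 → k, curveValue a s ≠ 0 ∧ curveValue a s ∈ pointAt γ P

/-- `x` is a point of the tangent line of `R` at the point under `P`, different from this point
(a linear space complementary to the point in the tangent line). -/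
def IsTangentPoint (γ : Fin g → K) {n : ℕ} (a : Fin n → Fin g → k) (P : Place k K)
    (x : Fin g → k) : Prop :=
  ∃ s : Fin 2 → k, curveValue a s ≠ 0 ∧ curveValue a s ∈ pointAt γ P ∧
    x ∈ curveTangent a s ∧ x ∉ pointAt γ P

/-- The parameter space: a rational curve `R ⊂ Λ` of degree `n - 1` through `E ∩ Λ`,
given by `a`, a point `q = curveValue a s` of `R`, and a point `y` of `E` with homogeneous
coordinates `v`. -/
structure IsConfiguration (γ : Fin g → K) (Λ : Submodule k (Fin g → k)) {n : ℕ}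
    (a : Fin n → Fin g → k) (s : Fin 2 → k) (y : Place k K) (v : Fin g → k) : Prop where
  curve : IsRationalCurveThrough γ Λ a
  parameter_ne : s ≠ 0
  point_mem : v ∈ pointAt γ y
  point_ne : v ≠ 0

/-- All coordinates of a configuration, in one vector. -/
def configCoords {n : ℕ} (a : Fin n → Fin g → k) (s : Fin 2 → k) (v : Fin g → k) :
    (Fin n × Fin g) ⊕ Fin 2 ⊕ Fin g → k :=
  Sum.elim (fun i => a i.1 i.2) (Sum.elim s v)

/-- The bundle `N_{E → Λ}[⇝ R][y → q]`: the positive modification of the pointing bundle at each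
point `P` of `E ∩ Λ` towards `N_{E → x P}`, where `x P` is a tangent point of `R`, and
then at `y` towards `N_{E → q}`. -/
def modifiedPointingBundle (γ : Fin g → K) (Λ : Submodule k (Fin g → k))
    (x : Place k K → Fin g → k) (y : Place k K) (q : Fin g → k) :
    Stalks k K (pointingSpace γ Λ) :=
  ((pointingBundle γ Λ).posModification (secantPoints γ Λ) fun P =>
      (pointingSpace γ (Submodule.span k {x P})).comap (pointingSpace γ Λ).subtype).posModification
    {y} fun _ =>
      (pointingSpace γ (Submodule.span k {q})).comap (pointingSpace γ Λ).subtype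

end Embedded

end Pointing

end

/-! Let `H` be the hyperplane divisor and `p 1, …, p n` the points of `E ∩ Λ`. The pointing bundle
splits as the direct sum of the line bundles `𝒪(H + 2 p j)`, the `j`-th summand being the bundle of
directions towards `p j` (`IsEmbedding.sum_constNormal_mem_iff`, `IsSecant.pointingBundle_stalk`).
The `n + 1` modifications each add one to the degree, so the resulting bundle `X` has rank `n` and
degree `n (g + 3) + 1`. Dually, a section of `X^∨(H + D)` gives functions `φ j` in `ℒ(D - 2 p j)`
subject to one linear condition at every `p l` and one at `y` (`IsModification.dual_mem_sections`).

On a curve of genus one, a subbundle contradicting stability has an annihilator in `X^∨` of slope at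
least `-(g + 3)`, and Riemann's inequality gives this annihilator a section after a suitable twist
of degree `g + 3`. So `X` is stable once no divisor `D` of degree `3` admits a nonzero tuple `φ`.

Such an `X` is found for one special curve. If `R` passes through `p j` at the parameter `s j`, and
`q` has the parameter `σ`, then after scaling the conditions form a Cauchy system: the sum of `φ j /
(s l - s j)` vanishes at `p l`, and the sum of `φ j / (σ - s j)` vanishes at `y`, to order one
relative to `D`. Without the condition at `y` the bundle of tuples has slope `-3`. The parameters
are chosen by induction on the number `m` of points, and two properties are carried along: some
twist of degree `3` has no section (`CauchyGood`), and every such twist has at most one section up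
to scalars (`CauchyOne`). Together they make the condition at `y` kill all sections for all but
finitely many `σ` (`CauchyGood.finite_not_stable`). With `σ = s m` and `y = p m` this gives
`CauchyOne` for `m + 1` points (`CauchyStable.one_succ`). `CauchyGood` passes from `m` to `m + 2` by
letting two parameters collide, since the system then becomes block triangular
(`CauchyGood.finite_not_add_two`). The cases of two and three points start the induction; three
points whose doubles are linearly equivalent need care, also in characteristic two
(`cauchyGood_three`).

The vanishing for all `D` of degree `3` is not visibly a polynomial condition. It is replaced by a
finite one: for finitely many twists of degree `4`, no sections, not all zero, have a common value
at an auxiliary point `z`. This follows from the vanishing in degree `3`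
(`exists_finset_common_value`), still implies stability (`Stalks.IsVectorBundle.isStable_of_dual`),
and is the injectivity of a single linear map depending polynomially on `(R, q, y)`, hence an open
condition (`IsRigid.exists_open`). The special curve shows that the open set is not empty. -/

noncomputable section
namespace Pointing
open Polynomial

/-! ### Places of a function field of one variable: discreteness, orders, residues. -/

section FunctionField
variable {k K : Type*} [Field k] [Field K] [Algebra k K]

-- The field `K` has transcendence degree one and is essentially of finite type over `k`, so any
-- transcendental element may replace the one given by the definition.
open IntermediateField.algebraAdjoinAdjoin in
theorem IsFunctionFieldOfCurve.finiteDimensional_adjoin (h : IsFunctionFieldOfCurve k K) {t : K}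
    (ht : Transcendental k t) : FiniteDimensional (IntermediateField.adjoin k {t}) K := by
  obtain ⟨x, hx, hfin⟩ := h
  have hx' : AlgebraicIndependent k (fun _ : Unit => x) :=
    algebraicIndependent_unique_type_iff.2 hx
  have ht' : AlgebraicIndependent k (fun _ : Unit => t) :=
    algebraicIndependent_unique_type_iff.2 ht
  have alg : Algebra.IsAlgebraic (IntermediateField.adjoin k {x}) K := inferInstance
  have hbx : IsTranscendenceBasis k (fun _ : Unit => x) := by
    rw [isTranscendenceBasis_iff_algebraicIndependent_isAlgebraic]
    refine ⟨hx', ?_⟩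
    have : Set.range (fun _ : Unit => x) = {x} := by simp
    rw [this]
    exact (IsFractionRing.comap_isAlgebraic_iff (A := Algebra.adjoin k {x})
      (K := IntermediateField.adjoin k {x}) (C := K)).2 alg
  have hbt : IsTranscendenceBasis k (fun _ : Unit => t) := by
    apply ht'.isTranscendenceBasis_of_lift_trdeg_le_of_finite
    rw [← hbx.lift_cardinalMk_eq_trdeg]
  have algt := hbt.isAlgebraic_field
  have hr : Set.range (fun _ : Unit => t) = {t} := by simp
  rw [hr] at algt
  have e1 : Algebra.EssFiniteType k (IntermediateField.adjoin k {x}) :=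
    IntermediateField.essFiniteType_iff.2 ⟨{x}, by simp⟩
  have e2 : Algebra.EssFiniteType k K :=
    Algebra.EssFiniteType.comp k (IntermediateField.adjoin k {x}) K
  have e3 : Algebra.EssFiniteType (IntermediateField.adjoin k {t}) K :=
    Algebra.EssFiniteType.of_comp k _ K
  obtain ⟨s, hs⟩ := IntermediateField.fg_top (IntermediateField.adjoin k {t}) K
  have : FiniteDimensional (IntermediateField.adjoin k {t})
      (IntermediateField.adjoin (IntermediateField.adjoin k {t}) (s : Set K)) :=
    IntermediateField.finiteDimensional_adjoin fun x _ => (algt.isAlgebraic x).isIntegral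
  rw [hs] at this
  exact Module.Finite.equiv
    (IntermediateField.topEquiv (F := IntermediateField.adjoin k {t}) (E := K)).toLinearEquiv

/-- As long as all constant coefficients vanish, the relation can be divided by `t`; this lowers the
total degree, so it comes to an end. -/
theorem exists_coeff_zero_ne_of_sum_eq_zero {ι : Type*} [Fintype ι] {t : K}
    (ht : t ≠ 0) (u : ι → K) (c : ι → k[X]) (hc : ∃ i, c i ≠ 0)
    (h : ∑ i, aeval t (c i) * u i = 0) :
    ∃ c : ι → k[X], (∃ i, (c i).coeff 0 ≠ 0) ∧ ∑ i, aeval t (c i) * u i = 0 := by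
  obtain ⟨d, hd⟩ : ∃ d, ∑ i, (c i).natDegree ≤ d := ⟨_, le_rfl⟩
  induction d generalizing c with
  | zero =>
    obtain ⟨i, hi⟩ := hc
    refine ⟨c, ⟨i, ?_⟩, h⟩
    have h0 : (c i).natDegree = 0 := by
      have := Finset.single_le_sum (f := fun i => (c i).natDegree) (fun _ _ => Nat.zero_le _)
        (Finset.mem_univ i)
      omega
    intro h1
    rw [eq_C_of_natDegree_eq_zero h0, h1] at hi
    exact hi (map_zero C)
  | succ d ih =>
    by_cases h1 : ∃ i, (c i).coeff 0 ≠ 0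
    · exact ⟨c, h1, h⟩
    · push Not at h1
      choose e he using fun i => X_dvd_iff.2 (h1 i)
      obtain ⟨i, hi⟩ := hc
      have hei : e i ≠ 0 := by rintro h0; rw [he, h0] at hi; simp at hi
      refine ih e ⟨i, hei⟩ ?_ ?_
      · have : t * ∑ i, aeval t (e i) * u i = 0 := by
          rw [← h, Finset.mul_sum]
          refine Finset.sum_congr rfl fun j _ => ?_
          rw [he j]; simp; ring
        exact (mul_eq_zero.1 this).resolve_left ht
      · have : ∑ i, (e i).natDegree < ∑ i, (c i).natDegree := by
          refine Finset.sum_lt_sum (fun j _ => ?_) ⟨i, Finset.mem_univ _, ?_⟩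
          · by_cases hj : e j = 0
            · simp [hj]
            · rw [he j, natDegree_X_mul hj]; omega
          · rw [he i, natDegree_X_mul hei]; omega
        omega

/-- The bound is the degree of `K` over `k(t)`: a linear relation over `k(t)` is cleared of
denominators and of common powers of `t`. Finiteness statements about places (discreteness, residue
fields, zeros of a function) are all derived from such relations. -/
theorem IsFunctionFieldOfCurve.exists_dependence (h : IsFunctionFieldOfCurve k K) {t : K}
    (ht : Transcendental k t) : ∃ N : ℕ, ∀ {ι : Type} [Fintype ι] (u : ι → K),
      N < Fintype.card ι →
      ∃ c : ι → k[X], (∃ i, (c i).coeff 0 ≠ 0) ∧ ∑ i, aeval t (c i) * u i = 0 := by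
  classical
  have := h.finiteDimensional_adjoin ht
  have ht0 : t ≠ 0 := fun h0 => ht (h0 ▸ isAlgebraic_zero)
  refine ⟨Module.finrank (IntermediateField.adjoin k {t}) K, fun {ι} _ u hcard => ?_⟩
  have hdep : ¬ LinearIndependent (IntermediateField.adjoin k {t}) u := fun hl => by
    have := hl.fintype_card_le_finrank
    omega
  rw [Fintype.not_linearIndependent_iff] at hdep
  obtain ⟨a, ha, i₀, hi₀⟩ := hdep
  have hrs : ∀ i, ∃ r s : k[X], s ≠ 0 ∧ (a i : K) * aeval t s = aeval t r ∧
      (a i ≠ 0 → r ≠ 0) := by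
    intro i
    obtain ⟨r, s, hh⟩ := (IntermediateField.mem_adjoin_simple_iff k (a i : K)).1 (a i).2
    by_cases h0 : a i = 0
    · exact ⟨0, 1, one_ne_zero, by simp [h0], by simp [h0]⟩
    · have h0' : (a i : K) ≠ 0 := fun h => h0 (Subtype.ext h)
      have hs : aeval t s ≠ 0 := by rintro hs; rw [hs] at hh; simp at hh; exact h0 hh
      have hr : aeval t r ≠ 0 := by rintro hs; rw [hs] at hh; simp at hh; exact h0 hh
      refine ⟨r, s, by rintro rfl; simp at hs, by rw [hh]; field_simp, fun _ => ?_⟩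
      rintro rfl; simp at hr
  choose r s hs hrs' hr using hrs
  refine exists_coeff_zero_ne_of_sum_eq_zero ht0 u
    (fun i => r i * ∏ j ∈ Finset.univ.erase i, s j) ⟨i₀, ?_⟩ ?_
  · exact mul_ne_zero (hr _ hi₀) (Finset.prod_ne_zero_iff.2 fun j _ => hs j)
  · have : ∀ i, aeval t (r i * ∏ j ∈ Finset.univ.erase i, s j) * u i =
        (∏ j, aeval t (s j)) * ((a i : K) * u i) := by
      intro i
      rw [map_mul, ← hrs' i, map_prod, ← Finset.mul_prod_erase _ _ (Finset.mem_univ i)]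
      ring
    simp only [this]
    rw [← Finset.mul_sum]
    have ha' : ∑ i, (a i : K) * u i = 0 := by
      simpa [Algebra.smul_def] using ha
    rw [ha', mul_zero]

end FunctionField

namespace Place
variable {k K : Type*} [Field k] [Field K] [Algebra k K]

theorem ext_ring {P Q : Place k K} (h : P.ring = Q.ring) : P = Q := by
  cases P; cases Q; congr

variable (P : Place k K)

theorem aeval_mem {t : K} (ht : t ∈ P.ring) (c : k[X]) : aeval t c ∈ P.ring := by
  rw [aeval_eq_sum_range]
  refine sum_mem fun i _ => ?_
  rw [Algebra.smul_def]
  exact mul_mem (P.algebraMap_mem _) (pow_mem ht _)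

/-- The valuation of a place, multiplicatively. -/
abbrev vl (P : Place k K) : Valuation K P.ring.ValueGroup := P.ring.valuation

theorem vl_algebraMap_le (c : k) : P.vl (algebraMap k K c) ≤ 1 :=
  (P.ring.valuation_le_one_iff _).2 (P.algebraMap_mem c)

theorem vl_algebraMap {c : k} (hc : c ≠ 0) : P.vl (algebraMap k K c) = 1 := by
  refine le_antisymm (P.vl_algebraMap_le c) ?_
  have h := P.vl_algebraMap_le c⁻¹
  rw [map_inv₀, map_inv₀] at h
  have h0 : P.vl (algebraMap k K c) ≠ 0 := by simpa using hc
  by_contra hlt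
  push Not at hlt
  exact absurd h (not_le.2 ((one_lt_inv₀ (zero_lt_iff.2 h0)).2 hlt))

theorem vl_aeval_sub_lt {t : K} (ht : P.vl t < 1) (c : k[X]) :
    P.vl (aeval t c - algebraMap k K (c.coeff 0)) < 1 := by
  obtain ⟨e, he⟩ : X ∣ c - C (c.coeff 0) := by simp [X_dvd_iff]
  have : aeval t c - algebraMap k K (c.coeff 0) = t * aeval t e := by
    have := congrArg (aeval t) he
    simpa using this
  rw [this, map_mul]
  exact mul_lt_one_of_lt_of_le ht
    ((P.ring.valuation_le_one_iff _).2 (P.aeval_mem ((P.ring.valuation_le_one_iff _).1 ht.le) e))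

theorem vl_aeval_eq_one {t : K} (ht : P.vl t < 1) {c : k[X]} (hc : c.coeff 0 ≠ 0) :
    P.vl (aeval t c) = 1 := by
  have h := P.vl_aeval_sub_lt ht c
  rw [← P.vl_algebraMap hc] at h
  have := Valuation.map_add_eq_of_lt_right P.vl h
  rwa [sub_add_cancel, P.vl_algebraMap hc] at this

theorem vl_aeval_le_of_coeff {t : K} (ht : P.vl t < 1) {c : k[X]} (hc : c.coeff 0 = 0) :
    P.vl (aeval t c) ≤ P.vl t := by
  obtain ⟨e, rfl⟩ := X_dvd_iff.2 hc
  rw [map_mul, aeval_X, map_mul]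
  exact mul_le_of_le_one_right' 
    ((P.ring.valuation_le_one_iff _).2 (P.aeval_mem ((P.ring.valuation_le_one_iff _).1 ht.le) e))

theorem exists_vl_lt_one : ∃ t : K, t ≠ 0 ∧ P.vl t < 1 := by
  by_contra! h
  apply P.ne_top
  rw [eq_top_iff]
  intro f _
  by_cases hf : f = 0
  · rw [hf]; exact zero_mem _
  · rw [← P.ring.valuation_le_one_iff]
    have := h f⁻¹ (inv_ne_zero hf)
    rw [map_inv₀] at this
    exact (one_le_inv₀ (zero_lt_iff.2 (by simpa using hf))).1 this

theorem transcendental_of_vl_lt_one {t : K} (h0 : t ≠ 0) (ht : P.vl t < 1) :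
    Transcendental k t := by
  rintro ⟨c, hc, hct⟩
  obtain ⟨c, ⟨_, h1⟩, h2⟩ := exists_coeff_zero_ne_of_sum_eq_zero (ι := Unit) h0 (fun _ => 1)
    (fun _ => c) ⟨(), hc⟩ (by simpa using hct)
  have := P.vl_aeval_eq_one ht h1
  simp only [Finset.univ_unique, Finset.sum_singleton, mul_one] at h2
  rw [h2] at this
  simp at this

/-- If all values lay above that of `t`, then in a relation between the `y i` the term of the first
`j` with nonzero constant coefficient would dominate: earlier terms carry a factor `t`, later ones
have smaller value by monotonicity. So at most `N` distinct values fit between those of `t` and `1`.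
-/
theorem not_strictAnti_of_dependence {t : K} (ht : P.vl t < 1) {N : ℕ} 
    (hN : ∀ u : Fin (N + 1) → K, 
      ∃ c : Fin (N + 1) → k[X], (∃ i, (c i).coeff 0 ≠ 0) ∧ ∑ i, aeval t (c i) * u i = 0)
    (y : Fin (N + 1) → K) (hy : StrictAnti fun i => P.vl (y i)) (h1 : ∀ i, P.vl (y i) ≤ 1) :
    ∃ i, P.vl (y i) ≤ P.vl t := by
  classical
  by_contra! hlt
  obtain ⟨c, hc, hsum⟩ := hN y
  obtain ⟨j, hj, hmin⟩ := WellFounded.has_min (wellFounded_lt (α := Fin (N + 1)))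
    {i | (c i).coeff 0 ≠ 0} hc
  rw [← Finset.add_sum_erase _ _ (Finset.mem_univ j)] at hsum
  have hj1 : P.vl (aeval t (c j) * y j) = P.vl (y j) := by
    rw [map_mul, P.vl_aeval_eq_one ht hj, one_mul]
  have hpos : 0 < P.vl (y j) := lt_of_le_of_lt zero_le (hlt j)
  have hrest : P.vl (∑ i ∈ Finset.univ.erase j, aeval t (c i) * y i) < P.vl (y j) := by
    refine Valuation.map_sum_lt _ hpos.ne' fun i hi => ?_
    rw [map_mul]
    rcases lt_or_gt_of_ne (Finset.ne_of_mem_erase hi) with h | h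
    · have h0 : (c i).coeff 0 = 0 := by
        by_contra h0
        exact hmin i h0 h
      calc _ ≤ P.vl t * 1 := mul_le_mul' (P.vl_aeval_le_of_coeff ht h0) (h1 i)
        _ < _ := by rw [mul_one]; exact hlt j
    · calc _ ≤ 1 * P.vl (y i) := mul_le_mul' ((P.ring.valuation_le_one_iff _).2
            (P.aeval_mem ((P.ring.valuation_le_one_iff _).1 ht.le) _)) le_rfl
        _ < _ := by rw [one_mul]; exact hy h
  rw [eq_neg_of_add_eq_zero_left hsum, Valuation.map_neg] at hj1
  exact absurd hj1 hrest.ne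

variable [hK : Fact (IsFunctionFieldOfCurve k K)]

/-- Without a largest value below `1` one could climb forever from the value of `t`, against the
bound on the length of such chains. -/
theorem exists_uniformizer : ∃ π : K, π ≠ 0 ∧ P.vl π < 1 ∧ ∀ f, P.vl f < 1 → P.vl f ≤ P.vl π := by
  obtain ⟨t, h0, ht⟩ := P.exists_vl_lt_one
  obtain ⟨N, hN⟩ := hK.out.exists_dependence (P.transcendental_of_vl_lt_one h0 ht)
  by_contra! hno
  have hstep : ∀ u : {u : K // u ≠ 0 ∧ P.vl u < 1}, ∃ v : {u : K // u ≠ 0 ∧ P.vl u < 1},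
      P.vl u.1 < P.vl v.1 := by
    rintro ⟨u, hu0, hu⟩
    obtain ⟨v, hv, huv⟩ := hno u hu0 hu
    refine ⟨⟨v, ?_, hv⟩, huv⟩
    rintro rfl
    simp at huv
  choose F hF using hstep
  let y : ℕ → {u : K // u ≠ 0 ∧ P.vl u < 1} := fun n => F^[n] (F ⟨t, h0, ht⟩)
  have hy : StrictMono fun n => P.vl (y n).1 := strictMono_nat_of_lt_succ fun n => by
    simp only [y, Function.iterate_succ_apply']
    exact hF _
  have hty : ∀ n, P.vl t < P.vl (y n).1 := fun n =>
    lt_of_lt_of_le (hF ⟨t, h0, ht⟩) (hy.monotone (Nat.zero_le n))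
  obtain ⟨i, hi⟩ := P.not_strictAnti_of_dependence ht (fun u => hN u (by simp))
    (fun i : Fin (N + 1) => (y (N - i)).1) (fun i j hij => hy (by have := j.2; simp only [Fin.lt_def] at hij; omega))
    (fun i => (y _).2.2.le)
  exact absurd hi (not_le.2 (hty _))

/-- A uniformizer at `P`. -/
def unif : K := P.exists_uniformizer.choose

theorem unif_ne_zero : P.unif ≠ 0 := P.exists_uniformizer.choose_spec.1

theorem vl_unif_lt_one : P.vl P.unif < 1 := P.exists_uniformizer.choose_spec.2.1

theorem vl_le_unif {f : K} (hf : P.vl f < 1) : P.vl f ≤ P.vl P.unif :=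
  P.exists_uniformizer.choose_spec.2.2 f hf

theorem vl_unif_pos : 0 < P.vl P.unif := by
  rw [zero_lt_iff]; simpa using P.unif_ne_zero

theorem exists_vl_eq_pow {f : K} (hf : f ≠ 0) (h1 : P.vl f ≤ 1) :
    ∃ n : ℕ, P.vl f = P.vl P.unif ^ n := by
  classical
  rcases h1.lt_or_eq with h1 | h1
  swap
  · exact ⟨0, by simpa using h1⟩
  obtain ⟨N, hN⟩ := hK.out.exists_dependence (P.transcendental_of_vl_lt_one hf h1)
  have hex : ∃ n : ℕ, P.vl P.unif ^ n ≤ P.vl f := by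
    obtain ⟨i, hi⟩ := P.not_strictAnti_of_dependence h1 (fun u => hN u (by simp))
      (fun i : Fin (N + 1) => P.unif ^ (i : ℕ)) 
      (fun i j hij => by
        simp only [map_pow]
        exact pow_lt_pow_right_of_lt_one₀ P.vl_unif_pos P.vl_unif_lt_one hij)
      (fun i => by rw [map_pow]; exact pow_le_one₀ zero_le P.vl_unif_lt_one.le)
    exact ⟨i, by simpa using hi⟩
  -- For the least such exponent `m + 1`, the quotient of `f` by the `m`-th power of the uniformizer
  -- still has value below `1`, hence at most that of the uniformizer.
  refine ⟨Nat.find hex, le_antisymm ?_ (Nat.find_spec hex)⟩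
  rcases h : Nat.find hex with _ | m
  · simpa using h1.le
  · have hm := Nat.find_min hex (m := m) (by omega)
    push Not at hm
    have hu : 0 < P.vl P.unif ^ m := pow_pos P.vl_unif_pos m
    have : P.vl (f / P.unif ^ m) < 1 := by
      rw [map_div₀, map_pow]
      exact (div_lt_one₀ hu).2 hm
    have := P.vl_le_unif this
    rw [map_div₀, map_pow, div_le_iff₀ hu] at this
    rwa [pow_succ, mul_comm]

theorem exists_vl_eq_zpow {f : K} (hf : f ≠ 0) : ∃ n : ℤ, P.vl f = P.vl P.unif ^ n := by
  rcases P.ring.mem_or_inv_mem f with h | h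
  · obtain ⟨n, hn⟩ := P.exists_vl_eq_pow hf ((P.ring.valuation_le_one_iff _).2 h)
    exact ⟨n, by simpa using hn⟩
  · obtain ⟨n, hn⟩ := P.exists_vl_eq_pow (inv_ne_zero hf) ((P.ring.valuation_le_one_iff _).2 h)
    refine ⟨-n, ?_⟩
    rw [map_inv₀] at hn
    rw [zpow_neg, zpow_natCast, ← hn, inv_inv]

open Classical in
/-- The order of vanishing at `P` (with the value `0` at `0`). -/
def ord (f : K) : ℤ := if h : f = 0 then 0 else (P.exists_vl_eq_zpow h).choose

theorem vl_eq {f : K} (hf : f ≠ 0) : P.vl f = P.vl P.unif ^ P.ord f := by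
  rw [ord, dif_neg hf]
  exact (P.exists_vl_eq_zpow hf).choose_spec

theorem unif_zpow_le_iff {m n : ℤ} : P.vl P.unif ^ m ≤ P.vl P.unif ^ n ↔ n ≤ m :=
  zpow_le_zpow_iff_right_of_lt_one₀ P.vl_unif_pos P.vl_unif_lt_one

theorem unif_zpow_inj {m n : ℤ} (h : P.vl P.unif ^ m = P.vl P.unif ^ n) : m = n :=
  le_antisymm (P.unif_zpow_le_iff.1 h.ge) (P.unif_zpow_le_iff.1 h.le)

@[simp] theorem ord_zero : P.ord 0 = 0 := by simp [ord]

theorem ord_eq_of {f : K} (hf : f ≠ 0) {m : ℤ} (h : P.vl f = P.vl P.unif ^ m) : P.ord f = m :=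
  P.unif_zpow_inj (by rw [← h, P.vl_eq hf])

@[simp] theorem ord_one : P.ord 1 = 0 := P.ord_eq_of one_ne_zero (by simp)

theorem ord_mul {f g : K} (hf : f ≠ 0) (hg : g ≠ 0) : P.ord (f * g) = P.ord f + P.ord g :=
  P.ord_eq_of (mul_ne_zero hf hg) (by
    rw [map_mul, P.vl_eq hf, P.vl_eq hg, zpow_add₀ P.vl_unif_pos.ne'])

theorem ord_inv (f : K) : P.ord f⁻¹ = -P.ord f := by
  by_cases hf : f = 0
  · simp [hf]
  · exact P.ord_eq_of (inv_ne_zero hf) (by rw [map_inv₀, P.vl_eq hf, zpow_neg])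

theorem ord_pow {f : K} (hf : f ≠ 0) (m : ℕ) : P.ord (f ^ m) = m * P.ord f :=
  P.ord_eq_of (pow_ne_zero m hf) (by
    rw [map_pow, P.vl_eq hf, ← zpow_natCast, ← zpow_mul, mul_comm])

theorem ord_zpow {f : K} (hf : f ≠ 0) (m : ℤ) : P.ord (f ^ m) = m * P.ord f :=
  P.ord_eq_of (zpow_ne_zero m hf) (by
    rw [map_zpow₀, P.vl_eq hf, ← zpow_mul, mul_comm])

@[simp] theorem ord_unif : P.ord P.unif = 1 := P.ord_eq_of P.unif_ne_zero (by simp)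

theorem ord_unif_zpow (m : ℤ) : P.ord (P.unif ^ m) = m := by
  rw [P.ord_zpow P.unif_ne_zero, ord_unif, mul_one]

theorem ord_prod {ι : Type*} (s : Finset ι) (f : ι → K) (hf : ∀ i ∈ s, f i ≠ 0) :
    P.ord (∏ i ∈ s, f i) = ∑ i ∈ s, P.ord (f i) := by
  classical
  induction s using Finset.induction_on with
  | empty => simp
  | insert a s ha ih =>
    rw [Finset.prod_insert ha, Finset.sum_insert ha, P.ord_mul (hf _ (Finset.mem_insert_self _ _))
      (Finset.prod_ne_zero_iff.2 fun i hi => hf _ (Finset.mem_insert_of_mem hi)),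
      ih fun i hi => hf _ (Finset.mem_insert_of_mem hi)]

theorem ord_algebraMap (c : k) : P.ord (algebraMap k K c) = 0 := by
  by_cases hc : c = 0
  · simp [hc]
  · exact P.ord_eq_of (by simpa using hc) (by simpa using P.vl_algebraMap hc)

/-- The functions vanishing at `P` to order at least `m`. -/
def fil (m : ℤ) : Submodule P.ring K where
  carrier := {f | P.vl f ≤ P.vl P.unif ^ m}
  add_mem' hf hg := by
    rw [Set.mem_ofPred_eq] at *
    exact (Valuation.map_add _ _ _).trans (max_le hf hg)
  zero_mem' := by simp
  smul_mem' c f hf := by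
    have : c • f = (c : K) * f := rfl
    rw [Set.mem_ofPred_eq] at *
    rw [this, map_mul]
    exact (mul_le_mul' (P.ring.valuation_le_one c) hf).trans (by rw [one_mul])

theorem mem_fil_def {m : ℤ} {f : K} : f ∈ P.fil m ↔ P.vl f ≤ P.vl P.unif ^ m := by
  rw [← Set.mem_ofPred_eq (p := fun f => P.vl f ≤ P.vl P.unif ^ m)]; rfl

theorem mem_fil_iff {m : ℤ} {f : K} : f ∈ P.fil m ↔ f = 0 ∨ m ≤ P.ord f := by
  rw [mem_fil_def]
  by_cases hf : f = 0
  · simp [hf]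
  · rw [P.vl_eq hf, P.unif_zpow_le_iff]; simp [hf]

theorem mem_fil_of_ne {m : ℤ} {f : K} (hf : f ≠ 0) : f ∈ P.fil m ↔ m ≤ P.ord f := by
  simp [mem_fil_iff, hf]

theorem mem_fil_zero {f : K} : f ∈ P.fil 0 ↔ f ∈ P.ring := by
  rw [← P.ring.valuation_le_one_iff]
  rw [mem_fil_def]
  simp

theorem mem_fil_one {f : K} : f ∈ P.fil 1 ↔ P.vl f < 1 := by
  rw [mem_fil_def]
  rw [zpow_one]
  exact ⟨fun h => h.trans_lt P.vl_unif_lt_one, P.vl_le_unif⟩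

theorem fil_anti {m n : ℤ} (h : m ≤ n) : P.fil n ≤ P.fil m := fun f hf => by
  rw [mem_fil_iff] at *
  exact hf.imp_right h.trans

theorem mul_mem_fil {m n : ℤ} {f g : K} (hf : f ∈ P.fil m) (hg : g ∈ P.fil n) :
    f * g ∈ P.fil (m + n) := by
  rw [mem_fil_def] at *
  rw [map_mul, zpow_add₀ P.vl_unif_pos.ne']
  exact mul_le_mul' hf hg

theorem unif_zpow_mem_fil (m : ℤ) : P.unif ^ m ∈ P.fil m := by
  rw [mem_fil_of_ne _ (zpow_ne_zero _ P.unif_ne_zero), ord_unif_zpow]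

theorem unif_mem_fil : P.unif ∈ P.fil 1 := by simpa using P.unif_zpow_mem_fil 1

theorem algebraMap_mem_fil (c : k) : algebraMap k K c ∈ P.fil 0 :=
  P.mem_fil_zero.2 (P.algebraMap_mem c)

theorem unif_mem_ring : P.unif ∈ P.ring := P.mem_fil_zero.1 (P.fil_anti zero_le_one P.unif_mem_fil)

theorem mul_mem_fil_iff {m : ℤ} {f g : K} (hf : f ≠ 0) :
    f * g ∈ P.fil m ↔ g ∈ P.fil (m - P.ord f) := by
  by_cases hg : g = 0
  · simp [hg]
  · rw [mem_fil_of_ne _ (mul_ne_zero hf hg), mem_fil_of_ne _ hg, P.ord_mul hf hg]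
    omega

theorem unif_zpow_mul_mem_fil_iff {m j : ℤ} {g : K} :
    P.unif ^ j * g ∈ P.fil m ↔ g ∈ P.fil (m - j) := by
  rw [P.mul_mem_fil_iff (zpow_ne_zero _ P.unif_ne_zero), ord_unif_zpow]

theorem le_ord_add {f g : K} {m : ℤ} (hfg : f + g ≠ 0) (hf : m ≤ P.ord f) (hg : m ≤ P.ord g) :
    m ≤ P.ord (f + g) :=
  (P.mem_fil_of_ne hfg).1 (add_mem (P.mem_fil_iff.2 (.inr hf)) (P.mem_fil_iff.2 (.inr hg)))

instance : IsDiscreteValuationRing P.ring := by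
  apply IsDiscreteValuationRing.ofHasUnitMulPowIrreducibleFactorization
  have hunit : ∀ u : P.ring, IsUnit u ↔ P.vl (u : K) = 1 := fun u => P.ring.valuation_eq_one_iff u
  refine ⟨⟨P.unif, P.unif_mem_ring⟩, ⟨?_, ?_⟩, ?_⟩
  · rw [hunit]; exact P.vl_unif_lt_one.ne
  · intro a b hab
    have hab' : P.unif = a * b := congrArg Subtype.val hab
    have ha0 : (a : K) ≠ 0 := fun h => P.unif_ne_zero (by rw [hab', h, zero_mul])
    have hb0 : (b : K) ≠ 0 := fun h => P.unif_ne_zero (by rw [hab', h, mul_zero])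
    have h1 := congrArg P.ord hab'
    rw [ord_unif, P.ord_mul ha0 hb0] at h1
    have ha := (P.mem_fil_of_ne ha0).1 (P.mem_fil_zero.2 a.2)
    have hb := (P.mem_fil_of_ne hb0).1 (P.mem_fil_zero.2 b.2)
    rw [hunit, hunit, P.vl_eq ha0, P.vl_eq hb0]
    have : P.ord (a : K) = 0 ∨ P.ord (b : K) = 0 := by omega
    rcases this with h | h
    · left; rw [h, zpow_zero]
    · right; rw [h, zpow_zero]
  · intro x hx
    have hx0 : (x : K) ≠ 0 := fun h => hx (Subtype.ext h)
    obtain ⟨n, hn⟩ := P.exists_vl_eq_pow hx0 (P.ring.valuation_le_one x)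
    refine ⟨n, ?_⟩
    rw [← map_pow] at hn
    obtain ⟨u, hu⟩ := (P.ring.valuation_eq_iff _ _).1 hn
    refine ⟨u, Subtype.ext ?_⟩
    rw [← hu]
    push_cast
    ring

theorem mem_maximalIdeal_iff (f : P.ring) :
    f ∈ IsLocalRing.maximalIdeal P.ring ↔ (f : K) ∈ P.fil 1 := by
  rw [P.ring.valuation_lt_one_iff, mem_fil_one]

/-- A discrete valuation ring is a maximal proper subring: a function with a pole at `P` has powers
that cancel the poles of any given function. -/
theorem eq_of_ring_le {P Q : Place k K} (h : P.ring ≤ Q.ring) : P = Q := by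
  refine ext_ring (le_antisymm h fun f hf => ?_)
  by_contra hfP
  have hf0 : f ≠ 0 := by rintro rfl; exact hfP (zero_mem _)
  have hneg : P.ord f < 0 := by
    by_contra h0
    push Not at h0
    exact hfP (P.mem_fil_zero.1 ((P.mem_fil_of_ne hf0).2 h0))
  apply Q.ne_top
  rw [eq_top_iff]
  intro g _
  by_cases hg : g = 0
  · rw [hg]; exact zero_mem _
  obtain ⟨n, hn⟩ : ∃ n : ℕ, -P.ord g ≤ n := ⟨(-P.ord g).toNat, Int.self_le_toNat _⟩
  have h1 : g * (f⁻¹) ^ n ∈ P.ring := by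
    rw [← P.mem_fil_zero, P.mem_fil_of_ne (mul_ne_zero hg (pow_ne_zero _ (inv_ne_zero hf0))),
      P.ord_mul hg (pow_ne_zero _ (inv_ne_zero hf0)), P.ord_pow (inv_ne_zero hf0), ord_inv]
    nlinarith
  have h2 := mul_mem (h h1) (pow_mem hf n)
  rwa [mul_assoc, ← mul_pow, inv_mul_cancel₀ hf0, one_pow, mul_one] at h2

section Residue
variable [IsAlgClosed k]

/-- The residue field is algebraic over `k`, because the powers of `f` are dependent modulo the
uniformizer. As `k` is algebraically closed, the resulting polynomial splits and one of its linear
factors in `f` vanishes at `P`. -/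
theorem exists_residue {f : K} (hf : f ∈ P.ring) : ∃ c : k, f - algebraMap k K c ∈ P.fil 1 := by
  obtain ⟨N, hN⟩ := hK.out.exists_dependence
    (P.transcendental_of_vl_lt_one P.unif_ne_zero P.vl_unif_lt_one)
  obtain ⟨c, ⟨i₀, hi₀⟩, hc⟩ := hN (fun i : Fin (N + 1) => f ^ (i : ℕ)) (by simp)
  let e : k[X] := ∑ i, C ((c i).coeff 0) * X ^ (i : ℕ)
  have he0 : e ≠ 0 := by
    intro h
    have := congrArg (fun q => q.coeff i₀) h
    simp only [e, finsetSum_coeff, coeff_C_mul, coeff_X_pow, coeff_zero] at this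
    rw [Finset.sum_eq_single i₀] at this
    · simp at this; exact hi₀ this
    · intro j _ hj
      rw [if_neg (fun h => hj (Fin.ext h.symm)), mul_zero]
    · simp
  have he : aeval f e ∈ P.fil 1 := by
    have : aeval f e = -∑ i, (aeval P.unif (c i) - algebraMap k K ((c i).coeff 0)) * f ^ (i : ℕ) := by
      simp only [e, map_sum, map_mul, aeval_C, map_pow, aeval_X, sub_mul, Finset.sum_sub_distrib]
      rw [hc]; ring
    rw [this]
    refine neg_mem (sum_mem fun i _ => ?_)
    have := P.mul_mem_fil (P.mem_fil_one.2 (P.vl_aeval_sub_lt P.vl_unif_lt_one (c i)))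
      (P.mem_fil_zero.2 (pow_mem hf (i : ℕ)))
    simpa using this
  by_contra! hno
  have hno' : ∀ c : k, P.vl (f - algebraMap k K c) = 1 := fun c => by
    refine le_antisymm ((P.ring.valuation_le_one_iff _).2 (sub_mem hf (P.algebraMap_mem c))) ?_
    by_contra h
    exact hno c (P.mem_fil_one.2 (not_le.1 h))
  rw [mem_fil_one] at he
  have hs := (IsAlgClosed.splits e).eq_prod_roots
  rw [hs] at he
  simp only [map_mul, aeval_C, map_multiset_prod, Multiset.map_map] at he
  have hl : P.vl (algebraMap k K e.leadingCoeff) = 1 :=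
    P.vl_algebraMap (leadingCoeff_ne_zero.2 he0)
  rw [hl, one_mul] at he
  refine absurd he (not_lt.2 (ge_of_eq ?_))
  apply Multiset.prod_eq_one
  intro x hx
  obtain ⟨a, _, rfl⟩ := Multiset.mem_map.1 hx
  simpa using hno' a

open Classical in
/-- The value at `P` of a function regular there (and `0` for other functions). -/
def res (f : K) : k := if h : f ∈ P.ring then (P.exists_residue h).choose else 0

theorem sub_res_mem {f : K} (hf : f ∈ P.ring) : f - algebraMap k K (P.res f) ∈ P.fil 1 := by
  rw [res, dif_pos hf]; exact (P.exists_residue hf).choose_spec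

omit [IsAlgClosed k] in
theorem algebraMap_mem_fil_one {c : k} (h : algebraMap k K c ∈ P.fil 1) : c = 0 := by
  by_contra hc
  rw [mem_fil_one, P.vl_algebraMap hc] at h
  exact lt_irrefl _ h

theorem res_eq_of {f : K} {c : k} (h : f - algebraMap k K c ∈ P.fil 1) : P.res f = c := by
  have hf : f ∈ P.ring := by
    have := add_mem (P.fil_anti zero_le_one h) (P.algebraMap_mem_fil c)
    rw [sub_add_cancel] at this
    exact P.mem_fil_zero.1 this
  have := sub_mem h (P.sub_res_mem hf)
  rw [sub_sub_sub_cancel_left, ← map_sub] at this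
  exact sub_eq_zero.1 (P.algebraMap_mem_fil_one this)

@[simp] theorem res_algebraMap (c : k) : P.res (algebraMap k K c) = c :=
  P.res_eq_of (by simp)

@[simp] theorem res_zero : P.res (0 : K) = 0 := P.res_eq_of (by simp)

@[simp] theorem res_one : P.res (1 : K) = 1 := P.res_eq_of (by simp)

theorem res_add {f g : K} (hf : f ∈ P.ring) (hg : g ∈ P.ring) :
    P.res (f + g) = P.res f + P.res g :=
  P.res_eq_of (by
    rw [map_add, add_sub_add_comm]; exact add_mem (P.sub_res_mem hf) (P.sub_res_mem hg))

theorem res_mul {f g : K} (hf : f ∈ P.ring) (hg : g ∈ P.ring) :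
    P.res (f * g) = P.res f * P.res g :=
  P.res_eq_of (by
    have h1 := P.mul_mem_fil (P.sub_res_mem hf) (P.mem_fil_zero.2 hg)
    have h2 := P.mul_mem_fil (P.algebraMap_mem_fil (P.res f)) (P.sub_res_mem hg)
    rw [zero_add] at h2
    rw [add_zero] at h1
    have := add_mem h1 h2
    convert this using 1
    rw [map_mul]; ring)

theorem res_smul {f : K} (c : k) (hf : f ∈ P.ring) : P.res (c • f) = c * P.res f := by
  rw [Algebra.smul_def, P.res_mul (P.algebraMap_mem c) hf, res_algebraMap]

theorem res_sum {ι : Type*} (s : Finset ι) (f : ι → K) (hf : ∀ i ∈ s, f i ∈ P.ring) :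
    P.res (∑ i ∈ s, f i) = ∑ i ∈ s, P.res (f i) := by
  classical
  induction s using Finset.induction_on with
  | empty => simp
  | insert a s ha ih =>
    rw [Finset.sum_insert ha, Finset.sum_insert ha, P.res_add (hf _ (Finset.mem_insert_self _ _))
      (sum_mem fun i hi => hf _ (Finset.mem_insert_of_mem hi)),
      ih fun i hi => hf _ (Finset.mem_insert_of_mem hi)]

theorem res_eq_zero_iff {f : K} (hf : f ∈ P.ring) : P.res f = 0 ↔ f ∈ P.fil 1 := by
  constructor
  · intro h
    have := P.sub_res_mem hf
    rwa [h, map_zero, sub_zero] at this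
  · intro h; exact P.res_eq_of (by simpa using h)

end Residue

end Place
end Pointing
end

/-! ### Finiteness of zeros and infinitude of places. -/

noncomputable section
namespace Pointing
open Polynomial

namespace Place
variable {k K : Type*} [Field k] [Field K] [Algebra k K] [hK : Fact (IsFunctionFieldOfCurve k K)]

open Classical in
/-- The real absolute value attached to a place. -/
def absv (P : Place k K) : AbsoluteValue K ℝ where
  toFun f := if f = 0 then 0 else (2 : ℝ) ^ (-P.ord f)
  map_mul' f g := by
    by_cases hf : f = 0
    · simp [hf]
    by_cases hg : g = 0
    · simp [hg]
    simp only [mul_eq_zero, hf, hg, or_self, if_false]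
    rw [P.ord_mul hf hg, neg_add, zpow_add₀ two_ne_zero]
  nonneg' f := by split_ifs <;> positivity
  eq_zero' f := by
    by_cases hf : f = 0
    · simp [hf]
    · simp only [hf, if_false, iff_false]
      exact zpow_ne_zero _ two_ne_zero
  add_le' f g := by
    by_cases hf : f = 0
    · simp [hf]
    by_cases hg : g = 0
    · simp [hg]
    by_cases hfg : f + g = 0
    · simp only [hfg, if_true]; positivity
    simp only [hf, hg, hfg, if_false]
    rcases le_total (P.ord f) (P.ord g) with h | h
    · have := P.le_ord_add hfg le_rfl h
      have : (2 : ℝ) ^ (-P.ord (f + g)) ≤ 2 ^ (-P.ord f) := zpow_le_zpow_right₀ one_le_two (by omega)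
      have : (0 : ℝ) ≤ 2 ^ (-P.ord g) := by positivity
      linarith
    · have := P.le_ord_add hfg h le_rfl
      have : (2 : ℝ) ^ (-P.ord (f + g)) ≤ 2 ^ (-P.ord g) := zpow_le_zpow_right₀ one_le_two (by omega)
      have : (0 : ℝ) ≤ 2 ^ (-P.ord f) := by positivity
      linarith

theorem absv_apply (P : Place k K) {f : K} (hf : f ≠ 0) : P.absv f = (2 : ℝ) ^ (-P.ord f) := by
  simp [absv, hf]

theorem absv_le_one_iff (P : Place k K) {f : K} : P.absv f ≤ 1 ↔ f ∈ P.ring := by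
  by_cases hf : f = 0
  · simp [hf, zero_mem]
  rw [P.absv_apply hf, ← P.mem_fil_zero, P.mem_fil_of_ne hf, ← zpow_zero (2 : ℝ),
    zpow_le_zpow_iff_right₀ one_lt_two]
  omega

theorem absv_lt_one_iff (P : Place k K) {f : K} : P.absv f < 1 ↔ f ∈ P.fil 1 := by
  by_cases hf : f = 0
  · simp [hf, zero_mem]
  rw [P.absv_apply hf, P.mem_fil_of_ne hf, ← zpow_zero (2 : ℝ),
    zpow_lt_zpow_iff_right₀ one_lt_two]
  omega

theorem finite_zeros {t : K} (h0 : t ≠ 0) : {P : Place k K | t ∈ P.fil 1}.Finite := by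
  classical
  by_contra hinf
  obtain ⟨P₀, hP₀⟩ := Set.Infinite.nonempty hinf
  obtain ⟨N, hN⟩ := hK.out.exists_dependence
    (P₀.transcendental_of_vl_lt_one h0 (P₀.mem_fil_one.1 hP₀))
  let p : Fin (N + 1) → Place k K := fun i => (Set.Infinite.natEmbedding _ hinf i).1
  have hp : Function.Injective p := fun i j h =>
    Fin.ext ((Set.Infinite.natEmbedding _ hinf).injective (Subtype.ext h))
  have hpt : ∀ i, t ∈ (p i).fil 1 := fun i => (Set.Infinite.natEmbedding _ hinf i).2
  -- Weak approximation gives functions `a i` with a pole at `p i` and regular at the other chosen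
  -- zeros of `t`. In a relation between them, a term whose coefficient is a unit at `p i` is the
  -- only one with a pole there.
  have key := AbsoluteValue.exists_one_lt_lt_one_pi_of_not_isEquiv (v := fun i => (p i).absv)
    (fun i => ⟨t, h0, ((p i).absv_lt_one_iff.2 (hpt i)).ne⟩)
    (fun i j hij h => hij (hp (eq_of_ring_le fun f hf => by
      rw [← absv_le_one_iff] at *
      have := h f 1
      simp only [map_one] at this
      exact this.1 hf)))
  choose a ha hab using key
  obtain ⟨c, ⟨i, hi⟩, hsum⟩ := hN a (by simp)
  have ht : (p i).vl t < 1 := (p i).mem_fil_one.1 (hpt i)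
  rw [← Finset.add_sum_erase _ _ (Finset.mem_univ i)] at hsum
  have h1 : aeval t (c i) * a i ∈ (p i).ring := by
    rw [eq_neg_of_add_eq_zero_left hsum]
    refine neg_mem (sum_mem fun j hj => mul_mem ((p i).aeval_mem ?_ _) ?_)
    · exact ((p i).ring.valuation_le_one_iff _).1 ht.le
    · exact (p i).absv_le_one_iff.1 (hab j i (Finset.ne_of_mem_erase hj).symm).le
  rw [← (p i).ring.valuation_le_one_iff, map_mul, (p i).vl_aeval_eq_one ht hi, one_mul,
    (p i).ring.valuation_le_one_iff, ← (p i).absv_le_one_iff] at h1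
  exact absurd h1 (not_le.2 (ha i))

theorem finite_ord_ne_zero (f : K) : {P : Place k K | P.ord f ≠ 0}.Finite := by
  by_cases hf : f = 0
  · simp [hf]
  refine ((finite_zeros hf).union (finite_zeros (inv_ne_zero hf))).subset fun P hP => ?_
  rw [Set.mem_ofPred_eq] at hP
  rw [Set.mem_union, Set.mem_ofPred_eq, Set.mem_ofPred_eq, P.mem_fil_of_ne hf,
    P.mem_fil_of_ne (inv_ne_zero hf), ord_inv]
  omega

-- The element `t` generates a proper ideal of `k[t]`, so a valuation ring dominates `k[t]` with `t`
-- in its maximal ideal.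
omit hK in
theorem exists_of_transcendental {t : K} (ht : Transcendental k t) :
    ∃ P : Place k K, P.vl t < 1 := by
  let A : Subring K := (Algebra.adjoin k {t}).toSubring
  have htA : t ∈ A := Algebra.self_mem_adjoin_singleton k t
  have hI : Ideal.span {(⟨t, htA⟩ : A)} ≠ ⊤ := by
    rw [Ne, Ideal.span_singleton_eq_top]
    intro hu
    obtain ⟨⟨b, hb⟩, hab⟩ := isUnit_iff_exists_inv.1 hu
    have hab' : t * b = 1 := congrArg Subtype.val hab
    obtain ⟨q, rfl⟩ : ∃ q : k[X], aeval t q = b := by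
      have : b ∈ Algebra.adjoin k {t} := hb
      rwa [Algebra.adjoin_singleton_eq_range_aeval] at this
    have : aeval t (X * q - 1) = 0 := by simp [hab']
    have h0 := transcendental_iff.1 ht _ this
    have := congrArg (fun q => q.coeff 0) h0
    simp at this
  obtain ⟨B, hAB, hB⟩ := Ideal.image_subset_nonunits_valuationSubring _ hI
  have htB : t ∈ B.nonunits := hB ⟨⟨t, htA⟩, Ideal.mem_span_singleton_self _, rfl⟩
  rw [ValuationSubring.mem_nonunits_iff] at htB
  have ht0 : t ≠ 0 := fun h0 => ht (h0 ▸ isAlgebraic_zero)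
  refine ⟨⟨B, fun c => hAB (Subalgebra.algebraMap_mem (Algebra.adjoin k {t}) c), ?_⟩, htB⟩
  rintro rfl
  have : t⁻¹ ∈ (⊤ : ValuationSubring K) := ValuationSubring.mem_top _
  rw [← ValuationSubring.valuation_le_one_iff, map_inv₀] at this
  exact absurd htB (not_lt.2 ((inv_le_one₀ (zero_lt_iff.2 (by simpa using ht0))).1 this))

variable (k K) in
theorem infinite [IsAlgClosed k] : Infinite (Place k K) := by
  obtain ⟨x, hx, -⟩ := hK.out
  have hx' : ∀ c : k, Transcendental k (x - algebraMap k K c) := fun c h =>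
    hx (by simpa using h.add (isAlgebraic_algebraMap c))
  choose P hP using fun c => exists_of_transcendental (hx' c)
  have : Infinite k := IsAlgClosed.instInfinite
  refine Infinite.of_injective P fun c d h => ?_
  have h1 := (P c).mem_fil_one.2 (hP c)
  have h2 := (P d).mem_fil_one.2 (hP d)
  rw [← h] at h2
  have := sub_mem h1 h2
  rw [sub_sub_sub_cancel_left, ← map_sub] at this
  exact (sub_eq_zero.1 ((P c).algebraMap_mem_fil_one this)).symm

end Place
end Pointing
end

/-! ### Lattices over the local rings, and their indices as orders of determinants. -/

noncomputable section
namespace Pointing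
open Module

namespace Place
variable {k K : Type*} [Field k] [Field K] [Algebra k K] (P : Place k K)
variable {V : Type*} [AddCommGroup V] [Module K V] {ι : Type*} [Fintype ι] [DecidableEq ι]

/-- A lattice in `V` over the local ring at `P`. -/
def IsLattice (M : Submodule P.ring V) : Prop :=
  M.FG ∧ Submodule.span K (M : Set V) = ⊤

/-- The lattice spanned by a basis. -/
abbrev lat (b : Basis ι K V) : Submodule P.ring V := Submodule.span P.ring (Set.range b)

omit [Fintype ι] [DecidableEq ι] in
theorem mem_lat {b : Basis ι K V} {v : V} : v ∈ P.lat b ↔ ∀ i, b.repr v i ∈ P.ring := by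
  rw [Basis.mem_span_iff_repr_mem]
  refine forall_congr' fun i => ⟨?_, fun h => ⟨⟨_, h⟩, rfl⟩⟩
  rintro ⟨a, ha⟩
  rw [← ha]; exact a.2

omit [DecidableEq ι] in
theorem isLattice_lat (b : Basis ι K V) : P.IsLattice (P.lat b) := by
  refine ⟨Submodule.fg_span (Set.finite_range b), ?_⟩
  rw [Submodule.span_span_of_tower, b.span_eq]

omit [Fintype ι] [DecidableEq ι] in
theorem smul_mem_of_mem_ring {M : Submodule P.ring V} {f : K} (hf : f ∈ P.ring) {v : V}
    (hv : v ∈ M) : f • v ∈ M := M.smul_mem (⟨f, hf⟩ : P.ring) hv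

variable [hK : Fact (IsFunctionFieldOfCurve k K)]

theorem pow_unif_mem_ring (m : ℕ) : P.unif ^ m ∈ P.ring := pow_mem P.unif_mem_ring m

theorem pow_smul_mem_of_le {M : Submodule P.ring V} {v : V} {m n : ℕ} (h : P.unif ^ m • v ∈ M)
    (hmn : m ≤ n) : P.unif ^ n • v ∈ M := by
  obtain ⟨d, rfl⟩ := Nat.exists_eq_add_of_le' hmn
  rw [pow_add, mul_smul]
  exact P.smul_mem_of_mem_ring (P.pow_unif_mem_ring d) h

theorem exists_pow_mul_mem (f : K) : ∃ m : ℕ, P.unif ^ m * f ∈ P.ring := by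
  by_cases hf : f = 0
  · exact ⟨0, by simp [hf, zero_mem]⟩
  refine ⟨(-P.ord f).toNat, ?_⟩
  rw [← P.mem_fil_zero, ← zpow_natCast, P.unif_zpow_mul_mem_fil_iff, P.mem_fil_of_ne hf]
  omega

theorem span_eq_top_iff {M : Submodule P.ring V} :
    Submodule.span K (M : Set V) = ⊤ ↔ ∀ v, ∃ m : ℕ, P.unif ^ m • v ∈ M := by
  constructor
  · intro h v
    have hv : v ∈ Submodule.span K (M : Set V) := h ▸ Submodule.mem_top
    induction hv using Submodule.span_induction with
    | mem v hv => exact ⟨0, by simpa using hv⟩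
    | zero => exact ⟨0, by simp⟩
    | add v w _ _ hv hw =>
      obtain ⟨m, hm⟩ := hv
      obtain ⟨n, hn⟩ := hw
      refine ⟨max m n, ?_⟩
      rw [smul_add]
      exact add_mem (P.pow_smul_mem_of_le hm (le_max_left _ _))
        (P.pow_smul_mem_of_le hn (le_max_right _ _))
    | smul a v _ hv =>
      obtain ⟨m, hm⟩ := hv
      obtain ⟨n, hn⟩ := P.exists_pow_mul_mem a
      refine ⟨n + m, ?_⟩
      have : P.unif ^ (n + m) • a • v = (P.unif ^ n * a) • P.unif ^ m • v := by
        rw [pow_add, smul_smul, smul_smul]; congr 1; ring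
      rw [this]
      exact P.smul_mem_of_mem_ring hn hm
  · intro h
    rw [eq_top_iff]
    intro v _
    obtain ⟨m, hm⟩ := h v
    have := Submodule.smul_mem _ (P.unif ^ m)⁻¹ (Submodule.subset_span (R := K) hm)
    rwa [smul_smul, inv_mul_cancel₀ (pow_ne_zero _ P.unif_ne_zero), one_smul] at this

theorem IsLattice.exists_pow {M : Submodule P.ring V} (hM : P.IsLattice M) (v : V) :
    ∃ m : ℕ, P.unif ^ m • v ∈ M := P.span_eq_top_iff.1 hM.2 v

theorem IsLattice.of_le {M N : Submodule P.ring V} (hN : P.IsLattice N) (h : M ≤ N)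
    (hM : ∀ v, ∃ m : ℕ, P.unif ^ m • v ∈ M) : P.IsLattice M :=
  ⟨Submodule.FG.of_le hN.1 h, P.span_eq_top_iff.2 hM⟩

theorem IsLattice.inf {M N : Submodule P.ring V} (hM : P.IsLattice M) (hN : P.IsLattice N) :
    P.IsLattice (M ⊓ N) := by
  refine hM.of_le P inf_le_left fun v => ?_
  obtain ⟨m, hm⟩ := hM.exists_pow P v
  obtain ⟨n, hn⟩ := hN.exists_pow P v
  exact ⟨max m n, P.pow_smul_mem_of_le hm (le_max_left _ _),
    P.pow_smul_mem_of_le hn (le_max_right _ _)⟩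

theorem IsLattice.comap {M : Submodule P.ring V} (hM : P.IsLattice M) (W : Submodule K V) :
    P.IsLattice (M.comap (W.subtype.restrictScalars P.ring)) := by
  refine ⟨?_, P.span_eq_top_iff.2 fun v => hM.exists_pow P (v : V)⟩
  refine Submodule.fg_of_fg_map_injective (W.subtype.restrictScalars P.ring)
    Subtype.val_injective ?_
  exact Submodule.FG.of_le hM.1 (Submodule.map_comap_le _ _)


instance isTorsionFree_module : Module.IsTorsionFree P.ring V :=
  Module.IsTorsionFree.trans_faithfulSMul P.ring K V

omit [DecidableEq ι] in
theorem IsLattice.exists_basis [FiniteDimensional K V] (hcard : Fintype.card ι = finrank K V)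
    {M : Submodule P.ring V} (hM : P.IsLattice M) : ∃ b : Basis ι K V, M = P.lat b := by
  have : Submodule.IsLattice K M := ⟨hM.1, hM.2⟩
  have : Module.Finite P.ring M := Module.Finite.iff_fg.2 hM.1
  obtain ⟨n, bM⟩ := Module.basisOfFiniteTypeTorsionFree' (R := P.ring) (M := M)
  let b := bM.extendOfIsLattice K
  have hn : n = Fintype.card ι := by
    rw [hcard, Module.finrank_eq_card_basis b, Fintype.card_fin]
  subst hn
  refine ⟨b.reindex (Fintype.equivFin ι).symm, ?_⟩
  rw [lat, Basis.range_reindex]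
  have : Set.range b = M.subtype '' Set.range bM := by
    rw [← Set.range_comp]; congr 1; ext i; simp [b]
  rw [this, ← Submodule.map_span, bM.span_eq, Submodule.map_top, Submodule.range_subtype]

omit hK in
theorem det_mem_ring {b b' : Basis ι K V} (h : P.lat b' ≤ P.lat b) : b.det b' ∈ P.ring := by
  rw [Basis.det_apply, Matrix.det_apply]
  refine sum_mem fun σ _ => ?_
  rw [Units.smul_def]
  refine zsmul_mem (prod_mem fun i _ => ?_) _
  exact P.mem_lat.1 (h (Submodule.subset_span ⟨_, rfl⟩)) _

theorem ord_det_nonneg {b b' : Basis ι K V} (h : P.lat b' ≤ P.lat b) : 0 ≤ P.ord (b.det b') := by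
  have := P.mem_fil_zero.2 (P.det_mem_ring h)
  rw [mem_fil_iff] at this
  rcases this with h | h
  · rw [h]; simp
  · exact h

omit hK [Fintype ι] [DecidableEq ι] in
theorem det_ne_zero [Fintype ι] [DecidableEq ι] (b b' : Basis ι K V) : b.det b' ≠ 0 := (b.isUnit_det b').ne_zero

theorem det_mul (b b' b'' : Basis ι K V) : b.det b' * b'.det b'' = b.det b'' :=
  Basis.det_mul_det b b' b''

theorem ord_det_add (b b' b'' : Basis ι K V) :
    P.ord (b.det b') + P.ord (b'.det b'') = P.ord (b.det b'') := by
  rw [← det_mul b b' b'', P.ord_mul (det_ne_zero _ _) (det_ne_zero _ _)]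

theorem ord_det_self (b : Basis ι K V) : P.ord (b.det b) = 0 := by
  rw [Basis.det_self, ord_one]

theorem ord_det_eq_zero {b b' : Basis ι K V} (h : P.lat b' = P.lat b) : P.ord (b.det b') = 0 := by
  have h1 := P.ord_det_nonneg h.le
  have h2 := P.ord_det_nonneg h.ge
  have := P.ord_det_add b b' b
  rw [ord_det_self] at this
  omega

theorem irreducible_unif : Irreducible (⟨P.unif, P.unif_mem_ring⟩ : P.ring) := by
  rw [IsDiscreteValuationRing.irreducible_iff_uniformizer]
  ext f
  rw [P.mem_maximalIdeal_iff, Ideal.mem_span_singleton]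
  constructor
  · intro hf
    have : P.unif ^ (-1 : ℤ) * (f : K) ∈ P.fil 0 := by rw [P.unif_zpow_mul_mem_fil_iff]; simpa using hf
    refine ⟨⟨_, P.mem_fil_zero.1 this⟩, Subtype.ext ?_⟩
    change (f : K) = P.unif * (P.unif ^ (-1 : ℤ) * f)
    rw [zpow_neg_one, mul_inv_cancel_left₀ P.unif_ne_zero]
  · rintro ⟨c, rfl⟩
    have := P.mul_mem_fil P.unif_mem_fil (P.mem_fil_zero.2 c.2)
    simpa using this

theorem length_quotient_span {a : P.ring} (ha : a ≠ 0) :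
    Module.length P.ring (P.ring ⧸ Ideal.span {a}) = ((P.ord (a : K)).toNat : ℕ∞) := by
  obtain ⟨n, u, rfl⟩ :=
    IsDiscreteValuationRing.eq_unit_mul_pow_irreducible ha P.irreducible_unif
  rw [Ideal.span_singleton_mul_left_unit u.isUnit, ← Ideal.span_singleton_pow,
    ← P.irreducible_unif.maximalIdeal_eq, IsDiscreteValuationRing.length_quotient_pow_maximalIdeal]
  have hu : P.ord ((u : P.ring) : K) = 0 :=
    P.ord_eq_of (by simp) (by rw [zpow_zero]; exact (P.ring.valuation_eq_one_iff _).1 u.isUnit)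
  have : P.ord ((((u : P.ring) * ⟨P.unif, P.unif_mem_ring⟩ ^ n : P.ring)) : K) = n := by
    push_cast
    rw [P.ord_mul (by simp) (pow_ne_zero _ P.unif_ne_zero), hu, P.ord_pow P.unif_ne_zero, ord_unif]
    ring
  rw [this]; simp

/-- Two nested lattices have bases that differ by powers of the uniformizer. -/
theorem exists_adapted [FiniteDimensional K V] {b b' : Basis ι K V} (h : P.lat b' ≤ P.lat b) :
    ∃ (β : Basis ι K V) (n : ι → ℕ), P.lat β = P.lat b ∧
      (∀ v, v ∈ P.lat b' ↔ ∀ i, β.repr v i ∈ P.fil (n i)) ∧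
      P.ord (b.det b') = ∑ i, (n i : ℤ) ∧
      Module.length P.ring (P.lat b ⧸ (P.lat b').submoduleOf (P.lat b)) = ∑ i, (n i : ℕ∞) := by
  let M := P.lat b
  have : Submodule.IsLattice K M := ⟨(P.isLattice_lat b).1, (P.isLattice_lat b).2⟩
  let N : Submodule P.ring M := (P.lat b').submoduleOf M
  have hrank : finrank P.ring N = finrank P.ring M := by
    rw [(Submodule.submoduleOfEquivOfLe h).finrank_eq,
      Module.finrank_eq_card_basis (b.restrictScalars P.ring),
      Module.finrank_eq_card_basis (b'.restrictScalars P.ring)]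
  let bM := b.restrictScalars P.ring
  -- The coefficients of the Smith normal form are powers of the uniformizer up to units; only their
  -- orders enter the conclusion.
  let a := Submodule.smithNormalFormCoeffs bM hrank
  have ha : ∀ i, a i ≠ 0 := Submodule.smithNormalFormCoeffs_ne_zero bM hrank
  let bT := Submodule.smithNormalFormTopBasis bM hrank
  let bB := Submodule.smithNormalFormBotBasis bM hrank
  have hB : ∀ i, (bB i : M) = a i • bT i := Submodule.smithNormalFormBotBasis_def bM hrank
  let β : Basis ι K V := bT.extendOfIsLattice K
  have hβ : ∀ i, β i = (bT i : V) := fun i => by simp [β]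
  have hK0 : ∀ i, (a i : K) ≠ 0 := fun i h => ha i (Subtype.ext h)
  have hnn : ∀ i, 0 ≤ P.ord (a i : K) := fun i =>
    (P.mem_fil_of_ne (hK0 i)).1 (P.mem_fil_zero.2 (a i).2)
  have hlat : P.lat β = P.lat b := by
    have : Set.range β = M.subtype '' Set.range bT := by
      rw [← Set.range_comp]; congr 1; ext i; simp [hβ]
    rw [lat, this, ← Submodule.map_span, bT.span_eq, Submodule.map_top, Submodule.range_subtype]
  have hmem : ∀ v, v ∈ P.lat b' ↔ ∀ i, β.repr v i ∈ P.fil ((P.ord (a i : K)).toNat : ℤ) := by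
    intro v
    have hB' : ∀ i, ((bB i : M) : V) = (a i : K) • β i := fun i => by
      rw [hB, hβ]; rfl
    constructor
    · intro hv
      have hvN : (⟨v, h hv⟩ : M) ∈ N := hv
      obtain ⟨c, hc⟩ := bB.mem_submodule_iff'.1 hvN
      have hc' : v = ∑ i, ((c i : K) * (a i : K)) • β i := by
        have := congrArg Subtype.val hc
        rw [Submodule.coe_sum] at this
        rw [show v = _ from this]
        refine Finset.sum_congr rfl fun i _ => ?_
        rw [Submodule.coe_smul, hB', mul_smul]; rfl
      intro i
      rw [hc', Basis.repr_sum_self]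
      have := P.mul_mem_fil (P.mem_fil_zero.2 (c i).2) (P.mem_fil_iff.2 (.inr le_rfl) : (a i : K) ∈ P.fil (P.ord (a i : K)))
      rw [Int.toNat_of_nonneg (hnn i)]
      simpa using this
    · intro hv
      rw [← β.sum_repr v]
      refine sum_mem fun i _ => ?_
      have h1 : (a i : K) * ((a i : K)⁻¹ * β.repr v i) ∈ P.fil ((P.ord (a i : K)).toNat : ℤ) := by
        rw [mul_inv_cancel_left₀ (hK0 i)]; exact hv i
      rw [P.mul_mem_fil_iff (hK0 i), Int.toNat_of_nonneg (hnn i), sub_self, mem_fil_zero] at h1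
      have h2 : β.repr v i • β i = ((a i : K)⁻¹ * β.repr v i) • ((bB i : M) : V) := by
        rw [hB', smul_smul]; congr 1
        field_simp [hK0 i]
      rw [h2]
      exact P.smul_mem_of_mem_ring h1 (bB i).2
  refine ⟨β, fun i => (P.ord (a i : K)).toNat, hlat, hmem, ?_, ?_⟩
  · let w : ι → Kˣ := fun i => Units.mk0 (a i : K) (hK0 i)
    have h1 : P.lat b' = P.lat (β.unitsSMul w) := by
      ext v
      rw [hmem, mem_lat]
      refine forall_congr' fun i => ?_
      rw [Basis.repr_unitsSMul, Units.smul_def, smul_eq_mul, ← P.mem_fil_zero, P.mul_mem_fil_iff (by simp),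
        Units.val_inv_eq_inv_val, ord_inv, Int.toNat_of_nonneg (hnn i)]
      simp [w]
    rw [← P.ord_det_add b β b', ← P.ord_det_add β (β.unitsSMul w) b',
      P.ord_det_eq_zero hlat, P.ord_det_eq_zero h1, Basis.det_unitsSMul_self, ord_prod]
    · simp only [w, Units.val_mk0, zero_add, add_zero]
      exact Finset.sum_congr rfl fun i _ => (Int.toNat_of_nonneg (hnn i)).symm
    · intro i _; exact hK0 i
  · rw [(Submodule.quotientEquivPiSpan N bM hrank).length_eq, Module.length_pi_of_fintype]
    exact Finset.sum_congr rfl fun i _ => P.length_quotient_span (ha i)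

theorem length_lat [FiniteDimensional K V] {b b' : Basis ι K V} (h : P.lat b' ≤ P.lat b) :
    ((Module.length P.ring (P.lat b ⧸ (P.lat b').submoduleOf (P.lat b))).toNat : ℤ) =
      P.ord (b.det b') := by
  obtain ⟨β, n, -, -, h1, h2⟩ := P.exists_adapted h
  rw [h1, h2, ← Nat.cast_sum, ENat.toNat_natCast, Nat.cast_sum]

/-- Both lattices are compared with their intersection. The sign reflects that a larger lattice has
a basis with poles, hence a determinant of negative order. -/
theorem relLength_lat [FiniteDimensional K V] (b b' : Basis ι K V) :
    Stalks.relLength (P.lat b') (P.lat b) = -P.ord (b.det b') := by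
  obtain ⟨q, hq⟩ := ((P.isLattice_lat b').inf P (P.isLattice_lat b)).exists_basis P (ι := ι)
    (Module.finrank_eq_card_basis b).symm
  rw [Stalks.relLength, hq, P.length_lat (hq ▸ inf_le_left), P.length_lat (hq ▸ inf_le_right),
    ← P.ord_det_add b b' q]
  ring

theorem lat_eq_of_le [FiniteDimensional K V] {b b' : Basis ι K V} (h : P.lat b' ≤ P.lat b)
    (h0 : P.ord (b.det b') = 0) : P.lat b' = P.lat b := by
  obtain ⟨β, n, h1, h2, h3, -⟩ := P.exists_adapted h
  rw [h0] at h3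
  have hn : ∀ i, n i = 0 := fun i => by
    have := (Finset.sum_eq_zero_iff_of_nonneg (fun i _ => Nat.cast_nonneg (α := ℤ) (n i))).1 h3.symm i
      (Finset.mem_univ i)
    exact_mod_cast this
  ext v
  rw [h2, ← h1, mem_lat]
  refine forall_congr' fun i => ?_
  rw [hn, Nat.cast_zero, mem_fil_zero]

section Jets
variable [IsAlgClosed k]

/-- Functions regular at `P` are determined modulo `π ^ n` by `n` coefficients. -/
theorem exists_jets (n : ℕ) : ∃ φ : K →ₗ[k] (Fin n → k),
    ∀ f ∈ P.fil 0, φ f = 0 → f ∈ P.fil n := by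
  have hsm : ∀ (c : k) (f : K) (m : ℤ), f ∈ P.fil m → c • f ∈ P.fil m := fun c f m hf => by
    rw [Algebra.smul_def]; simpa using P.mul_mem_fil (P.algebraMap_mem_fil c) hf
  let F : ℤ → Submodule k K := fun m =>
    { carrier := P.fil m
      add_mem' := add_mem
      zero_mem' := zero_mem _
      smul_mem' := fun c f hf => hsm c f m hf }
  suffices ∃ φ : F 0 →ₗ[k] (Fin n → k), ∀ f : F 0, φ f = 0 → (f : K) ∈ P.fil n by
    obtain ⟨φ, hφ⟩ := this
    obtain ⟨ψ, hψ⟩ := φ.exists_extend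
    refine ⟨ψ, fun f hf h => hφ ⟨f, hf⟩ ?_⟩
    rw [← hψ]; exact h
  induction n with
  | zero => exact ⟨0, fun f _ => f.2⟩
  | succ n ih =>
    obtain ⟨φ, hφ⟩ := ih
    let ψ₀ : LinearMap.ker φ →ₗ[k] k :=
      { toFun := fun f => P.res (P.unif ^ (-(n : ℤ)) * ((f : F 0) : K))
        map_add' := fun f g => by
          rw [← P.res_add]
          · congr 1; simp [mul_add]
          · rw [← P.mem_fil_zero, P.unif_zpow_mul_mem_fil_iff]; simpa using hφ f f.2
          · rw [← P.mem_fil_zero, P.unif_zpow_mul_mem_fil_iff]; simpa using hφ g g.2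
        map_smul' := fun c f => by
          rw [RingHom.id_apply, smul_eq_mul, ← P.res_smul]
          · congr 1; simp
          · rw [← P.mem_fil_zero, P.unif_zpow_mul_mem_fil_iff]; simpa using hφ f f.2 }
    obtain ⟨ψ, hψ⟩ := ψ₀.exists_extend
    refine ⟨LinearMap.pi (Fin.snoc (α := fun _ => F 0 →ₗ[k] k) (fun i => LinearMap.proj i ∘ₗ φ) ψ), fun f hf => ?_⟩
    have h1 : φ f = 0 := by
      ext i
      have := congrFun hf i.castSucc
      simpa using this
    have h2 : ψ f = 0 := by
      have := congrFun hf (Fin.last n)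
      simpa using this
    have h3 : ψ₀ ⟨f, h1⟩ = 0 := by rw [← hψ]; exact h2
    change P.res (P.unif ^ (-(n : ℤ)) * (f : K)) = 0 at h3
    rw [P.res_eq_zero_iff, P.unif_zpow_mul_mem_fil_iff] at h3
    · rw [sub_neg_eq_add, add_comm] at h3; exact_mod_cast h3
    · rw [← P.mem_fil_zero, P.unif_zpow_mul_mem_fil_iff]; simpa using hφ f h1

/-- In adapted bases the sublattice is described by the vanishing of the first `n i` Taylor
coefficients of the `i`-th coordinate, and the `n i` add up to the index. This bounds the number of
conditions on global sections. -/
theorem exists_codim [Module k V] [IsScalarTower k K V] [FiniteDimensional K V] {b b' : Basis ι K V}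
    (h : P.lat b' ≤ P.lat b) : ∃ φ : V →ₗ[k] (Fin (P.ord (b.det b')).toNat → k),
      ∀ v ∈ P.lat b, φ v = 0 → v ∈ P.lat b' := by
  obtain ⟨β, n, h1, h2, h3, -⟩ := P.exists_adapted h
  choose φ hφ using fun i => P.exists_jets (n i)
  let e : (Σ i, Fin (n i)) ≃ Fin (P.ord (b.det b')).toNat := Fintype.equivFinOfCardEq (by
    rw [h3, ← Nat.cast_sum, Int.toNat_natCast]; simp)
  refine ⟨LinearMap.pi fun j => LinearMap.proj (e.symm j).2 ∘ₗ φ (e.symm j).1 ∘ₗ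
    ((Finsupp.lapply (e.symm j).1 ∘ₗ β.repr.toLinearMap).restrictScalars k), fun v hv h0 => ?_⟩
  rw [h2]
  intro i
  rw [← h1, mem_lat] at hv
  refine hφ i _ (P.mem_fil_zero.2 (hv i)) ?_
  ext j
  have := congrFun h0 (e ⟨i, j⟩)
  change φ (e.symm (e ⟨i, j⟩)).1 (β.repr v (e.symm (e ⟨i, j⟩)).1) (e.symm (e ⟨i, j⟩)).2 = 0 at this
  rwa [Equiv.symm_apply_apply] at this

end Jets

end Place
end Pointing
end

/-! ### Local degrees and the product formula. -/

noncomputable section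
namespace Pointing
open Module
set_option linter.unusedSectionVars false

namespace Place
variable {k K : Type*} [Field k] [Field K] [Algebra k K] [hK : Fact (IsFunctionFieldOfCurve k K)]
variable {V : Type*} [AddCommGroup V] [Module K V] {ι κ : Type*} [Fintype ι] [DecidableEq ι]
  [Fintype κ] [DecidableEq κ]

theorem lat_reindex (P : Place k K) (b : Basis ι K V) (e : ι ≃ κ) :
    P.lat (b.reindex e) = P.lat b := by
  rw [lat, Basis.range_reindex]

theorem lat_le_iff (P : Place k K) {b b' : Basis ι K V} :
    P.lat b' ≤ P.lat b ↔ ∀ i j, b.repr (b' j) i ∈ P.ring := by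
  rw [lat, Submodule.span_le]
  constructor
  · intro h i j
    exact P.mem_lat.1 (h ⟨j, rfl⟩) i
  · rintro h _ ⟨j, rfl⟩
    exact P.mem_lat.2 fun i => h i j

theorem finite_not_mem_ring (f : K) : {P : Place k K | f ∉ P.ring}.Finite := by
  refine (finite_ord_ne_zero f).subset fun P hP => ?_
  rw [Set.mem_ofPred_eq] at *
  intro h0
  apply hP
  rw [← P.mem_fil_zero, P.mem_fil_iff]
  exact .inr h0.ge

theorem finite_not_lat_le (b b' : Basis ι K V) :
    {P : Place k K | ¬ P.lat b' ≤ P.lat b}.Finite := by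
  refine (Set.finite_iUnion fun i : ι => Set.finite_iUnion fun j : ι =>
    finite_not_mem_ring (k := k) (b.repr (b' j) i)).subset fun P hP => ?_
  rw [Set.mem_ofPred_eq, lat_le_iff] at hP
  push Not at hP
  obtain ⟨i, j, h⟩ := hP
  exact Set.mem_iUnion.2 ⟨i, Set.mem_iUnion.2 ⟨j, h⟩⟩

theorem finite_lat_ne (b b' : Basis ι K V) : {P : Place k K | P.lat b' ≠ P.lat b}.Finite := by
  refine ((finite_not_lat_le b b').union (finite_not_lat_le b' b)).subset fun P hP => ?_
  rw [Set.mem_ofPred_eq] at hP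
  rw [Set.mem_union, Set.mem_ofPred_eq, Set.mem_ofPred_eq]
  by_contra! h
  exact hP (le_antisymm h.1 h.2)

end Place

namespace Stalks
variable {k K : Type*} [Field k] [Field K] [Algebra k K] [hK : Fact (IsFunctionFieldOfCurve k K)]
variable {V : Type*} [AddCommGroup V] [Module K V] {ι κ : Type*} [Fintype ι] [DecidableEq ι]
  [Fintype κ] [DecidableEq κ] {X Y : Stalks k K V}

theorem IsVectorBundle.isLattice (hX : X.IsVectorBundle) (P : Place k K) :
    P.IsLattice (X.stalk P) := hX.1 P

theorem IsVectorBundle.finiteDimensional (hX : X.IsVectorBundle) : FiniteDimensional K V :=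
  Module.Finite.of_basis hX.2.choose

theorem IsVectorBundle.finite_ne (hX : X.IsVectorBundle) (b : Basis ι K V) :
    {P | X.stalk P ≠ P.lat b}.Finite := by
  obtain ⟨b₀, hb₀⟩ := hX.2
  have e : Fin (finrank K V) ≃ ι := Fintype.equivOfCardEq (by
    rw [Fintype.card_fin, Module.finrank_eq_card_basis b])
  refine (hb₀.union (Place.finite_lat_ne (k := k) (b₀.reindex e) b)).subset fun P hP => ?_
  rw [Set.mem_union, Set.mem_ofPred_eq, Set.mem_ofPred_eq, Place.lat_reindex]
  rw [Set.mem_ofPred_eq] at hP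
  by_contra! h
  exact hP (h.1.trans h.2.symm)

theorem isVectorBundle_of (b : Basis ι K V) (h : ∀ P : Place k K, P.IsLattice (X.stalk P))
    (hfin : {P | X.stalk P ≠ P.lat b}.Finite) : X.IsVectorBundle := by
  have e : ι ≃ Fin (finrank K V) := Fintype.equivOfCardEq (by
    rw [Fintype.card_fin, Module.finrank_eq_card_basis b])
  refine ⟨h, b.reindex e, ?_⟩
  convert hfin using 4 with P
  exact P.lat_reindex b e

theorem IsVectorBundle.exists_lat (hX : X.IsVectorBundle) (b : Basis ι K V) (P : Place k K) :
    ∃ c : Basis ι K V, X.stalk P = P.lat c := by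
  have := hX.finiteDimensional
  exact (hX.isLattice P).exists_basis P (Module.finrank_eq_card_basis b).symm

/-- The local contribution at `P` to the degree, with respect to a basis. -/
def degAt (X : Stalks k K V) (b : Basis ι K V) (P : Place k K) : ℤ :=
  relLength (X.stalk P) (P.lat b)

theorem degAt_eq {b c : Basis ι K V} {P : Place k K} (h : X.stalk P = P.lat c) :
    X.degAt b P = -P.ord (b.det c) := by
  have := Module.Finite.of_basis b
  rw [degAt, h, P.relLength_lat]

theorem degAt_eq_zero {b : Basis ι K V} {P : Place k K} (h : X.stalk P = P.lat b) :
    X.degAt b P = 0 := by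
  rw [degAt_eq h, P.ord_det_self, neg_zero]

theorem IsVectorBundle.degAt_change (hX : X.IsVectorBundle) (b b' : Basis ι K V) (P : Place k K) :
    X.degAt b P = X.degAt b' P - P.ord (b.det b') := by
  obtain ⟨c, hc⟩ := hX.exists_lat b P
  rw [degAt_eq hc, degAt_eq hc, ← P.ord_det_add b b' c]
  ring

theorem IsVectorBundle.finite_degAt (hX : X.IsVectorBundle) (b : Basis ι K V) :
    (Function.support (X.degAt b)).Finite := by
  refine (hX.finite_ne b).subset fun P hP => ?_
  rw [Function.mem_support] at hP
  rw [Set.mem_ofPred_eq]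
  exact fun h => hP (degAt_eq_zero h)

theorem degAt_reindex (b : Basis ι K V) (e : ι ≃ κ) (P : Place k K) :
    X.degAt (b.reindex e) P = X.degAt b P := by
  rw [degAt, degAt, P.lat_reindex]

theorem IsVectorBundle.degAt_mono (hX : X.IsVectorBundle) (hY : Y.IsVectorBundle)
    (b : Basis ι K V) {P : Place k K} (h : X.stalk P ≤ Y.stalk P) :
    X.degAt b P ≤ Y.degAt b P := by
  obtain ⟨c, hc⟩ := hX.exists_lat b P
  obtain ⟨d, hd⟩ := hY.exists_lat b P
  rw [degAt_eq hc, degAt_eq hd, ← P.ord_det_add b d c]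
  have := P.ord_det_nonneg (hc ▸ hd ▸ h)
  omega

theorem IsVectorBundle.stalk_eq_of_degAt (hX : X.IsVectorBundle) (hY : Y.IsVectorBundle)
    (b : Basis ι K V) {P : Place k K} (h : X.stalk P ≤ Y.stalk P)
    (h0 : Y.degAt b P ≤ X.degAt b P) : X.stalk P = Y.stalk P := by
  have := Module.Finite.of_basis b
  obtain ⟨c, hc⟩ := hX.exists_lat b P
  obtain ⟨d, hd⟩ := hY.exists_lat b P
  rw [degAt_eq hc, degAt_eq hd, ← P.ord_det_add b d c] at h0
  have h1 := P.ord_det_nonneg (hc ▸ hd ▸ h)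
  rw [hc, hd]
  exact P.lat_eq_of_le (hc ▸ hd ▸ h) (by omega)

end Stalks

section Product
variable {k K : Type*} [Field k] [Field K] [Algebra k K] [hK : Fact (IsFunctionFieldOfCurve k K)]

/-- The line bundle generated by a nonzero function. -/
def principalBundle (k : Type*) {K : Type*} [Field k] [Field K] [Algebra k K] (f : K) :
    Stalks k K K where
  stalk P := Submodule.span P.ring {f}

/-- The basis of `K` over itself given by a nonzero element. -/
def unitBasis {f : K} (hf : f ≠ 0) : Basis (Fin 1) K K :=
  (Basis.singleton (Fin 1) K).unitsSMul fun _ => Units.mk0 f hf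

theorem range_unitBasis {f : K} (hf : f ≠ 0) : Set.range (unitBasis hf) = {f} := by
  ext x; simp [unitBasis, Basis.unitsSMul_apply, Units.smul_def, eq_comm]

theorem unitBasis_apply {f : K} (hf : f ≠ 0) (i : Fin 1) : unitBasis hf i = f := by
  simp [unitBasis, Basis.unitsSMul_apply, Units.smul_def]

theorem det_unitBasis {f g : K} (hf : f ≠ 0) (hg : g ≠ 0) :
    (unitBasis hf).det (unitBasis hg) = f⁻¹ * g := by
  have h1 : (unitBasis hf).repr g 0 = f⁻¹ * g := by
    have : g = (f⁻¹ * g) • unitBasis hf 0 := by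
      rw [unitBasis_apply, smul_eq_mul]; field_simp
    conv_lhs => rw [this, map_smul, Finsupp.smul_apply, Basis.repr_self]
    simp
  rw [Basis.det_apply, Matrix.det_unique]
  simp only [Fin.default_eq_zero, Basis.toMatrix_apply, unitBasis_apply, h1]

theorem mem_span_unit (P : Place k K) {f x : K} (hf : f ≠ 0) :
    x ∈ Submodule.span P.ring {f} ↔ x ∈ P.fil (P.ord f) := by
  rw [Submodule.mem_span_singleton]
  constructor
  · rintro ⟨a, rfl⟩
    exact (P.fil _).smul_mem a ((P.mem_fil_of_ne hf).2 le_rfl)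
  · intro h
    have : f * (f⁻¹ * x) ∈ P.fil (P.ord f) := by rwa [mul_inv_cancel_left₀ hf]
    rw [P.mul_mem_fil_iff hf, sub_self, P.mem_fil_zero] at this
    exact ⟨⟨_, this⟩, by
      change f⁻¹ * x * f = x
      field_simp⟩

theorem principalBundle_isVectorBundle {f : K} (hf : f ≠ 0) :
    (principalBundle k f).IsVectorBundle := by
  have : ∀ P, (principalBundle k f).stalk P = P.lat (unitBasis hf) := fun P => by
    rw [Place.lat, range_unitBasis]; rfl
  refine Stalks.isVectorBundle_of (unitBasis hf) (fun P => ?_) ?_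
  · rw [this]; exact P.isLattice_lat _
  · simp [this]

theorem globalSections_principalBundle {f : K} (hf : f ≠ 0) :
    Nonempty ((principalBundle k f).globalSections ≃ₗ[k]
      (principalBundle k (1 : K)).globalSections) := by
  have h : (principalBundle k f).globalSections =
      (principalBundle k (1 : K)).globalSections.map (LinearMap.mulLeft k f) := by
    ext x
    rw [Submodule.mem_map]
    constructor
    · intro hx
      refine ⟨f⁻¹ * x, fun P => ?_, by simp [hf]⟩
      have := hx P
      change _ ∈ Submodule.span P.ring {1}
      change _ ∈ Submodule.span P.ring {f} at this
      rw [mem_span_unit P one_ne_zero, P.mul_mem_fil_iff (inv_ne_zero hf), P.ord_inv, P.ord_one]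
      rw [mem_span_unit P hf] at this
      simpa using this
    · rintro ⟨y, hy, rfl⟩ P
      have := hy P
      change _ ∈ Submodule.span P.ring {1} at this
      change _ ∈ Submodule.span P.ring {f}
      rw [mem_span_unit P one_ne_zero, P.ord_one] at this
      rw [mem_span_unit P hf, LinearMap.mulLeft_apply, P.mul_mem_fil_iff hf, sub_self]
      exact this
  rw [h]
  exact ⟨(Submodule.equivMapOfInjective _ (fun x y hxy => mul_left_cancel₀ hf hxy) _).symm⟩

theorem finsum_ord_unit {f : K} (hf : f ≠ 0) (m : ℤ) :
    ∑ᶠ P : Place k K, P.ord (f ^ m) = m * ∑ᶠ P : Place k K, P.ord f := by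
  simp only [fun P : Place k K => P.ord_zpow hf m]
  rw [← mul_finsum]

/-- The degree is measured against an unspecified basis of `K`, that is, against a nonzero function
`g`. Its contribution cannot be dropped before the product formula is known. -/
theorem exists_degAt_finBasis : ∃ g : K, g ≠ 0 ∧ ∀ (f : K), f ≠ 0 →
    (principalBundle k f).deg = ∑ᶠ P : Place k K, P.ord g - ∑ᶠ P : Place k K, P.ord f := by
  have h1 : finrank K K = 1 := finrank_self K
  let e : Fin (finrank K K) ≃ Fin 1 := finCongr h1
  let b := (finBasis K K).reindex e
  have hg : b 0 ≠ 0 := b.ne_zero 0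
  refine ⟨b 0, hg, fun f hf => ?_⟩
  have hb : ∀ P : Place k K, P.lat (finBasis K K) = P.lat (unitBasis hg) := fun P => by
    rw [← P.lat_reindex _ e]
    rw [Place.lat, Place.lat, range_unitBasis]
    congr 1
    have : Set.range b = {b 0} := by
      rw [Set.range_unique, Fin.default_eq_zero]
    rw [← this]
  have h2 : (principalBundle k f).deg = ∑ᶠ P : Place k K, (P.ord (b 0) - P.ord f) := by
    refine finsum_congr fun P => ?_
    change Stalks.relLength (Submodule.span P.ring {f}) (P.lat (finBasis K K)) = _
    rw [hb, ← range_unitBasis hf]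
    change Stalks.relLength (P.lat (unitBasis hf)) _ = _
    rw [P.relLength_lat, det_unitBasis, P.ord_mul (inv_ne_zero hg) hf, P.ord_inv]
    ring
  rw [h2, finsum_sub_distrib]
  · exact Place.finite_ord_ne_zero _
  · exact Place.finite_ord_ne_zero _

/-- The product formula. -/
theorem finsum_ord {p : ℤ} (hp : HasGenus k K p) {f : K} (hf : f ≠ 0) :
    ∑ᶠ P : Place k K, P.ord f = 0 := by
  obtain ⟨g, hg, hdeg⟩ := exists_degAt_finBasis (k := k) (K := K)
  set A := ∑ᶠ P : Place k K, P.ord g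
  set h := finrank k (principalBundle k (1 : K)).globalSections
  set S := ∑ᶠ P : Place k K, P.ord f with hS
  -- Multiplication by `f ^ m` preserves the number of sections while it shifts the degree by `-m *
  -- S`. The genus bounds the degree for every `m`, which forces `S = 0`.
  have key : ∀ m : ℤ, A - m * S - h + 1 ≤ p := fun m => by
    refine hp.2 ?_
    rw [Set.mem_ofPred_eq]
    have hm : f ^ m ≠ 0 := zpow_ne_zero m hf
    refine ⟨principalBundle k (f ^ m), principalBundle_isVectorBundle hm, ?_⟩
    rw [hdeg _ hm, finsum_ord_unit hf, (globalSections_principalBundle hm).some.finrank_eq]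
  by_contra hne
  -- For this exponent the shift is a positive multiple of `S * S ≥ 1`, large enough to break the
  -- bound.
  have h2 := key (-((|A - h + 1 - p| + 1) * S))
  have h3 : 1 ≤ S * S := by
    have := mul_self_pos.2 hne
    omega
  have h4 := neg_abs_le (A - h + 1 - p)
  have h5 := abs_nonneg (A - h + 1 - p)
  nlinarith

theorem finsum_ord_mul_unit {p : ℤ} (hp : HasGenus k K p) (f : K) :
    ∑ᶠ P : Place k K, P.ord f = 0 := by
  by_cases hf : f = 0
  · simp [hf]
  · exact finsum_ord hp hf

end Product
end Pointing
end

/-! ### Twists by divisors and the global degree. -/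

noncomputable section
namespace Pointing
open Module
set_option linter.unusedSectionVars false

variable {k K : Type*} [Field k] [Field K] [Algebra k K] [hK : Fact (IsFunctionFieldOfCurve k K)]

theorem finsum_eq_degree (D : Place k K →₀ ℤ) : ∑ᶠ P, D P = D.degree := by
  rw [finsum_eq_sum_of_support_subset (s := D.support) _ (by simp), Finsupp.degree_apply]

theorem finsum_mono_of_finite {ι : Type*} {f g : ι → ℤ} (hf : (Function.support f).Finite)
    (hg : (Function.support g).Finite) (h : ∀ i, f i ≤ g i) : ∑ᶠ i, f i ≤ ∑ᶠ i, g i := by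
  classical
  rw [finsum_eq_sum_of_support_subset (s := (hf.union hg).toFinset) f (by simp),
    finsum_eq_sum_of_support_subset (s := (hf.union hg).toFinset) g (by simp)]
  exact Finset.sum_le_sum fun i _ => h i

theorem finsum_strictMono_of_finite {ι : Type*} {f g : ι → ℤ} (hf : (Function.support f).Finite)
    (hg : (Function.support g).Finite) (h : ∀ i, f i ≤ g i) {i : ι} (hi : f i < g i) :
    ∑ᶠ i, f i < ∑ᶠ i, g i := by
  classical
  rw [finsum_eq_sum_of_support_subset (s := (hf.union hg).toFinset) f (by simp),
    finsum_eq_sum_of_support_subset (s := (hf.union hg).toFinset) g (by simp)]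
  refine Finset.sum_lt_sum (fun i _ => h i) ⟨i, ?_, hi⟩
  rw [Set.Finite.mem_toFinset, Set.mem_union, Function.mem_support, Function.mem_support]
  omega

/-- The space of functions `f` with `div f + D ≥ 0`. -/
def rrSpace (D : Place k K →₀ ℤ) : Submodule k K where
  carrier := {f | ∀ P : Place k K, f ∈ P.fil (-D P)}
  add_mem' hf hg P := add_mem (hf P) (hg P)
  zero_mem' P := zero_mem _
  smul_mem' c f hf P := by
    rw [Algebra.smul_def]
    simpa using P.mul_mem_fil (P.algebraMap_mem_fil c) (hf P)

theorem mem_rrSpace {D : Place k K →₀ ℤ} {f : K} : f ∈ rrSpace D ↔ ∀ P : Place k K, f ∈ P.fil (-D P) := Iff.rfl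

namespace Stalks
variable {V : Type*} [AddCommGroup V] [Module K V] {ι κ : Type*} [Fintype ι] [DecidableEq ι]
  [Fintype κ] [DecidableEq κ] {X Y : Stalks k K V}

/-- The twist of a bundle by a divisor. -/
def twistDiv (X : Stalks k K V) (D : Place k K →₀ ℤ) : Stalks k K V where
  stalk P := (X.stalk P).comap (LinearMap.restrictScalars P.ring
    (LinearMap.lsmul K V (P.unif ^ D P)))

theorem mem_twistDiv {D : Place k K →₀ ℤ} {P : Place k K} {v : V} :
    v ∈ (X.twistDiv D).stalk P ↔ P.unif ^ D P • v ∈ X.stalk P := Iff.rfl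

theorem twistDiv_eq_lat {c : Basis ι K V} {P : Place k K} (h : X.stalk P = P.lat c)
    (D : Place k K →₀ ℤ) : (X.twistDiv D).stalk P =
      P.lat (c.unitsSMul fun _ => Units.mk0 (P.unif ^ (-D P)) (zpow_ne_zero _ P.unif_ne_zero)) := by
  ext v
  rw [mem_twistDiv, h, P.mem_lat, P.mem_lat]
  refine forall_congr' fun i => ?_
  rw [Basis.repr_unitsSMul, Units.smul_def, Units.val_inv_eq_inv_val, Units.val_mk0, zpow_neg,
    inv_inv, map_smul, Finsupp.smul_apply]

theorem twistDiv_of_eq_zero {D : Place k K →₀ ℤ} {P : Place k K} (h : D P = 0) :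
    (X.twistDiv D).stalk P = X.stalk P := by
  ext v; rw [mem_twistDiv, h, zpow_zero, one_smul]

theorem IsVectorBundle.twistDiv (hX : X.IsVectorBundle) (D : Place k K →₀ ℤ) :
    (X.twistDiv D).IsVectorBundle := by
  have := hX.finiteDimensional
  refine isVectorBundle_of (finBasis K V) (fun P => ?_)
    (((hX.finite_ne (finBasis K V)).union D.hasFiniteSupport).subset fun P hP => ?_)
  · obtain ⟨c, hc⟩ := hX.exists_lat (finBasis K V) P
    rw [twistDiv_eq_lat hc]
    exact P.isLattice_lat _
  · rw [Set.mem_ofPred_eq] at hP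
    rw [Set.mem_union, Set.mem_ofPred_eq, Function.mem_support]
    by_contra! h
    exact hP ((twistDiv_of_eq_zero h.2).trans h.1)

theorem IsVectorBundle.degAt_twistDiv (hX : X.IsVectorBundle) (D : Place k K →₀ ℤ)
    (b : Basis ι K V) (P : Place k K) :
    (X.twistDiv D).degAt b P = X.degAt b P + Fintype.card ι * D P := by
  obtain ⟨c, hc⟩ := hX.exists_lat b P
  rw [degAt_eq hc, degAt_eq (twistDiv_eq_lat hc D), ← P.ord_det_add b c, Basis.det_unitsSMul_self,
    P.ord_prod]
  · simp only [Units.val_mk0, P.ord_unif_zpow, Finset.sum_const, Finset.card_univ, nsmul_eq_mul]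
    ring
  · intro i _
    exact zpow_ne_zero _ P.unif_ne_zero

theorem twistDiv_twistDiv (X : Stalks k K V) (D E : Place k K →₀ ℤ) :
    (X.twistDiv D).twistDiv E = X.twistDiv (D + E) := by
  have : ∀ P, ((X.twistDiv D).twistDiv E).stalk P = (X.twistDiv (D + E)).stalk P := fun P => by
    ext v
    rw [mem_twistDiv, mem_twistDiv, mem_twistDiv, smul_smul, ← zpow_add₀ P.unif_ne_zero,
      Finsupp.add_apply]
  cases h1 : (X.twistDiv D).twistDiv E
  cases h2 : X.twistDiv (D + E)
  congr
  funext P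
  have := this P
  rwa [h1, h2] at this

theorem sub_twistDiv (X : Stalks k K V) (D : Place k K →₀ ℤ) (W : Submodule K V) :
    (X.twistDiv D).sub W = (X.sub W).twistDiv D := rfl

theorem twistDiv_stalk_mono {D E : Place k K →₀ ℤ} {P : Place k K} (h : D P ≤ E P) :
    (X.twistDiv D).stalk P ≤ (X.twistDiv E).stalk P := fun v hv => by
  rw [mem_twistDiv] at *
  have : P.unif ^ E P • v = P.unif ^ (E P - D P) • P.unif ^ D P • v := by
    rw [smul_smul, ← zpow_add₀ P.unif_ne_zero]; congr 2; ring
  rw [this]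
  exact P.smul_mem_of_mem_ring (P.mem_fil_zero.1 (P.fil_anti (by omega) (P.unif_zpow_mem_fil _))) hv

/-- With a basis of `V` adapted to `W` and a complement, almost all stalks are the coordinate
lattices of this basis, and these meet `W` in coordinate lattices. -/
theorem IsVectorBundle.sub (hX : X.IsVectorBundle) (W : Submodule K V) :
    (X.sub W).IsVectorBundle := by
  have := hX.finiteDimensional
  obtain ⟨C, hC⟩ := W.exists_isCompl
  let b := ((finBasis K W).prod (finBasis K C)).map (Submodule.prodEquivOfIsCompl W C hC)
  have hb : ∀ (w : W) i, b.repr w (.inl i) = (finBasis K W).repr w i := fun w i => by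
    simp [b]
  have hb' : ∀ (w : W) i, b.repr w (.inr i) = 0 := fun w i => by
    simp [b]
  refine isVectorBundle_of (finBasis K W) (fun P => (hX.isLattice P).comap P W) 
    ((hX.finite_ne b).subset fun P hP => ?_)
  rw [Set.mem_ofPred_eq] at *
  intro h
  apply hP
  ext w
  change (w : V) ∈ X.stalk P ↔ _
  rw [h, P.mem_lat, P.mem_lat]
  constructor
  · intro hw i; rw [← hb]; exact hw _
  · rintro hw (i | i)
    · rw [hb]; exact hw i
    · rw [hb']; exact zero_mem _

section Degree
variable [hG : Fact (HasGenus k K 1)]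

/-- A change of basis alters the local terms by the orders of a single determinant, and these sum to
zero by the product formula. -/
theorem IsVectorBundle.deg_eq [FiniteDimensional K V] (hX : X.IsVectorBundle) (b : Basis ι K V) :
    X.deg = ∑ᶠ P, X.degAt b P := by
  let e : ι ≃ Fin (finrank K V) := Fintype.equivOfCardEq (by
    rw [Fintype.card_fin, Module.finrank_eq_card_basis b])
  have : ∀ P, X.degAt (finBasis K V) P = X.degAt b P - P.ord ((finBasis K V).det (b.reindex e)) :=
    fun P => by rw [hX.degAt_change _ (b.reindex e), degAt_reindex]
  calc X.deg = ∑ᶠ P, X.degAt (finBasis K V) P := rfl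
    _ = _ := by
      rw [finsum_congr this, finsum_sub_distrib (hX.finite_degAt b) (Place.finite_ord_ne_zero _),
        finsum_ord_mul_unit hG.out, sub_zero]

theorem IsVectorBundle.deg_twistDiv [FiniteDimensional K V] (hX : X.IsVectorBundle)
    (D : Place k K →₀ ℤ) : (X.twistDiv D).deg = X.deg + finrank K V * D.degree := by
  rw [(hX.twistDiv D).deg_eq (finBasis K V), hX.deg_eq (finBasis K V),
    finsum_congr (hX.degAt_twistDiv D (finBasis K V)),
    finsum_add_distrib (hX.finite_degAt _), ← mul_finsum, finsum_eq_degree, Fintype.card_fin]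
  exact (D.hasFiniteSupport).subset (fun P hP => by
    rw [Function.mem_support] at *
    exact right_ne_zero_of_mul hP)

theorem IsVectorBundle.deg_mono [FiniteDimensional K V] (hX : X.IsVectorBundle)
    (hY : Y.IsVectorBundle) (h : ∀ P, X.stalk P ≤ Y.stalk P) : X.deg ≤ Y.deg := by
  rw [hX.deg_eq (finBasis K V), hY.deg_eq (finBasis K V)]
  exact finsum_mono_of_finite (hX.finite_degAt _) (hY.finite_degAt _) fun P =>
    hX.degAt_mono hY _ (h P)

theorem IsVectorBundle.stalk_eq_of_deg_le [FiniteDimensional K V] (hX : X.IsVectorBundle)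
    (hY : Y.IsVectorBundle) (h : ∀ P, X.stalk P ≤ Y.stalk P) (hd : Y.deg ≤ X.deg) (P : Place k K) :
    X.stalk P = Y.stalk P := by
  refine hX.stalk_eq_of_degAt hY (finBasis K V) (h P) ?_
  by_contra! hlt
  rw [hX.deg_eq (finBasis K V), hY.deg_eq (finBasis K V)] at hd
  refine absurd hd (not_le.2 ?_)
  exact finsum_strictMono_of_finite (hX.finite_degAt _) (hY.finite_degAt _)
    (fun P => hX.degAt_mono hY _ (h P)) hlt

/-- The trivial bundle spanned by a basis. -/
def trivialBundle (k : Type*) {K V ι : Type*} [Field k] [Field K] [Algebra k K] [AddCommGroup V]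
    [Module K V] (b : Basis ι K V) : Stalks k K V where
  stalk P := P.lat b

theorem trivialBundle_isVectorBundle (b : Basis ι K V) : (trivialBundle k b).IsVectorBundle :=
  isVectorBundle_of b (fun P => P.isLattice_lat b) (by simp [trivialBundle])

theorem deg_trivialBundle [FiniteDimensional K V] (b : Basis ι K V) :
    (trivialBundle k b).deg = 0 := by
  rw [(trivialBundle_isVectorBundle b).deg_eq b, finsum_congr fun P => degAt_eq_zero rfl,
    finsum_zero]

theorem deg_principalBundle {f : K} (hf : f ≠ 0) : (principalBundle k f).deg = 0 := by
  obtain ⟨g, hg, h⟩ := exists_degAt_finBasis (k := k) (K := K)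
  rw [h f hf, finsum_ord hG.out hg, finsum_ord hG.out hf, sub_zero]

end Degree
end Stalks
end Pointing
end

/-! ### Line bundles, divisors and Riemann–Roch in genus one. -/

noncomputable section
namespace Pointing
open Module
set_option linter.unusedSectionVars false

variable {k K : Type*} [Field k] [Field K] [Algebra k K] [hK : Fact (IsFunctionFieldOfCurve k K)]

theorem Stalks.ext_stalk {V : Type*} [AddCommGroup V] [Module K V] {X Y : Stalks k K V}
    (h : ∀ P, X.stalk P = Y.stalk P) : X = Y := by
  cases X; cases Y; congr; exact funext h

/-- The line bundle `𝒪(D)`. -/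
abbrev lineBundle (D : Place k K →₀ ℤ) : Stalks k K K := (principalBundle k (1 : K)).twistDiv D

theorem mem_lineBundle {D : Place k K →₀ ℤ} {P : Place k K} {f : K} :
    f ∈ (lineBundle D).stalk P ↔ f ∈ P.fil (-D P) := by
  rw [Stalks.mem_twistDiv]
  change _ ∈ Submodule.span P.ring {1} ↔ _
  rw [mem_span_unit P one_ne_zero, P.ord_one, smul_eq_mul, P.unif_zpow_mul_mem_fil_iff, zero_sub]

theorem globalSections_lineBundle (D : Place k K →₀ ℤ) :
    (lineBundle D).globalSections = rrSpace D := by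
  ext f
  exact forall_congr' fun P => mem_lineBundle

theorem Stalks.IsVectorBundle.exists_div {L : Stalks k K K} (hL : L.IsVectorBundle) :
    ∃ D, L = lineBundle D := by
  have h1 : ∀ P : Place k K, ∃ f : K, f ≠ 0 ∧ L.stalk P = Submodule.span P.ring {f} := fun P => by
    obtain ⟨c, hc⟩ := hL.exists_lat (unitBasis (one_ne_zero (α := K))) P
    refine ⟨c 0, c.ne_zero 0, ?_⟩
    rw [hc, Place.lat, Set.range_unique, Fin.default_eq_zero]
  choose f hf hL' using h1
  have hfin : (Function.support fun P : Place k K => -P.ord (f P)).Finite := by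
    refine (hL.finite_ne (unitBasis (one_ne_zero (α := K)))).subset fun P hP => ?_
    rw [Function.mem_support] at hP
    rw [Set.mem_ofPred_eq]
    intro h
    apply hP
    rw [hL', Place.lat, range_unitBasis] at h
    have h1 : (1 : K) ∈ Submodule.span P.ring {f P} := h ▸ Submodule.mem_span_singleton_self _
    have h2 : f P ∈ Submodule.span P.ring {(1 : K)} := h ▸ Submodule.mem_span_singleton_self _
    rw [mem_span_unit P (hf P), P.mem_fil_of_ne one_ne_zero, P.ord_one] at h1
    rw [mem_span_unit P one_ne_zero, P.mem_fil_of_ne (hf P), P.ord_one] at h2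
    omega
  refine ⟨Finsupp.ofSupportFinite _ hfin, Stalks.ext_stalk fun P => ?_⟩
  ext x
  rw [mem_lineBundle, hL', mem_span_unit P (hf P)]
  simp [Finsupp.ofSupportFinite_coe]

theorem lineBundle_isVectorBundle (D : Place k K →₀ ℤ) : (lineBundle D).IsVectorBundle :=
  (principalBundle_isVectorBundle one_ne_zero).twistDiv D

/-- The divisor of a function (`0` for the zero function). -/
def divisor (k : Type*) {K : Type*} [Field k] [Field K] [Algebra k K]
    [hK : Fact (IsFunctionFieldOfCurve k K)] (f : K) : Place k K →₀ ℤ :=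
  Finsupp.ofSupportFinite (fun P => P.ord f) (Place.finite_ord_ne_zero f)

@[simp] theorem divisor_apply (f : K) (P : Place k K) : divisor k f P = P.ord f := rfl

theorem divisor_mul {f g : K} (hf : f ≠ 0) (hg : g ≠ 0) :
    divisor k (f * g) = divisor k f + divisor k g := by
  ext P; exact P.ord_mul hf hg

theorem divisor_inv (f : K) : divisor k f⁻¹ = -divisor k f := by
  ext P; exact P.ord_inv f

theorem divisor_zpow {f : K} (hf : f ≠ 0) (m : ℤ) : divisor k (f ^ m) = m • divisor k f := by
  ext P; exact P.ord_zpow hf m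

theorem divisor_one : divisor k (1 : K) = 0 := by
  ext P; exact P.ord_one

theorem mem_rrSpace_of_ne {D : Place k K →₀ ℤ} {f : K} (hf : f ≠ 0) :
    f ∈ rrSpace D ↔ 0 ≤ D + divisor k f := by
  rw [mem_rrSpace, Finsupp.le_def]
  refine forall_congr' fun P => ?_
  rw [P.mem_fil_of_ne hf, Finsupp.zero_apply, Finsupp.add_apply, divisor_apply]
  omega

theorem rrSpace_mono {D E : Place k K →₀ ℤ} (h : D ≤ E) : rrSpace D ≤ rrSpace E :=
  fun f hf P => P.fil_anti (by have := h P; omega) (hf P)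

theorem mul_mem_rrSpace {D E : Place k K →₀ ℤ} {f g : K} (hf : f ∈ rrSpace D)
    (hg : g ∈ rrSpace E) : f * g ∈ rrSpace (D + E) := fun P => by
  have := P.mul_mem_fil (hf P) (hg P)
  rwa [← neg_add, ← Finsupp.add_apply] at this

theorem mul_mem_rrSpace_iff {D : Place k K →₀ ℤ} {f g : K} (hf : f ≠ 0) :
    f * g ∈ rrSpace D ↔ g ∈ rrSpace (D + divisor k f) := by
  refine forall_congr' fun P => ?_
  rw [P.mul_mem_fil_iff hf, Finsupp.add_apply, divisor_apply, neg_add']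

theorem algebraMap_mem_rrSpace {D : Place k K →₀ ℤ} (hD : 0 ≤ D) (c : k) :
    algebraMap k K c ∈ rrSpace D := fun P =>
  P.fil_anti (by have := hD P; simp at this; omega) (P.algebraMap_mem_fil c)

theorem one_mem_rrSpace {D : Place k K →₀ ℤ} (hD : 0 ≤ D) : (1 : K) ∈ rrSpace D := by
  simpa using algebraMap_mem_rrSpace (K := K) hD 1

theorem finrank_rrSpace_add_divisor (D : Place k K →₀ ℤ) {f : K} (hf : f ≠ 0) :
    finrank k (rrSpace (D + divisor k f)) = finrank k (rrSpace D) := by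
  have : rrSpace D = (rrSpace (D + divisor k f)).map (LinearMap.mulLeft k f) := by
    ext x
    rw [Submodule.mem_map]
    constructor
    · intro hx
      refine ⟨f⁻¹ * x, ?_, by simp [hf]⟩
      rwa [← mul_mem_rrSpace_iff hf, mul_inv_cancel_left₀ hf]
    · rintro ⟨y, hy, rfl⟩
      rwa [LinearMap.mulLeft_apply, mul_mem_rrSpace_iff hf]
  rw [this]
  exact (Submodule.equivMapOfInjective _ (fun x y hxy => mul_left_cancel₀ hf hxy) _).finrank_eq

section
variable [IsAlgClosed k]

/-- The leading coefficient at `P` of the elements of `ℒ(D)`. -/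
def evAt (D : Place k K →₀ ℤ) (P : Place k K) : rrSpace D →ₗ[k] k where
  toFun f := P.res (P.unif ^ D P * (f : K))
  map_add' f g := by
    rw [← P.res_add]
    · simp [mul_add]
    · rw [← P.mem_fil_zero, P.unif_zpow_mul_mem_fil_iff, zero_sub]; exact f.2 P
    · rw [← P.mem_fil_zero, P.unif_zpow_mul_mem_fil_iff, zero_sub]; exact g.2 P
  map_smul' c f := by
    rw [RingHom.id_apply, smul_eq_mul, ← P.res_smul]
    · simp
    · rw [← P.mem_fil_zero, P.unif_zpow_mul_mem_fil_iff, zero_sub]; exact f.2 P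

theorem mem_rrSpace_sub_single [DecidableEq (Place k K)] {D : Place k K →₀ ℤ} {P : Place k K} {f : K} :
    f ∈ rrSpace (D - Finsupp.single P 1) ↔ f ∈ rrSpace D ∧ f ∈ P.fil (-D P + 1) := by
  constructor
  · intro h
    refine ⟨rrSpace_mono (by simp) h, ?_⟩
    have := h P
    rwa [Finsupp.sub_apply, Finsupp.single_eq_same, neg_sub', sub_neg_eq_add] at this
  · rintro ⟨h1, h2⟩ Q
    rw [Finsupp.sub_apply]
    by_cases hQ : Q = P
    · subst hQ
      rwa [Finsupp.single_eq_same, neg_sub', sub_neg_eq_add]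
    · rw [Finsupp.single_eq_of_ne (by exact hQ), sub_zero]
      exact h1 Q

theorem evAt_eq_zero_iff {D : Place k K →₀ ℤ} {P : Place k K} (f : rrSpace D) :
    evAt D P f = 0 ↔ (f : K) ∈ rrSpace (D - Finsupp.single P 1) := by
  classical
  have h : P.unif ^ D P * (f : K) ∈ P.ring := by
    rw [← P.mem_fil_zero, P.unif_zpow_mul_mem_fil_iff, zero_sub]; exact f.2 P
  rw [mem_rrSpace_sub_single]
  change P.res _ = 0 ↔ _
  rw [P.res_eq_zero_iff h, P.unif_zpow_mul_mem_fil_iff, sub_eq_add_neg, add_comm]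
  exact ⟨fun h => ⟨f.2, h⟩, fun h => h.2⟩

end

section Genus
variable [hG : Fact (HasGenus k K 1)]

theorem degree_divisor (f : K) : (divisor k f).degree = 0 := by
  rw [← finsum_eq_degree]
  exact finsum_ord_mul_unit hG.out f

theorem deg_lineBundle (D : Place k K →₀ ℤ) : (lineBundle D).deg = D.degree := by
  rw [(principalBundle_isVectorBundle one_ne_zero).deg_twistDiv, 
    Stalks.deg_principalBundle one_ne_zero, finrank_self]
  simp

theorem degree_le_finrank (D : Place k K →₀ ℤ) : D.degree ≤ finrank k (rrSpace D) := by
  have hp := hG.out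
  have : (lineBundle D).deg - (finrank k (lineBundle D).globalSections : ℤ) + 1 ≤ 1 := by
    refine hp.2 ?_
    rw [Set.mem_ofPred_eq]
    exact ⟨lineBundle D, lineBundle_isVectorBundle D, rfl⟩
  rw [globalSections_lineBundle, deg_lineBundle] at this
  omega

theorem exists_degree_eq_finrank : ∃ D : Place k K →₀ ℤ, D.degree = finrank k (rrSpace D) := by
  have h := hG.out.1
  rw [Set.mem_ofPred_eq] at h
  obtain ⟨L, hL, h⟩ := h
  obtain ⟨D, rfl⟩ := hL.exists_div
  refine ⟨D, ?_⟩
  rw [globalSections_lineBundle, deg_lineBundle] at h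
  omega

theorem degree_nonneg {D : Place k K →₀ ℤ} (hD : 0 ≤ D) : 0 ≤ D.degree := by
  rw [Finsupp.degree_apply]
  exact Finset.sum_nonneg fun P _ => hD P

theorem eq_zero_of_degree_eq_zero {D : Place k K →₀ ℤ} (hD : 0 ≤ D) (h : D.degree = 0) : D = 0 := by
  rw [Finsupp.degree_apply, Finset.sum_eq_zero_iff_of_nonneg fun P _ => hD P] at h
  ext P
  by_cases hP : P ∈ D.support
  · exact h P hP
  · simpa using hP

theorem eq_zero_of_degree_neg {D : Place k K →₀ ℤ} (hD : D.degree < 0) {f : K}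
    (hf : f ∈ rrSpace D) : f = 0 := by
  by_contra h0
  have := degree_nonneg ((mem_rrSpace_of_ne h0).1 hf)
  rw [map_add, degree_divisor] at this
  omega

theorem divisor_eq_of_degree_zero {D : Place k K →₀ ℤ} (hD : D.degree = 0) {f : K} (h0 : f ≠ 0)
    (hf : f ∈ rrSpace D) : divisor k f = -D := by
  have := eq_zero_of_degree_eq_zero ((mem_rrSpace_of_ne h0).1 hf) (by
    rw [map_add, degree_divisor, hD, add_zero])
  rw [add_comm] at this
  exact eq_neg_of_add_eq_zero_left this

theorem exists_single_of_degree_one {D : Place k K →₀ ℤ} (hD : 0 ≤ D) (h : D.degree = 1) :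
    ∃ P, D = Finsupp.single P 1 := by
  classical
  have : ∃ P, D P ≠ 0 := by
    by_contra! h0
    have : D = 0 := by ext P; exact h0 P
    rw [this] at h; simp at h
  obtain ⟨P, hP⟩ := this
  refine ⟨P, ?_⟩
  have h1 : 0 ≤ D - Finsupp.single P 1 := by
    intro Q
    rw [Finsupp.sub_apply, Finsupp.zero_apply]
    have := hD Q
    rw [Finsupp.zero_apply] at this
    by_cases hQ : Q = P
    · subst hQ; rw [Finsupp.single_eq_same]; omega
    · rw [Finsupp.single_eq_of_ne (by exact hQ)]; omega
  exact sub_eq_zero.1 (eq_zero_of_degree_eq_zero h1 (by rw [map_sub, h, Finsupp.degree_single, sub_self]))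

variable [IsAlgClosed k]

theorem finiteDimensional_rrSpace (D : Place k K →₀ ℤ) : FiniteDimensional k (rrSpace D) := by
  classical
  obtain ⟨P⟩ : Nonempty (Place k K) := (Place.infinite k K).nonempty
  obtain ⟨m, hm⟩ : ∃ m : ℕ, 1 ≤ (D + Finsupp.single P (m : ℤ)).degree := by
    refine ⟨(1 - D.degree).toNat, ?_⟩
    rw [map_add, Finsupp.degree_single]
    omega
  have h := degree_le_finrank (D + Finsupp.single P (m : ℤ))
  -- As `finrank` is zero in infinite dimension, the positive lower bound given by the genus already
  -- implies finiteness.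
  have : FiniteDimensional k (rrSpace (D + Finsupp.single P (m : ℤ))) :=
    FiniteDimensional.of_finrank_pos (by omega)
  have hle : D ≤ D + Finsupp.single P (m : ℤ) :=
    le_add_of_nonneg_right (Finsupp.single_nonneg.2 (Nat.cast_nonneg m))
  exact Submodule.finiteDimensional_of_le (rrSpace_mono hle)

theorem finrank_rrSpace_le_add_one (D : Place k K →₀ ℤ) (P : Place k K) :
    finrank k (rrSpace D) ≤ finrank k (rrSpace (D - Finsupp.single P 1)) + 1 := by
  have := finiteDimensional_rrSpace D
  have := finiteDimensional_rrSpace (D - Finsupp.single P 1)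
  have h1 := LinearMap.finrank_range_add_finrank_ker (evAt D P)
  have h2 : finrank k (LinearMap.range (evAt D P)) ≤ 1 := by
    simpa using Submodule.finrank_le (LinearMap.range (evAt D P))
  have h3 : finrank k (LinearMap.ker (evAt D P)) ≤ finrank k (rrSpace (D - Finsupp.single P 1)) := by
    refine LinearMap.finrank_le_finrank_of_injective
      (f := LinearMap.codRestrict _ ((rrSpace D).subtype ∘ₗ (LinearMap.ker (evAt D P)).subtype)
        fun f => (evAt_eq_zero_iff f.1).1 f.2) ?_
    intro x y hxy
    have := congrArg Subtype.val hxy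
    exact Subtype.ext (Subtype.ext this)
  omega

/-- If a nonconstant `u` has only a simple pole at `Q`, then `u - u(P)` has divisor `P - Q`, so
every divisor is equivalent to a multiple of `Q`. -/
theorem exists_divisor_of_pencil {Q : Place k K} {u : K} (hu : u ∈ rrSpace (Finsupp.single Q 1))
    (hc : ∀ c : k, u ≠ algebraMap k K c) (D : Place k K →₀ ℤ) :
    ∃ h : K, h ≠ 0 ∧ divisor k h = D - D.degree • Finsupp.single Q 1 := by
  classical
  induction D using Finsupp.induction_linear with
  | zero => exact ⟨1, one_ne_zero, by simp [divisor_one]⟩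
  | add D E hD hE =>
    obtain ⟨f, hf, hf'⟩ := hD
    obtain ⟨g, hg, hg'⟩ := hE
    refine ⟨f * g, mul_ne_zero hf hg, ?_⟩
    rw [divisor_mul hf hg, hf', hg', map_add, add_smul]
    abel
  | single P m =>
    by_cases hPQ : P = Q
    · subst hPQ
      exact ⟨1, one_ne_zero, by simp [divisor_one]⟩
    have hr : u ∈ P.ring := by
      have := hu P
      rwa [Finsupp.single_eq_of_ne (by exact hPQ), neg_zero, P.mem_fil_zero] at this
    have h0 : u - algebraMap k K (P.res u) ≠ 0 := sub_ne_zero.2 (hc _)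
    have hmem : u - algebraMap k K (P.res u) ∈ rrSpace (Finsupp.single Q 1 - Finsupp.single P 1) := by
      rw [mem_rrSpace_sub_single]
      refine ⟨sub_mem hu (algebraMap_mem_rrSpace (by simp) _), ?_⟩
      rw [Finsupp.single_eq_of_ne (by exact hPQ), neg_zero, zero_add]
      exact P.sub_res_mem hr
    have hd := divisor_eq_of_degree_zero (by simp [Finsupp.degree_single]) h0 hmem
    refine ⟨_, zpow_ne_zero m h0, ?_⟩
    rw [divisor_zpow h0, hd, Finsupp.degree_single, neg_sub, smul_sub, Finsupp.smul_single,
      smul_eq_mul, mul_one]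

/-- Two independent sections in degree one would make the curve rational: their quotient `u` has a
single simple pole `Q`. Then a divisor `E` of degree `d` is equivalent to `d Q`, and the powers of
`u` up to `d` give it `d + 1` sections. -/
theorem finrank_rrSpace_le_one {D : Place k K →₀ ℤ} (hD : D.degree = 1) :
    finrank k (rrSpace D) ≤ 1 := by
  classical
  by_contra! hlt
  obtain ⟨f, hf⟩ : ∃ f : rrSpace D, f ≠ 0 := by
    have : Nontrivial (rrSpace D) := Module.nontrivial_of_finrank_pos (R := k) (by omega)
    exact exists_ne 0
  obtain ⟨g, hg⟩ : ∃ g : rrSpace D, ∀ c : k, g ≠ c • f := by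
    by_contra! h
    have := finrank_le_one f fun g => by obtain ⟨c, hc⟩ := h g; exact ⟨c, hc.symm⟩
    omega
  have hf0 : (f : K) ≠ 0 := fun h => hf (Subtype.ext h)
  obtain ⟨Q, hQ⟩ := exists_single_of_degree_one ((mem_rrSpace_of_ne hf0).1 f.2) (by
    rw [map_add, degree_divisor, hD, add_zero])
  have hu : (f : K)⁻¹ * g ∈ rrSpace (Finsupp.single Q 1) := by
    rw [← hQ, ← mul_mem_rrSpace_iff hf0, mul_inv_cancel_left₀ hf0]
    exact g.2
  have hc : ∀ c : k, (f : K)⁻¹ * g ≠ algebraMap k K c := fun c h => by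
    apply hg c
    apply Subtype.ext
    rw [Submodule.coe_smul, Algebra.smul_def, ← h]
    field_simp
  set u := (f : K)⁻¹ * g
  have hu0 : u ≠ 0 := by simpa using hc 0
  have hordu : Q.ord u < 0 := by
    by_contra! h0
    have h1 : u ∈ rrSpace (Finsupp.single Q 1 - Finsupp.single Q 1) := by
      rw [mem_rrSpace_sub_single]
      exact ⟨hu, by simpa using (Q.mem_fil_of_ne hu0).2 h0⟩
    rw [sub_self] at h1
    have h2 : u - algebraMap k K (Q.res u) ∈ rrSpace (0 - Finsupp.single Q 1) := by
      rw [mem_rrSpace_sub_single]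
      refine ⟨sub_mem h1 (algebraMap_mem_rrSpace le_rfl _), ?_⟩
      have := Q.sub_res_mem (Q.mem_fil_zero.1 (by simpa using h1 Q))
      simpa using this
    have := eq_zero_of_degree_neg (by simp) h2
    exact hc _ (sub_eq_zero.1 this)
  have htr : Transcendental k u := by
    have := Q.transcendental_of_vl_lt_one (inv_ne_zero hu0) (Q.mem_fil_one.1
      ((Q.mem_fil_of_ne (inv_ne_zero hu0)).2 (by rw [Q.ord_inv]; omega)))
    intro h
    exact this h.inv
  -- Genus one means that the bound is attained, so some `E` has exactly as many sections as its
  -- degree; this is what the powers of `u` contradict.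
  obtain ⟨E, hE⟩ := exists_degree_eq_finrank (k := k) (K := K)
  obtain ⟨h, hh, hdiv⟩ := exists_divisor_of_pencil hu hc E
  obtain ⟨d, hd⟩ : ∃ d : ℕ, E.degree = d := ⟨_, hE⟩
  have hE2 : E = (d : ℤ) • Finsupp.single Q 1 + divisor k h := by rw [hdiv, hd]; abel
  have hpow : ∀ i : ℕ, u ^ i ∈ rrSpace ((i : ℤ) • Finsupp.single Q 1) := fun i => by
    induction i with
    | zero => simpa using one_mem_rrSpace (K := K) (le_refl 0)
    | succ i ih =>
      rw [pow_succ, Nat.cast_succ, add_smul, one_smul]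
      exact mul_mem_rrSpace ih hu
  have hpow' : ∀ i : Fin (d + 1), u ^ (i : ℕ) ∈ rrSpace ((d : ℤ) • Finsupp.single Q 1) := fun i =>
    rrSpace_mono (by
      intro R
      simp only [Finsupp.smul_apply, smul_eq_mul]
      have := i.2
      have h1 : (0 : ℤ) ≤ Finsupp.single Q 1 R := by
        rw [Finsupp.single_apply]; split_ifs <;> simp
      nlinarith) (hpow i)
  have hli : LinearIndependent k fun i : Fin (d + 1) => 
      (⟨u ^ (i : ℕ), hpow' i⟩ : rrSpace ((d : ℤ) • Finsupp.single Q 1)) := by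
    apply LinearIndependent.of_comp (Submodule.subtype _)
    have h1 := (Polynomial.basisMonomials k).linearIndependent.map'
      (Polynomial.aeval u).toLinearMap
      (LinearMap.ker_eq_bot.2 (transcendental_iff_injective.1 htr))
    have h2 := h1.comp (fun i : Fin (d + 1) => (i : ℕ)) Fin.val_injective
    have h3 : ((rrSpace ((d : ℤ) • Finsupp.single Q 1)).subtype ∘ fun i : Fin (d + 1) =>
        (⟨u ^ (i : ℕ), hpow' i⟩ : rrSpace ((d : ℤ) • Finsupp.single Q 1))) =
        (⇑(Polynomial.aeval u).toLinearMap ∘ ⇑(Polynomial.basisMonomials k)) ∘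
          fun i : Fin (d + 1) => (i : ℕ) := by
      funext i
      simp [Polynomial.aeval_monomial]
    rw [h3]
    exact h2
  have := finiteDimensional_rrSpace ((d : ℤ) • Finsupp.single Q 1)
  have h1 := hli.fintype_card_le_finrank
  rw [Fintype.card_fin, ← finrank_rrSpace_add_divisor _ hh, ← hE2] at h1
  omega

/-- Riemann-Roch on a curve of genus one. -/
theorem finrank_rrSpace {D : Place k K →₀ ℤ} (hD : 0 < D.degree) :
    (finrank k (rrSpace D) : ℤ) = D.degree := by
  refine le_antisymm ?_ (degree_le_finrank D)
  obtain ⟨P⟩ : Nonempty (Place k K) := (Place.infinite k K).nonempty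
  obtain ⟨d, hd⟩ : ∃ d : ℕ, D.degree = d + 1 := ⟨(D.degree - 1).toNat, by omega⟩
  -- The upper bound: removing a point costs at most one section, and degree one is already settled.
  induction d generalizing D with
  | zero =>
    have := finrank_rrSpace_le_one (D := D) (by omega)
    omega
  | succ d ih =>
    have h1 := finrank_rrSpace_le_add_one D P
    have h2 : (D - Finsupp.single P (1 : ℤ)).degree = (d : ℤ) + 1 := by
      rw [map_sub, Finsupp.degree_single, hd]; push_cast; ring
    have := ih (by omega) h2
    omega

end Genus
end Pointing
end

/-! ### Global sections of vector bundles. -/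

noncomputable section
namespace Pointing
open Module
set_option linter.unusedSectionVars false

variable {k K : Type*} [Field k] [Field K] [Algebra k K] [hK : Fact (IsFunctionFieldOfCurve k K)]

namespace Stalks
variable {V : Type*} [AddCommGroup V] [Module K V] {ι κ : Type*} [Fintype ι] [DecidableEq ι]
  [Fintype κ] [DecidableEq κ] {X Y : Stalks k K V}

section Sections
variable [Module k V] [IsScalarTower k K V]

/-- The global sections of a bundle. -/
def sections (X : Stalks k K V) : Submodule k V where
  carrier := {v | ∀ P : Place k K, v ∈ X.stalk P}
  add_mem' hf hg P := add_mem (hf P) (hg P)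
  zero_mem' P := zero_mem _
  smul_mem' c f hf P := by
    rw [← algebraMap_smul K]
    exact P.smul_mem_of_mem_ring (P.algebraMap_mem c) (hf P)

theorem mem_sections {v : V} : v ∈ X.sections ↔ ∀ P : Place k K, v ∈ X.stalk P := Iff.rfl

theorem mul_mem_twistDiv {D : Place k K →₀ ℤ} {P : Place k K} {f : K} {v : V} {m : ℤ}
    (hf : f ∈ P.fil m) (hv : v ∈ (X.twistDiv D).stalk P) (E : Place k K →₀ ℤ) (h : D P ≤ E P + m) :
    f • v ∈ (X.twistDiv E).stalk P := by
  rw [mem_twistDiv] at *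
  have : P.unif ^ E P • f • v = (P.unif ^ (E P - D P) * f) • P.unif ^ D P • v := by
    rw [smul_smul, smul_smul, mul_right_comm, ← zpow_add₀ P.unif_ne_zero]; congr 3; ring
  rw [this]
  refine P.smul_mem_of_mem_ring (P.mem_fil_zero.1 ?_) hv
  rw [P.unif_zpow_mul_mem_fil_iff]
  exact P.fil_anti (by omega) hf

theorem smul_mem_sections_twistDiv {D E : Place k K →₀ ℤ} {f : K} {v : V} (hf : f ∈ rrSpace E)
    (hv : v ∈ (X.twistDiv D).sections) : f • v ∈ (X.twistDiv (D + E)).sections := fun P =>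
  mul_mem_twistDiv (hf P) (hv P) _ (by rw [Finsupp.add_apply]; omega)

variable [IsAlgClosed k] [hG : Fact (HasGenus k K 1)]

theorem exists_le_twist (hX : X.IsVectorBundle) (b : Basis ι K V) :
    ∃ E : Place k K →₀ ℤ, ∀ P, X.stalk P ≤ ((trivialBundle k b).twistDiv E).stalk P := by
  classical
  have h1 : ∀ P : Place k K, ∃ m : ℕ, ∀ v ∈ X.stalk P, P.unif ^ m • v ∈ P.lat b := fun P => by
    obtain ⟨c, hc⟩ := hX.exists_lat b P
    choose m hm using fun j => (P.isLattice_lat b).exists_pow P (c j)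
    refine ⟨∑ j, m j, fun v hv => ?_⟩
    rw [hc] at hv
    have : P.lat c ≤ (P.lat b).comap (LinearMap.restrictScalars P.ring
        (LinearMap.lsmul K V (P.unif ^ ∑ j, m j))) := by
      rw [Place.lat, Submodule.span_le]
      rintro _ ⟨j, rfl⟩
      exact P.pow_smul_mem_of_le (hm j) (Finset.single_le_sum (fun _ _ => Nat.zero_le _) (Finset.mem_univ j))
    exact this hv
  choose m hm using h1
  let E : Place k K → ℤ := fun P => if X.stalk P = P.lat b then 0 else m P
  have hE : (Function.support E).Finite := (hX.finite_ne b).subset fun P hP => by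
    rw [Function.mem_support] at hP
    rw [Set.mem_ofPred_eq]
    intro h
    exact hP (if_pos h)
  refine ⟨Finsupp.ofSupportFinite E hE, fun P v hv => ?_⟩
  rw [mem_twistDiv, Finsupp.ofSupportFinite_coe]
  by_cases h : X.stalk P = P.lat b
  · simp only [E, if_pos h, zpow_zero, one_smul]; change v ∈ P.lat b; rwa [← h]
  · simp only [E, if_neg h, zpow_natCast]; exact hm P v hv

/-- The sections of a split bundle. -/
def sectionsTrivialTwist (b : Basis ι K V) (E : Place k K →₀ ℤ) :
    ((trivialBundle k b).twistDiv E).sections ≃ₗ[k] (ι → rrSpace E) where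
  toFun v i := ⟨b.repr v i, fun P => by
    have := v.2 P
    rw [mem_twistDiv] at this
    have := P.mem_lat.1 this i
    rw [map_smul, Finsupp.smul_apply, smul_eq_mul, ← P.mem_fil_zero, P.unif_zpow_mul_mem_fil_iff,
      zero_sub] at this
    exact this⟩
  map_add' v w := by ext i; simp
  map_smul' c v := by
    ext i
    have : b.repr (c • (v : V)) i = c • b.repr v i := by
      rw [← algebraMap_smul K, map_smul, Finsupp.smul_apply, algebraMap_smul]
    simpa using this
  invFun f := ⟨∑ i, (f i : K) • b i, fun P => by
    rw [mem_twistDiv]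
    refine P.mem_lat.2 fun i => ?_
    rw [map_smul, Finsupp.smul_apply, Basis.repr_sum_self, smul_eq_mul,
      ← P.mem_fil_zero, P.unif_zpow_mul_mem_fil_iff, zero_sub]
    exact (f i).2 P⟩
  left_inv v := by
    ext
    exact b.sum_repr v
  right_inv f := by
    ext i
    change b.repr (∑ i, (f i : K) • b i) i = _
    rw [Basis.repr_sum_self]

theorem IsVectorBundle.finiteDimensional_sections (hX : X.IsVectorBundle) :
    FiniteDimensional k X.sections := by
  have := hX.finiteDimensional
  obtain ⟨E, hE⟩ := exists_le_twist hX (finBasis K V)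
  have := finiteDimensional_rrSpace E
  have : FiniteDimensional k ((trivialBundle k (finBasis K V)).twistDiv E).sections :=
    Module.Finite.equiv (sectionsTrivialTwist (finBasis K V) E).symm
  have hle : X.sections ≤ ((trivialBundle k (finBasis K V)).twistDiv E).sections :=
    fun v hv P => hE P (hv P)
  exact Submodule.finiteDimensional_of_le hle

/-- The subsheaf is cut out in the larger bundle by local conditions (`Place.exists_codim`), whose
total number is the difference of the degrees. -/
theorem IsVectorBundle.finrank_sections_le [FiniteDimensional K V] (hX : X.IsVectorBundle)
    (hY : Y.IsVectorBundle) (h : ∀ P, X.stalk P ≤ Y.stalk P) :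
    (finrank k Y.sections : ℤ) ≤ finrank k X.sections + (Y.deg - X.deg) := by
  classical
  let b := finBasis K V
  have hcod : ∀ P : Place k K, ∃ φ : V →ₗ[k] (Fin (Y.degAt b P - X.degAt b P).toNat → k),
      ∀ v ∈ Y.stalk P, φ v = 0 → v ∈ X.stalk P := fun P => by
    obtain ⟨c, hc⟩ := hX.exists_lat b P
    obtain ⟨d, hd⟩ := hY.exists_lat b P
    have h0 : -P.ord (b.det d) - -(P.ord (b.det d) + P.ord (d.det c)) = P.ord (d.det c) := by ring
    rw [degAt_eq hc, degAt_eq hd, ← P.ord_det_add b d c, hc, hd, h0]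
    exact P.exists_codim (k := k) (hc ▸ hd ▸ h P : P.lat c ≤ P.lat d)
  choose φ hφ using hcod
  let S : Finset (Place k K) := ((hX.finite_degAt b).union (hY.finite_degAt b)).toFinset
  have hS : ∀ P ∉ S, X.stalk P = Y.stalk P := fun P hP => by
    rw [Set.Finite.mem_toFinset, Set.mem_union, Function.mem_support, Function.mem_support] at hP
    push Not at hP
    exact hX.stalk_eq_of_degAt hY b (h P) (by rw [hP.1, hP.2])
  have hdeg : Y.deg - X.deg = ∑ P ∈ S, (Y.degAt b P - X.degAt b P) := by
    rw [hX.deg_eq b, hY.deg_eq b, finsum_eq_sum_of_support_subset (s := S) _ (by simp [S]),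
      finsum_eq_sum_of_support_subset (s := S) _ (by simp [S]), Finset.sum_sub_distrib]
  let Φ : Y.sections →ₗ[k] ((P : S) → Fin (Y.degAt b P.1 - X.degAt b P.1).toNat → k) :=
    LinearMap.pi fun P => φ P.1 ∘ₗ Y.sections.subtype
  have := hX.finiteDimensional_sections
  have := hY.finiteDimensional_sections
  have h1 := LinearMap.finrank_range_add_finrank_ker Φ
  have h2 : (finrank k (LinearMap.range Φ) : ℤ) ≤ Y.deg - X.deg := by
    refine (Nat.cast_le.2 (Submodule.finrank_le (LinearMap.range Φ))).trans ?_
    rw [Module.finrank_pi_fintype, hdeg, Nat.cast_sum, Finset.sum_coe_sort S fun P => ((finrank k (Fin (Y.degAt b P - X.degAt b P).toNat → k) : ℕ) : ℤ)]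
    refine Finset.sum_le_sum fun P _ => ?_
    have := hX.degAt_mono hY b (h P)
    rw [Module.finrank_fin_fun]
    omega
  have h3 : finrank k (LinearMap.ker Φ) ≤ finrank k X.sections := by
    refine LinearMap.finrank_le_finrank_of_injective
      (f := LinearMap.codRestrict _ (Y.sections.subtype ∘ₗ (LinearMap.ker Φ).subtype)
        fun v P => ?_) ?_
    · by_cases hP : P ∈ S
      · exact hφ P _ (v.1.2 P) (congrFun (LinearMap.mem_ker.1 v.2) ⟨P, hP⟩)
      · rw [hS P hP]; exact v.1.2 P
    · intro x y hxy
      exact Subtype.ext (Subtype.ext (congrArg (fun z : X.sections => (z : V)) hxy))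
  omega

/-- The Riemann inequality for vector bundles. -/
theorem IsVectorBundle.deg_le_finrank_sections [FiniteDimensional K V] (hX : X.IsVectorBundle) :
    X.deg ≤ finrank k X.sections := by
  -- The bundle is embedded in a direct sum of copies of `𝒪(E)`, for which the inequality follows
  -- from that for line bundles, and the loss of sections is at most the loss of degree.
  obtain ⟨E, hE⟩ := exists_le_twist hX (finBasis K V)
  have := finiteDimensional_rrSpace E
  have hT := trivialBundle_isVectorBundle (k := k) (finBasis K V)
  have h1 := hX.finrank_sections_le (hT.twistDiv E) hE
  rw [hT.deg_twistDiv, deg_trivialBundle, (sectionsTrivialTwist (finBasis K V) E).finrank_eq,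
    Module.finrank_pi_fintype] at h1
  have h2 := degree_le_finrank E
  simp only [Finset.sum_const, Finset.card_univ, Fintype.card_fin, smul_eq_mul] at h1
  push_cast at h1
  nlinarith

theorem IsVectorBundle.exists_section_of_deg_pos [FiniteDimensional K V] (hX : X.IsVectorBundle)
    (h : 0 < X.deg) : ∃ v ∈ X.sections, v ≠ 0 := by
  have h1 := hX.deg_le_finrank_sections
  have : Nontrivial X.sections := Module.nontrivial_of_finrank_pos (R := k) (by omega)
  obtain ⟨v, hv⟩ := exists_ne (0 : X.sections)
  exact ⟨v, v.2, fun h => hv (Subtype.ext h)⟩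


/-- Where the vectors of `b` fail to generate the stalk, their determinant vanishes, so their
reductions are linearly dependent over `k`. A relation between the reductions gives a combination
divisible by the uniformizer. -/
theorem exists_vanishing_combination (hX : X.IsVectorBundle) {b : Basis ι K V}
    (hb : ∀ P : Place k K, P.lat b ≤ X.stalk P) (hdeg : ∃ P : Place k K, P.lat b ≠ X.stalk P) :
    ∃ (P : Place k K) (a : ι → k), a ≠ 0 ∧
      P.unif ^ (-1 : ℤ) • ∑ i, algebraMap k K (a i) • b i ∈ X.stalk P := by
  obtain ⟨P, hP⟩ := hdeg
  obtain ⟨c, hc⟩ := hX.exists_lat b P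
  have hcb : P.lat b ≤ P.lat c := hc ▸ hb P
  let M : Matrix ι ι k := fun i j => P.res (c.repr (b j) i)
  have hmem := P.lat_le_iff.1 hcb
  have hdet : M.det = 0 := by
    have h1 : M.det = P.res (c.det b) := by
      rw [Basis.det_apply, Matrix.det_apply, Matrix.det_apply, P.res_sum]
      · refine Finset.sum_congr rfl fun σ _ => ?_
        have hp : ∀ s : Finset ι, (∏ i ∈ s, c.toMatrix b (σ i) i) ∈ P.ring ∧
            P.res (∏ i ∈ s, c.toMatrix b (σ i) i) = ∏ i ∈ s, M (σ i) i := fun s => by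
          induction s using Finset.induction_on with
          | empty => simp [one_mem]
          | insert i s hi ih =>
            rw [Finset.prod_insert hi, Finset.prod_insert hi]
            have : c.toMatrix b (σ i) i ∈ P.ring := hmem (σ i) i
            exact ⟨mul_mem this ih.1, by rw [P.res_mul this ih.1, ih.2]; rfl⟩
        rw [← (hp Finset.univ).2]
        rcases Int.units_eq_one_or (Equiv.Perm.sign σ) with h | h
        · rw [h, one_smul, one_smul]
        · rw [h, Units.neg_smul, Units.neg_smul, one_smul, one_smul]
          have := P.res_smul (-1) (hp Finset.univ).1
          rw [neg_smul, one_smul, neg_one_mul] at this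
          exact this.symm
      · intro σ _
        rw [Units.smul_def]
        exact zsmul_mem (prod_mem fun i _ => hmem (σ i) i) _
    rw [h1, P.res_eq_zero_iff (P.det_mem_ring hcb), P.mem_fil_of_ne (Place.det_ne_zero _ _)]
    have h2 := P.ord_det_nonneg hcb
    rcases h2.eq_or_lt with h2 | h2
    · have := Module.Finite.of_basis b
      exact absurd (hc ▸ P.lat_eq_of_le hcb h2.symm) hP
    · exact h2
  obtain ⟨a, ha, hM⟩ := Matrix.exists_mulVec_eq_zero_iff.2 hdet
  refine ⟨P, a, ha, ?_⟩
  rw [hc, P.mem_lat]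
  intro i
  rw [map_smul, Finsupp.smul_apply, smul_eq_mul, ← P.mem_fil_zero, P.unif_zpow_mul_mem_fil_iff,
    zero_sub, neg_neg]
  have h1 : c.repr (∑ j, algebraMap k K (a j) • b j) i = ∑ j, a j • c.repr (b j) i := by
    rw [map_sum, Finset.sum_apply']
    refine Finset.sum_congr rfl fun j _ => ?_
    rw [map_smul, Finsupp.smul_apply, algebraMap_smul]
  have h2 : ∀ j ∈ Finset.univ, a j • c.repr (b j) i ∈ P.ring := fun j _ => by
    rw [Algebra.smul_def]; exact mul_mem (P.algebraMap_mem _) (hmem i j)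
  rw [h1, ← P.res_eq_zero_iff (sum_mem h2), P.res_sum _ _ h2]
  have h3 := congrFun hM i
  rw [Matrix.mulVec, dotProduct] at h3
  rw [← h3.trans (Pi.zero_apply i)]
  refine Finset.sum_congr rfl fun j _ => ?_
  rw [P.res_smul _ (hmem i j), mul_comm]

/-- A bundle whose degree is at least its positive rank has a section with a zero. -/
theorem IsVectorBundle.exists_section_with_zero [FiniteDimensional K V] (hX : X.IsVectorBundle)
    (hr : 0 < finrank K V) (h : (finrank K V : ℤ) ≤ X.deg) :
    ∃ (P : Place k K), ∃ v ∈ (X.twistDiv (-Finsupp.single P 1)).sections, v ≠ 0 := by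
  classical
  have hfin := hX.finiteDimensional_sections
  have h1 : finrank K V ≤ finrank k X.sections := by
    have := hX.deg_le_finrank_sections
    omega
  obtain ⟨s, hs⟩ := exists_linearIndependent_of_le_finrank h1
  let t : Fin (finrank K V) → V := fun i => s i
  have ht : LinearIndependent k t := hs.map' X.sections.subtype (Submodule.ker_subtype _)
  -- If as many sections as the rank are independent over `K`, they span a trivial subsheaf of
  -- degree `0`. The degree of the bundle is positive, so this subsheaf is strictly smaller at some
  -- place, where a constant combination vanishes.
  by_cases hli : LinearIndependent K t
  · have : Nonempty (Fin (finrank K V)) := ⟨⟨0, hr⟩⟩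
    let b : Basis (Fin (finrank K V)) K V :=
      basisOfLinearIndependentOfCardEqFinrank hli (Fintype.card_fin _)
    have hb : ∀ i, b i = s i := fun i => by simp [b, t]
    have hle : ∀ P : Place k K, P.lat b ≤ X.stalk P := fun P => by
      rw [Place.lat, Submodule.span_le]
      rintro _ ⟨i, rfl⟩
      rw [hb]; exact (s i).2 P
    have hne : ∃ P : Place k K, P.lat b ≠ X.stalk P := by
      by_contra! h0
      have : X = trivialBundle k b := ext_stalk fun P => (h0 P).symm
      rw [this, deg_trivialBundle] at h
      omega
    obtain ⟨P, a, ha, hmem⟩ := exists_vanishing_combination hX hle hne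
    have hsum : ∑ i, algebraMap k K (a i) • b i = ∑ i, a i • t i := by
      refine Finset.sum_congr rfl fun i _ => ?_
      rw [algebraMap_smul, hb]
    rw [hsum] at hmem
    refine ⟨P, ∑ i, a i • t i, fun Q => ?_, fun h0 => ?_⟩
    · rw [mem_twistDiv]
      by_cases hQ : Q = P
      · subst hQ
        simpa using hmem
      · rw [Finsupp.neg_apply, Finsupp.single_eq_of_ne (by exact hQ), neg_zero, zpow_zero, one_smul]
        exact (X.sections.sum_mem fun i _ => X.sections.smul_mem (a i) (s i).2) Q
    · exact ha (funext fun i => Fintype.linearIndependent_iff.1 ht a h0 i)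
  -- Otherwise they lie in a subbundle of smaller rank, and vanishing at any chosen point imposes
  -- fewer conditions than there are sections.
  · let W : Submodule K V := Submodule.span K (Set.range t)
    have hW : finrank K W < finrank K V := by
      by_contra! h0
      apply hli
      have : Fintype.card (Fin (finrank K V)) = finrank K W := by
        rw [Fintype.card_fin]
        exact le_antisymm h0 (Submodule.finrank_le W)
      exact linearIndependent_iff_card_eq_finrank_span.2 this
    obtain ⟨P⟩ : Nonempty (Place k K) := (Place.infinite k K).nonempty
    have hY := hX.sub W
    have h2 : finrank K V ≤ finrank k (X.sub W).sections := by
      have := hY.finiteDimensional_sections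
      have hsW : ∀ i, t i ∈ W := fun i => Submodule.subset_span ⟨i, rfl⟩
      let u : Fin (finrank K V) → (X.sub W).sections := fun i => ⟨⟨t i, hsW i⟩, fun P => (s i).2 P⟩
      have hu : LinearIndependent k u := by
        refine LinearIndependent.of_comp (W.subtype.restrictScalars k ∘ₗ (X.sub W).sections.subtype) ?_
        exact ht
      simpa using hu.fintype_card_le_finrank
    have h3 := (hY.twistDiv (-Finsupp.single P 1)).finrank_sections_le hY fun Q => by
      have : (X.sub W) = (X.sub W).twistDiv 0 := ext_stalk fun R => (twistDiv_of_eq_zero rfl).symm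
      conv_rhs => rw [this]
      exact twistDiv_stalk_mono (by
        rw [Finsupp.neg_apply, Finsupp.single_apply]; split_ifs <;> simp)
    rw [hY.deg_twistDiv, map_neg, Finsupp.degree_single] at h3
    have : Nontrivial ((X.sub W).twistDiv (-Finsupp.single P 1)).sections :=
      Module.nontrivial_of_finrank_pos (R := k) (by omega)
    obtain ⟨v, hv⟩ := exists_ne (0 : ((X.sub W).twistDiv (-Finsupp.single P 1)).sections)
    exact ⟨P, v.1.1, v.2, fun h => hv (Subtype.ext (Subtype.ext h))⟩

/-- Line subbundles `𝒪(D i)` of the same degree `d`, pairwise not isomorphic and more than the rank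
many, force a subbundle of slope larger than `d`. -/
theorem IsVectorBundle.exists_sub_of_many_lines [FiniteDimensional K V] (hX : X.IsVectorBundle)
    (D : κ → Place k K →₀ ℤ) (φ : κ → V) (d : ℤ) (hφ : ∀ i, φ i ≠ 0)
    (hmem : ∀ i, φ i ∈ (X.twistDiv (-D i)).sections) (hd : ∀ i, (D i).degree = d)
    (hne : ∀ i j, i ≠ j → ∀ f : K, f ≠ 0 → divisor k f ≠ D i - D j)
    (hcard : finrank K V < Fintype.card κ) :
    ∃ F : Submodule K V, F ≠ ⊥ ∧ d * finrank K F + 1 ≤ (X.sub F).deg := by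
  -- A maximal independent set of the lines spans `F`; as there are more lines than the rank, one
  -- further line `φ i₀` lies in `F`.
  obtain ⟨S, hS, hmax⟩ := exists_maximal_linearIndepOn K φ
  have hcS : ∃ i, i ∉ S := by
    by_contra! h
    have : S = Set.univ := Set.eq_univ_of_forall h
    rw [this, linearIndepOn_univ_iff] at hS
    have := hS.fintype_card_le_finrank
    omega
  obtain ⟨i₀, hi₀⟩ := hcS
  obtain ⟨a, ha0, ha⟩ := hmax i₀ hi₀
  let F := Submodule.span K (φ '' S)
  have hi₀F : φ i₀ ∈ F := by
    have := F.smul_mem a⁻¹ ha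
    rwa [smul_smul, inv_mul_cancel₀ ha0, one_smul] at this
  refine ⟨F, fun h => hφ i₀ (by rw [h] at hi₀F; simpa using hi₀F), ?_⟩
  classical
  have hSfin : Fintype S := Fintype.ofFinite S
  have hF : F = Submodule.span K (Set.range fun i : S => φ i) := by
    rw [← Set.image_eq_range]
  have hli : LinearIndependent K (fun i : S => φ i) := hS
  let bF : Basis S K F := (Basis.span hli).map (LinearEquiv.ofEq _ _ hF.symm)
  have hbF : ∀ i, (bF i : V) = φ i := fun i => by simp [bF, Basis.span_apply]
  -- the direct sum of the line bundles
  let Y : Stalks k K F := ⟨fun P => P.lat (bF.unitsSMul fun i => Units.mk0 (P.unif ^ (-D i P)) (zpow_ne_zero _ P.unif_ne_zero))⟩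
  have hYrepr : ∀ (P : Place k K) (v : F), v ∈ Y.stalk P ↔ ∀ i : S, bF.repr v i ∈ P.fil (-D i P) := fun P v => by
    refine P.mem_lat.trans (forall_congr' fun i => ?_)
    rw [Basis.repr_unitsSMul, Units.smul_def, Units.val_inv_eq_inv_val, Units.val_mk0, zpow_neg,
      inv_inv, smul_eq_mul, ← P.mem_fil_zero, P.unif_zpow_mul_mem_fil_iff, zero_sub]
  have hY : Y.IsVectorBundle := by
    refine isVectorBundle_of bF (fun P => P.isLattice_lat _) ?_
    refine (Set.finite_iUnion fun i : κ => (D i).hasFiniteSupport).subset fun P hP => ?_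
    rw [Set.mem_ofPred_eq] at hP
    rw [Set.mem_iUnion]
    by_contra! h
    apply hP
    ext v
    rw [hYrepr, P.mem_lat]
    refine forall_congr' fun i => ?_
    have : D i P = 0 := by simpa using h i
    rw [this, neg_zero, P.mem_fil_zero]
  have hYdeg : Y.deg = d * finrank K F := by
    have h1 : ∀ P : Place k K, Y.degAt bF P = ∑ i : S, D i P := fun P => by
      rw [degAt_eq (c := bF.unitsSMul fun i => Units.mk0 (P.unif ^ (-D i P)) (zpow_ne_zero _ P.unif_ne_zero)) rfl,
        Basis.det_unitsSMul_self]
      simp only [Units.val_mk0]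
      rw [P.ord_prod _ _ fun i _ => zpow_ne_zero _ P.unif_ne_zero]
      simp only [P.ord_unif_zpow, Finset.sum_neg_distrib, neg_neg]
    rw [hY.deg_eq bF, finsum_congr h1, finsum_sum_comm Finset.univ (fun (P : Place k K) (i : S) => D i P)
      fun i _ => (D i).hasFiniteSupport]
    simp only [finsum_eq_degree, hd, Finset.sum_const, Finset.card_univ, nsmul_eq_mul]
    rw [Module.finrank_eq_card_basis bF, mul_comm]
  have hle : ∀ P, Y.stalk P ≤ (X.sub F).stalk P := fun P => by
    refine Submodule.span_le.2 ?_
    rintro _ ⟨i, rfl⟩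
    have := hmem i P
    rw [mem_twistDiv, Finsupp.neg_apply] at this
    change ((bF.unitsSMul _ i : F) : V) ∈ X.stalk P
    rw [Basis.unitsSMul_apply, Units.smul_def, Submodule.coe_smul, hbF]
    exact this
  -- If the degree did not exceed that of the direct sum `Y`, then `Y` would be all of the
  -- subbundle. The projections of the extra line to the summands are maps between line bundles of
  -- equal degree that are not isomorphic, so all of them vanish.
  by_contra! hlt
  have heq := hY.stalk_eq_of_deg_le (hX.sub F) hle (by rw [hYdeg]; omega)
  have hrel : ∀ i : S, bF.repr ⟨φ i₀, hi₀F⟩ i ∈ rrSpace (D i - D i₀) := fun i P => by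
    have h1 : (P.unif ^ (-D i₀ P) • ⟨φ i₀, hi₀F⟩ : F) ∈ Y.stalk P := by
      rw [heq]
      have := hmem i₀ P
      rw [mem_twistDiv, Finsupp.neg_apply] at this
      exact this
    rw [hYrepr] at h1
    have := h1 i
    rw [map_smul, Finsupp.smul_apply, smul_eq_mul, P.unif_zpow_mul_mem_fil_iff] at this
    rw [Finsupp.sub_apply]
    convert this using 2
    ring
  apply hφ i₀
  have : (⟨φ i₀, hi₀F⟩ : F) = 0 := by
    apply bF.repr.injective
    rw [map_zero]
    ext i
    by_contra h0
    have h1 := divisor_eq_of_degree_zero (by rw [map_sub, hd, hd, sub_self]) h0 (hrel i)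
    rw [neg_sub] at h1
    exact hne i₀ i (fun h => hi₀ (h ▸ i.2)) _ h0 h1
  exact congrArg Subtype.val this

end Sections
end Stalks
end Pointing
end

/-! ### Duality and a criterion for stability. -/

noncomputable section
namespace Pointing
open Module
set_option linter.unusedSectionVars false

variable {k K : Type*} [Field k] [Field K] [Algebra k K] [hK : Fact (IsFunctionFieldOfCurve k K)]
variable {V : Type*} [AddCommGroup V] [Module K V] {ι κ : Type*} [Fintype ι] [DecidableEq ι]
  [Fintype κ] [DecidableEq κ]

/-- A lattice has a basis adapted to a given subspace. -/
theorem Place.IsLattice.exists_basis_sub [FiniteDimensional K V] {P : Place k K}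
    {M : Submodule P.ring V} (hM : P.IsLattice M) (F : Submodule K V) 
    (hι : Fintype.card ι = finrank K F) (hκ : Fintype.card κ = finrank K (V ⧸ F)) :
    ∃ (cF : Basis ι K F) (c : Basis (ι ⊕ κ) K V), (∀ i, c (.inl i) = cF i) ∧ M = P.lat c := by
  obtain ⟨cF, hcF⟩ := (hM.comap P F).exists_basis P hι
  let q : V →ₗ[P.ring] V ⧸ F := F.mkQ.restrictScalars P.ring
  -- The image of the lattice in the quotient space is free, so a basis of it can be lifted and
  -- joined to a basis of the intersection with `F`.
  have hQ : P.IsLattice (M.map q) := by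
    refine ⟨hM.1.map q, P.span_eq_top_iff.2 fun v => ?_⟩
    obtain ⟨v, rfl⟩ := F.mkQ_surjective v
    obtain ⟨m, hm⟩ := hM.exists_pow P v
    exact ⟨m, _, hm, map_smul F.mkQ _ _⟩
  obtain ⟨u, hu⟩ := hQ.exists_basis P hκ
  have hlift : ∀ j, ∃ v ∈ M, F.mkQ v = u j := fun j => by
    have : u j ∈ M.map q := hu ▸ Submodule.subset_span ⟨j, rfl⟩
    exact this
  choose l hlM hlu using hlift
  let c₀ : ι ⊕ κ → V := Sum.elim (fun i => (cF i : V)) l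
  have hM' : M = Submodule.span P.ring (Set.range c₀) := by
    apply le_antisymm
    · intro v hv
      have h1 : F.mkQ v ∈ P.lat u := hu ▸ ⟨v, hv, rfl⟩
      have h2 := P.mem_lat.1 h1
      set w := ∑ j, u.repr (F.mkQ v) j • l j with hw
      have hwM : w ∈ Submodule.span P.ring (Set.range c₀) :=
        sum_mem fun j _ => P.smul_mem_of_mem_ring (h2 j) (Submodule.subset_span ⟨.inr j, rfl⟩)
      have hwM' : w ∈ M := sum_mem fun j _ => P.smul_mem_of_mem_ring (h2 j) (hlM j)
      have h3 : v - w ∈ F := by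
        rw [← Submodule.ker_mkQ F, LinearMap.mem_ker, map_sub, sub_eq_zero, hw, map_sum]
        simp only [map_smul, hlu]
        exact (u.sum_repr _).symm
      have h4 : (⟨v - w, h3⟩ : F) ∈ P.lat cF := hcF ▸ (sub_mem hv hwM' : v - w ∈ M)
      have h5 := P.mem_lat.1 h4
      have h6 : v - w = ∑ i, cF.repr ⟨v - w, h3⟩ i • (cF i : V) := by
        have := congrArg Subtype.val (cF.sum_repr ⟨v - w, h3⟩)
        rw [Submodule.coe_sum] at this
        exact this.symm
      rw [← sub_add_cancel v w]
      refine add_mem ?_ hwM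
      rw [h6]
      exact sum_mem fun i _ => P.smul_mem_of_mem_ring (h5 i) (Submodule.subset_span ⟨.inl i, rfl⟩)
    · rw [Submodule.span_le]
      rintro _ ⟨i | j, rfl⟩
      · have : cF i ∈ P.lat cF := Submodule.subset_span ⟨i, rfl⟩
        rw [← hcF] at this
        exact this
      · exact hlM j
  have hsp : ⊤ ≤ Submodule.span K (Set.range c₀) := by
    rw [← hM.2, hM', Submodule.span_span_of_tower]
  have hcard : Fintype.card (ι ⊕ κ) = finrank K V := by
    rw [Fintype.card_sum, hι, hκ, add_comm, Submodule.finrank_quotient_add_finrank]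
  refine ⟨cF, basisOfTopLeSpanOfCardEqFinrank c₀ hsp hcard, fun i => ?_, ?_⟩
  · rw [coe_basisOfTopLeSpanOfCardEqFinrank]; rfl
  · rw [hM', Place.lat, coe_basisOfTopLeSpanOfCardEqFinrank]

/-- The basis of the annihilator of `F` dual to the part of a basis outside of `F`. -/
def annBasis {F : Submodule K V} {cF : Basis ι K F} {c : Basis (ι ⊕ κ) K V}
    (h : ∀ i, c (.inl i) = cF i) : Basis κ K F.dualAnnihilator :=
  Basis.ofEquivFun
    { toFun := fun φ j => (φ : Dual K V) (c (.inr j))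
      map_add' := fun _ _ => rfl
      map_smul' := fun _ _ => rfl
      invFun := fun a => ⟨c.constr K (Sum.elim 0 a), by
        rw [Submodule.mem_dualAnnihilator]
        intro v hv
        rw [← Submodule.coe_mk v hv, ← cF.sum_repr ⟨v, hv⟩, Submodule.coe_sum, map_sum]
        refine Finset.sum_eq_zero fun i _ => ?_
        rw [Submodule.coe_smul, map_smul, ← h, Basis.constr_basis]
        simp⟩
      left_inv := fun φ => by
        apply Subtype.ext
        apply c.ext
        rintro (i | j)
        · rw [Basis.constr_basis, h]
          exact ((Submodule.mem_dualAnnihilator _).1 φ.2 _ (cF i).2).symm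
        · rw [Basis.constr_basis]; rfl
      right_inv := fun a => by
        funext j
        change c.constr K (Sum.elim 0 a) _ = _
        rw [Basis.constr_basis]; rfl }

theorem annBasis_repr {F : Submodule K V} {cF : Basis ι K F} {c : Basis (ι ⊕ κ) K V}
    (h : ∀ i, c (.inl i) = cF i) (φ : F.dualAnnihilator) (j : κ) :
    (annBasis h).repr φ j = (φ : Dual K V) (c (.inr j)) := by
  rw [annBasis, Basis.ofEquivFun_repr_apply]; rfl

theorem annBasis_apply {F : Submodule K V} {cF : Basis ι K F} {c : Basis (ι ⊕ κ) K V}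
    (h : ∀ i, c (.inl i) = cF i) (j : κ) :
    (annBasis h j : Dual K V) = c.coord (.inr j) := by
  rw [annBasis, Basis.coe_ofEquivFun]
  change c.constr K (Sum.elim 0 (Pi.single j 1)) = _
  apply c.ext
  rintro (i | i)
  · rw [Basis.constr_basis]; simp
  · rw [Basis.constr_basis, Basis.coord_apply, Basis.repr_self]
    simp [Pi.single_apply, Finsupp.single_apply, eq_comm]

/-- The matrix of the change of adapted bases is block triangular. Its second diagonal block belongs
to the quotient by `F`, hence is the transpose of the matrix for the annihilator, with the roles of
the bases exchanged. -/
theorem det_eq_mul_annBasis {F : Submodule K V} {cF dF : Basis ι K F} {c d : Basis (ι ⊕ κ) K V}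
    (hc : ∀ i, c (.inl i) = cF i) (hd : ∀ i, d (.inl i) = dF i) :
    c.det d = cF.det dF * (annBasis hd).det (annBasis hc) := by
  have hrepr : ∀ (v : F) i, c.repr v (.inl i) = cF.repr v i := fun v i => by
    conv_lhs => rw [← cF.sum_repr v, Submodule.coe_sum]
    simp only [Submodule.coe_smul, ← hc]
    rw [map_sum, Finset.sum_apply']
    simp [Finsupp.single_apply]
  have hrepr' : ∀ (v : F) j, c.repr v (.inr j) = 0 := fun v j => by
    conv_lhs => rw [← cF.sum_repr v, Submodule.coe_sum]
    simp only [Submodule.coe_smul, ← hc]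
    rw [map_sum, Finset.sum_apply']
    simp
  have hM : c.toMatrix d = Matrix.fromBlocks (cF.toMatrix dF)
      (Matrix.of fun i j => c.repr (d (.inr j)) (.inl i)) 0
      ((annBasis hd).toMatrix (annBasis hc)).transpose := by
    ext (i | i) (j | j)
    · rw [Matrix.fromBlocks_apply₁₁, Basis.toMatrix_apply, Basis.toMatrix_apply, hd, hrepr]
    · rfl
    · rw [Matrix.fromBlocks_apply₂₁, Basis.toMatrix_apply, hd, hrepr']; rfl
    · rw [Matrix.fromBlocks_apply₂₂, Matrix.transpose_apply, Basis.toMatrix_apply,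
        Basis.toMatrix_apply, annBasis_repr, annBasis_apply]; rfl
  rw [Basis.det_apply, hM, Matrix.det_fromBlocks_zero₂₁, Matrix.det_transpose, Basis.det_apply,
    Basis.det_apply]

namespace Stalks
variable {X Y : Stalks k K V}

omit hK in
/-- The dual bundle. -/
def dual (X : Stalks k K V) : Stalks k K (Dual K V) where
  stalk P :=
    { carrier := {φ | ∀ v ∈ X.stalk P, φ v ∈ P.ring}
      add_mem' := fun hf hg v hv => add_mem (hf v hv) (hg v hv)
      zero_mem' := fun _ _ => zero_mem _
      smul_mem' := fun c _ hφ v hv => mul_mem c.2 (hφ v hv) }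

omit hK in
theorem mem_dual {P : Place k K} {φ : Dual K V} :
    φ ∈ X.dual.stalk P ↔ ∀ v ∈ X.stalk P, φ v ∈ P.ring := Iff.rfl

omit hK in
theorem mem_dual_iff {P : Place k K} {c : Basis ι K V} (h : X.stalk P = P.lat c) {φ : Dual K V} :
    φ ∈ X.dual.stalk P ↔ ∀ i, φ (c i) ∈ P.ring := by
  rw [mem_dual, h]
  constructor
  · intro hφ i
    exact hφ _ (Submodule.subset_span ⟨i, rfl⟩)
  · intro hφ v hv
    rw [← c.sum_repr v, map_sum]
    refine sum_mem fun i _ => ?_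
    rw [map_smul]
    exact mul_mem (P.mem_lat.1 hv i) (hφ i)

theorem dual_sub_stalk {P : Place k K} {F : Submodule K V} {cF : Basis ι K F}
    {c : Basis (ι ⊕ κ) K V} (hc : ∀ i, c (.inl i) = cF i) (h : X.stalk P = P.lat c) :
    (X.dual.sub F.dualAnnihilator).stalk P = P.lat (annBasis hc) := by
  ext φ
  rw [P.mem_lat]
  change (φ : Dual K V) ∈ X.dual.stalk P ↔ _
  rw [mem_dual_iff h]
  simp only [annBasis_repr]
  constructor
  · intro hφ j; exact hφ _
  · rintro hφ (i | j)
    · rw [hc, (Submodule.mem_dualAnnihilator _).1 φ.2 _ (cF i).2]; exact zero_mem _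
    · exact hφ j

theorem sub_stalk {P : Place k K} {F : Submodule K V} {cF : Basis ι K F}
    {c : Basis (ι ⊕ κ) K V} (hc : ∀ i, c (.inl i) = cF i) (h : X.stalk P = P.lat c) :
    (X.sub F).stalk P = P.lat cF := by
  have hrepr : ∀ (v : F) i, c.repr v (.inl i) = cF.repr v i := fun v i => by
    conv_lhs => rw [← cF.sum_repr v, Submodule.coe_sum]
    simp only [Submodule.coe_smul, ← hc]
    rw [map_sum, Finset.sum_apply']
    simp [Finsupp.single_apply]
  have hrepr' : ∀ (v : F) j, c.repr v (.inr j) = 0 := fun v j => by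
    conv_lhs => rw [← cF.sum_repr v, Submodule.coe_sum]
    simp only [Submodule.coe_smul, ← hc]
    rw [map_sum, Finset.sum_apply']
    simp
  ext v
  change (v : V) ∈ X.stalk P ↔ _
  rw [h, P.mem_lat, P.mem_lat]
  constructor
  · intro hv i; rw [← hrepr]; exact hv _
  · rintro hv (i | j)
    · rw [hrepr]; exact hv i
    · rw [hrepr']; exact zero_mem _

variable [hG : Fact (HasGenus k K 1)]

/-- The annihilator of `F` is the dual of the quotient by `F`, so this is additivity of the degree.
-/
theorem IsVectorBundle.dual_sub (hX : X.IsVectorBundle) (F : Submodule K V) :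
    (X.dual.sub F.dualAnnihilator).IsVectorBundle ∧
      ∀ [FiniteDimensional K V], (X.sub F).deg = X.deg + (X.dual.sub F.dualAnnihilator).deg := by
  have := hX.finiteDimensional
  have hloc : ∀ P : Place k K, ∃ (cF : Basis (Fin (finrank K F)) K F)
      (c : Basis (Fin (finrank K F) ⊕ Fin (finrank K (V ⧸ F))) K V),
      (∀ i, c (.inl i) = cF i) ∧ X.stalk P = P.lat c := fun P =>
    (hX.isLattice P).exists_basis_sub F (Fintype.card_fin _) (Fintype.card_fin _)
  obtain ⟨P₀⟩ : Nonempty (Place k K) := by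
    obtain ⟨x, hx, -⟩ := hK.out
    obtain ⟨P, -⟩ := Place.exists_of_transcendental hx
    exact ⟨P⟩
  obtain ⟨dF, d, hd, -⟩ := hloc P₀
  have hvb : (X.dual.sub F.dualAnnihilator).IsVectorBundle := by
    refine isVectorBundle_of (annBasis hd) (fun P => ?_) ((hX.finite_ne d).subset fun P hP => ?_)
    · obtain ⟨cF, c, hc, hP⟩ := hloc P
      rw [dual_sub_stalk hc hP]
      exact P.isLattice_lat _
    · rw [Set.mem_ofPred_eq] at *
      exact fun h => hP (dual_sub_stalk hd h)
  refine ⟨hvb, ?_⟩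
  intro _
  rw [hX.deg_eq d, (hX.sub F).deg_eq dF, hvb.deg_eq (annBasis hd),
    ← finsum_add_distrib (hX.finite_degAt _) (hvb.finite_degAt _)]
  refine finsum_congr fun P => ?_
  obtain ⟨cF, c, hc, hP⟩ := hloc P
  rw [degAt_eq hP, degAt_eq (sub_stalk hc hP), degAt_eq (dual_sub_stalk hc hP)]
  have h1 := P.ord_det_add d c d
  have h2 := P.ord_det_add dF cF dF
  rw [P.ord_det_self] at h1 h2
  have h3 : P.ord (c.det d) = P.ord (cF.det dF) + P.ord ((annBasis hd).det (annBasis hc)) := by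
    rw [det_eq_mul_annBasis hc hd, P.ord_mul (Place.det_ne_zero _ _) (Place.det_ne_zero _ _)]
  omega

section Criterion
variable [IsAlgClosed k] [Module k V] [IsScalarTower k K V]

/-- A bundle such that several of its twists have at least as many sections as the rank has, for
each of these twists, nonzero sections with a common value at a given point. -/
theorem IsVectorBundle.exists_common_value [FiniteDimensional K V] (hX : X.IsVectorBundle)
    (hr : 0 < finrank K V) (ε : ι → V →ₗ[K] K) {z : Place k K}
    (hε : ∀ v ∈ X.stalk z, ∀ j, ε j v ∈ z.ring) [Nonempty κ] (E : κ → Place k K →₀ ℤ)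
    (hE : ∀ i, (finrank K V : ℤ) ≤ (X.twistDiv (E i)).deg) (hEz : ∀ i, E i z = 0) :
    ∃ s : κ → V, (∀ i, s i ∈ (X.twistDiv (E i)).sections) ∧
      (∀ i i' j, z.res (ε j (s i)) = z.res (ε j (s i'))) ∧ ∃ i, s i ≠ 0 := by
  set r := finrank K V with hr'
  have hFz : ∀ i (s : (X.twistDiv (E i)).sections), (s : V) ∈ X.stalk z := fun i s => by
    have := s.2 z
    rwa [mem_twistDiv, hEz, zpow_zero, one_smul] at this
  let ev : ∀ i, (X.twistDiv (E i)).sections →ₗ[k] (ι → k) := fun i =>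
    { toFun := fun s j => z.res (ε j (s : V))
      map_add' := fun s t => by
        funext j
        rw [Submodule.coe_add, map_add]
        exact z.res_add (hε _ (hFz i s) j) (hε _ (hFz i t) j)
      map_smul' := fun a s => by
        funext j
        rw [Submodule.coe_smul, ← algebraMap_smul K a (s : V), map_smul, algebraMap_smul]
        exact z.res_smul a (hε _ (hFz i s) j) }
  have hev : ∀ i s j, ev i s j = z.res (ε j (s : V)) := fun _ _ _ => rfl
  have hcount : ∀ i, r ≤ finrank k (X.twistDiv (E i)).sections := fun i => by
    have h1 := (hX.twistDiv (E i)).deg_le_finrank_sections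
    have := hE i
    omega
  -- If some twist has a nonzero section with zero value at `z`, it is taken together with the zero
  -- sections of the other twists.
  by_cases hinj : ∀ i, LinearMap.ker (ev i) = ⊥
  swap
  · push Not at hinj
    obtain ⟨i, hi⟩ := hinj
    obtain ⟨s, hs, hs0⟩ := (Submodule.ne_bot_iff _).1 hi
    classical
    refine ⟨fun i' => if h : i' = i then (s : V) else 0, fun i' => ?_, ?_, i, ?_⟩
    · by_cases h : i' = i
      · subst h; dsimp only; rw [dif_pos rfl]; exact s.2
      · dsimp only; rw [dif_neg h]; exact zero_mem _
    · have h0 : ∀ i' j, z.res (ε j (if h : i' = i then (s : V) else 0)) = 0 := fun i' j => by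
        by_cases h : i' = i
        · rw [dif_pos h]; exact congrFun hs j
        · rw [dif_neg h]; simp
      intro i₁ i₂ j
      rw [h0, h0]
    · dsimp only
      rw [dif_pos rfl]
      exact fun h => hs0 (Subtype.ext h)
  have hinj' : ∀ i, Function.Injective (ev i) := fun i => LinearMap.ker_eq_bot.1 (hinj i)
  obtain ⟨c, hc⟩ := hX.exists_lat (finBasis K V) z
  let T : Submodule k (ι → k) := Submodule.span k (Set.range fun l j => z.res (ε j (c l)))
  have hT : finrank k T ≤ r := by
    have := finrank_range_le_card (R := k) (fun (l : Fin r) j => z.res (ε j (c l)))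
    rwa [Fintype.card_fin] at this
  have hcmem : ∀ l j, ε j (c l) ∈ z.ring := fun l =>
    hε _ (hc ▸ Submodule.subset_span ⟨l, rfl⟩)
  have hevT : ∀ i s, ev i s ∈ T := fun i s => by
    have h1 := hFz i s
    rw [hc, z.mem_lat] at h1
    have : ev i s = ∑ l, z.res (c.repr s l) • fun j => z.res (ε j (c l)) := by
      funext j
      rw [Finset.sum_apply, hev]
      have h2 : ε j (s : V) = ∑ l, c.repr s l * ε j (c l) := by
        conv_lhs => rw [← c.sum_repr (s : V), map_sum]
        simp only [map_smul, smul_eq_mul]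
      rw [h2, z.res_sum _ _ fun l _ => mul_mem (h1 l) (hcmem l j)]
      refine Finset.sum_congr rfl fun l _ => ?_
      rw [z.res_mul (h1 l) (hcmem l j)]; rfl
    rw [this]
    exact T.sum_mem fun l _ => T.smul_mem _ (Submodule.subset_span ⟨l, rfl⟩)
  -- The values fill at most `r` dimensions and every twist has at least `r` sections, so each
  -- injective evaluation is onto `T`, and a value attained in one twist is attained in all of them.
  have hrange : ∀ i, LinearMap.range (ev i) = T := fun i => by
    have hle : LinearMap.range (ev i) ≤ T := by rintro _ ⟨s, rfl⟩; exact hevT i s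
    refine Submodule.eq_of_le_of_finrank_le hle ?_
    rw [LinearMap.finrank_range_of_inj (hinj' i)]
    exact hT.trans (hcount i)
  obtain ⟨i₀⟩ := ‹Nonempty κ›
  have : Nontrivial (X.twistDiv (E i₀)).sections :=
    Module.nontrivial_of_finrank_pos (R := k) (hr.trans_le (hcount i₀))
  obtain ⟨s₀, hs₀⟩ := exists_ne (0 : (X.twistDiv (E i₀)).sections)
  have hex : ∀ i, ∃ s, ev i s = ev i₀ s₀ := fun i => by
    have := hevT i₀ s₀
    rw [← hrange i] at this
    exact this
  choose s hs using hex
  refine ⟨fun i => s i, fun i => (s i).2, fun i i' j => ?_, i₀, fun h => hs₀ ?_⟩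
  · rw [← hev, ← hev, hs, hs]
  · have h1 : s i₀ = s₀ := hinj' i₀ (hs i₀)
    rw [← h1]; exact Subtype.ext h

/-- A criterion for stability in terms of sections of twists of the dual bundle. -/
theorem IsVectorBundle.isStable_of_dual [FiniteDimensional K V] (hX : X.IsVectorBundle) {N : ℤ}
    (e : Basis ι K V) (hcard : 0 < Fintype.card ι)
    (hdeg : X.deg = Fintype.card ι * N + 1) {z : Place k K} (hz : X.stalk z = z.lat e)
    [Nonempty κ] (E : κ → Place k K →₀ ℤ) (hE : ∀ i, (E i).degree = N + 1)
    (hEz : ∀ i, E i z = 0)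
    (hinj : ∀ φ : κ → Dual K V, (∀ i (P : Place k K), φ i ∈ (X.dual.twistDiv (E i)).stalk P) →
      (∀ i i' j, z.res (φ i (e j)) = z.res (φ i' (e j))) → ∀ i, φ i = 0) :
    X.IsStable := by
  have hrank : finrank K V = Fintype.card ι := Module.finrank_eq_card_basis e
  refine ⟨hX, by omega, fun W hW0 hW1 => ?_⟩
  have hWpos : 0 < finrank K W := Module.finrank_pos_iff.2 ((Submodule.nontrivial_iff_ne_bot).2 hW0)
  by_contra! hslope
  -- The slope of `W` is at least that of the whole bundle, hence larger than the integer `N`, and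
  -- degrees are integers.
  have hd : (finrank K W : ℤ) * N + 1 ≤ (X.sub W).deg := by
    rw [slope, slope, div_le_div_iff₀ (by exact_mod_cast (by omega : 0 < finrank K V)) (by exact_mod_cast hWpos), hdeg, hrank] at hslope
    have h1 : (Fintype.card ι * N + 1) * (finrank K W : ℤ) ≤ (X.sub W).deg * Fintype.card ι := by
      exact_mod_cast hslope
    have h2 : (0 : ℤ) < finrank K W := by exact_mod_cast hWpos
    have h3 : (0 : ℤ) < Fintype.card ι := by exact_mod_cast hcard
    by_contra! h4
    have h5 : (X.sub W).deg ≤ finrank K W * N := by omega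
    nlinarith
  obtain ⟨hvb, hdegF⟩ := hX.dual_sub W
  rw [hdegF, hdeg] at hd
  have hr : finrank K W + finrank K W.dualAnnihilator = Fintype.card ι := by
    rw [← hrank]; exact Subspace.finrank_add_finrank_dualAnnihilator_eq W
  have hWlt : finrank K W < Fintype.card ι := by
    rw [← hrank]; exact Submodule.finrank_lt hW1
  have h2 : (finrank K W : ℤ) = Fintype.card ι - finrank K W.dualAnnihilator := by omega
  -- The annihilator of `W` has slope at least `-N`. Twisting by degree `N + 1` makes its degree at
  -- least its rank, as needed for common values.
  obtain ⟨s, hs, hval, i, hi⟩ := hvb.exists_common_value (by omega)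
    (fun j => (Dual.eval K V (e j)).domRestrict W.dualAnnihilator) (z := z)
    (fun φ hφ j => (mem_dual_iff hz).1 hφ j) E
    (fun i => by rw [hvb.deg_twistDiv, hE]; rw [h2] at hd; nlinarith) hEz
  exact hi (Subtype.ext (hinj (fun i => s i) (fun i P => hs i P) hval i))

end Criterion
end Stalks
end Pointing
end

/-! ### Bundles of tuples of functions with linear conditions at points. -/

noncomputable section
namespace Pointing
open Module
set_option linter.unusedSectionVars false

variable {k K : Type*} [Field k] [Field K] [Algebra k K] [hK : Fact (IsFunctionFieldOfCurve k K)]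
variable {ι κ : Type*} [Fintype ι] [DecidableEq ι] [Fintype κ] [DecidableEq κ]

theorem Place.smul_mem_fil (P : Place k K) {m : ℤ} {f : K} (c : k) (hf : f ∈ P.fil m) :
    c • f ∈ P.fil m := by
  rw [Algebra.smul_def]; simpa using P.mul_mem_fil (P.algebraMap_mem_fil c) hf

theorem Place.smul_mem_fil_iff (P : Place k K) {m : ℤ} {f : K} {c : k} (hc : c ≠ 0) :
    c • f ∈ P.fil m ↔ f ∈ P.fil m := by
  refine ⟨fun h => ?_, P.smul_mem_fil c⟩
  have := P.smul_mem_fil c⁻¹ h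
  rwa [smul_smul, inv_mul_cancel₀ hc, one_smul] at this

/-- Tuples of functions, the `j`-th vanishing along `e j`, that satisfy linear conditions with
constant coefficients `a l` at the points `r l`. -/
def condBundle (e : ι → Place k K →₀ ℤ) (r : κ → Place k K) (a : κ → ι → k) :
    Stalks k K (ι → K) where
  stalk P :=
    { carrier := {φ | (∀ j, φ j ∈ P.fil (e j P)) ∧ ∀ l, r l = P → ∑ j, a l j • φ j ∈ P.fil 1}
      add_mem' := fun hf hg => ⟨fun j => add_mem (hf.1 j) (hg.1 j), fun l hl => by
        simp only [Pi.add_apply, smul_add, Finset.sum_add_distrib]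
        exact add_mem (hf.2 l hl) (hg.2 l hl)⟩
      zero_mem' := ⟨fun j => zero_mem _, fun l _ => by simp⟩
      smul_mem' := fun c φ hφ => ⟨fun j => Submodule.smul_mem _ c (hφ.1 j), fun l hl => by
        have : ∑ j, a l j • (c • φ) j = c • ∑ j, a l j • φ j := by
          rw [Finset.smul_sum]
          refine Finset.sum_congr rfl fun j _ => ?_
          change a l j • ((c : K) * φ j) = (c : K) * (a l j • φ j)
          rw [mul_smul_comm]
        rw [this]
        exact Submodule.smul_mem _ c (hφ.2 l hl)⟩ }

variable {e : ι → Place k K →₀ ℤ} {r : κ → Place k K} {a : κ → ι → k}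

theorem mem_condBundle {P : Place k K} {φ : ι → K} : φ ∈ (condBundle e r a).stalk P ↔
    (∀ j, φ j ∈ P.fil (e j P)) ∧ ∀ l, r l = P → ∑ j, a l j • φ j ∈ P.fil 1 := Iff.rfl

theorem mem_condBundle_twistDiv {P : Place k K} {φ : ι → K} {D : Place k K →₀ ℤ} :
    φ ∈ ((condBundle e r a).twistDiv D).stalk P ↔
    (∀ j, φ j ∈ P.fil (e j P - D P)) ∧ ∀ l, r l = P → ∑ j, a l j • φ j ∈ P.fil (1 - D P) := by
  rw [Stalks.mem_twistDiv, mem_condBundle]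
  refine and_congr (forall_congr' fun j => ?_) (forall₂_congr fun l hl => ?_)
  · rw [Pi.smul_apply, smul_eq_mul, P.unif_zpow_mul_mem_fil_iff]
  · rw [← P.unif_zpow_mul_mem_fil_iff, Finset.mul_sum]
    simp only [Pi.smul_apply, smul_eq_mul, mul_smul_comm]

theorem mem_sections_condBundle {φ : ι → K} {D : Place k K →₀ ℤ} :
    φ ∈ ((condBundle e r a).twistDiv D).sections ↔
    (∀ j, φ j ∈ rrSpace (D - e j)) ∧ ∀ l, ∑ j, a l j • φ j ∈ (r l).fil (1 - D (r l)) := by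
  rw [Stalks.mem_sections]
  simp only [mem_condBundle_twistDiv]
  constructor
  · intro h
    exact ⟨fun j P => by rw [Finsupp.sub_apply, neg_sub]; exact (h P).1 j,
      fun l => (h (r l)).2 l rfl⟩
  · rintro ⟨h1, h2⟩ P
    exact ⟨fun j => by have := h1 j P; rwa [Finsupp.sub_apply, neg_sub] at this,
      fun l hl => hl ▸ h2 l⟩

theorem condBundle_isVectorBundle (he : ∀ j, 0 ≤ e j) : (condBundle e r a).IsVectorBundle := by
  have hle : ∀ P, (condBundle e r a).stalk P ≤ P.lat (Pi.basisFun K ι) := fun P φ hφ => by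
    rw [P.mem_lat]
    intro j
    rw [Pi.basisFun_repr, ← P.mem_fil_zero]
    exact P.fil_anti (he j P) ((mem_condBundle.1 hφ).1 j)
  refine Stalks.isVectorBundle_of (Pi.basisFun K ι) (fun P => ?_) ?_
  · refine (P.isLattice_lat (Pi.basisFun K ι)).of_le P (hle P) fun v => ?_
    obtain ⟨m, hm⟩ := (P.isLattice_lat (Pi.basisFun K ι)).exists_pow P v
    obtain ⟨N, hN⟩ : ∃ N : ℕ, ∀ j, e j P ≤ N := by
      refine ⟨∑ j, (e j P).toNat, fun j => ?_⟩
      have := Finset.single_le_sum (f := fun j => (e j P).toNat) (fun _ _ => Nat.zero_le _)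
        (Finset.mem_univ j)
      have h2 := Int.self_le_toNat (e j P)
      exact h2.trans (by exact_mod_cast this)
    have hfil : ∀ j, (P.unif ^ (N + 1 + m) • v) j ∈ P.fil (N + 1 : ℕ) := fun j => by
      have h1 := P.mem_lat.1 hm j
      rw [Pi.basisFun_repr, ← P.mem_fil_zero] at h1
      have h2 := P.mul_mem_fil (P.unif_zpow_mem_fil (N + 1 : ℕ)) h1
      rw [add_zero] at h2
      convert h2 using 1
      rw [Pi.smul_apply, Pi.smul_apply, smul_eq_mul, smul_eq_mul, pow_add, zpow_natCast, mul_assoc]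
    refine ⟨N + 1 + m, mem_condBundle.2 ⟨fun j => P.fil_anti ?_ (hfil j), fun l _ => ?_⟩⟩
    · have := hN j; push_cast; omega
    · exact sum_mem fun j _ => P.smul_mem_fil _ (P.fil_anti (by push_cast; omega) (hfil j))
  · refine (((Set.finite_iUnion fun j => (e j).hasFiniteSupport).union
      (Set.finite_range r))).subset fun P hP => ?_
    rw [Set.mem_ofPred_eq] at hP
    by_contra! h
    rw [Set.mem_union, Set.mem_iUnion] at h
    push Not at h
    apply hP
    refine le_antisymm (hle P) fun φ hφ => mem_condBundle.2 ⟨fun j => ?_, fun l hl => ?_⟩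
    · have h1 : e j P = 0 := by simpa using h.1 j
      have := P.mem_lat.1 hφ j
      rwa [h1, P.mem_fil_zero]
    · exact absurd ⟨l, hl⟩ h.2

section Genus
variable [IsAlgClosed k] [hG : Fact (HasGenus k K 1)]

/-- By Riemann–Roch the class has a section, and an effective divisor of degree one is a point.
Hence divisor classes of a fixed degree are parametrized by points of the curve. -/
theorem exists_of_degree_one {D : Place k K →₀ ℤ} (hD : D.degree = 1) :
    ∃ (P : Place k K) (f : K), f ≠ 0 ∧ D + divisor k f = Finsupp.single P 1 := by
  have h1 := finrank_rrSpace (D := D) (by omega)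
  have : Nontrivial (rrSpace D) := Module.nontrivial_of_finrank_pos (R := k) (by omega)
  obtain ⟨f, hf⟩ := exists_ne (0 : rrSpace D)
  have hf0 : (f : K) ≠ 0 := fun h => hf (Subtype.ext h)
  obtain ⟨P, hP⟩ := exists_single_of_degree_one ((mem_rrSpace_of_ne hf0).1 f.2) (by
    rw [map_add, degree_divisor, hD, add_zero])
  exact ⟨P, f, hf0, hP⟩

theorem eq_algebraMap_of_mem_rrSpace_single {P : Place k K} {f : K}
    (hf : f ∈ rrSpace (Finsupp.single P 1)) : ∃ c : k, f = algebraMap k K c := by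
  have h1 := finrank_rrSpace (D := Finsupp.single P 1) (by simp)
  rw [Finsupp.degree_single] at h1
  have h2 : (⟨1, one_mem_rrSpace (by simp)⟩ : rrSpace (k := k) (Finsupp.single P 1)) ≠ 0 := fun h =>
    one_ne_zero (α := K) (congrArg Subtype.val h)
  obtain ⟨c, hc⟩ := exists_smul_eq_of_finrank_eq_one (by exact_mod_cast h1) h2 ⟨f, hf⟩
  refine ⟨c, ?_⟩
  have := congrArg Subtype.val hc
  rw [Algebra.algebraMap_eq_smul_one]
  exact this.symm

/-- A function with at most one simple pole is constant, so distinct points are not equivalent. -/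
theorem eq_of_divisor_eq {P Q : Place k K} {f : K}
    (h : divisor k f = Finsupp.single P 1 - Finsupp.single Q 1) : P = Q := by
  suffices Finsupp.single P (1 : ℤ) = Finsupp.single Q 1 from
    Finsupp.single_left_injective one_ne_zero this
  rw [← sub_eq_zero, ← h]
  by_cases hf : f = 0
  · ext R; simp [hf, divisor_apply]
  · obtain ⟨c, hc⟩ := eq_algebraMap_of_mem_rrSpace_single (P := Q) (f := f)
      ((mem_rrSpace_of_ne hf).2 (by rw [h]; simp))
    ext R
    rw [hc, divisor_apply, Place.ord_algebraMap]
    rfl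

end Genus
end Pointing
end

/-! ### The Cauchy system of conditions: generic vanishing and the additional condition at a point.
-/

noncomputable section
namespace Pointing
open Module
set_option linter.unusedSectionVars false

variable {k K : Type*} [Field k] [Field K] [Algebra k K] [hK : Fact (IsFunctionFieldOfCurve k K)]

section Generic
variable {ι κ : Type*} [Fintype ι] [DecidableEq ι] [Fintype κ] [DecidableEq κ]

theorem Place.smul_sum_mem_fil (P : Place k K) {m : ℤ} {f : ι → K} (a : ι → k)
    (hf : ∀ j, f j ∈ P.fil m) : ∑ j, a j • f j ∈ P.fil m :=
  sum_mem fun j _ => P.smul_mem_fil _ (hf j)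

variable [IsAlgClosed k]

/-- The leading coefficient at `P` of a function of order at least `m`. -/
def Place.lead (P : Place k K) (m : ℤ) (f : K) : k := P.res (P.unif ^ (-m) * f)

theorem Place.unif_zpow_neg_mul_mem_ring (P : Place k K) {m : ℤ} {f : K} (hf : f ∈ P.fil m) :
    P.unif ^ (-m) * f ∈ P.ring := by
  rw [← P.mem_fil_zero, P.unif_zpow_mul_mem_fil_iff]; simpa using hf

theorem Place.lead_eq_zero_iff (P : Place k K) {m : ℤ} {f : K} (hf : f ∈ P.fil m) :
    P.lead m f = 0 ↔ f ∈ P.fil (m + 1) := by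
  rw [Place.lead, P.res_eq_zero_iff (P.unif_zpow_neg_mul_mem_ring hf),
    P.unif_zpow_mul_mem_fil_iff, sub_neg_eq_add, add_comm]

theorem Place.lead_sum (P : Place k K) {m : ℤ} {f : ι → K} (hf : ∀ j, f j ∈ P.fil m) (a : ι → k) :
    P.lead m (∑ j, a j • f j) = ∑ j, a j * P.lead m (f j) := by
  rw [Place.lead, Finset.mul_sum, P.res_sum _ _ fun j _ => ?_]
  · refine Finset.sum_congr rfl fun j _ => ?_
    rw [mul_smul_comm, P.res_smul _ (P.unif_zpow_neg_mul_mem_ring (hf j)), Place.lead]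
  · rw [mul_smul_comm, ← P.mem_fil_zero]
    exact P.smul_mem_fil _ (P.mem_fil_zero.2 (P.unif_zpow_neg_mul_mem_ring (hf j)))

theorem Place.sum_smul_mem_fil_iff (P : Place k K) {m : ℤ} {f : ι → K}
    (hf : ∀ j, f j ∈ P.fil m) (a : ι → k) :
    ∑ j, a j • f j ∈ P.fil (m + 1) ↔ ∑ j, a j * P.lead m (f j) = 0 := by
  rw [← P.lead_sum hf, P.lead_eq_zero_iff (P.smul_sum_mem_fil a hf)]

variable [hG : Fact (HasGenus k K 1)]

/-- Sections of infinitely many such twists would give more pairwise nonisomorphic line subbundles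
of degree `-D.degree` than the rank, hence a subbundle of larger slope. Its twist by `D` has
positive degree, and therefore a section. -/
theorem Stalks.IsVectorBundle.finite_of_sections_eq_bot {V : Type*} [AddCommGroup V] [Module K V]
    [Module k V] [IsScalarTower k K V] [FiniteDimensional K V] {X : Stalks k K V}
    (hX : X.IsVectorBundle) {C D : Place k K →₀ ℤ} (h : (X.twistDiv D).sections = ⊥)
    (hCD : C.degree + 1 = D.degree) :
    {d : Place k K | (X.twistDiv (C + Finsupp.single d 1)).sections ≠ ⊥}.Finite := by
  classical
  by_contra hinf
  rw [Set.not_finite] at hinf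
  obtain ⟨S, hS, hcard⟩ := hinf.exists_subset_card_eq (finrank K V + 1)
  have hv : ∀ d : S, ∃ v ∈ (X.twistDiv (C + Finsupp.single d.1 1)).sections, v ≠ 0 := fun d =>
    (Submodule.ne_bot_iff _).1 (hS d.2)
  choose v hv hv0 using hv
  obtain ⟨F, hF, hdeg⟩ := hX.exists_sub_of_many_lines (fun d : S => -(C + Finsupp.single d.1 1)) v
    (-D.degree) hv0 (fun d => by rw [neg_neg]; exact hv d)
    (fun d => by rw [map_neg, map_add, Finsupp.degree_single]; omega)
    (fun i j hij f hf h => hij (Subtype.ext (eq_of_divisor_eq (P := j.1) (Q := i.1) (f := f)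
      (by rw [h]; abel)).symm)) (by rw [Fintype.card_coe]; omega)
  have h1 := (hX.sub F).deg_twistDiv D
  obtain ⟨w, hw, hw0⟩ := ((hX.sub F).twistDiv D).exists_section_of_deg_pos (by
    rw [h1]; nlinarith)
  rw [← Stalks.sub_twistDiv] at hw
  have : (w : V) ∈ (X.twistDiv D).sections := fun P => hw P
  rw [h, Submodule.mem_bot] at this
  exact hw0 (Subtype.ext this)

end Generic
section Cauchy

variable (p : ℕ → Place k K) (s : ℕ → k) (m : ℕ)

/-- `m`-tuples of functions whose `j`-th member vanishes doubly at `p j`, subject to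
conditions at the points `p l` whose coefficients form a Cauchy matrix. -/
def cauchyBundle : Stalks k K (Fin m → K) :=
  condBundle (fun j : Fin m => Finsupp.single (p j) 2) (fun j : Fin m => p j)
    fun l j => (s l - s j)⁻¹

/-- The sections of `cauchyBundle` twisted by a divisor. -/
def cauchySections (D : Place k K →₀ ℤ) : Submodule k (Fin m → K) :=
  ((cauchyBundle p s m).twistDiv D).sections

variable {p s m}

theorem mem_cauchySections {D : Place k K →₀ ℤ} {φ : Fin m → K} :
    φ ∈ cauchySections p s m D ↔ (∀ j : Fin m, φ j ∈ rrSpace (D - Finsupp.single (p j) 2)) ∧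
      ∀ l : Fin m, ∑ j : Fin m, (s l - s j)⁻¹ • φ j ∈ (p l).fil (1 - D (p l)) :=
  mem_sections_condBundle

theorem cauchyBundle_isVectorBundle : (cauchyBundle p s m).IsVectorBundle :=
  condBundle_isVectorBundle fun j P => by
    classical
    rw [Finsupp.single_apply]; split_ifs <;> simp

theorem mul_mem_cauchySections {D E : Place k K →₀ ℤ} {f : K} {φ : Fin m → K}
    (hf : f ∈ rrSpace E) (hφ : φ ∈ cauchySections p s m D) :
    f • φ ∈ cauchySections p s m (D + E) :=
  Stalks.smul_mem_sections_twistDiv hf hφ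

variable (p s m)

/-- Some twist of degree three has no sections. -/
def CauchyGood : Prop := ∃ D : Place k K →₀ ℤ, D.degree = 3 ∧ cauchySections p s m D = ⊥

/-- The twists of degree three have at most one section. -/
def CauchyOne : Prop := ∀ D : Place k K →₀ ℤ, D.degree = 3 →
  ∀ φ ∈ cauchySections p s m D, ∀ ψ ∈ cauchySections p s m D, φ ≠ 0 → ∃ c : k, ψ = c • φ

/-- The twists of degree three have no section that satisfies a further condition, with
parameter `σ`, at the point `y`. -/
def CauchyStable (σ : k) (y : Place k K) : Prop := ∀ D : Place k K →₀ ℤ, D.degree = 3 →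
  ∀ φ ∈ cauchySections p s m D, ∑ j : Fin m, (σ - s j)⁻¹ • φ j ∈ y.fil (1 - D y) → φ = 0

variable {p s m} [IsAlgClosed k] [hG : Fact (HasGenus k K 1)]

theorem CauchyGood.finite (h : CauchyGood p s m) (o : Place k K) :
    {d : Place k K | cauchySections p s m (Finsupp.single o 2 + Finsupp.single d 1) ≠ ⊥}.Finite := by
  obtain ⟨D, hD, h⟩ := h
  exact cauchyBundle_isVectorBundle.finite_of_sections_eq_bot h (by simp [hD])

theorem exists_proportional {D : Place k K →₀ ℤ} (hD : D.degree ≤ 1) {f g : K}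
    (hf : f ∈ rrSpace D) (hg : g ∈ rrSpace D) (h0 : f ≠ 0) : ∃ c : k, g = c • f := by
  have hle : finrank k (rrSpace D) ≤ 1 := by
    rcases lt_trichotomy D.degree 0 with h | h | h
    · exact absurd (eq_zero_of_degree_neg h hf) h0
    · obtain ⟨P⟩ : Nonempty (Place k K) := (Place.infinite k K).nonempty
      have := finiteDimensional_rrSpace (D + Finsupp.single P 1)
      refine (Submodule.finrank_mono (rrSpace_mono (E := D + Finsupp.single P 1) ?_)).trans
        (finrank_rrSpace_le_one (by simp [h]))
      exact le_add_of_nonneg_right (by simp)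
    · exact finrank_rrSpace_le_one (by omega)
  have := finiteDimensional_rrSpace D
  have hpos : finrank k (rrSpace D) = 1 := by
    refine le_antisymm hle (Module.finrank_pos_iff_exists_ne_zero.2 ⟨⟨f, hf⟩, fun h => h0 ?_⟩)
    exact congrArg Subtype.val h
  obtain ⟨c, hc⟩ := exists_smul_eq_of_finrank_eq_one hpos
    (x := (⟨f, hf⟩ : rrSpace D)) (fun h => h0 (congrArg Subtype.val h)) ⟨g, hg⟩
  exact ⟨c, (congrArg Subtype.val hc).symm⟩

/-- A Cauchy combination of a nonzero vector vanishes for finitely many parameters only. -/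
theorem eq_zero_of_infinite_cauchy {ι : Type*} [Fintype ι] [DecidableEq ι] {t c : ι → k}
    (ht : Function.Injective t) (h : {σ : k | ∑ j, (σ - t j)⁻¹ * c j = 0}.Infinite) : c = 0 := by
  have hpoly : ∑ j, Polynomial.C (c j) *
      ∏ i ∈ Finset.univ.erase j, (Polynomial.X - Polynomial.C (t i)) = 0 := by
    refine Polynomial.eq_zero_of_infinite_isRoot _ ((h.sdiff (Set.finite_range t)).mono ?_)
    rintro σ ⟨hσ, hσt⟩
    have hne : ∀ j, σ - t j ≠ 0 := fun j h => hσt ⟨j, (sub_eq_zero.1 h).symm⟩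
    rw [Set.mem_ofPred_eq] at hσ ⊢
    rw [Polynomial.IsRoot, Polynomial.eval_finsetSum]
    calc _ = (∏ i, (σ - t i)) * ∑ j, (σ - t j)⁻¹ * c j := by
          rw [Finset.mul_sum]
          refine Finset.sum_congr rfl fun j _ => ?_
          rw [← Finset.mul_prod_erase _ _ (Finset.mem_univ j)]
          simp only [Polynomial.eval_mul, Polynomial.eval_C, Polynomial.eval_prod,
            Polynomial.eval_sub, Polynomial.eval_X]
          have := hne j
          field_simp
      _ = 0 := by rw [hσ, mul_zero]
  funext j
  -- With denominators cleared, evaluation at the node `t j` leaves only the `j`-th term.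
  have h1 := congrArg (Polynomial.eval (t j)) hpoly
  rw [Polynomial.eval_finsetSum, Finset.sum_eq_single j] at h1
  · simp only [Polynomial.eval_mul, Polynomial.eval_C, Polynomial.eval_prod,
      Polynomial.eval_sub, Polynomial.eval_X, Polynomial.eval_zero, mul_eq_zero] at h1
    refine h1.resolve_right (Finset.prod_ne_zero_iff.2 fun i hi => ?_)
    exact sub_ne_zero.2 fun h => (Finset.mem_erase.1 hi).1 (ht h).symm
  · intro i _ hij
    simp only [Polynomial.eval_mul, Polynomial.eval_C, Polynomial.eval_prod,
      Polynomial.eval_sub, Polynomial.eval_X]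
    rw [Finset.prod_eq_zero (Finset.mem_erase.2 ⟨hij.symm, Finset.mem_univ j⟩) (sub_self _), mul_zero]
  · simp

/-- Up to equivalence, divisors of degree three form the one-parameter family `2 o + d`, so
finiteness over all classes becomes finiteness over the points `d`. -/
theorem exists_translate {D : Place k K →₀ ℤ} (hD : D.degree = 3) (o : Place k K) :
    ∃ (d : Place k K) (f : K), f ≠ 0 ∧
      D + divisor k f = Finsupp.single o 2 + Finsupp.single d 1 := by
  obtain ⟨d, f, hf0, hf⟩ := exists_of_degree_one (D := D - Finsupp.single o 2) (by simp [hD])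
  exact ⟨d, f, hf0, by rw [← hf]; abel⟩

/-- The section is unique up to a factor, so each `σ` in question is a zero of one Cauchy sum in its
values at `y`. Such a sum has finitely many zeros unless all the values vanish. -/
theorem CauchyGood.finite_vanishing (h : CauchyGood p s m) (h1 : CauchyOne p s m)
    (hs : Function.Injective fun j : Fin m => s j) {y : Place k K} (hy : ∀ j : Fin m, p j ≠ y)
    {A : Place k K →₀ ℤ} (hA : A.degree = 3) :
    {σ | ∃ φ ∈ cauchySections p s m A, φ ≠ 0 ∧
      ∑ j : Fin m, (σ - s j)⁻¹ • φ j ∈ y.fil (1 - A y)}.Finite := by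
  classical
  by_contra hinf
  rw [Set.not_finite] at hinf
  obtain ⟨σ₀, φ, hφ, hφ0, -⟩ := hinf.nonempty
  have hφy : ∀ j, φ j ∈ y.fil (-A y) := fun j => by
    have := (mem_cauchySections.1 hφ).1 j y
    rwa [Finsupp.sub_apply, Finsupp.single_eq_of_ne (by exact (hy j).symm), sub_zero] at this
  have hc : (fun j => y.lead (-A y) (φ j)) = 0 := by
    refine eq_zero_of_infinite_cauchy hs (hinf.mono ?_)
    rintro σ ⟨ψ, hψ, hψ0, hψy⟩
    obtain ⟨c, hc⟩ := h1 A hA _ hψ _ hφ hψ0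
    rw [Set.mem_ofPred_eq, ← y.sum_smul_mem_fil_iff hφy, neg_add_eq_sub]
    have : ∑ j : Fin m, (σ - s j)⁻¹ • φ j = c • ∑ j : Fin m, (σ - s j)⁻¹ • ψ j := by
      rw [Finset.smul_sum, hc]
      refine Finset.sum_congr rfl fun j _ => ?_
      rw [Pi.smul_apply, smul_comm]
    rw [this]
    exact y.smul_mem_fil _ hψy
  -- When the values at `y` all vanish, `φ` is a section of a twist of degree two. Multiplied by a
  -- suitable function, it becomes a nonzero section of the twist of degree three that has none.
  have hφ' : φ ∈ cauchySections p s m (A - Finsupp.single y 1) := by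
    rw [mem_cauchySections] at hφ ⊢
    refine ⟨fun j => ?_, fun l => ?_⟩
    · rw [sub_right_comm, mem_rrSpace_sub_single]
      refine ⟨hφ.1 j, ?_⟩
      rw [Finsupp.sub_apply, Finsupp.single_eq_of_ne (by exact (hy j).symm), sub_zero,
        ← y.lead_eq_zero_iff (hφy j)]
      exact congrFun hc j
    · have := hφ.2 l
      rwa [Finsupp.sub_apply, Finsupp.single_eq_of_ne (by exact hy l), sub_zero]
  obtain ⟨D, hD, hU⟩ := h
  have hdeg : (D - (A - Finsupp.single y 1)).degree = 1 := by simp [hD, hA]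
  obtain ⟨d, f, hf0, hf⟩ := exists_of_degree_one hdeg
  have hfr : f ∈ rrSpace (D - (A - Finsupp.single y 1)) := by
    rw [mem_rrSpace_of_ne hf0, hf]; simp
  have := mul_mem_cauchySections hfr hφ'
  rw [add_sub_cancel, hU, Submodule.mem_bot] at this
  exact hφ0 ((smul_eq_zero.1 this).resolve_left hf0)

theorem CauchyGood.finite_not_stable (h : CauchyGood p s m) (h1 : CauchyOne p s m)
    (hs : Function.Injective fun j : Fin m => s j) {y : Place k K} (hy : ∀ j : Fin m, p j ≠ y) :
    {σ | ¬ CauchyStable p s m σ y}.Finite := by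
  obtain ⟨o⟩ : Nonempty (Place k K) := (Place.infinite k K).nonempty
  refine ((h.finite o).biUnion fun d _ => h.finite_vanishing h1 hs hy
    (A := Finsupp.single o 2 + Finsupp.single d 1) (by simp)).subset fun σ hσ => ?_
  rw [Set.mem_ofPred_eq] at hσ
  simp only [CauchyStable] at hσ
  push Not at hσ
  obtain ⟨D, hD, φ, hφ, hφy, hφ0⟩ := hσ
  obtain ⟨d, f, hf0, hf⟩ := exists_translate hD o
  have hfi : f⁻¹ ∈ rrSpace (divisor k f) := by
    rw [mem_rrSpace_of_ne (inv_ne_zero hf0), divisor_inv, add_neg_cancel]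
  have hmem : f⁻¹ • φ ∈ cauchySections p s m (Finsupp.single o 2 + Finsupp.single d 1) := by
    rw [← hf]; exact mul_mem_cauchySections hfi hφ
  have hne : f⁻¹ • φ ≠ 0 := smul_ne_zero (inv_ne_zero hf0) hφ0
  refine Set.mem_biUnion (x := d) ((Submodule.ne_bot_iff _).2 ⟨_, hmem, hne⟩) ⟨_, hmem, hne, ?_⟩
  have := y.mul_mem_fil (hfi y) hφy
  rw [← hf, Finsupp.add_apply]
  convert this using 1
  · rw [show -(divisor k f) y + (1 - D y) = 1 - (D y + divisor k f y) by ring]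
  · rw [Finset.mul_sum]
    refine Finset.sum_congr rfl fun j _ => ?_
    rw [Pi.smul_apply, smul_eq_mul, mul_smul_comm]

/-- The last component lies in a Riemann–Roch space of degree one, which has dimension one. When it
vanishes, the other components satisfy the system for `m` points, and the condition at the new point
`p m` is exactly the additional one. -/
theorem CauchyStable.one_succ (h : CauchyStable p s m (s m) (p m)) : CauchyOne p s (m + 1) := by
  have key : ∀ D : Place k K →₀ ℤ, D.degree = 3 → ∀ φ ∈ cauchySections p s (m + 1) D,
      φ (Fin.last m) = 0 → φ = 0 := by
    intro D hD φ hφ h0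
    rw [mem_cauchySections] at hφ
    have : Fin.init φ = 0 := by
      refine h D hD _ (mem_cauchySections.2 ⟨fun j => hφ.1 j.castSucc, fun l => ?_⟩) ?_
      · have := hφ.2 l.castSucc
        rw [Fin.sum_univ_castSucc, h0, smul_zero, add_zero] at this
        exact this
      · have := hφ.2 (Fin.last m)
        rw [Fin.sum_univ_castSucc, h0, smul_zero, add_zero] at this
        exact this
    rw [← Fin.snoc_init_self φ, this, h0]
    funext j
    refine Fin.lastCases ?_ (fun j => ?_) j <;> simp
  intro D hD φ hφ ψ hψ hne
  have hlast : φ (Fin.last m) ≠ 0 := fun h => hne (key D hD φ hφ h)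
  obtain ⟨c, hc⟩ := exists_proportional (by simp [hD]) ((mem_cauchySections.1 hφ).1 (Fin.last m))
    ((mem_cauchySections.1 hψ).1 (Fin.last m)) hlast
  refine ⟨c, sub_eq_zero.1 (key D hD _ (sub_mem hψ (Submodule.smul_mem _ c hφ)) ?_)⟩
  rw [Pi.sub_apply, Pi.smul_apply, hc, sub_self]

end Cauchy
end Pointing
end

/-! ### Collision of two Cauchy parameters, and the case of two points. -/

noncomputable section
namespace Pointing
open Module
set_option linter.unusedSectionVars false

/-- When two Cauchy parameters `τ` and `θ` collide, the linear system becomes block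
triangular; hence it is nondegenerate for all but finitely many `θ`. -/
theorem finite_degenerate_pair {k ι : Type*} [Field k] [Fintype ι] [DecidableEq ι] {s : ι → k}
    {τ : k} (hτ : ∀ j, τ ≠ s j) {N : Matrix ι ι k} (hN : N.det ≠ 0) (b c r r' : ι → k) {α β : k}
    (hα : α ≠ 0) (hβ : β ≠ 0) :
    {θ : k | ∃ (v : ι → k) (x y : k), ¬ (v = 0 ∧ x = 0 ∧ y = 0) ∧
      (∀ l, ∑ j, N l j * v j + b l * x + (s l - θ)⁻¹ * (c l * y) = 0) ∧
      ∑ j, r j * v j + (τ - θ)⁻¹ * (β * y) = 0 ∧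
      ∑ j, (θ - s j)⁻¹ * (r' j * v j) + (θ - τ)⁻¹ * (α * x) = 0}.Finite := by
  let Q : Polynomial k := ∏ i, (Polynomial.X - Polynomial.C (s i))
  let Q' : ι → Polynomial k := fun j =>
    ∏ i ∈ Finset.univ.erase j, (Polynomial.X - Polynomial.C (s i))
  have hQQ : ∀ θ j, (θ - s j) * (Q' j).eval θ = Q.eval θ := fun θ j => by
    simp only [Q, Q', Polynomial.eval_prod, Polynomial.eval_sub, Polynomial.eval_X,
      Polynomial.eval_C]
    rw [Finset.mul_prod_erase _ (fun i => θ - s i) (Finset.mem_univ j)]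
  have hQ : ∀ θ, (∀ j, θ ≠ s j) → Q.eval θ ≠ 0 := fun θ h => by
    simp only [Q, Polynomial.eval_prod, Polynomial.eval_sub, Polynomial.eval_X, Polynomial.eval_C]
    exact Finset.prod_ne_zero_iff.2 fun j _ => sub_ne_zero.2 (h j)
  -- The last two equations express `x` and `y` through `v` with a factor `θ - τ`. Substituted into
  -- the others and cleared of denominators by `Q`, they leave the system with matrix `M`, which at
  -- `θ = τ` is a nonzero multiple of `N`.
  let M : Matrix ι ι (Polynomial k) := Matrix.of fun l j => Polynomial.C (N l j) * Q -
    (Polynomial.X - Polynomial.C τ) *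
      (Polynomial.C (c l * r j / β) * Q' l + Polynomial.C (b l * r' j / α) * Q' j)
  have hM : ∀ θ l j, (M l j).eval θ = N l j * Q.eval θ -
      (θ - τ) * (c l * r j / β * (Q' l).eval θ + b l * r' j / α * (Q' j).eval θ) := fun θ l j => by
    simp [M]
  have hdet : ∀ θ, M.det.eval θ = (Matrix.of fun l j => (M l j).eval θ).det := fun θ => by
    rw [← Polynomial.coe_evalRingHom, RingHom.map_det]; rfl
  have hM0 : M.det ≠ 0 := fun h => by
    have h1 := hdet τ
    have h2 : (Matrix.of fun l j => (M l j).eval τ) = Q.eval τ • N := by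
      ext l j
      rw [Matrix.of_apply, hM, Matrix.smul_apply, smul_eq_mul]; ring
    rw [h, Polynomial.eval_zero, h2, Matrix.det_smul] at h1
    exact mul_ne_zero (pow_ne_zero _ (hQ τ hτ)) hN h1.symm
  refine ((Polynomial.finite_setOfPred_isRoot hM0).union
    ((Set.finite_range s).union (Set.finite_singleton τ))).subset ?_
  rintro θ ⟨v, x, y, hne, h1, h2, h3⟩
  by_contra hθ
  simp only [Set.mem_union, Set.mem_range, Set.mem_singleton_iff, not_or, not_exists] at hθ
  obtain ⟨hθ1, hθ2, hθ3⟩ := hθ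
  have hs : ∀ j, θ - s j ≠ 0 := fun j => sub_ne_zero.2 fun h => hθ2 j h.symm
  have hs' : ∀ j, s j - θ ≠ 0 := fun j => sub_ne_zero.2 fun h => hθ2 j h
  have ht : θ - τ ≠ 0 := sub_ne_zero.2 hθ3
  have ht' : τ - θ ≠ 0 := sub_ne_zero.2 fun h => hθ3 h.symm
  have hy : y = (θ - τ) / β * ∑ j, r j * v j := by
    rw [eq_neg_of_add_eq_zero_left h2]
    field_simp
    ring
  have hx : x = -((θ - τ) / α * ∑ j, (θ - s j)⁻¹ * (r' j * v j)) := by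
    rw [eq_neg_of_add_eq_zero_left h3]
    field_simp
  have hv : v = 0 := by
    refine Matrix.eq_zero_of_mulVec_eq_zero
      (M := Matrix.of fun l j => (M l j).eval θ) (by rw [← hdet]; exact hθ1) ?_
    funext l
    have h4 := congrArg (Q.eval θ * ·) (h1 l)
    simp only [mul_zero] at h4
    rw [Pi.zero_apply, ← h4, hx, hy, mul_add, mul_add]
    simp only [Matrix.mulVec, dotProduct, Matrix.of_apply, hM]
    rw [Finset.mul_sum, Finset.mul_sum, Finset.mul_sum, ← Finset.sum_neg_distrib, Finset.mul_sum,
      Finset.mul_sum, Finset.mul_sum, Finset.mul_sum, Finset.mul_sum, ← Finset.sum_add_distrib,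
      ← Finset.sum_add_distrib]
    refine Finset.sum_congr rfl fun j _ => ?_
    have e1 : (Q' l).eval θ = (θ - s l)⁻¹ * Q.eval θ := by rw [← hQQ θ l, inv_mul_cancel_left₀ (hs l)]
    have e2 : (Q' j).eval θ = (θ - s j)⁻¹ * Q.eval θ := by rw [← hQQ θ j, inv_mul_cancel_left₀ (hs j)]
    have e3 : (s l - θ)⁻¹ = -(θ - s l)⁻¹ := by rw [← neg_sub, inv_neg]
    rw [e1, e2, e3]
    field_simp
    ring
  refine hne ⟨hv, ?_, ?_⟩
  · rw [hx, hv]; simp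
  · rw [hy, hv]; simp

variable {k K : Type*} [Field k] [Field K] [Algebra k K] [hK : Fact (IsFunctionFieldOfCurve k K)]
variable {p : ℕ → Place k K} {s : ℕ → k} {m : ℕ} [IsAlgClosed k] [hG : Fact (HasGenus k K 1)]

theorem rrSpace_ne_bot_iff {D : Place k K →₀ ℤ} (hD : D.degree = 0) :
    rrSpace D ≠ ⊥ ↔ ∃ f : K, f ≠ 0 ∧ divisor k f = -D := by
  rw [Submodule.ne_bot_iff]
  constructor
  · rintro ⟨f, hf, h0⟩
    exact ⟨f, h0, divisor_eq_of_degree_zero hD h0 hf⟩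
  · rintro ⟨f, h0, hf⟩
    exact ⟨f, (mem_rrSpace_of_ne h0).2 (by rw [hf]; simp), h0⟩

theorem finite_rrSpace_ne_bot {C : Place k K →₀ ℤ} (hC : C.degree = -1) :
    {d : Place k K | rrSpace (C + Finsupp.single d 1) ≠ ⊥}.Finite := by
  refine Set.Subsingleton.finite fun d hd d' hd' => ?_
  obtain ⟨f, hf0, hf⟩ := (rrSpace_ne_bot_iff (by simp [hC])).1 hd
  obtain ⟨f', hf0', hf'⟩ := (rrSpace_ne_bot_iff (by simp [hC])).1 hd'
  refine (eq_of_divisor_eq (f := f * f'⁻¹) ?_).symm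
  rw [divisor_mul hf0 (inv_ne_zero hf0'), divisor_inv, hf, hf']
  abel

/-- The conditions at the points `p l` become the equations of a matrix over `k`: a Cauchy matrix
multiplied entrywise by leading coefficients of the `h j`. -/
theorem mem_cauchySections_smul {A : Place k K →₀ ℤ} {h : ℕ → K}
    (hh : ∀ j, h j ∈ rrSpace (A - Finsupp.single (p j) 2)) {c : Fin m → k} :
    (fun j : Fin m => c j • h j) ∈ cauchySections p s m A ↔ ∀ l : Fin m,
      ∑ j : Fin m, (s l - s j)⁻¹ * ((p l).lead (-A (p l)) (h j) * c j) = 0 := by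
  classical
  have hfil : ∀ (P : Place k K) j, h j ∈ P.fil (-A P) := fun P j => P.fil_anti (by
    rw [Finsupp.sub_apply, Finsupp.single_apply]; split_ifs <;> omega) (hh j P)
  rw [mem_cauchySections]
  refine (and_iff_right fun j : Fin m => Submodule.smul_mem _ (c j) (hh j)).trans
    (forall_congr' fun l => ?_)
  rw [← neg_add_eq_sub]
  simp only [smul_smul]
  rw [(p l).sum_smul_mem_fil_iff (fun j : Fin m => hfil (p l) j)]
  refine iff_of_eq (congrArg (· = 0) (Finset.sum_congr rfl fun j _ => ?_))
  ring

/-- As the new parameter `x` approaches `s m`, the two entries linking the new points blow up and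
decouple these points from the old system. The step is by two because a single added point has
diagonal entry zero. -/
theorem CauchyGood.finite_not_add_two (hgood : CauchyGood p s m) (hp : Function.Injective p)
    (hs : ∀ j < m, s m ≠ s j) :
    {x | ¬ CauchyGood p (Function.update s (m + 1) x) (m + 2)}.Finite := by
  classical
  have hpp : p m ≠ p (m + 1) := fun h => by have := hp h; omega
  let o := p 0
  -- The point `d` is chosen such that the old system has no section, and such that the functions
  -- for the points `p m` and `p (m + 1)` do not vanish at the other one of these points; this gives
  -- the nonzero coefficients `α` and `β`.
  have hbad := ((hgood.finite o).union (finite_rrSpace_ne_bot (C := Finsupp.single o 2 -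
    Finsupp.single (p m) 2 - Finsupp.single (p (m + 1)) 1) (by simp))).union
    (finite_rrSpace_ne_bot (C := Finsupp.single o 2 -
    Finsupp.single (p (m + 1)) 2 - Finsupp.single (p m) 1) (by simp))
  have := Place.infinite k K
  obtain ⟨d, hd⟩ := hbad.infinite_compl.nonempty
  simp only [Set.mem_compl_iff, Set.mem_union, Set.mem_ofPred_eq, not_or, not_not] at hd
  obtain ⟨⟨hd1, hd2⟩, hd3⟩ := hd
  let A : Place k K →₀ ℤ := Finsupp.single o 2 + Finsupp.single d 1
  have hA : A.degree = 3 := by simp [A]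
  have hh : ∀ j, ∃ h : K, h ∈ rrSpace (A - Finsupp.single (p j) 2) ∧ h ≠ 0 := fun j => by
    obtain ⟨P, f, hf0, hf⟩ := exists_of_degree_one (D := A - Finsupp.single (p j) 2) (by simp [hA])
    exact ⟨f, (mem_rrSpace_of_ne hf0).2 (by rw [hf]; simp), hf0⟩
  choose h hh hh0 using hh
  let L : ℕ → ℕ → k := fun l j => (p l).lead (-A (p l)) (h j)
  have hL : ∀ {l j}, p l ≠ p j →
      rrSpace (A - Finsupp.single (p j) 2 - Finsupp.single (p l) 1) = ⊥ → L l j ≠ 0 := by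
    intro l j hlj hbot h0
    have e : (A - Finsupp.single (p j) 2 : Place k K →₀ ℤ) (p l) = A (p l) := by
      rw [Finsupp.sub_apply, Finsupp.single_eq_of_ne (by exact hlj), sub_zero]
    have hf := hh j (p l)
    rw [e] at hf
    rw [(p l).lead_eq_zero_iff hf, ← e] at h0
    have := mem_rrSpace_sub_single.2 ⟨hh j, h0⟩
    rw [hbot, Submodule.mem_bot] at this
    exact hh0 j this
  have hα : L (m + 1) m ≠ 0 := hL hpp.symm (by rw [← hd2]; congr 1; simp only [A]; abel)
  have hβ : L m (m + 1) ≠ 0 := hL hpp (by rw [← hd3]; congr 1; simp only [A]; abel)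
  have hN : (Matrix.of fun l j : Fin m => (s l - s j)⁻¹ * L l j).det ≠ 0 := by
    intro h0
    obtain ⟨v, hv0, hv⟩ := Matrix.exists_mulVec_eq_zero_iff.2 h0
    have : (fun j : Fin m => v j • h j) ∈ cauchySections p s m A := by
      rw [mem_cauchySections_smul hh]
      intro l
      have := congrFun hv l
      rw [Pi.zero_apply] at this
      rw [← this]
      simp only [Matrix.mulVec, dotProduct, Matrix.of_apply]
      exact Finset.sum_congr rfl fun j _ => (mul_assoc _ _ _).symm
    rw [hd1, Submodule.mem_bot] at this
    refine hv0 (funext fun j => ?_)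
    exact (smul_eq_zero.1 (congrFun this j)).resolve_right (hh0 _)
  refine (finite_degenerate_pair (s := fun j : Fin m => s j) (τ := s m) (fun j => hs j j.2) hN
    (fun l => (s l - s m)⁻¹ * L l m) (fun l => L l (m + 1)) (fun j => (s m - s j)⁻¹ * L m j)
    (fun j => L (m + 1) j) hα hβ).subset fun x hx => ?_
  have hx1 : cauchySections p (Function.update s (m + 1) x) (m + 2) A ≠ ⊥ := fun hb => hx ⟨A, hA, hb⟩
  obtain ⟨φ, hφ, hφ0⟩ := (Submodule.ne_bot_iff _).1 hx1
  have hc : ∀ j : Fin (m + 2), ∃ c : k, φ j = c • h j := fun j =>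
    exists_proportional (by simp [hA]) (hh j) ((mem_cauchySections.1 hφ).1 j) (hh0 j)
  choose c hc using hc
  obtain rfl : φ = fun j : Fin (m + 2) => c j • h j := funext hc
  rw [mem_cauchySections_smul hh] at hφ
  have hu : ∀ j : Fin m, Function.update s (m + 1) x j = s j := fun j =>
    Function.update_of_ne (by have := j.2; omega) _ _
  have hum : Function.update s (m + 1) x m = s m := Function.update_of_ne (by omega) _ _
  have hum' : Function.update s (m + 1) x (m + 1) = x := Function.update_self _ _ _
  simp only [Fin.sum_univ_castSucc, Fin.val_castSucc, Fin.val_last, hu, hum, hum'] at hφ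
  refine ⟨fun j => c j.castSucc.castSucc, c (Fin.last m).castSucc, c (Fin.last (m + 1)), ?_, ?_, ?_,
    ?_⟩
  · rintro ⟨h1, h2, h3⟩
    refine hφ0 (funext fun j => ?_)
    suffices c j = 0 by simp [this]
    refine Fin.lastCases h3 (fun j => ?_) j
    exact Fin.lastCases h2 (fun j => congrFun h1 j) j
  · intro l
    have := hφ l.castSucc.castSucc
    simp only [Fin.val_castSucc, hu] at this
    rw [← this]
    simp only [Matrix.of_apply, L, mul_assoc]
  · have := hφ (Fin.last m).castSucc
    simp only [Fin.val_castSucc, Fin.val_last, hum, sub_self, inv_zero, zero_mul, add_zero] at this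
    rw [← this]
    simp only [L, mul_assoc]
  · have := hφ (Fin.last (m + 1))
    simp only [Fin.val_last, hum', sub_self, inv_zero, zero_mul, add_zero] at this
    rw [← this]

/-- The inverse of `0` is `0`, so the condition at each of the two points involves only the
component of the other one: the system splits into two Riemann–Roch spaces. -/
theorem cauchySections_two {D : Place k K →₀ ℤ} (hp : p 0 ≠ p 1) (hs : s 0 ≠ s 1) {φ : Fin 2 → K}
    (hφ : φ ∈ cauchySections p s 2 D) :
    φ 0 ∈ rrSpace (D - Finsupp.single (p 0) 2 - Finsupp.single (p 1) 1) ∧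
      φ 1 ∈ rrSpace (D - Finsupp.single (p 1) 2 - Finsupp.single (p 0) 1) := by
  classical
  obtain ⟨h1, h2⟩ := mem_cauchySections.1 hφ
  have h20 := h2 0
  have h21 := h2 1
  rw [Fin.sum_univ_two] at h20 h21
  simp only [Fin.coe_ofNat_eq_mod, Nat.zero_mod, Nat.mod_succ, sub_self, inv_zero, zero_smul,
    zero_add, add_zero] at h20 h21
  rw [Place.smul_mem_fil_iff _ (inv_ne_zero (sub_ne_zero.2 hs))] at h20
  rw [Place.smul_mem_fil_iff _ (inv_ne_zero (sub_ne_zero.2 hs.symm))] at h21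
  rw [mem_rrSpace_sub_single, mem_rrSpace_sub_single, Finsupp.sub_apply, Finsupp.sub_apply,
    Finsupp.single_eq_of_ne (by exact hp.symm), Finsupp.single_eq_of_ne (by exact hp), sub_zero,
    sub_zero, neg_add_eq_sub, neg_add_eq_sub]
  exact ⟨⟨h1 0, h21⟩, h1 1, h20⟩

theorem cauchyGood_two (hp : p 0 ≠ p 1) (hs : s 0 ≠ s 1) : CauchyGood p s 2 := by
  classical
  have hbad := (finite_rrSpace_ne_bot (C := Finsupp.single (p 0) 2 -
    Finsupp.single (p 0) 2 - Finsupp.single (p 1) 1) (by simp)).union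
    (finite_rrSpace_ne_bot (C := Finsupp.single (p 0) 2 -
    Finsupp.single (p 1) 2 - Finsupp.single (p 0) 1) (by simp))
  have := Place.infinite k K
  obtain ⟨d, hd⟩ := hbad.infinite_compl.nonempty
  simp only [Set.mem_compl_iff, Set.mem_union, Set.mem_ofPred_eq, not_or, not_not] at hd
  refine ⟨Finsupp.single (p 0) 2 + Finsupp.single d 1, by simp, ?_⟩
  rw [Submodule.eq_bot_iff]
  intro φ hφ
  obtain ⟨h1, h2⟩ := cauchySections_two hp hs hφ
  rw [add_sub_right_comm, add_sub_right_comm, hd.1, Submodule.mem_bot] at h1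
  rw [add_sub_right_comm, add_sub_right_comm, hd.2, Submodule.mem_bot] at h2
  funext j
  fin_cases j <;> assumption

/-- If both of the spaces in degree zero were nonzero, `2 p 0 + p 1` and `2 p 1 + p 0` would be
equivalent, hence so would `p 0` and `p 1`. -/
theorem cauchyOne_two (hp : p 0 ≠ p 1) (hs : s 0 ≠ s 1) : CauchyOne p s 2 := by
  intro D hD φ hφ ψ hψ hne
  obtain ⟨h1, h2⟩ := cauchySections_two hp hs hφ
  obtain ⟨h3, h4⟩ := cauchySections_two hp hs hψ
  have hor : (φ 0 = 0 ∧ ψ 0 = 0) ∨ (φ 1 = 0 ∧ ψ 1 = 0) := by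
    have hd0 : (D - Finsupp.single (p 0) 2 - Finsupp.single (p 1) 1).degree = 0 := by simp [hD]
    have hd1 : (D - Finsupp.single (p 1) 2 - Finsupp.single (p 0) 1).degree = 0 := by simp [hD]
    by_cases hb : rrSpace (D - Finsupp.single (p 0) 2 - Finsupp.single (p 1) 1) = ⊥
    · rw [hb, Submodule.mem_bot] at h1 h3
      exact Or.inl ⟨h1, h3⟩
    · by_cases hb' : rrSpace (D - Finsupp.single (p 1) 2 - Finsupp.single (p 0) 1) = ⊥
      · rw [hb', Submodule.mem_bot] at h2 h4
        exact Or.inr ⟨h2, h4⟩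
      · obtain ⟨f, hf0, hf⟩ := (rrSpace_ne_bot_iff hd0).1 hb
        obtain ⟨f', hf0', hf'⟩ := (rrSpace_ne_bot_iff hd1).1 hb'
        refine absurd (eq_of_divisor_eq (f := f * f'⁻¹) ?_) hp
        rw [divisor_mul hf0 (inv_ne_zero hf0'), divisor_inv, hf, hf']
        rw [show (2 : ℤ) = 1 + 1 by norm_num, Finsupp.single_add, Finsupp.single_add]
        abel
  rcases hor with ⟨ha, hb⟩ | ⟨ha, hb⟩
  · have h0 : φ 1 ≠ 0 := fun h => hne (by funext j; fin_cases j <;> assumption)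
    obtain ⟨c, hc⟩ := exists_proportional (by simp [hD]) h2 h4 h0
    refine ⟨c, ?_⟩
    funext j
    fin_cases j
    · simp [ha, hb]
    · exact hc
  · have h0 : φ 0 ≠ 0 := fun h => hne (by funext j; fin_cases j <;> assumption)
    obtain ⟨c, hc⟩ := exists_proportional (by simp [hD]) h1 h3 h0
    refine ⟨c, ?_⟩
    funext j
    fin_cases j
    · exact hc
    · simp [ha, hb]

end Pointing
end

/-! ### Three points, two-torsion, and the choice of the Cauchy parameters. -/

noncomputable section
namespace Pointing
open Module
set_option linter.unusedSectionVars false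

variable {k K : Type*} [Field k] [Field K] [Algebra k K] [hK : Fact (IsFunctionFieldOfCurve k K)]
variable {p : ℕ → Place k K} {s : ℕ → k} {m : ℕ} [IsAlgClosed k] [hG : Fact (HasGenus k K 1)]

theorem sum_fin_three {M : Type*} [AddCommMonoid M] (F : Fin 3 → M) {a b c : Fin 3}
    (hab : a ≠ b) (hac : a ≠ c) (hbc : b ≠ c) : ∑ j, F j = F a + F b + F c := by
  have : (Finset.univ : Finset (Fin 3)) = {a, b, c} := by
    revert a b c; decide
  rw [this, Finset.sum_insert (by simp [hab, hac]), Finset.sum_pair hbc, add_assoc]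

/-- With `D = 2 p a + p b` the component `φ a` is constant. The condition at `p b` then removes the
pole of `φ c` there, so `φ c` lies in the zero space of `2 p a - 2 p c`. The condition at `p a` puts
`φ b` in the zero space of `p a - p b`, and the condition at `p c` kills the constant. -/
theorem cauchyGood_three_of_not_equiv (hp : Function.Injective p)
    (hs : ∀ i j : Fin 3, i ≠ j → s i ≠ s j) {a b c : Fin 3}
    (hab : a ≠ b) (hac : a ≠ c) (hbc : b ≠ c)
    (h : ∀ f : K, f ≠ 0 → divisor k f ≠ Finsupp.single (p a) 2 - Finsupp.single (p c) 2) :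
    CauchyGood p s 3 := by
  classical
  have hne : ∀ {i j : Fin 3}, i ≠ j → p i ≠ p j := fun hij h => hij (Fin.ext (hp h))
  refine ⟨Finsupp.single (p a) 2 + Finsupp.single (p b) 1, by simp, ?_⟩
  rw [Submodule.eq_bot_iff]
  intro φ hφ
  rw [mem_cauchySections] at hφ
  obtain ⟨h1, h2⟩ := hφ
  have hsum : ∀ l : Fin 3, (s l - s a)⁻¹ • φ a + (s l - s b)⁻¹ • φ b + (s l - s c)⁻¹ • φ c ∈
      (p l).fil (1 - (Finsupp.single (p a) 2 + Finsupp.single (p b) 1 : Place k K →₀ ℤ) (p l)) :=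
    fun l => by
      have := h2 l
      rwa [sum_fin_three _ hab hac hbc] at this
  have ha := h1 a
  rw [add_sub_cancel_left] at ha
  obtain ⟨e, he⟩ := eq_algebraMap_of_mem_rrSpace_single ha
  have hc : φ c = 0 := by
    by_contra hc0
    have hcm : φ c ∈ rrSpace (Finsupp.single (p a) 2 + Finsupp.single (p b) 1 -
        Finsupp.single (p c) 2 - Finsupp.single (p b) 1) := by
      rw [mem_rrSpace_sub_single]
      refine ⟨h1 c, ?_⟩
      have := hsum b
      rw [sub_self, inv_zero, zero_smul, add_zero, he, Finsupp.add_apply, Finsupp.single_eq_same,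
        Finsupp.single_eq_of_ne (by exact hne hab.symm)] at this
      rw [Finsupp.sub_apply, Finsupp.add_apply, Finsupp.single_eq_same,
        Finsupp.single_eq_of_ne (by exact hne hab.symm),
        Finsupp.single_eq_of_ne (by exact hne hbc)]
      have h3 := sub_mem this ((p b).smul_mem_fil (s b - s a)⁻¹ ((p b).algebraMap_mem_fil e))
      rw [add_sub_cancel_left, Place.smul_mem_fil_iff _
        (inv_ne_zero (sub_ne_zero.2 (hs _ _ hbc)))] at h3
      simpa using h3
    have hdiv := divisor_eq_of_degree_zero (by simp) hc0 hcm
    refine h (φ c)⁻¹ (inv_ne_zero hc0) ?_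
    rw [divisor_inv, hdiv]
    abel
  have hb : φ b = 0 := by
    by_contra hb0
    have hbm : φ b ∈ rrSpace (Finsupp.single (p a) 2 + Finsupp.single (p b) 1 -
        Finsupp.single (p b) 2 - Finsupp.single (p a) 1) := by
      rw [mem_rrSpace_sub_single]
      refine ⟨h1 b, ?_⟩
      have := hsum a
      rw [sub_self, inv_zero, zero_smul, zero_add, hc, smul_zero, add_zero, Finsupp.add_apply,
        Finsupp.single_eq_same, Finsupp.single_eq_of_ne (by exact hne hab),
        Place.smul_mem_fil_iff _ (inv_ne_zero (sub_ne_zero.2 (hs _ _ hab)))] at this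
      rw [Finsupp.sub_apply, Finsupp.add_apply, Finsupp.single_eq_same,
        Finsupp.single_eq_of_ne (by exact hne hab), Finsupp.single_eq_of_ne (by exact hne hab)]
      simpa using this
    have hdiv := divisor_eq_of_degree_zero (by simp) hb0 hbm
    refine hne hab (eq_of_divisor_eq (f := (φ b)⁻¹) ?_)
    rw [divisor_inv, hdiv, show (2 : ℤ) = 1 + 1 by norm_num, Finsupp.single_add,
      Finsupp.single_add]
    abel
  have ha0 : φ a = 0 := by
    have := hsum c
    rw [hc, hb, smul_zero, smul_zero, add_zero, add_zero, he, Place.smul_mem_fil_iff _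
      (inv_ne_zero (sub_ne_zero.2 (hs _ _ hac.symm))), Finsupp.add_apply,
      Finsupp.single_eq_of_ne (by exact hne hac.symm),
      Finsupp.single_eq_of_ne (by exact hne hbc.symm)] at this
    have h0 : e = 0 := (p c).algebraMap_mem_fil_one (by simpa using this)
    rw [he, h0, map_zero]
  funext j
  have : j = a ∨ j = b ∨ j = c := by
    clear * - hab hac hbc
    revert a b c j; decide
  rcases this with rfl | rfl | rfl <;> assumption

/-- Two functions with double poles at `P` and elsewhere double zeros are related affinely. -/
theorem exists_translate_of_double {P Q R : Place k K} (hPQ : P ≠ Q) (hPR : P ≠ R) (hQR : Q ≠ R)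
    {f f' : K} (hf0 : f ≠ 0) (hf0' : f' ≠ 0)
    (hf : divisor k f = Finsupp.single Q 2 - Finsupp.single P 2)
    (hf' : divisor k f' = Finsupp.single R 2 - Finsupp.single P 2) :
    ∃ t : k, t ≠ 0 ∧ ∃ c : k, c ≠ 0 ∧ f' = c • (f + algebraMap k K t) := by
  classical
  have hm : f ∈ P.fil (-2) := by
    rw [P.mem_fil_of_ne hf0, ← divisor_apply, hf, Finsupp.sub_apply, Finsupp.single_eq_same,
      Finsupp.single_eq_of_ne (by exact hPQ)]; simp
  have hm' : f' ∈ P.fil (-2) := by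
    rw [P.mem_fil_of_ne hf0', ← divisor_apply, hf', Finsupp.sub_apply, Finsupp.single_eq_same,
      Finsupp.single_eq_of_ne (by exact hPR)]; simp
  have hl : P.lead (-2) f ≠ 0 := by
    rw [Ne, P.lead_eq_zero_iff hm, P.mem_fil_of_ne hf0, ← divisor_apply, hf, Finsupp.sub_apply,
      Finsupp.single_eq_same, Finsupp.single_eq_of_ne (by exact hPQ)]
    simp
  have hr : f ∈ rrSpace (Finsupp.single P 2) := by
    rw [mem_rrSpace_of_ne hf0, hf]; simp
  have hr' : f' ∈ rrSpace (Finsupp.single P 2) := by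
    rw [mem_rrSpace_of_ne hf0', hf']; simp
  let c := P.lead (-2) f' / P.lead (-2) f
  -- Matching the leading coefficients at `P` leaves at most a simple pole, hence a constant.
  obtain ⟨e, he⟩ : ∃ e : k, f' - c • f = algebraMap k K e := by
    refine eq_algebraMap_of_mem_rrSpace_single (P := P) ?_
    rw [show Finsupp.single P (1 : ℤ) = Finsupp.single P 2 - Finsupp.single P 1 by
      rw [← Finsupp.single_sub]; norm_num, mem_rrSpace_sub_single, Finsupp.single_eq_same]
    refine ⟨sub_mem hr' (Submodule.smul_mem _ _ hr), ?_⟩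
    have := (P.sum_smul_mem_fil_iff (m := -2) (f := ![f', f]) (fun j => by
      fin_cases j <;> assumption) ![1, -c]).2 (by simp [c, hl])
    simpa [← sub_eq_add_neg] using this
  have hc : c ≠ 0 := by
    intro hc
    rw [hc, zero_smul, sub_zero] at he
    have := congrArg (fun D => D R) hf'
    rw [he] at this
    simp only [divisor_apply, Place.ord_algebraMap, Finsupp.sub_apply, Finsupp.single_eq_same,
      Finsupp.single_eq_of_ne (show R ≠ P from hPR.symm)] at this
    omega
  refine ⟨c⁻¹ * e, ?_, c, hc, ?_⟩
  · intro ht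
    have he0 : e = 0 := (mul_eq_zero.1 ht).resolve_left (inv_ne_zero hc)
    rw [he0, map_zero, sub_eq_zero, Algebra.smul_def] at he
    rw [he, divisor_mul (by simpa using hc) hf0] at hf'
    have h1 := congrArg (fun D => D R) hf'
    have h2 := congrArg (fun D => D R) hf
    simp only [Finsupp.add_apply, divisor_apply, Place.ord_algebraMap, Finsupp.sub_apply,
      Finsupp.single_eq_same, Finsupp.single_eq_of_ne (show R ≠ P from hPR.symm),
      Finsupp.single_eq_of_ne (show R ≠ Q from hQR.symm)] at h1 h2
    omega
  · rw [smul_add, Algebra.smul_def c (algebraMap k K _), ← map_mul, mul_inv_cancel_left₀ hc, ← he]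
    abel

/-- In characteristic two there is at most one nontrivial two-torsion point. -/
theorem not_double_of_charTwo [CharP K 2] {P Q R : Place k K} (hPQ : P ≠ Q) (hPR : P ≠ R)
    (hQR : Q ≠ R) {f : K} {t : k} (ht : t ≠ 0) (hf0 : f ≠ 0)
    (hf : divisor k f = Finsupp.single Q 2 - Finsupp.single P 2)
    (hft0 : f + algebraMap k K t ≠ 0)
    (hft : divisor k (f + algebraMap k K t) = Finsupp.single R 2 - Finsupp.single P 2) : False := by
  classical
  obtain ⟨B, hB⟩ : ∃ B : Place k K →₀ ℤ, B = Finsupp.single P 1 + Finsupp.single Q 1 := ⟨_, rfl⟩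
  have hBP : B P = 1 := by simp [hB, Finsupp.single_eq_of_ne (show P ≠ Q from hPQ)]
  have hBQ : B Q = 1 := by simp [hB, Finsupp.single_eq_of_ne (show Q ≠ P from hPQ.symm)]
  have hBR : B R = 0 := by
    simp [hB, Finsupp.single_eq_of_ne (show R ≠ P from hPR.symm),
      Finsupp.single_eq_of_ne (show R ≠ Q from hQR.symm)]
  have hfP : P.ord f = -2 := by
    rw [← divisor_apply, hf]; simp [Finsupp.single_eq_of_ne (show P ≠ Q from hPQ)]
  have hfQ : Q.ord f = 2 := by
    rw [← divisor_apply, hf]; simp [Finsupp.single_eq_of_ne (show Q ≠ P from hPQ.symm)]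
  have hfR : R.ord f = 0 := by
    rw [← divisor_apply, hf]; simp [Finsupp.single_eq_of_ne (show R ≠ P from hPR.symm),
      Finsupp.single_eq_of_ne (show R ≠ Q from hQR.symm)]
  have hftR : R.ord (f + algebraMap k K t) = 2 := by
    rw [← divisor_apply, hft]; simp [Finsupp.single_eq_of_ne (show R ≠ P from hPR.symm)]
  have hBsub : B - Finsupp.single P 1 = Finsupp.single Q 1 := by rw [hB, add_sub_cancel_left]
  have hBsub' : B - Finsupp.single Q 1 = Finsupp.single P 1 := by
    rw [hB, add_sub_cancel_right]
  -- a nonconstant function with simple poles at `P` and `Q`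
  obtain ⟨z, hz, hzc⟩ : ∃ z ∈ rrSpace B, ∀ c : k, z ≠ algebraMap k K c := by
    by_contra! hall
    have h2 := finrank_rrSpace (D := B) (by simp [hB])
    have : finrank k (rrSpace B) ≤ 1 := finrank_le_one (⟨1, one_mem_rrSpace (by
      simp only [hB]; exact add_nonneg (by simp) (by simp))⟩ : rrSpace B) fun w => by
      obtain ⟨c, hc⟩ := hall w w.2
      exact ⟨c, Subtype.ext (by rw [hc, Algebra.algebraMap_eq_smul_one]; rfl)⟩
    rw [hB, map_add, Finsupp.degree_single, Finsupp.degree_single, ← hB] at h2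
    omega
  have hzP := hz P
  have hzQ := hz Q
  have hzR := hz R
  rw [hBP] at hzP
  rw [hBQ] at hzQ
  rw [hBR, neg_zero] at hzR
  have hlP : P.lead (-1) z ≠ 0 := fun h => by
    rw [P.lead_eq_zero_iff hzP] at h
    have := mem_rrSpace_sub_single.2 ⟨hz, by rwa [hBP]⟩
    rw [hBsub] at this
    obtain ⟨c, hc⟩ := eq_algebraMap_of_mem_rrSpace_single this
    exact hzc c hc
  have hmP : f ∈ P.fil (-2) := by rw [P.mem_fil_of_ne hf0, hfP]
  have hmQ : f⁻¹ ∈ Q.fil (-2) := by rw [Q.mem_fil_of_ne (inv_ne_zero hf0), Q.ord_inv, hfQ]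
  have hlf : P.lead (-2) f ≠ 0 := by
    rw [Ne, P.lead_eq_zero_iff hmP, P.mem_fil_of_ne hf0, hfP]; simp
  have hlf' : Q.lead (-2) f⁻¹ ≠ 0 := by
    rw [Ne, Q.lead_eq_zero_iff hmQ, Q.mem_fil_of_ne (inv_ne_zero hf0), Q.ord_inv, hfQ]; simp
  have hz2 : z ^ 2 ∈ rrSpace (B + B) := by rw [pow_two]; exact mul_mem_rrSpace hz hz
  have hz2P : z ^ 2 ∈ P.fil (-2) := by
    have := hz2 P; rwa [Finsupp.add_apply, hBP] at this
  have hz2Q : z ^ 2 ∈ Q.fil (-2) := by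
    have := hz2 Q; rwa [Finsupp.add_apply, hBQ] at this
  -- The double poles of `z ^ 2` at `P` and `Q` are cancelled by `f` and its inverse. What remains
  -- lies in `ℒ(P + Q)`, spanned by `1` and `z`, which gives a quadratic equation for `z` over
  -- `k(f)`.
  obtain ⟨α, hα⟩ : ∃ α : k, z ^ 2 - α • f ∈ P.fil (-1) := by
    refine ⟨P.lead (-2) (z ^ 2) / P.lead (-2) f, ?_⟩
    have := (P.sum_smul_mem_fil_iff (m := -2) (f := ![z ^ 2, f]) (fun j => by
      fin_cases j <;> assumption) ![1, -(P.lead (-2) (z ^ 2) / P.lead (-2) f)]).2 (by simp [hlf])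
    simpa [← sub_eq_add_neg] using this
  obtain ⟨β, hβ⟩ : ∃ β : k, z ^ 2 - β • f⁻¹ ∈ Q.fil (-1) := by
    refine ⟨Q.lead (-2) (z ^ 2) / Q.lead (-2) f⁻¹, ?_⟩
    have := (Q.sum_smul_mem_fil_iff (m := -2) (f := ![z ^ 2, f⁻¹]) (fun j => by
      fin_cases j <;> assumption) ![1, -(Q.lead (-2) (z ^ 2) / Q.lead (-2) f⁻¹)]).2 (by simp [hlf'])
    simpa [← sub_eq_add_neg] using this
  have hBB : B + B - Finsupp.single P 1 - Finsupp.single Q 1 = B := by simp only [hB]; abel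
  have hw : z ^ 2 - α • f - β • f⁻¹ ∈ rrSpace B := by
    rw [← hBB, mem_rrSpace_sub_single, mem_rrSpace_sub_single, Finsupp.sub_apply,
      Finsupp.single_eq_of_ne (show Q ≠ P from hPQ.symm), Finsupp.add_apply, Finsupp.add_apply,
      hBP, hBQ]
    refine ⟨⟨sub_mem (sub_mem hz2 (Submodule.smul_mem _ _ ?_)) (Submodule.smul_mem _ _ ?_), ?_⟩, ?_⟩
    · rw [mem_rrSpace_of_ne hf0, hf]
      have : B + B + (Finsupp.single Q 2 - Finsupp.single P 2) = Finsupp.single Q 4 := by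
        simp only [hB, show (4 : ℤ) = 1 + 1 + 2 by norm_num, show (2 : ℤ) = 1 + 1 by norm_num,
          Finsupp.single_add]
        abel
      rw [this]; simp
    · rw [mem_rrSpace_of_ne (inv_ne_zero hf0), divisor_inv, hf]
      have : B + B + -(Finsupp.single Q 2 - Finsupp.single P 2) = Finsupp.single P 4 := by
        simp only [hB, show (4 : ℤ) = 1 + 1 + 2 by norm_num, show (2 : ℤ) = 1 + 1 by norm_num,
          Finsupp.single_add]
        abel
      rw [this]; simp
    · refine sub_mem hα (P.smul_mem_fil _ ?_)
      rw [P.mem_fil_of_ne (inv_ne_zero hf0), P.ord_inv, hfP]; norm_num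
    · rw [sub_right_comm]
      refine sub_mem hβ (Q.smul_mem_fil _ ?_)
      rw [Q.mem_fil_of_ne hf0, hfQ]; norm_num
  obtain ⟨δ, ε, hδ⟩ : ∃ δ ε : k, z ^ 2 - α • f - β • f⁻¹ - δ • z = algebraMap k K ε := by
    refine ⟨P.lead (-1) (z ^ 2 - α • f - β • f⁻¹) / P.lead (-1) z,
      eq_algebraMap_of_mem_rrSpace_single (P := Q) ?_⟩
    rw [← hBsub, mem_rrSpace_sub_single, hBP]
    refine ⟨sub_mem hw (Submodule.smul_mem _ _ hz), ?_⟩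
    have hwP := hw P
    rw [hBP] at hwP
    have := (P.sum_smul_mem_fil_iff (m := -1) (f := ![z ^ 2 - α • f - β • f⁻¹, z]) (fun j => by
      fin_cases j <;> assumption)
      ![1, -(P.lead (-1) (z ^ 2 - α • f - β • f⁻¹) / P.lead (-1) z)]).2 (by simp [hlP])
    simpa [← sub_eq_add_neg] using this
  have htwo : (2 : K) = 0 := CharP.cast_eq_zero K 2
  have htK : algebraMap k K t ≠ 0 := by simpa using ht
  -- compare the expansions at `R`
  have hδ0 : δ = 0 := by
    by_contra hδ0
    have hzz : z - algebraMap k K (R.res z) ∈ R.fil 1 := R.sub_res_mem (R.mem_fil_zero.1 hzR)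
    have hsq : z ^ 2 + algebraMap k K (R.res z) ^ 2 ∈ R.fil 2 := by
      have := R.mul_mem_fil hzz hzz
      rw [one_add_one_eq_two] at this
      have e : z ^ 2 + algebraMap k K (R.res z) ^ 2 =
          (z - algebraMap k K (R.res z)) * (z - algebraMap k K (R.res z)) := by
        linear_combination algebraMap k K (R.res z) * z * htwo
      rwa [e]
    have h1 : f + algebraMap k K t ∈ R.fil 2 := by rw [R.mem_fil_of_ne hft0, hftR]
    have h2 : f⁻¹ + (algebraMap k K t)⁻¹ ∈ R.fil 2 := by
      have : f⁻¹ + (algebraMap k K t)⁻¹ = (f * algebraMap k K t)⁻¹ * (f + algebraMap k K t) := by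
        field_simp; ring
      rw [this, R.mul_mem_fil_iff (inv_ne_zero (mul_ne_zero hf0 htK)), R.ord_inv,
        R.ord_mul hf0 htK, hfR, R.ord_algebraMap]
      simpa using h1
    have h3 : δ • (z - algebraMap k K (R.res z)) + algebraMap k K (ε + δ * R.res z + R.res z ^ 2 -
        α * t - β * t⁻¹) ∈ R.fil 2 := by
      have := sub_mem (sub_mem hsq (R.smul_mem_fil α h1)) (R.smul_mem_fil β h2)
      convert this using 1
      simp only [Algebra.smul_def] at hδ ⊢
      simp only [map_add, map_sub, map_mul, map_pow, map_inv₀]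
      linear_combination -hδ
    have h4 : ε + δ * R.res z + R.res z ^ 2 - α * t - β * t⁻¹ = 0 := by
      refine R.algebraMap_mem_fil_one ?_
      have := sub_mem (R.fil_anti one_le_two h3) (R.smul_mem_fil δ hzz)
      rwa [add_sub_cancel_left] at this
    rw [h4, map_zero, add_zero, R.smul_mem_fil_iff hδ0] at h3
    -- If `δ` were nonzero, `z` minus its value at `R` would have divisor `2 R - P - Q`; divided by
    -- `f + t`, with divisor `2 R - 2 P`, it would make `P` and `Q` equivalent.
    have hg0 : z - algebraMap k K (R.res z) ≠ 0 := sub_ne_zero.2 (hzc _)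
    have hBR1 : (B - Finsupp.single R 1 : Place k K →₀ ℤ) R = -1 := by
      rw [Finsupp.sub_apply, hBR, Finsupp.single_eq_same]; rfl
    have hg : z - algebraMap k K (R.res z) ∈ rrSpace (B - Finsupp.single R 1 - Finsupp.single R 1) := by
      rw [mem_rrSpace_sub_single, mem_rrSpace_sub_single, hBR, hBR1]
      refine ⟨⟨sub_mem hz (algebraMap_mem_rrSpace ?_ _), ?_⟩, ?_⟩
      · rw [hB]; exact add_nonneg (by simp) (by simp)
      · simpa using hzz
      · simpa using h3
    have hgd := divisor_eq_of_degree_zero (by simp [hB]) hg0 hg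
    refine hPQ (eq_of_divisor_eq (f := (f + algebraMap k K t)⁻¹ * (z - algebraMap k K (R.res z))) ?_)
    rw [divisor_mul (inv_ne_zero hft0) hg0, divisor_inv, hft, hgd]
    simp only [hB, show (2 : ℤ) = 1 + 1 by norm_num, Finsupp.single_add]
    abel
  obtain ⟨a, rfl⟩ := IsAlgClosed.exists_pow_nat_eq α (n := 2) two_pos
  obtain ⟨b, rfl⟩ := IsAlgClosed.exists_pow_nat_eq β (n := 2) two_pos
  obtain ⟨e, rfl⟩ := IsAlgClosed.exists_pow_nat_eq ε (n := 2) two_pos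
  rw [hδ0, zero_smul, sub_zero] at hδ
  have hze : z + algebraMap k K e ≠ 0 := fun h => hzc (-e) (by
    rw [map_neg]; exact eq_neg_of_add_eq_zero_left h)
  -- Without the linear term, all coefficients are squares and the equation says in characteristic
  -- two that `f` is the square of `w`, whose divisor would be `Q - P`.
  let w := (algebraMap k K a * f + algebraMap k K b) / (z + algebraMap k K e)
  have hw2 : w ^ 2 = f := by
    rw [div_pow, div_eq_iff (pow_ne_zero _ hze)]
    simp only [Algebra.smul_def, map_pow] at hδ
    have := congrArg (f * ·) hδ
    have hff : f * (algebraMap k K b ^ 2 * f⁻¹) = algebraMap k K b ^ 2 := by field_simp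
    simp only [mul_sub, hff] at this
    linear_combination -this + (algebraMap k K a * f * algebraMap k K b -
      f * z * algebraMap k K e - f * algebraMap k K e ^ 2) * htwo
  have hw0 : w ≠ 0 := fun h => hf0 (by rw [← hw2, h]; simp)
  refine hPQ (eq_of_divisor_eq (f := w) ?_).symm
  have := hf
  rw [← hw2, pow_two, divisor_mul hw0 hw0] at this
  ext S
  have h1 := DFunLike.congr_fun this S
  simp only [Finsupp.add_apply, Finsupp.sub_apply, Finsupp.single_apply, divisor_apply] at h1 ⊢
  split_ifs at h1 ⊢ <;> omega

/-- By `cauchyGood_three_of_not_equiv` only the case where the doubles of all three points are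
equivalent is left. Then two two-torsion classes differ from zero and from each other, which is
impossible in characteristic two; otherwise an explicit twist works. -/
theorem cauchyGood_three (hp : Function.Injective p)
    (hs : ∀ i j : Fin 3, i ≠ j → s i ≠ s j) : CauchyGood p s 3 := by
  classical
  by_contra hbad
  have hall : ∀ a b c : Fin 3, a ≠ b → a ≠ c → b ≠ c →
      ∃ f : K, f ≠ 0 ∧ divisor k f = Finsupp.single (p a) 2 - Finsupp.single (p c) 2 := by
    intro a b c hab hac hbc
    by_contra! h
    exact hbad (cauchyGood_three_of_not_equiv hp hs hab hac hbc h)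
  obtain ⟨f, hf0, hf⟩ := hall 1 2 0 (by decide) (by decide) (by decide)
  obtain ⟨f', hf0', hf'⟩ := hall 2 1 0 (by decide) (by decide) (by decide)
  have h01 : p 0 ≠ p 1 := fun h => by have := hp h; omega
  have h02 : p 0 ≠ p 2 := fun h => by have := hp h; omega
  have h12 : p 1 ≠ p 2 := fun h => by have := hp h; omega
  have h03 : p 0 ≠ p 3 := fun h => by have := hp h; omega
  have h13 : p 1 ≠ p 3 := fun h => by have := hp h; omega
  have h23 : p 2 ≠ p 3 := fun h => by have := hp h; omega
  have hs01 : s 0 ≠ s 1 := hs 0 1 (by decide)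
  have hs02 : s 0 ≠ s 2 := hs 0 2 (by decide)
  have hs12 : s 1 ≠ s 2 := hs 1 2 (by decide)
  simp only [Fin.coe_ofNat_eq_mod, Nat.zero_mod, Nat.reduceMod, Nat.one_mod] at hf hf'
  obtain ⟨t, ht, c, hc, hft⟩ := exists_translate_of_double h01 h02 h12 hf0 hf0' hf hf'
  have hg0 : f + algebraMap k K t ≠ 0 := fun h => hf0' (by rw [hft, h, smul_zero])
  have hg : divisor k (f + algebraMap k K t) = Finsupp.single (p 2) 2 - Finsupp.single (p 0) 2 := by
    rw [← hf', hft, Algebra.smul_def, divisor_mul (by simpa using hc) hg0]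
    ext S; simp [Place.ord_algebraMap]
  by_cases h2 : (2 : K) = 0
  · have := CharTwo.of_one_ne_zero_of_two_eq_zero (one_ne_zero (α := K)) h2
    exact not_double_of_charTwo h01 h02 h12 ht hf0 hf hg0 hg
  have h2k : (2 : k) ≠ 0 := fun h => h2 (by rw [← map_ofNat (algebraMap k K) 2, h, map_zero])
  apply hbad
  -- For this twist the components are multiples of `1`, `f` and `f + t`, so only three constants
  -- are unknown. The auxiliary point `p 3` is the next one of the sequence.
  refine ⟨Finsupp.single (p 0) 2 + Finsupp.single (p 3) 1, by simp, ?_⟩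
  rw [Submodule.eq_bot_iff]
  intro φ hφ
  rw [mem_cauchySections] at hφ
  obtain ⟨h1, h2⟩ := hφ
  have e0 := h1 0
  have e1 := h1 1
  have e2 := h1 2
  have g0 := h2 0
  have g1 := h2 1
  have g2 := h2 2
  rw [Fin.sum_univ_three] at g0 g1 g2
  simp only [Fin.coe_ofNat_eq_mod, Nat.zero_mod, Nat.reduceMod, Nat.one_mod, sub_self, inv_zero,
    zero_smul, zero_add, add_zero, Finsupp.add_apply, Finsupp.single_eq_same,
    Finsupp.single_eq_of_ne (show p 0 ≠ p 3 from h03),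
    Finsupp.single_eq_of_ne (show p 1 ≠ p 3 from h13),
    Finsupp.single_eq_of_ne (show p 2 ≠ p 3 from h23),
    Finsupp.single_eq_of_ne (show p 1 ≠ p 0 from h01.symm),
    Finsupp.single_eq_of_ne (show p 2 ≠ p 0 from h02.symm)] at e0 e1 e2 g0 g1 g2
  rw [add_sub_cancel_left] at e0
  obtain ⟨c0, hc0⟩ := eq_algebraMap_of_mem_rrSpace_single e0
  have hfm : f ∈ rrSpace (Finsupp.single (p 0) 2 + Finsupp.single (p 3) 1 -
      Finsupp.single (p 1) 2) := by
    rw [mem_rrSpace_of_ne hf0, hf]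
    rw [show Finsupp.single (p 0) 2 + Finsupp.single (p 3) 1 - Finsupp.single (p 1) 2 +
      (Finsupp.single (p 1) 2 - Finsupp.single (p 0) 2) = Finsupp.single (p 3) (1 : ℤ) by abel]
    simp
  have hgm : f + algebraMap k K t ∈ rrSpace (Finsupp.single (p 0) 2 + Finsupp.single (p 3) 1 -
      Finsupp.single (p 2) 2) := by
    rw [mem_rrSpace_of_ne hg0, hg]
    rw [show Finsupp.single (p 0) 2 + Finsupp.single (p 3) 1 - Finsupp.single (p 2) 2 +
      (Finsupp.single (p 2) 2 - Finsupp.single (p 0) 2) = Finsupp.single (p 3) (1 : ℤ) by abel]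
    simp
  obtain ⟨c1, hc1⟩ := exists_proportional (by simp) hfm e1 hf0
  obtain ⟨c2, hc2⟩ := exists_proportional (by simp) hgm e2 hg0
  have hfP : (p 0).ord f = -2 := by
    rw [← divisor_apply, hf]; simp [Finsupp.single_eq_of_ne (show p 0 ≠ p 1 from h01)]
  have hfQ : f ∈ (p 1).fil 1 := by
    rw [(p 1).mem_fil_of_ne hf0, ← divisor_apply, hf]
    simp [Finsupp.single_eq_of_ne (show p 1 ≠ p 0 from h01.symm)]
  have hgR : f + algebraMap k K t ∈ (p 2).fil 1 := by
    rw [(p 2).mem_fil_of_ne hg0, ← divisor_apply, hg]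
    simp [Finsupp.single_eq_of_ne (show p 2 ≠ p 0 from h02.symm)]
  rw [hc1, hc2] at g0
  rw [hc0, hc2] at g1
  rw [hc0, hc1] at g2
  have r0 : (s 0 - s 1)⁻¹ * c1 + (s 0 - s 2)⁻¹ * c2 = 0 := by
    by_contra hne
    have hcst : algebraMap k K ((s 0 - s 2)⁻¹ * c2 * t) ∈ (p 0).fil (1 - 2) :=
      (p 0).fil_anti (by norm_num) ((p 0).algebraMap_mem_fil _)
    have := sub_mem g0 hcst
    have e : (s 0 - s 1)⁻¹ • c1 • f + (s 0 - s 2)⁻¹ • c2 • (f + algebraMap k K t) -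
        algebraMap k K ((s 0 - s 2)⁻¹ * c2 * t) =
        ((s 0 - s 1)⁻¹ * c1 + (s 0 - s 2)⁻¹ * c2) • f := by
      simp only [Algebra.smul_def, map_add, map_mul]; ring
    rw [e, (p 0).smul_mem_fil_iff hne, (p 0).mem_fil_of_ne hf0, hfP] at this
    omega
  have r1 : (s 1 - s 0)⁻¹ * c0 + (s 1 - s 2)⁻¹ * c2 * t = 0 := by
    refine (p 1).algebraMap_mem_fil_one ?_
    have := sub_mem g1 ((p 1).smul_mem_fil ((s 1 - s 2)⁻¹ * c2) hfQ)
    have e : algebraMap k K ((s 1 - s 0)⁻¹ * c0 + (s 1 - s 2)⁻¹ * c2 * t) =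
        (s 1 - s 0)⁻¹ • algebraMap k K c0 + (s 1 - s 2)⁻¹ • c2 • (f + algebraMap k K t) -
          ((s 1 - s 2)⁻¹ * c2) • f := by
      simp only [Algebra.smul_def, map_add, map_mul]; ring
    rw [e]
    exact this
  have r2 : (s 2 - s 0)⁻¹ * c0 - (s 2 - s 1)⁻¹ * c1 * t = 0 := by
    refine (p 2).algebraMap_mem_fil_one ?_
    have := sub_mem g2 ((p 2).smul_mem_fil ((s 2 - s 1)⁻¹ * c1) hgR)
    have e : algebraMap k K ((s 2 - s 0)⁻¹ * c0 - (s 2 - s 1)⁻¹ * c1 * t) =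
        (s 2 - s 0)⁻¹ • algebraMap k K c0 + (s 2 - s 1)⁻¹ • c1 • f -
          ((s 2 - s 1)⁻¹ * c1) • (f + algebraMap k K t) := by
      simp only [Algebra.smul_def, map_sub, map_mul]; ring
    rw [e]
    exact this
  have n1 : (s 0 - s 1)⁻¹ ≠ 0 := inv_ne_zero (sub_ne_zero.2 hs01)
  have n2 : (s 0 - s 2)⁻¹ ≠ 0 := inv_ne_zero (sub_ne_zero.2 hs02)
  have n3 : (s 1 - s 2)⁻¹ ≠ 0 := inv_ne_zero (sub_ne_zero.2 hs12)
  rw [← neg_sub (s 0), inv_neg] at r1 r2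
  rw [← neg_sub (s 1), inv_neg] at r2
  have hc2' : c2 = 0 := by
    -- The elimination leaves a factor `2`, which is why characteristic two was set apart.
    have : 2 * t * (s 1 - s 2)⁻¹ * (s 0 - s 2)⁻¹ * c2 = 0 := by
      linear_combination (s 0 - s 2)⁻¹ * r1 - (s 0 - s 1)⁻¹ * r2 + (s 1 - s 2)⁻¹ * t * r0
    simpa [h2k, ht, sub_ne_zero.2 hs12, sub_ne_zero.2 hs02] using this
  have hc1' : c1 = 0 := by
    rw [hc2', mul_zero, add_zero] at r0
    exact (mul_eq_zero.1 r0).resolve_left n1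
  have hc0' : c0 = 0 := by
    rw [hc2', mul_zero, zero_mul, add_zero] at r1
    exact (mul_eq_zero.1 r1).resolve_left (neg_ne_zero.2 n1)
  funext j
  fin_cases j
  · exact hc0.trans (by rw [hc0', map_zero]; rfl)
  · exact hc1.trans (by rw [hc1', zero_smul]; rfl)
  · exact hc2.trans (by rw [hc2', zero_smul]; rfl)

theorem cauchySections_congr {s' : ℕ → k} (h : ∀ j < m, s j = s' j) (D : Place k K →₀ ℤ) :
    cauchySections p s m D = cauchySections p s' m D := by
  ext φ
  simp only [mem_cauchySections, fun j : Fin m => h j j.2]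

theorem CauchyGood.congr {s' : ℕ → k} (hg : CauchyGood p s m) (h : ∀ j < m, s j = s' j) :
    CauchyGood p s' m := by
  obtain ⟨D, hD, hU⟩ := hg
  exact ⟨D, hD, by rwa [← cauchySections_congr h]⟩

theorem CauchyStable.congr {s' : ℕ → k} {σ : k} {y : Place k K} (hg : CauchyStable p s m σ y)
    (h : ∀ j < m, s j = s' j) : CauchyStable p s' m σ y := by
  intro D hD φ hφ hy
  rw [← cauchySections_congr h] at hφ
  refine hg D hD φ hφ ?_
  simpa only [fun j : Fin m => h j j.2] using hy

/-- The last clause is part of the induction because `CauchyGood` advances by two: it must be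
available for `m + 1` points when the parameter `s m` is chosen. -/
theorem exists_cauchy_parameters (hp : Function.Injective p) (hm : 2 ≤ m) :
    ∃ s : ℕ → k, (∀ i < m, ∀ j < m, i ≠ j → s i ≠ s j) ∧ CauchyGood p s m ∧ CauchyOne p s m ∧
      {x | ¬ CauchyGood p (Function.update s m x) (m + 1)}.Finite := by
  classical
  have hpne : ∀ {i j}, i ≠ j → p i ≠ p j := fun hij h => hij (hp h)
  induction m, hm using Nat.le_induction with
  | base =>
    refine ⟨fun j => if j = 0 then 0 else 1, ?_, cauchyGood_two (hpne (by decide)) (by simp),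
      cauchyOne_two (hpne (by decide)) (by simp), ?_⟩
    · intro i hi j hj hij
      interval_cases i <;> interval_cases j <;> simp_all
    · refine (Set.toFinite {0, 1}).subset fun x hx => ?_
      by_contra hx'
      simp only [Set.mem_insert_iff, Set.mem_singleton_iff, not_or] at hx'
      refine hx (cauchyGood_three hp fun i j hij => ?_)
      fin_cases i <;> fin_cases j <;> simp_all [Function.update, eq_comm]
  | succ m hm ih =>
    obtain ⟨s, hs, hgood, hone, hfin⟩ := ih
    have hinj : Function.Injective fun j : Fin m => s j := fun i j hij => by
      by_contra hne
      exact hs i i.2 j j.2 (fun h => hne (Fin.ext h)) hij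
    -- The new parameter avoids three finite sets: those where `CauchyGood` fails for `m + 1`
    -- points, where the condition at `p m` leaves a section, and where a parameter is repeated.
    have hbad := (hfin.union (hgood.finite_not_stable hone hinj (y := p m)
      fun j => hpne j.2.ne)).union (Set.finite_range fun j : Fin m => s j)
    obtain ⟨x, hx⟩ := hbad.infinite_compl.nonempty
    simp only [Set.mem_compl_iff, Set.mem_union, Set.mem_ofPred_eq, not_or, not_not,
      Set.mem_range, not_exists] at hx
    obtain ⟨⟨hx1, hx2⟩, hx3⟩ := hx
    have hcongr : ∀ j < m, s j = Function.update s m x j := fun j hj =>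
      (Function.update_of_ne hj.ne _ _).symm
    have hself : Function.update s m x m = x := Function.update_self _ _ _
    refine ⟨Function.update s m x, ?_, hx1, ?_, ?_⟩
    · intro i hi j hj hij
      rcases Nat.lt_succ_iff_lt_or_eq.1 hi with hi | rfl <;>
        rcases Nat.lt_succ_iff_lt_or_eq.1 hj with hj | rfl
      · rw [← hcongr i hi, ← hcongr j hj]; exact hs i hi j hj hij
      · rw [← hcongr i hi, hself]; exact hx3 ⟨i, hi⟩
      · rw [← hcongr j hj, hself]; exact fun h => hx3 ⟨j, hj⟩ h.symm
      · exact absurd rfl hij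
    · refine CauchyStable.one_succ ?_
      rw [hself]
      exact hx2.congr hcongr
    · refine (hgood.congr hcongr).finite_not_add_two hp fun j hj => ?_
      rw [hself, ← hcongr j hj]
      exact fun h => hx3 ⟨j, hj⟩ h.symm

/-- A configuration on the dual side: no twist of degree three has a section. -/
theorem exists_stable_parameters {n : ℕ} (hn : 2 ≤ n) {p : Fin n → Place k K}
    (hp : Function.Injective p) {y : Place k K} (hy : ∀ j, p j ≠ y) :
    ∃ (s : Fin n → k) (σ : k), Function.Injective s ∧ (∀ j, σ ≠ s j) ∧
      ∀ D : Place k K →₀ ℤ, D.degree = 3 → ∀ φ : Fin n → K,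
        (∀ j, φ j ∈ rrSpace (D - Finsupp.single (p j) 2)) →
        (∀ l, ∑ j, (s l - s j)⁻¹ • φ j ∈ (p l).fil (1 - D (p l))) →
        ∑ j, (σ - s j)⁻¹ • φ j ∈ y.fil (1 - D y) → φ = 0 := by
  have := Place.infinite k K
  -- The induction refers to points beyond the `n` given ones, so these are extended to an injective
  -- sequence.
  let q := (Set.finite_range p).infinite_compl.natEmbedding
  let p' : ℕ → Place k K := fun i => if h : i < n then p ⟨i, h⟩ else q i
  have hp'1 : ∀ i : Fin n, p' i = p i := fun i => dif_pos i.2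
  have hp'2 : ∀ i, ¬ i < n → p' i = q i := fun i h => dif_neg h
  have hp' : Function.Injective p' := by
    intro i j hij
    by_cases hi : i < n <;> by_cases hj : j < n
    · have h1 := hp'1 ⟨i, hi⟩
      have h2 := hp'1 ⟨j, hj⟩
      exact congrArg Fin.val (hp (h1.symm.trans (hij.trans h2)))
    · have h1 := hp'1 ⟨i, hi⟩
      exact absurd ⟨_, h1.symm.trans (hij.trans (hp'2 j hj))⟩ (q j).2
    · have h1 := hp'1 ⟨j, hj⟩
      exact absurd ⟨_, h1.symm.trans (hij.symm.trans (hp'2 i hi))⟩ (q i).2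
    · exact q.injective (Subtype.ext ((hp'2 i hi).symm.trans (hij.trans (hp'2 j hj))))
  obtain ⟨s, hs, hgood, hone, -⟩ := exists_cauchy_parameters hp' hn
  have hinj : Function.Injective fun j : Fin n => s j := fun i j hij => by
    by_contra hne
    exact hs i i.2 j j.2 (fun h => hne (Fin.ext h)) hij
  have hbad := (hgood.finite_not_stable hone hinj (y := y) fun j => by rw [hp'1]; exact hy j).union
    (Set.finite_range fun j : Fin n => s j)
  obtain ⟨σ, hσ⟩ := hbad.infinite_compl.nonempty
  simp only [Set.mem_compl_iff, Set.mem_union, Set.mem_ofPred_eq, not_or, not_not,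
    Set.mem_range, not_exists] at hσ
  refine ⟨fun j => s j, σ, hinj, fun j h => hσ.2 j h.symm, fun D hD φ h1 h2 h3 => ?_⟩
  refine hσ.1 D hD φ (mem_cauchySections.2 ⟨fun j => ?_, fun l => ?_⟩) h3
  · rw [hp'1]; exact h1 j
  · rw [hp'1]; exact h2 l

end Pointing
end

/-! ### From vanishing in all twists of degree three to finitely many twists of degree four. -/

noncomputable section
namespace Pointing
open Module
set_option linter.unusedSectionVars false

variable {k K : Type*} [Field k] [Field K] [Algebra k K] [hK : Fact (IsFunctionFieldOfCurve k K)]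

/-- A sublattice cut out by the vanishing of one functional at `P` has index at most one. -/
theorem Place.ord_det_le_one [IsAlgClosed k] {V ι : Type*} [AddCommGroup V] [Module K V] [Fintype ι]
    [DecidableEq ι] [FiniteDimensional K V] (P : Place k K) {b b' : Basis ι K V}
    (h : P.lat b' ≤ P.lat b) (ε : V →ₗ[K] K) (hε : ∀ v ∈ P.lat b, ε v ∈ P.ring)
    (hker : ∀ v ∈ P.lat b, ε v ∈ P.fil 1 → v ∈ P.lat b') : P.ord (b.det b') ≤ 1 := by
  obtain ⟨β, n, h1, h2, h3, -⟩ := P.exists_adapted h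
  rw [h3]
  have hβ : ∀ i, β i ∈ P.lat b := fun i => h1 ▸ Submodule.subset_span ⟨i, rfl⟩
  have hle : ∀ i, n i ≤ 1 := fun i => by
    by_contra! hi
    have hm : P.unif • β i ∈ P.lat b := P.smul_mem_of_mem_ring P.unif_mem_ring (hβ i)
    have := hker _ hm (by
      rw [map_smul, smul_eq_mul]
      simpa using P.mul_mem_fil P.unif_mem_fil (P.mem_fil_zero.2 (hε _ (hβ i))))
    have := (h2 _).1 this i
    rw [map_smul, Finsupp.smul_apply, Basis.repr_self, Finsupp.single_eq_same, smul_eq_mul, mul_one,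
      P.mem_fil_of_ne P.unif_ne_zero] at this
    have h4 := P.ord_unif_zpow 1
    rw [zpow_one] at h4
    omega
  -- Of two basis vectors with positive exponents, some nontrivial constant combination is killed by
  -- `ε` at `P`. It lies in the sublattice, which forces its coefficients to vanish.
  have huniq : ∀ i j, n i ≠ 0 → n j ≠ 0 → i = j := fun i j hi hj => by
    by_contra hij
    have hv : ∀ c d : k, algebraMap k K c • β i + algebraMap k K d • β j ∈ P.lat b := fun c d =>
      add_mem (P.smul_mem_of_mem_ring (P.algebraMap_mem c) (hβ i))
        (P.smul_mem_of_mem_ring (P.algebraMap_mem d) (hβ j))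
    have key : ∀ c d : k, c * P.res (ε (β i)) + d * P.res (ε (β j)) = 0 → c = 0 ∧ d = 0 := by
      intro c d hcd
      have h5 : ε (algebraMap k K c • β i + algebraMap k K d • β j) ∈ P.fil 1 := by
        rw [← P.res_eq_zero_iff (hε _ (hv c d)), map_add, map_smul, map_smul,
          algebraMap_smul, algebraMap_smul, P.res_add, P.res_smul _ (hε _ (hβ i)),
          P.res_smul _ (hε _ (hβ j)), hcd]
        · rw [← P.mem_fil_zero]; exact P.smul_mem_fil _ (P.mem_fil_zero.2 (hε _ (hβ i)))
        · rw [← P.mem_fil_zero]; exact P.smul_mem_fil _ (P.mem_fil_zero.2 (hε _ (hβ j)))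
      have h6 := (h2 _).1 (hker _ (hv c d) h5)
      have h6i := h6 i
      have h6j := h6 j
      simp only [map_add, map_smul, Finsupp.add_apply, Finsupp.smul_apply, Basis.repr_self,
        Finsupp.single_eq_same, Finsupp.single_eq_of_ne hij, smul_eq_mul, mul_one,
        Finsupp.single_eq_of_ne (Ne.symm hij), mul_zero, add_zero, zero_add] at h6i h6j
      exact ⟨P.algebraMap_mem_fil_one (P.fil_anti (by omega) h6i),
        P.algebraMap_mem_fil_one (P.fil_anti (by omega) h6j)⟩
    obtain ⟨e1, e2⟩ := key (P.res (ε (β j))) (-P.res (ε (β i))) (by ring)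
    exact one_ne_zero (key 1 0 (by rw [neg_eq_zero.1 e2]; ring)).1
  by_cases hn : ∃ i, n i ≠ 0
  · obtain ⟨i, hi⟩ := hn
    rw [Finset.sum_eq_single i (fun j _ hj => by
      by_contra h0
      exact hj (huniq j i (by exact_mod_cast h0) hi)) (by simp)]
    exact_mod_cast hle i
  · push Not at hn
    simp [hn]

theorem Stalks.IsVectorBundle.deg_le_add_one [IsAlgClosed k] [hG : Fact (HasGenus k K 1)]
    {V : Type*} [AddCommGroup V] [Module K V]
    [FiniteDimensional K V] {X Y : Stalks k K V} (hX : X.IsVectorBundle) (hY : Y.IsVectorBundle)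
    {z : Place k K} (h : ∀ P, X.stalk P ≤ Y.stalk P) (hz : ∀ P ≠ z, Y.stalk P ≤ X.stalk P)
    (ε : V →ₗ[K] K) (hε : ∀ v ∈ Y.stalk z, ε v ∈ z.ring)
    (hker : ∀ v ∈ Y.stalk z, ε v ∈ z.fil 1 → v ∈ X.stalk z) : Y.deg ≤ X.deg + 1 := by
  classical
  rw [hX.deg_eq (finBasis K V), hY.deg_eq (finBasis K V)]
  have h1 : ∑ᶠ P : Place k K, (X.degAt (finBasis K V) P + (Finsupp.single z (1 : ℤ)) P) =
      ∑ᶠ P, X.degAt (finBasis K V) P + 1 := by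
    rw [finsum_add_distrib (hX.finite_degAt _) (Finsupp.single z (1 : ℤ)).hasFiniteSupport,
      finsum_eq_degree, Finsupp.degree_single]
  rw [← h1]
  refine finsum_mono_of_finite (hY.finite_degAt _) ?_ fun P => ?_
  · exact ((hX.finite_degAt (finBasis K V)).union
      (Finsupp.single z (1 : ℤ)).hasFiniteSupport).subset (Function.support_add _ _)
  · by_cases hP : P = z
    · subst hP
      rw [Finsupp.single_eq_same]
      obtain ⟨c, hc⟩ := hY.exists_lat (finBasis K V) P
      obtain ⟨c', hc'⟩ := hX.exists_lat (finBasis K V) P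
      rw [degAt_eq hc, degAt_eq hc', ← P.ord_det_add (finBasis K V) c c']
      rw [hc] at hε hker
      simp only [hc'] at hker
      have := P.ord_det_le_one (by rw [← hc, ← hc']; exact h P) ε hε hker
      omega
    · rw [Finsupp.single_eq_of_ne (by exact hP), add_zero]
      exact hY.degAt_mono hX _ (hz P hP)

variable {ι κ : Type*} [Fintype ι] [DecidableEq ι] [Fintype κ] [DecidableEq κ]
variable {e : ι → Place k K →₀ ℤ} {r : κ → Place k K} {a : κ → ι → k}
variable [IsAlgClosed k] [hG : Fact (HasGenus k K 1)]

/-- If the value `w` at `z` were attained in all twists of degree four by `B - d`, then more such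
sections than the rank would give a subbundle of slope larger than `-4` among the tuples whose value
at `z` is a multiple of `w`. Dropping this restriction at `z` raises the degree by at least the rank
minus one, so a subbundle of slope at least `-3` results, and some twist of degree three would have
a section. -/
theorem exists_avoiding_value (he : ∀ j, 0 ≤ e j) {z : Place k K} (hrz : ∀ l, r l ≠ z)
    (hez : ∀ j, e j z = 0)
    (hstab : ∀ D : Place k K →₀ ℤ, D.degree = 3 → ((condBundle e r a).twistDiv D).sections = ⊥)
    {B : Place k K →₀ ℤ} (hB : B.degree = 5) (hBz : B z = 0) {T : Set (Place k K)} (hT : T.Finite)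
    (hzT : z ∈ T) {w : ι → k} (hw : w ≠ 0) :
    ∃ d ∉ T, ∀ φ ∈ ((condBundle e r a).twistDiv (B - Finsupp.single d 1)).sections,
      ¬ ∀ j, z.res (φ j) = w j := by
  classical
  by_contra! hall
  have := Place.infinite k K
  obtain ⟨S, hS, hcard⟩ := hT.infinite_compl.exists_subset_card_eq
    (Fintype.card ι + 1)
  have hSz : ∀ d : S, d.1 ≠ z := fun d h => hS d.2 (h ▸ hzT)
  choose φ hφ hval using fun d : S => hall d.1 (hS d.2)
  let X := condBundle e r a
  have hX : X.IsVectorBundle := condBundle_isVectorBundle he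
  -- The tuples whose value at `z` is proportional to `w`, expressed by the two-by-two minors with
  -- `w`. Below, `X'` consists of the tuples that vanish at `z`.
  let Y : Stalks k K (ι → K) := condBundle e (Sum.elim r fun _ : ι × ι => z)
    (Sum.elim a fun ij => w ij.1 • Pi.single ij.2 1 - w ij.2 • Pi.single ij.1 1)
  have hY : Y.IsVectorBundle := condBundle_isVectorBundle he
  let X' : Stalks k K (ι → K) := condBundle (fun j => e j + Finsupp.single z 1) r a
  have hX' : X'.IsVectorBundle :=
    condBundle_isVectorBundle fun j => add_nonneg (he j) (by simp)
  have hsum : ∀ (ψ : ι → K) (i i' : ι), ∑ j, (w i • Pi.single i' 1 - w i' • Pi.single i 1 : ι → k) j •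
      ψ j = w i • ψ i' - w i' • ψ i := fun ψ i i' => by
    simp only [Pi.sub_apply, Pi.smul_apply, smul_eq_mul, sub_smul, mul_smul, Finset.sum_sub_distrib,
      ← Finset.smul_sum]
    simp [Pi.single_apply, ite_smul]
  have hYmem : ∀ {P : Place k K} {ψ : ι → K}, ψ ∈ Y.stalk P ↔ ψ ∈ X.stalk P ∧
      (P = z → ∀ i i', w i • ψ i' - w i' • ψ i ∈ P.fil 1) := by
    intro P ψ
    refine mem_condBundle.trans ?_
    rw [Sum.forall, ← and_assoc]
    refine and_congr Iff.rfl ?_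
    constructor
    · intro h hP i i'
      have := h (i, i') hP.symm
      dsimp only [Sum.elim_inr] at this
      rwa [hsum] at this
    · intro h ii' hP
      dsimp only [Sum.elim_inr] at hP ⊢
      rw [hsum]
      exact h hP.symm _ _
  have hφ0 : ∀ d, φ d ≠ 0 := fun d h => hw (funext fun j => by
    rw [← hval d j, h]; simp)
  have hφY : ∀ d : S, φ d ∈ (Y.twistDiv (-(-(B - Finsupp.single d.1 1)))).sections := by
    intro d P
    have h1 := hφ d P
    rw [neg_neg, Stalks.mem_twistDiv, hYmem]
    rw [Stalks.mem_twistDiv] at h1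
    refine ⟨h1, ?_⟩
    rintro rfl i i'
    have h0 : (B - Finsupp.single d.1 1 : Place k K →₀ ℤ) P = 0 := by
      rw [Finsupp.sub_apply, hBz, Finsupp.single_eq_of_ne (by exact (hSz d).symm), sub_zero]
    rw [h0, zpow_zero, one_smul] at h1 ⊢
    have hr : ∀ j, φ d j ∈ P.ring := fun j => by
      have := (mem_condBundle.1 h1).1 j
      rwa [hez, P.mem_fil_zero] at this
    have hr' : ∀ (c : k) j, c • φ d j ∈ P.ring := fun c j => by
      rw [← P.mem_fil_zero]; exact P.smul_mem_fil _ (P.mem_fil_zero.2 (hr j))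
    rw [← P.res_eq_zero_iff (sub_mem (hr' _ _) (hr' _ _)), sub_eq_add_neg, ← neg_smul,
      P.res_add (hr' _ _) (hr' _ _), P.res_smul _ (hr _), P.res_smul _ (hr _), hval, hval]
    ring
  obtain ⟨F, hF, hdeg⟩ := hY.exists_sub_of_many_lines
    (fun d : S => -(B - Finsupp.single d.1 1)) φ (-4) hφ0 hφY
    (fun d => by rw [map_neg, map_sub, Finsupp.degree_single, hB]; norm_num)
    (fun i j hij f hf h => hij (Subtype.ext (eq_of_divisor_eq (P := i.1) (Q := j.1) (f := f)
      (by rw [h]; abel)))) (by rw [Fintype.card_coe, Module.finrank_fintype_fun_eq_card]; omega)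
  obtain ⟨j₀, hj₀⟩ : ∃ j, w j ≠ 0 := by
    by_contra! h
    exact hw (funext h)
  have hX'Y : ∀ P, X'.stalk P ≤ Y.stalk P := fun P ψ hψ => by
    obtain ⟨h1, h2⟩ := mem_condBundle.1 hψ
    have h3 : ∀ j, e j P ≤ (e j + Finsupp.single z 1 : Place k K →₀ ℤ) P := fun j => by
      rw [Finsupp.add_apply, Finsupp.single_apply]; split_ifs <;> omega
    refine hYmem.2 ⟨mem_condBundle.2 ⟨fun j => P.fil_anti (h3 j) (h1 j), h2⟩, ?_⟩
    rintro rfl i i'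
    have h4 : ∀ j, ψ j ∈ P.fil 1 := fun j => by
      have := h1 j
      rwa [Finsupp.add_apply, hez, Finsupp.single_eq_same, zero_add] at this
    exact sub_mem (P.smul_mem_fil _ (h4 _)) (P.smul_mem_fil _ (h4 _))
  -- A value proportional to `w` is zero as soon as its coordinate `j₀` is, because `w j₀` is not
  -- zero; so only one condition separates `X'` from `Y`.
  have h1 : (Y.sub F).deg ≤ (X'.sub F).deg + 1 := by
    refine (hX'.sub F).deg_le_add_one (hY.sub F) (z := z) (fun P v hv => hX'Y P hv) ?_
      (LinearMap.proj j₀ ∘ₗ F.subtype) ?_ ?_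
    · intro P hP v hv
      obtain ⟨h1, h2⟩ := mem_condBundle.1 (hYmem.1 hv).1
      refine mem_condBundle.2 ⟨fun j => ?_, h2⟩
      rw [Finsupp.add_apply, Finsupp.single_eq_of_ne (by exact hP), add_zero]
      exact h1 j
    · intro v hv
      have := (mem_condBundle.1 (hYmem.1 hv).1).1 j₀
      rwa [hez, z.mem_fil_zero] at this
    · intro v hv hv0
      refine mem_condBundle.2 ⟨fun j => ?_, fun l hl => absurd hl (hrz l)⟩
      rw [Finsupp.add_apply, hez, Finsupp.single_eq_same, zero_add]
      have := add_mem ((hYmem.1 hv).2 rfl j₀ j) (z.smul_mem_fil (w j) hv0)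
      rw [← z.smul_mem_fil_iff hj₀]
      convert this using 1
      exact (sub_add_cancel _ _).symm
  have h2 : (X'.sub F).deg ≤ (X.sub F).deg - finrank K F := by
    have h3 := (hX.sub F).deg_twistDiv (-Finsupp.single z 1)
    rw [map_neg, Finsupp.degree_single, mul_neg_one, ← sub_eq_add_neg] at h3
    rw [← h3]
    refine (hX'.sub F).deg_mono ((hX.sub F).twistDiv _) fun P v hv => ?_
    obtain ⟨h1, h2⟩ := mem_condBundle.1 hv
    change (v : ι → K) ∈ (X.twistDiv _).stalk P
    rw [mem_condBundle_twistDiv]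
    refine ⟨fun j => ?_, fun l hl => ?_⟩
    · rw [Finsupp.neg_apply, sub_neg_eq_add]
      exact h1 j
    · have hPz : P ≠ z := fun h => hrz l (hl.trans h)
      rw [Finsupp.neg_apply, Finsupp.single_eq_of_ne (by exact hPz), neg_zero, sub_zero]
      exact h2 l hl
  have hr : 0 < finrank K F :=
    Module.finrank_pos_iff.2 ((Submodule.nontrivial_iff_ne_bot).2 hF)
  have h3 := (hX.sub F).deg_twistDiv (Finsupp.single z 4)
  rw [Finsupp.degree_single] at h3
  -- The twist of `F` by `4 z` has degree at least its rank. A section of it that vanishes at `x` is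
  -- a section of the twist by `4 z - x`, of degree three.
  obtain ⟨x, v, hv, hv0⟩ := ((hX.sub F).twistDiv (Finsupp.single z 4)).exists_section_with_zero hr
    (by rw [h3]; linarith)
  have h4 : (v : ι → K) ∈ (X.twistDiv (Finsupp.single z 4 + -Finsupp.single x 1)).sections := by
    intro P
    have := hv P
    rw [Stalks.twistDiv_twistDiv] at this
    exact this
  rw [hstab _ (by simp), Submodule.mem_bot] at h4
  exact hv0 (Subtype.ext h4)

/-- A finite intersection of the spaces of least dimension must be zero, since any nonzero vector in
it could be removed by one more space. -/
theorem exists_finset_of_avoiding {k α V : Type*} [Field k] [AddCommGroup V] [Module k V]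
    [FiniteDimensional k V] (W : α → Submodule k V) (h : ∀ w ≠ 0, ∃ a, w ∉ W a) :
    ∃ S : Finset α, ∀ w, (∀ a ∈ S, w ∈ W a) → w = 0 := by
  classical
  obtain ⟨S, hS⟩ := WellFounded.has_min
    (measure fun S : Finset α => finrank k (⨅ a ∈ S, W a : Submodule k V)).wf Set.univ ⟨∅, trivial⟩
  refine ⟨S, fun w hw => ?_⟩
  by_contra hw0
  obtain ⟨a, ha⟩ := h w hw0
  refine hS.2 (insert a S) trivial (Submodule.finrank_lt_finrank_of_lt (lt_of_le_of_ne ?_ ?_))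
  · exact biInf_mono fun b hb => Finset.mem_insert_of_mem hb
  · intro heq
    have : w ∈ (⨅ a ∈ S, W a : Submodule k V) := by simpa [Submodule.mem_iInf] using hw
    rw [← heq] at this
    simp only [Submodule.mem_iInf] at this
    exact ha (this a (Finset.mem_insert_self a S))

/-- A common value lies in the value spaces of all the twists, and by `exists_avoiding_value`
finitely many of these have intersection zero. A section of the twist by `B - d` with zero value at
`z` is one of the twist by `B - d - z`, of degree three. -/
theorem exists_finset_common_value (he : ∀ j, 0 ≤ e j) {z : Place k K} (hrz : ∀ l, r l ≠ z)
    (hez : ∀ j, e j z = 0)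
    (hstab : ∀ D : Place k K →₀ ℤ, D.degree = 3 → ((condBundle e r a).twistDiv D).sections = ⊥)
    {B : Place k K →₀ ℤ} (hB : B.degree = 5) (hBz : B z = 0) {T : Set (Place k K)} (hT : T.Finite)
    (hzT : z ∈ T) :
    ∃ S : Finset (Place k K), S.Nonempty ∧ (∀ d ∈ S, d ∉ T) ∧
      ∀ φ : S → ι → K,
        (∀ d : S, φ d ∈ ((condBundle e r a).twistDiv (B - Finsupp.single d.1 1)).sections) →
        (∀ d d' j, z.res (φ d j) = z.res (φ d' j)) → ∀ d, φ d = 0 := by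
  classical
  have hne : ∀ {d : Place k K}, d ∉ T → d ≠ z := fun hd h => hd (h ▸ hzT)
  have hring : ∀ {d : Place k K}, d ≠ z → ∀ {φ : ι → K},
      φ ∈ ((condBundle e r a).twistDiv (B - Finsupp.single d 1)).sections → ∀ j, φ j ∈ z.ring := by
    intro d hd φ hφ j
    have := (mem_sections_condBundle.1 hφ).1 j z
    rwa [Finsupp.sub_apply, Finsupp.sub_apply, hBz, hez, Finsupp.single_eq_of_ne (by exact hd.symm),
      sub_zero, sub_zero, neg_zero, z.mem_fil_zero] at this
  obtain ⟨S, hS⟩ := exists_finset_of_avoiding (fun d : {d : Place k K // d ∉ T} =>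
    ({ carrier := {w | ∃ φ ∈ ((condBundle e r a).twistDiv
        (B - Finsupp.single d.1 1)).sections, ∀ j, z.res (φ j) = w j}
       add_mem' := fun {w w'} h h' => by
        obtain ⟨φ, hφ, h1⟩ := h
        obtain ⟨φ', hφ', h1'⟩ := h'
        exact ⟨φ + φ', add_mem hφ hφ', fun j => by
          rw [Pi.add_apply, z.res_add (hring (hne d.2) hφ j) (hring (hne d.2) hφ' j), h1, h1']; rfl⟩
       zero_mem' := ⟨0, zero_mem _, fun j => by simp⟩
       smul_mem' := fun c w h => by
        obtain ⟨φ, hφ, h1⟩ := h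
        exact ⟨c • φ, Submodule.smul_mem _ c hφ, fun j => by
          rw [Pi.smul_apply, z.res_smul _ (hring (hne d.2) hφ j), h1]; rfl⟩ } : Submodule k (ι → k)))
    fun w hw => by
      obtain ⟨d, hd, hav⟩ := exists_avoiding_value he hrz hez hstab hB hBz hT hzT hw
      exact ⟨⟨d, hd⟩, fun ⟨φ, hφ, h1⟩ => hav φ hφ h1⟩
  have := Place.infinite k K
  obtain ⟨d₀, hd₀⟩ := hT.infinite_compl.nonempty
  -- The extra point `d₀` only ensures that the set is not empty.
  refine ⟨insert d₀ (S.image Subtype.val), Finset.insert_nonempty _ _, ?_, ?_⟩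
  · intro d hd
    rcases Finset.mem_insert.1 hd with rfl | hd
    · exact hd₀
    · obtain ⟨d', -, rfl⟩ := Finset.mem_image.1 hd
      exact d'.2
  · intro φ hφ hval
    have hz0 : ∀ d j, z.res (φ d j) = 0 := by
      intro d
      refine congrFun (hS (fun j => z.res (φ d j)) fun d' hd' => ?_)
      obtain ⟨x, hx⟩ : ∃ x : (insert d₀ (S.image Subtype.val) : Finset (Place k K)), x.1 = d'.1 :=
        ⟨⟨d'.1, Finset.mem_insert_of_mem (Finset.mem_image_of_mem _ hd')⟩, rfl⟩
      have hφx := hφ x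
      rw [hx] at hφx
      exact ⟨φ x, hφx, hval x d⟩
    intro d
    have hdz : d.1 ≠ z := by
      rcases Finset.mem_insert.1 d.2 with h | h
      · rw [h]; exact hne hd₀
      · obtain ⟨d', -, h⟩ := Finset.mem_image.1 h
        rw [← h]; exact hne d'.2
    have hBdz : (B - Finsupp.single d.1 1 : Place k K →₀ ℤ) z = 0 := by
      rw [Finsupp.sub_apply, hBz, Finsupp.single_eq_of_ne (by exact hdz.symm), sub_zero]
    have : φ d ∈ ((condBundle e r a).twistDiv
        (B - Finsupp.single d.1 1 - Finsupp.single z 1)).sections := by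
      obtain ⟨h1, h2⟩ := mem_sections_condBundle.1 (hφ d)
      refine mem_sections_condBundle.2 ⟨fun j => ?_, fun l => ?_⟩
      · rw [sub_right_comm, mem_rrSpace_sub_single]
        refine ⟨h1 j, ?_⟩
        rw [Finsupp.sub_apply, hBdz, hez, sub_zero, neg_zero, zero_add,
          ← z.res_eq_zero_iff (hring hdz (hφ d) j)]
        exact hz0 d j
      · rw [Finsupp.sub_apply _ (Finsupp.single z 1), Finsupp.single_eq_of_ne (by exact hrz l),
          sub_zero]
        exact h2 l
    rwa [hstab _ (by simp [hB]), Submodule.mem_bot] at this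

end Pointing
end

/-! ### Derivations of the function field and their regularity at a place. -/

noncomputable section
namespace Pointing
open Module
set_option linter.unusedSectionVars false

section Relation
open MvPolynomial

theorem derivation_aeval {R A σ : Type*} [CommRing R] [CommRing A] [Algebra R A] [Fintype σ]
    [DecidableEq σ] (D : Derivation R A A) (a : σ → A) (F : MvPolynomial σ R) :
    D (aeval a F) = ∑ i, aeval a (pderiv i F) * D (a i) := by
  induction F using MvPolynomial.induction_on with
  | C c => simp
  | add F G hF hG => simp only [map_add, hF, hG, add_mul, Finset.sum_add_distrib]
  | mul_X F j hF =>
    simp only [map_mul, aeval_X, Derivation.leibniz, hF, smul_eq_mul, pderiv_X, map_add, add_mul,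
      Finset.sum_add_distrib]
    congr 1
    · rw [Finset.sum_eq_single j]
      · simp
      · intro i _ hij; simp [hij.symm]
      · simp
    · rw [Finset.mul_sum]
      exact Finset.sum_congr rfl fun i _ => by ring

theorem totalDegree_pderiv_lt {R σ : Type*} [CommRing R] {F : MvPolynomial σ R} {i : σ}
    (h : pderiv i F ≠ 0) : (pderiv i F).totalDegree < F.totalDegree := by
  have key : ∀ m ∈ (pderiv i F).support, m.degree + 1 ≤ F.totalDegree := fun m hm => by
    rw [MvPolynomial.mem_support_iff, coeff_pderiv] at hm
    have := le_totalDegree (MvPolynomial.mem_support_iff.2 (left_ne_zero_of_mul hm))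
    rw [Finsupp.sum_add_index' (by simp) (by simp)] at this
    rw [Finsupp.sum_single_index rfl] at this
    exact this
  obtain ⟨m, hm⟩ := support_nonempty.2 h
  have h1 := key m hm
  refine lt_of_le_of_lt (b := F.totalDegree - 1) ?_ (by omega)
  refine Finset.sup_le fun m hm => ?_
  have := key m hm
  have h2 : (m.sum fun _ e => e) = m.degree := rfl
  omega

variable {k K : Type*} [Field k] [Field K] [Algebra k K]

/-- Over a perfect field, a relation of minimal degree has a nonzero partial derivative. -/
theorem exists_pderiv_ne_zero [PerfectField k] {σ : Type*} {a : σ → K} {F : MvPolynomial σ k}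
    (hmin : ∀ F' : MvPolynomial σ k, F' ≠ 0 → aeval a F' = 0 → F.totalDegree ≤ F'.totalDegree)
    (hF0 : F ≠ 0) (hF : aeval a F = 0) : ∃ i, pderiv i F ≠ 0 := by
  suffices ∃ i, ∃ m ∈ F.support, ((m i : ℕ) : k) ≠ 0 by
    obtain ⟨i, m, hm, hmi⟩ := this
    refine ⟨i, fun h => ?_⟩
    have h1 := coeff_pderiv F (m - Finsupp.single i 1) (i := i)
    have hm0 : m i ≠ 0 := fun h => hmi (by rw [h, Nat.cast_zero])
    rw [h, coeff_zero, tsub_add_cancel_of_le (by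
      rw [Finsupp.single_le_iff]; omega)] at h1
    have h2 : (((m - Finsupp.single i 1 : σ →₀ ℕ) i : ℕ) : k) + 1 = (m i : k) := by
      rw [Finsupp.tsub_apply, Finsupp.single_eq_same]
      exact_mod_cast congrArg (Nat.cast (R := k)) (show m i - 1 + 1 = m i by omega)
    rw [h2] at h1
    exact mul_ne_zero (MvPolynomial.mem_support_iff.1 hm) hmi h1.symm
  classical
  rcases CharP.exists' k with h0 | ⟨p, hp, hpk⟩
  · by_contra! h
    have : F = C (F.coeff 0) := by
      ext m
      rw [coeff_C]
      split_ifs with hm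
      · rw [hm]
      · by_contra hne
        refine hm ?_
        ext i
        have := h i m (MvPolynomial.mem_support_iff.2 hne)
        exact_mod_cast this.symm
    rw [this, aeval_C, map_eq_zero] at hF
    exact hF0 (by rw [this, hF, C_0])
  · have : ExpChar k p := .prime hp.out
    have : CharP K p := .of_ringHom_of_ne_zero (algebraMap k K) p hp.out.ne_zero
    -- As `k` is perfect, linear independence over `k` passes to `p`-th powers. A relation of
    -- minimal degree therefore cannot have all its exponents divisible by `p`.
    obtain ⟨i, m, hm, hmi⟩ := exists_mem_support_not_dvd_of_forall_totalDegree_le p hp.out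
      (fun s hs => by
        apply hs.map_of_injective_injective (frobeniusEquiv k p).symm (frobenius K p).toAddMonoidHom
        · simp
        · simp [frobenius]
        · intro r x
          change (_ • x) ^ p = r • x ^ p
          rw [Algebra.smul_def, Algebra.smul_def, mul_pow, ← map_pow,
            frobeniusEquiv_symm_pow_p])
      hmin hF0 hF
    exact ⟨i, m, hm, fun h => hmi ((CharP.cast_eq_zero_iff k p _).1 h)⟩

end Relation

variable {k K : Type*} [Field k] [Field K] [Algebra k K] [hK : Fact (IsFunctionFieldOfCurve k K)]

open IntermediateField.algebraAdjoinAdjoin in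
variable (k K) in
theorem trdeg_eq_one : Algebra.trdeg k K = 1 := by
  obtain ⟨x, hx, hfin⟩ := hK.out
  have hx' : AlgebraicIndependent k (fun _ : Unit => x) :=
    algebraicIndependent_unique_type_iff.2 hx
  have hbx : IsTranscendenceBasis k (fun _ : Unit => x) := by
    rw [isTranscendenceBasis_iff_algebraicIndependent_isAlgebraic]
    refine ⟨hx', ?_⟩
    rw [Set.range_const]
    exact (IsFractionRing.comap_isAlgebraic_iff (A := Algebra.adjoin k {x})
      (K := IntermediateField.adjoin k {x}) (C := K)).2 inferInstance
  have := hbx.lift_cardinalMk_eq_trdeg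
  simpa using this.symm

variable (k) in
theorem exists_relation (f g : K) : ∃ F : MvPolynomial (Fin 2) k, F ≠ 0 ∧
    MvPolynomial.aeval ![f, g] F = 0 := by
  by_contra! h
  have hind : AlgebraicIndependent k ![f, g] := by
    rw [algebraicIndependent_iff]
    intro F hF
    by_contra h0
    exact h F h0 hF
  have := hind.lift_cardinalMk_le_trdeg
  rw [trdeg_eq_one] at this
  simp at this

-- If all derivations were zero, `K` would be unramified and hence separable algebraic over `k`.
variable (k K) in
theorem exists_derivation_ne_zero : ∃ D : Derivation k K K, D ≠ 0 := by
  obtain ⟨x, hx, hfin⟩ := hK.out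
  have e1 : Algebra.EssFiniteType k (IntermediateField.adjoin k {x}) :=
    IntermediateField.essFiniteType_iff.2 ⟨{x}, by simp⟩
  have e2 : Algebra.EssFiniteType k K :=
    Algebra.EssFiniteType.comp k (IntermediateField.adjoin k {x}) K
  have hnt : Nontrivial (Ω[K⁄k]) := by
    by_contra hsub
    rw [not_nontrivial_iff_subsingleton] at hsub
    have h1 : Algebra.FormallyUnramified k K := ⟨hsub⟩
    have h2 := Algebra.FormallyUnramified.isSeparable k K
    exact hx (Algebra.IsSeparable.isSeparable k x).isIntegral.isAlgebraic
  obtain ⟨φ, hφ⟩ := exists_ne (0 : Dual K (Ω[K⁄k]))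
  exact ⟨KaehlerDifferential.linearMapEquivDerivation k K φ, by simpa using hφ⟩

variable [IsAlgClosed k] (P : Place k K)

namespace Place

theorem aeval_mem_ring {σ : Type*} {a : σ → K} (ha : ∀ i, a i ∈ P.ring) (F : MvPolynomial σ k) :
    MvPolynomial.aeval a F ∈ P.ring := by
  induction F using MvPolynomial.induction_on with
  | C c => rw [MvPolynomial.aeval_C]; exact P.algebraMap_mem c
  | add F G hF hG => rw [map_add]; exact add_mem hF hG
  | mul_X F j hF => rw [map_mul, MvPolynomial.aeval_X]; exact mul_mem hF (ha j)

theorem aeval_sub_mem_fil {σ : Type*} {a b : σ → K} (ha : ∀ i, a i ∈ P.ring)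
    (hb : ∀ i, b i ∈ P.ring) {m : ℤ} (h : ∀ i, a i - b i ∈ P.fil m) (F : MvPolynomial σ k) :
    MvPolynomial.aeval a F - MvPolynomial.aeval b F ∈ P.fil m := by
  induction F using MvPolynomial.induction_on with
  | C c => simp
  | add F G hF hG => rw [map_add, map_add, add_sub_add_comm]; exact add_mem hF hG
  | mul_X F j hF =>
    have h1 := P.mul_mem_fil (P.mem_fil_zero.2 (P.aeval_mem_ring ha F)) (h j)
    have h2 := P.mul_mem_fil hF (P.mem_fil_zero.2 (hb j))
    rw [zero_add] at h1
    rw [add_zero] at h2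
    have := add_mem h1 h2
    rw [map_mul, map_mul, MvPolynomial.aeval_X, MvPolynomial.aeval_X]
    convert this using 1
    ring

theorem polynomial_aeval_mem_ring {f : K} (hf : f ∈ P.ring) (q : Polynomial k) :
    Polynomial.aeval f q ∈ P.ring := by
  induction q using Polynomial.induction_on' with
  | add q r hq hr => rw [map_add]; exact add_mem hq hr
  | monomial n c => rw [Polynomial.aeval_monomial]; exact mul_mem (P.algebraMap_mem c) (pow_mem hf n)

theorem exists_polynomial_sub_mem {f : K} (hf : f ∈ P.ring) (m : ℕ) :
    ∃ q : Polynomial k, f - Polynomial.aeval P.unif q ∈ P.fil m := by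
  induction m generalizing f with
  | zero => exact ⟨0, by simpa [P.mem_fil_zero] using hf⟩
  | succ m ih =>
    obtain ⟨f₁, hf₁, h⟩ : ∃ f₁ ∈ P.ring, f = algebraMap k K (P.res f) + P.unif * f₁ := by
      refine ⟨P.unif⁻¹ * (f - algebraMap k K (P.res f)), ?_, ?_⟩
      · rw [← P.mem_fil_zero, ← zpow_neg_one, P.unif_zpow_mul_mem_fil_iff]
        simpa using P.sub_res_mem hf
      · rw [mul_inv_cancel_left₀ P.unif_ne_zero]; ring
    obtain ⟨q, hq⟩ := ih hf₁
    refine ⟨Polynomial.C (P.res f) + Polynomial.X * q, ?_⟩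
    have := P.mul_mem_fil P.unif_mem_fil hq
    rw [map_add, map_mul, Polynomial.aeval_C, Polynomial.aeval_X]
    nth_rw 1 [h]
    rw [add_sub_add_left_eq_sub, ← mul_sub]
    convert this using 2
    push_cast; ring

theorem X_pow_dvd_of_aeval_mem {q : Polynomial k} {m : ℕ}
    (h : Polynomial.aeval P.unif q ∈ P.fil m) : Polynomial.X ^ m ∣ q := by
  induction m generalizing q with
  | zero => simp
  | succ m ih =>
    have hq := Polynomial.divX_mul_X_add q
    have h1 : Polynomial.aeval P.unif q.divX ∈ P.ring := P.polynomial_aeval_mem_ring P.unif_mem_ring _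
    have h2 := P.mul_mem_fil (P.mem_fil_zero.2 h1) P.unif_mem_fil
    have h0 : q.coeff 0 = 0 := by
      refine P.algebraMap_mem_fil_one ?_
      have h3 := sub_mem (P.fil_anti (by push_cast; omega) h : _ ∈ P.fil (0 + 1)) h2
      have e := congrArg (Polynomial.aeval P.unif) hq
      rw [map_add, map_mul, Polynomial.aeval_X, Polynomial.aeval_C] at e
      rw [← e, add_sub_cancel_left] at h3
      simpa using h3
    rw [h0, map_zero, add_zero] at hq
    rw [← hq, pow_succ]
    refine mul_dvd_mul_right (ih ?_) _
    rw [← hq, map_mul, Polynomial.aeval_X, mul_comm, P.mul_mem_fil_iff P.unif_ne_zero] at h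
    have h4 := P.ord_unif_zpow 1
    rw [zpow_one] at h4
    rw [h4] at h
    simpa using h

theorem aeval_derivative_mem {q : Polynomial k} {m : ℕ}
    (h : Polynomial.aeval P.unif q ∈ P.fil m) :
    Polynomial.aeval P.unif (Polynomial.derivative q) ∈ P.fil ((m : ℤ) - 1) := by
  obtain ⟨r, rfl⟩ := P.X_pow_dvd_of_aeval_mem h
  rcases m with _ | m
  · exact P.fil_anti (by simp) (P.mem_fil_zero.2 (P.polynomial_aeval_mem_ring P.unif_mem_ring _))
  · have hr := fun r : Polynomial k =>
      P.mem_fil_zero.2 (P.polynomial_aeval_mem_ring P.unif_mem_ring r)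
    have hpow : ∀ n : ℕ, P.unif ^ n ∈ P.fil n := fun n => by
      simpa using P.unif_zpow_mem_fil (n : ℤ)
    have hn : ((m + 1 : ℕ) : K) ∈ P.fil 0 := by
      rw [P.mem_fil_zero]; exact natCast_mem _ _
    have e : Polynomial.aeval P.unif (Polynomial.derivative (Polynomial.X ^ (m + 1) * r)) =
        ((m + 1 : ℕ) : K) * (P.unif ^ m * Polynomial.aeval P.unif r) +
          P.unif ^ (m + 1) * Polynomial.aeval P.unif (Polynomial.derivative r) := by
      simp [Polynomial.derivative_mul]; ring
    rw [e]
    refine add_mem ?_ ?_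
    · simpa using P.mul_mem_fil hn (P.mul_mem_fil (hpow m) (hr r))
    · refine P.fil_anti ?_ (P.mul_mem_fil (hpow (m + 1)) (hr _))
      push_cast; omega

/-- Every regular function has a regular derivative with respect to the uniformizer. -/
theorem exists_derivative {f : K} (hf : f ∈ P.ring) :
    ∃ b ∈ P.ring, ∀ D : Derivation k K K, D f = b * D P.unif := by
  classical
  obtain ⟨F, ⟨hF0, hF⟩, hmin⟩ := WellFounded.has_min
    (measure fun F : MvPolynomial (Fin 2) k => F.totalDegree).wf
    {F | F ≠ 0 ∧ MvPolynomial.aeval ![P.unif, f] F = 0} (exists_relation k P.unif f)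
  have hmin' : ∀ F' : MvPolynomial (Fin 2) k, F' ≠ 0 → MvPolynomial.aeval ![P.unif, f] F' = 0 →
      F.totalDegree ≤ F'.totalDegree := fun F' h0 h => not_lt.1 (hmin F' ⟨h0, h⟩)
  set A := MvPolynomial.aeval ![P.unif, f] (MvPolynomial.pderiv 0 F) with hA
  set B := MvPolynomial.aeval ![P.unif, f] (MvPolynomial.pderiv 1 F) with hB
  have hring : ∀ i, (![P.unif, f] : Fin 2 → K) i ∈ P.ring := fun i => by
    fin_cases i
    · exact P.unif_mem_ring
    · exact hf
  -- Implicit differentiation of the relation, with `f` replaced by a Taylor polynomial `q` in the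
  -- uniformizer: the derivative of a polynomial divisible by the `m`-th power of the variable is
  -- divisible by the power `m - 1`. Here `c` is the value of `q'`.
  have key : ∀ m : ℕ, ∃ c ∈ P.ring, A + B * c ∈ P.fil ((m : ℤ) - 1) := by
    intro m
    obtain ⟨q, hq⟩ := P.exists_polynomial_sub_mem hf m
    have hqr := P.polynomial_aeval_mem_ring P.unif_mem_ring q
    have hring' : ∀ i, (![P.unif, Polynomial.aeval P.unif q] : Fin 2 → K) i ∈ P.ring := fun i => by
      fin_cases i
      · exact P.unif_mem_ring
      · exact hqr
    have hcongr : ∀ G : MvPolynomial (Fin 2) k, MvPolynomial.aeval ![P.unif, f] G -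
        MvPolynomial.aeval ![P.unif, Polynomial.aeval P.unif q] G ∈ P.fil m := fun G =>
      P.aeval_sub_mem_fil hring hring' (fun i => by
        fin_cases i
        · simp
        · exact hq) G
    have hcomp : ∀ G : MvPolynomial (Fin 2) k, Polynomial.aeval P.unif
        (MvPolynomial.aeval ![Polynomial.X, q] G) =
        MvPolynomial.aeval ![P.unif, Polynomial.aeval P.unif q] G := fun G => by
      rw [← AlgHom.comp_apply, MvPolynomial.comp_aeval]
      congr 2
      funext i
      fin_cases i <;> simp
    have h1 := hcongr F
    rw [hF, zero_sub, neg_mem_iff, ← hcomp] at h1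
    have h2 := P.aeval_derivative_mem h1
    have h3 := derivation_aeval (Polynomial.derivative' (R := k)) ![Polynomial.X, q] F
    rw [Fin.sum_univ_two] at h3
    change Polynomial.derivative _ = _ * Polynomial.derivative Polynomial.X +
      _ * Polynomial.derivative q at h3
    rw [h3, Polynomial.derivative_X, mul_one, map_add, map_mul, hcomp, hcomp] at h2
    have hc := P.polynomial_aeval_mem_ring P.unif_mem_ring (Polynomial.derivative q)
    refine ⟨_, hc, ?_⟩
    have h4 := P.fil_anti (by omega : (m : ℤ) - 1 ≤ m) (hcongr (MvPolynomial.pderiv 0 F))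
    have h5 := P.fil_anti (by omega : (m : ℤ) - 1 ≤ m + 0)
      (P.mul_mem_fil (hcongr (MvPolynomial.pderiv 1 F)) (P.mem_fil_zero.2 hc))
    have := add_mem h2 (add_mem h4 h5)
    convert this using 1
    ring
  -- If `B` vanished, `A` would vanish to every order. Both partial derivatives would then be
  -- relations, and the nonzero one has smaller degree than the minimal relation.
  have hB0 : B ≠ 0 := by
    intro hB0
    have hA0 : A = 0 := by
      by_contra hA0
      obtain ⟨c, -, hc⟩ := key ((P.ord A).toNat + 2)
      rw [hB0, zero_mul, add_zero, P.mem_fil_of_ne hA0] at hc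
      push_cast at hc
      omega
    obtain ⟨i, hi⟩ := exists_pderiv_ne_zero hmin' hF0 hF
    have h1 := totalDegree_pderiv_lt hi
    have h2 := hmin' _ hi (by
      fin_cases i
      · exact hA0
      · exact hB0)
    omega
  obtain ⟨c, hc, h⟩ := key ((P.ord B).toNat + 1)
  refine ⟨-(A * B⁻¹), ?_, fun D => ?_⟩
  · have h1 : B⁻¹ * (A + B * c) ∈ P.ring := by
      rw [← P.mem_fil_zero, P.mul_mem_fil_iff (inv_ne_zero hB0), P.ord_inv]
      exact P.fil_anti (by push_cast; omega) h
    have h2 : -(A * B⁻¹) = c - B⁻¹ * (A + B * c) := by field_simp; ring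
    rw [h2]
    exact sub_mem hc h1
  · have h1 := derivation_aeval D ![P.unif, f] F
    rw [hF, map_zero, Fin.sum_univ_two] at h1
    change 0 = A * D P.unif + B * D f at h1
    field_simp
    linear_combination -h1

/-- Regular functions have a derivative with respect to the uniformizer that is regular and the same
for all derivations. Hence a nonzero derivation does not kill the uniformizer, and can be
normalized. -/
theorem exists_derivation : ∃ D : Derivation k K K, D P.unif = 1 ∧ (∀ f ∈ P.ring, D f ∈ P.ring) ∧
    ∀ (D' : Derivation k K K) (f : K), D' f = D' P.unif * D f := by
  obtain ⟨D₀, hD₀⟩ := exists_derivation_ne_zero k K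
  have hmem : ∀ f : K, f ≠ 0 → f ∈ P.ring ∨ f⁻¹ ∈ P.ring := fun f _ => P.ring.mem_or_inv_mem f
  have hext : ∀ D D' : Derivation k K K, (∀ f ∈ P.ring, D f = D' f) → D = D' := by
    intro D D' h
    ext f
    rcases P.ring.mem_or_inv_mem f with hf | hf
    · exact h f hf
    · have := h _ hf
      rw [← inv_inv f, Derivation.leibniz_inv, Derivation.leibniz_inv D', this]
  have h0 : D₀ P.unif ≠ 0 := fun h => hD₀ (hext _ _ fun f hf => by
    obtain ⟨b, -, hb⟩ := P.exists_derivative hf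
    rw [hb, h, mul_zero]; rfl)
  have h1 : ((D₀ P.unif)⁻¹ • D₀) P.unif = 1 := inv_mul_cancel₀ h0
  refine ⟨(D₀ P.unif)⁻¹ • D₀, h1, fun f hf => ?_, fun D' f => ?_⟩
  · obtain ⟨b, hb, h⟩ := P.exists_derivative hf
    rw [h, h1, mul_one]
    exact hb
  · refine DFunLike.congr_fun (hext D' (D' P.unif • (D₀ P.unif)⁻¹ • D₀) fun f hf => ?_) f
    obtain ⟨b, hb, h⟩ := P.exists_derivative hf
    rw [Derivation.smul_apply, h, h ((D₀ P.unif)⁻¹ • D₀), h1, smul_eq_mul]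
    ring

end Place
end Pointing
end

/-! ### Expansions at a place and frames along the embedded curve. -/

noncomputable section
namespace Pointing
open Module
set_option linter.unusedSectionVars false

variable {k K : Type*} [Field k] [Field K] [Algebra k K] [hK : Fact (IsFunctionFieldOfCurve k K)]
variable [IsAlgClosed k]

namespace Place
variable (P : Place k K)

/-- The second term of the expansion of a regular function in the uniformizer. -/
def tail (f : K) : K := P.unif⁻¹ * (f - algebraMap k K (P.res f))

theorem tail_mem_ring {f : K} (hf : f ∈ P.ring) : P.tail f ∈ P.ring := by
  rw [tail, ← P.mem_fil_zero, ← zpow_neg_one, P.unif_zpow_mul_mem_fil_iff]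
  simpa using P.sub_res_mem hf

theorem res_add_unif_mul_tail (f : K) : algebraMap k K (P.res f) + P.unif * P.tail f = f := by
  rw [tail, mul_inv_cancel_left₀ P.unif_ne_zero]; ring

theorem smul_mem_ring {f : K} (c : k) (hf : f ∈ P.ring) : c • f ∈ P.ring := by
  rw [← P.mem_fil_zero]; exact P.smul_mem_fil c (P.mem_fil_zero.2 hf)

theorem res_linearCombination {ι : Type*} [Fintype ι] {f : ι → K} (hf : ∀ i, f i ∈ P.ring)
    (c : ι → k) : P.res (∑ i, c i • f i) = ∑ i, c i * P.res (f i) := by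
  rw [P.res_sum _ _ fun i _ => P.smul_mem_ring _ (hf i)]
  exact Finset.sum_congr rfl fun i _ => P.res_smul _ (hf i)

theorem tail_linearCombination {ι : Type*} [Fintype ι] {f : ι → K} (hf : ∀ i, f i ∈ P.ring)
    (c : ι → k) : P.tail (∑ i, c i • f i) = ∑ i, c i • P.tail (f i) := by
  rw [tail, P.res_linearCombination hf, map_sum, ← Finset.sum_sub_distrib, Finset.mul_sum]
  refine Finset.sum_congr rfl fun i _ => ?_
  rw [tail, map_mul, Algebra.smul_def, Algebra.smul_def]
  ring

theorem mul_unif_mem_fil_succ {f : K} {m : ℤ} : P.unif * f ∈ P.fil (m + 1) ↔ f ∈ P.fil m := by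
  rw [← zpow_one P.unif, P.unif_zpow_mul_mem_fil_iff, add_sub_cancel_right]

theorem mem_fil_succ_of_tail {f : K} (h : P.res f = 0) {m : ℤ} (ht : P.tail f ∈ P.fil m) :
    f ∈ P.fil (m + 1) := by
  rw [← P.res_add_unif_mul_tail f, h, map_zero, zero_add, P.mul_unif_mem_fil_succ]
  exact ht

variable {P} {D : Derivation k K K}

theorem derivation_eq_tail (hD : D P.unif = 1) (f : K) :
    D f = P.tail f + P.unif * D (P.tail f) := by
  conv_lhs => rw [← P.res_add_unif_mul_tail f]
  rw [map_add, Derivation.map_algebraMap, Derivation.leibniz, hD]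
  simp only [smul_eq_mul]
  ring

/-- Applied to coordinates, this shows that the direction towards the point under `P` itself
vanishes doubly at `P` modulo the tangent line. It is the source of the twist by `2 p j`. -/
theorem sub_unif_mul_derivation (hD : D P.unif = 1) (f : K) :
    f - P.unif * D f = algebraMap k K (P.res f) - P.unif ^ 2 * D (P.tail f) := by
  linear_combination -P.unif * derivation_eq_tail hD f - P.res_add_unif_mul_tail f

theorem mem_fil_two_of_derivation (hD : D P.unif = 1) (hDr : ∀ f ∈ P.ring, D f ∈ P.ring) {f : K}
    (hf : f ∈ P.ring) (h0 : P.res f = 0) (h1 : P.res (D f) = 0) : f ∈ P.fil 2 := by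
  rw [P.res_eq_zero_iff (hDr f hf), derivation_eq_tail hD] at h1
  have h2 := P.mul_mem_fil P.unif_mem_fil (P.mem_fil_zero.2 (hDr _ (P.tail_mem_ring hf)))
  rw [add_zero] at h2
  have h3 := sub_mem h1 h2
  rw [add_sub_cancel_right] at h3
  exact P.mem_fil_succ_of_tail h0 h3

/-- The derivative of `tail f` gives the quadratic Taylor coefficient itself, whereas the second
derivative of `f` would give twice this coefficient and be useless in characteristic two. -/
theorem mem_fil_three_of_derivation (hD : D P.unif = 1) (hDr : ∀ f ∈ P.ring, D f ∈ P.ring) {f : K}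
    (hf : f ∈ P.ring) (h0 : P.res f = 0) (h1 : P.res (D f) = 0) (h2 : P.res (D (P.tail f)) = 0) :
    f ∈ P.fil 3 := by
  have h3 := mem_fil_two_of_derivation hD hDr hf h0 h1
  have ht : P.tail f ∈ P.fil 1 := by
    rw [← P.mul_unif_mem_fil_succ]
    have := P.res_add_unif_mul_tail f
    rw [h0, map_zero, zero_add] at this
    rwa [this]
  exact P.mem_fil_succ_of_tail h0 (mem_fil_two_of_derivation hD hDr (P.tail_mem_ring hf)
    ((P.res_eq_zero_iff (P.tail_mem_ring hf)).2 ht) h2)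

/-- Vectors of regular functions with independent reductions: a combination of them is regular
only if its coefficients are. -/
theorem mem_ring_of_combination {S ι : Type*} [Fintype S] [DecidableEq S] [Fintype ι]
    {U : S → ι → K} (hU : ∀ s i, U s i ∈ P.ring)
    (hdual : ∀ s, ∃ ℓ : ι → k, ∀ s', ∑ i, ℓ i * P.res (U s' i) = if s' = s then 1 else 0)
    {a : S → K} (ha : ∀ i, ∑ s, a s * U s i ∈ P.ring) (s : S) : a s ∈ P.ring := by
  -- The dual constant forms recover each coefficient up to terms with one pole less, so the pole
  -- order bound goes down one by one.
  have step : ∀ (m : ℕ) (a : S → K), (∀ i, ∑ s, a s * U s i ∈ P.ring) →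
      (∀ s, a s ∈ P.fil (-((m : ℤ) + 1))) → ∀ s, a s ∈ P.fil (-(m : ℤ)) := by
    intro m a ha hm s
    obtain ⟨ℓ, hℓ⟩ := hdual s
    have hring : ∀ s', ∑ i, ℓ i • U s' i ∈ P.ring := fun s' =>
      sum_mem fun i _ => P.smul_mem_ring _ (hU s' i)
    have h1 : ∑ s', a s' * ∑ i, ℓ i • U s' i ∈ P.ring := by
      have e : ∑ s', a s' * ∑ i, ℓ i • U s' i = ∑ i, ℓ i • ∑ s', a s' * U s' i := by
        simp only [Finset.mul_sum, Finset.smul_sum]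
        rw [Finset.sum_comm]
        exact Finset.sum_congr rfl fun i _ => Finset.sum_congr rfl fun s' _ => mul_smul_comm _ _ _
      rw [e]
      exact sum_mem fun i _ => P.smul_mem_ring _ (ha i)
    have h2 : ∑ s', a s' * (∑ i, ℓ i • U s' i - algebraMap k K (if s' = s then 1 else 0)) ∈
        P.fil (-(m : ℤ)) := by
      refine sum_mem fun s' _ => ?_
      have h3 := P.sub_res_mem (hring s')
      rw [P.res_linearCombination (hU s'), hℓ] at h3
      have := P.mul_mem_fil (hm s') h3
      rwa [neg_add, neg_add_cancel_right] at this
    have h3 := sub_mem (P.fil_anti (by omega : -(m : ℤ) ≤ 0) (P.mem_fil_zero.2 h1)) h2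
    rw [← Finset.sum_sub_distrib] at h3
    convert h3 using 1
    simp only [mul_sub, sub_sub_cancel]
    rw [Finset.sum_eq_single s (by intro b _ hb; simp [hb]) (by simp)]
    simp
  obtain ⟨m, hm⟩ : ∃ m : ℕ, ∀ s, a s ∈ P.fil (-(m : ℤ)) := by
    refine ⟨∑ s, (-P.ord (a s)).toNat, fun s => ?_⟩
    rw [P.mem_fil_iff]
    right
    have := Finset.single_le_sum (f := fun s => (-P.ord (a s)).toNat) (fun _ _ => Nat.zero_le _)
      (Finset.mem_univ s)
    have h2 := Int.self_le_toNat (-P.ord (a s))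
    have h3 : ((-P.ord (a s)).toNat : ℤ) ≤ ((∑ s, (-P.ord (a s)).toNat : ℕ) : ℤ) := by
      exact_mod_cast this
    omega
  induction m with
  | zero => simpa [P.mem_fil_zero] using hm s
  | succ m ih => exact ih (step m a ha fun s => by simpa using hm s)

end Place

/-- `γ` is a basis of the Riemann–Roch space of a divisor whose degree is the number of its
members. -/
structure IsEmbedding {g : ℕ} (γ : Fin g → K) (H : Place k K →₀ ℤ) : Prop where
  linearIndependent : LinearIndependent k γ
  span_eq : Submodule.span k (Set.range γ) = rrSpace H
  degree_eq : H.degree = g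

variable {g : ℕ} {γ : Fin g → K} {H : Place k K →₀ ℤ}

/-- The point of the embedded curve under `P`, as a vector. -/
def pointVec (γ : Fin g → K) (H : Place k K →₀ ℤ) (P : Place k K) (i : Fin g) : k :=
  P.lead (-H P) (γ i)

/-- The coordinates of the curve, scaled to be regular at `P`. -/
def scaled (γ : Fin g → K) (H : Place k K →₀ ℤ) (P : Place k K) (i : Fin g) : K :=
  P.unif ^ H P * γ i

namespace IsEmbedding
variable (hγ : IsEmbedding γ H)
include hγ

theorem mem_fil (P : Place k K) (i : Fin g) : γ i ∈ P.fil (-H P) := by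
  have : γ i ∈ rrSpace H := hγ.span_eq ▸ Submodule.subset_span ⟨i, rfl⟩
  exact this P

theorem sum_mem_rrSpace (ℓ : Fin g → k) : ∑ i, ℓ i • γ i ∈ rrSpace H := by
  rw [← hγ.span_eq]
  exact sum_mem fun i _ => Submodule.smul_mem _ _ (Submodule.subset_span ⟨i, rfl⟩)

theorem exists_form {f : K} (hf : f ∈ rrSpace H) : ∃ ℓ : Fin g → k, ∑ i, ℓ i • γ i = f := by
  rw [← hγ.span_eq] at hf
  exact (Submodule.mem_span_range_iff_exists_fun k).1 hf

theorem form_eq_zero {ℓ : Fin g → k} (h : ∑ i, ℓ i • γ i = 0) : ℓ = 0 :=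
  funext (Fintype.linearIndependent_iff.1 hγ.linearIndependent ℓ h)

theorem scaled_mem (P : Place k K) (i : Fin g) : scaled γ H P i ∈ P.ring := by
  rw [scaled, ← P.mem_fil_zero, P.unif_zpow_mul_mem_fil_iff, zero_sub]
  exact hγ.mem_fil P i

omit hγ in
theorem res_scaled (P : Place k K) (i : Fin g) : P.res (scaled γ H P i) = pointVec γ H P i := by
  rw [scaled, pointVec, Place.lead, neg_neg]

theorem dot_pointVec_eq_zero_iff (P : Place k K) (ℓ : Fin g → k) :
    ∑ i, ℓ i * pointVec γ H P i = 0 ↔ ∑ i, ℓ i • γ i ∈ P.fil (-H P + 1) :=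
  (P.sum_smul_mem_fil_iff (hγ.mem_fil P) ℓ).symm

variable [hG : Fact (HasGenus k K 1)] {n : ℕ}

/-- A regular frame at `P`: the points of the curve under `p j` (a second derivative, when
`p j = P`), the point under `P`, and its derivative. -/
def _root_.Pointing.frame (γ : Fin g → K) (H : Place k K →₀ ℤ) (p : Fin n → Place k K)
    (P : Place k K) (D : Derivation k K K) : Fin n ⊕ Fin 2 → Fin g → K :=
  open Classical in
  Sum.elim
    (fun j => if p j = P then fun i => D (P.tail (scaled γ H P i))
      else fun i => algebraMap k K (pointVec γ H (p j) i))
    ![scaled γ H P, fun i => D (scaled γ H P i)]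

/-- Independence of the reductions at `P` means that the points `p j` together with `2 P` impose
independent conditions on hyperplanes. The hyperplanes that satisfy all of them correspond to `ℒ(H -
E)`, of dimension `g - n - 2` by Riemann–Roch, since `n + 3 ≤ g` makes this degree positive. -/
theorem exists_dual_frame {p : Fin n → Place k K} (hp : Function.Injective p) (hng : n + 3 ≤ g)
    {P : Place k K} {D : Derivation k K K} (hD : D P.unif = 1)
    (hDr : ∀ f ∈ P.ring, D f ∈ P.ring) :
    (∀ s i, frame γ H p P D s i ∈ P.ring) ∧ ∀ s, ∃ ℓ : Fin g → k,
      ∀ s', ∑ i, ℓ i * P.res (frame γ H p P D s' i) = if s' = s then 1 else 0 := by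
  classical
  have hring : ∀ s i, frame γ H p P D s i ∈ P.ring := by
    rintro (j | j) i
    · simp only [frame, Sum.elim_inl]
      split_ifs
      · exact hDr _ (P.tail_mem_ring (hγ.scaled_mem P i))
      · exact P.algebraMap_mem _
    · fin_cases j
      · exact hγ.scaled_mem P i
      · exact hDr _ (hγ.scaled_mem P i)
  refine ⟨hring, ?_⟩
  let Φ : (Fin g → k) →ₗ[k] (Fin n ⊕ Fin 2 → k) :=
    LinearMap.pi fun s => Fintype.linearCombination k fun i => P.res (frame γ H p P D s i)
  have hΦ : ∀ ℓ s, Φ ℓ s = ∑ i, ℓ i * P.res (frame γ H p P D s i) := fun ℓ s => by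
    simp [Φ, Fintype.linearCombination_apply]
  -- If `P` is one of the `p j`, its multiplicity is three, which matches the second derivative in
  -- the frame.
  let E : Place k K →₀ ℤ := ∑ j, Finsupp.single (p j) 1 + Finsupp.single P 2
  have hE : (H - E).degree = g - n - 2 := by
    simp only [E, map_sub, map_add, map_sum, Finsupp.degree_single, hγ.degree_eq, Finset.sum_const,
      Finset.card_univ, Fintype.card_fin]
    simp; ring
  have hEapp : ∀ Q, E Q = (if ∃ j, p j = Q then 1 else 0) + if P = Q then 2 else 0 := fun Q => by
    simp only [E, Finsupp.add_apply, Finsupp.finsetSum_apply, Finsupp.single_apply]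
    congr 1
    split_ifs with h
    · obtain ⟨j, rfl⟩ := h
      rw [Finset.sum_eq_single j (fun i _ hij => if_neg fun h => hij (hp h)) (by simp), if_pos rfl]
    · exact Finset.sum_eq_zero fun j _ => if_neg fun h' => h ⟨j, h'⟩
  have hker : ∀ ℓ, Φ ℓ = 0 → ∑ i, ℓ i • γ i ∈ rrSpace (H - E) := by
    intro ℓ hℓ Q
    have h0 : ∀ s, ∑ i, ℓ i * P.res (frame γ H p P D s i) = 0 := fun s => by
      rw [← hΦ, hℓ]; rfl
    rw [Finsupp.sub_apply, hEapp, neg_sub]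
    have hf := hγ.sum_mem_rrSpace ℓ
    set f := ∑ i, ℓ i • γ i with hfdef
    have hsc : ∑ i, ℓ i • scaled γ H P i = P.unif ^ H P * f := by
      rw [hfdef, Finset.mul_sum]
      exact Finset.sum_congr rfl fun i _ => (mul_smul_comm _ _ _).symm
    have hfr : P.unif ^ H P * f ∈ P.ring := by
      rw [← P.mem_fil_zero, P.unif_zpow_mul_mem_fil_iff, zero_sub]; exact hf P
    have e0 : P.res (P.unif ^ H P * f) = 0 := by
      rw [← hsc, P.res_linearCombination (hγ.scaled_mem P)]; exact h0 (.inr 0)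
    have e1 : P.res (D (P.unif ^ H P * f)) = 0 := by
      rw [← hsc, map_sum]
      simp only [Derivation.map_smul]
      rw [P.res_linearCombination fun i => hDr _ (hγ.scaled_mem P i)]
      exact h0 (.inr 1)
    by_cases hPQ : P = Q
    · subst hPQ
      rw [if_pos rfl]
      by_cases hj : ∃ j, p j = P
      · rw [if_pos hj]
        obtain ⟨j, hj⟩ := hj
        have e2 : P.res (D (P.tail (P.unif ^ H P * f))) = 0 := by
          rw [← hsc, P.tail_linearCombination (hγ.scaled_mem P), map_sum]
          simp only [Derivation.map_smul]
          rw [P.res_linearCombination fun i => hDr _ (P.tail_mem_ring (hγ.scaled_mem P i))]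
          have := h0 (.inl j)
          simpa only [frame, Sum.elim_inl, if_pos hj] using this
        have := P.mem_fil_three_of_derivation hD hDr hfr e0 e1 e2
        rwa [P.unif_zpow_mul_mem_fil_iff] at this
      · rw [if_neg hj]
        have := P.mem_fil_two_of_derivation hD hDr hfr e0 e1
        rwa [P.unif_zpow_mul_mem_fil_iff] at this
    · rw [if_neg hPQ]
      by_cases hj : ∃ j, p j = Q
      · rw [if_pos hj]
        obtain ⟨j, rfl⟩ := hj
        have := h0 (.inl j)
        simp only [frame, Sum.elim_inl, if_neg (Ne.symm hPQ), Place.res_algebraMap] at this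
        rw [hγ.dot_pointVec_eq_zero_iff] at this
        convert this using 2
        ring
      · rw [if_neg hj]
        convert hf Q using 2
        ring
  have hsurj : LinearMap.range Φ = ⊤ := by
    have h1 := LinearMap.finrank_range_add_finrank_ker Φ
    have := finiteDimensional_rrSpace (H - E)
    let Ψ : LinearMap.ker Φ →ₗ[k] rrSpace (H - E) :=
      ((Fintype.linearCombination k γ).comp (LinearMap.ker Φ).subtype).codRestrict _ fun ℓ => by
        have := hker ℓ.1 ℓ.2
        simpa [Fintype.linearCombination_apply] using this
    have hΨ : Function.Injective Ψ := by
      rw [injective_iff_map_eq_zero]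
      intro ℓ hℓ
      have := congrArg Subtype.val hℓ
      change Fintype.linearCombination k γ ℓ.1 = 0 at this
      rw [Fintype.linearCombination_apply] at this
      exact Subtype.ext (hγ.form_eq_zero this)
    have h2 := LinearMap.finrank_le_finrank_of_injective hΨ
    have h3 := finrank_rrSpace (D := H - E) (by rw [hE]; omega)
    apply Submodule.eq_top_of_finrank_eq
    refine le_antisymm (Submodule.finrank_le _) ?_
    rw [Module.finrank_fintype_fun_eq_card] at h1 ⊢
    simp only [Fintype.card_fin, Fintype.card_sum] at h1 ⊢
    omega
  intro s
  obtain ⟨ℓ, hℓ⟩ := LinearMap.range_eq_top.1 hsurj (Pi.single s 1)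
  refine ⟨ℓ, fun s' => ?_⟩
  rw [← hΦ, hℓ, Pi.single_apply]

end IsEmbedding
end Pointing
end

/-! ### The normal bundle and the splitting of the pointing bundle. -/

noncomputable section
namespace Pointing
open Module
set_option linter.unusedSectionVars false

variable {k K : Type*} [Field k] [Field K] [Algebra k K] [hK : Fact (IsFunctionFieldOfCurve k K)]
variable [IsAlgClosed k] {g : ℕ} {γ : Fin g → K} {H : Place k K →₀ ℤ}

/-- The normal vector defined by a vector with constant coordinates. -/
def constNormal (γ : Fin g → K) (v : Fin g → k) : NormalSpace k γ :=
  (genericTangent k γ).mkQ fun i => algebraMap k K (v i)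

variable (k K) in
/-- The inclusion of the vectors with constant coordinates. -/
def constVec (g : ℕ) : (Fin g → k) →ₗ[k] (Fin g → K) where
  toFun v i := algebraMap k K (v i)
  map_add' v w := by funext i; simp
  map_smul' c v := by funext i; simp [Algebra.smul_def]

variable (γ) in
/-- `constNormal` as a `k`-linear map. -/
def constNormalₗ : (Fin g → k) →ₗ[k] NormalSpace k γ :=
  ((genericTangent k γ).mkQ.restrictScalars k).comp (constVec k K g)

theorem constNormalₗ_apply (v : Fin g → k) : constNormalₗ γ v = constNormal γ v := rfl

theorem pointingSpace_span (S : Set (Fin g → k)) :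
    pointingSpace γ (Submodule.span k S) = Submodule.span K (constNormal γ '' S) := by
  have h1 : Submodule.span K ((fun v : Fin g → k => fun i => algebraMap k K (v i)) ''
      (Submodule.span k S : Set (Fin g → k))) = Submodule.span K (constVec k K g '' S) := by
    rw [← Submodule.span_span_of_tower k K (constVec k K g '' S), ← Submodule.map_span,
      Submodule.map_coe]
    rfl
  rw [pointingSpace, h1, Submodule.map_span, Set.image_image]
  rfl

namespace IsEmbedding

/-- Derivations form a line over `K`, and rescaling the coordinates does not change the tangent
space; so it is spanned by vectors that are regular at `P`. -/
theorem mem_genericTangent_iff {P : Place k K} {D : Derivation k K K}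
    (hDu : ∀ (D' : Derivation k K K) (f : K), D' f = D' P.unif * D f) {w : Fin g → K} :
    w ∈ genericTangent k γ ↔ ∃ α β : K, ∀ i, w i = α * scaled γ H P i + β * D (scaled γ H P i) := by
  have hu : P.unif ^ H P ≠ 0 := zpow_ne_zero _ P.unif_ne_zero
  set u := P.unif ^ H P with hudef
  have hDs : ∀ i, D (scaled γ H P i) = u * D (γ i) + γ i * D u := fun i => by
    rw [scaled, Derivation.leibniz]; rfl
  have hspan : genericTangent k γ =
      Submodule.span K {scaled γ H P, fun i => D (scaled γ H P i)} := by
    apply le_antisymm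
    · rw [genericTangent, Submodule.span_le, Set.union_subset_iff]
      constructor
      · rintro _ rfl
        refine Submodule.mem_span_pair.2 ⟨u⁻¹, 0, ?_⟩
        funext i
        simp only [Pi.add_apply, Pi.smul_apply, smul_eq_mul, zero_mul, add_zero, scaled]
        rw [← hudef, inv_mul_cancel_left₀ hu]
      · rintro _ ⟨D', rfl⟩
        refine Submodule.mem_span_pair.2 ⟨-(D' P.unif * D u * u⁻¹ * u⁻¹), D' P.unif * u⁻¹, ?_⟩
        funext i
        simp only [Pi.add_apply, Pi.smul_apply, smul_eq_mul, hDs]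
        rw [hDu D' (γ i), scaled, ← hudef]
        field_simp
        ring
    · rw [Submodule.span_le]
      have h1 : γ ∈ genericTangent k γ := Submodule.subset_span (Or.inl rfl)
      have h2 : (fun i => D (γ i)) ∈ genericTangent k γ := Submodule.subset_span (Or.inr ⟨D, rfl⟩)
      rintro _ (rfl | rfl)
      · exact Submodule.smul_mem _ u h1
      · have := add_mem (Submodule.smul_mem _ u h2) (Submodule.smul_mem _ (D u) h1)
        have e : (fun i => D (scaled γ H P i)) = u • (fun i => D (γ i)) + D u • γ := by
          funext i
          rw [hDs]
          simp [mul_comm]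
        rw [← e] at this
        exact this
  rw [hspan, Submodule.mem_span_pair]
  refine exists₂_congr fun α β => ⟨fun h i => ?_, fun h => funext fun i => ?_⟩
  · rw [← h]; simp
  · rw [h]; simp

variable (hγ : IsEmbedding γ H)
include hγ

theorem pointVec_ne_zero [hG : Fact (HasGenus k K 1)] (hg : 2 ≤ g) (P : Place k K) :
    pointVec γ H P ≠ 0 := by
  classical
  intro h0
  have h1 : ∀ i, γ i ∈ rrSpace (H - Finsupp.single P 1) := fun i => by
    rw [mem_rrSpace_sub_single]
    exact ⟨hγ.span_eq ▸ Submodule.subset_span ⟨i, rfl⟩,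
      (P.lead_eq_zero_iff (hγ.mem_fil P i)).1 (congrFun h0 i)⟩
  have h2 : rrSpace H ≤ rrSpace (H - Finsupp.single P 1) := by
    rw [← hγ.span_eq, Submodule.span_le]
    rintro _ ⟨i, rfl⟩
    exact h1 i
  have := finiteDimensional_rrSpace (H - Finsupp.single P 1)
  have h3 := Submodule.finrank_mono h2
  have h4 := finrank_rrSpace (D := H) (by rw [hγ.degree_eq]; omega)
  have h5 := finrank_rrSpace (D := H - Finsupp.single P 1) (by
    rw [map_sub, Finsupp.degree_single, hγ.degree_eq]; omega)
  rw [map_sub, Finsupp.degree_single] at h5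
  omega

theorem scaled_smul_mem_iff [hG : Fact (HasGenus k K 1)] (hg : 2 ≤ g) {P : Place k K} {a : K} :
    (∀ i, a * γ i ∈ P.ring) ↔ a ∈ P.fil (H P) := by
  constructor
  · intro h
    obtain ⟨i, hi⟩ : ∃ i, pointVec γ H P i ≠ 0 := by
      by_contra! h
      exact hγ.pointVec_ne_zero hg P (funext h)
    have hγi : γ i ≠ 0 := by
      rintro h0
      exact hi (by rw [pointVec, h0, Place.lead, mul_zero, Place.res_zero])
    have h1 : P.ord (γ i) = -H P := by
      have h2 := (P.mem_fil_of_ne hγi).1 (hγ.mem_fil P i)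
      have h3 : ¬ _ := fun h => hi ((P.lead_eq_zero_iff (hγ.mem_fil P i)).2 h)
      rw [P.mem_fil_of_ne hγi] at h3
      omega
    have := h i
    rw [mul_comm, ← P.mem_fil_zero, P.mul_mem_fil_iff hγi, h1] at this
    simpa using this
  · intro h i
    rw [← P.mem_fil_zero]
    simpa using P.mul_mem_fil h (hγ.mem_fil P i)

/-- The power of the uniformizer generates the coefficients that make the coordinates regular. The
tangent coefficients may have poles, because only the class modulo the tangent space matters. -/
theorem mkQ_mem_normalBundle_iff [hG : Fact (HasGenus k K 1)] (hg : 2 ≤ g) {P : Place k K}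
    {D : Derivation k K K} (hDu : ∀ (D' : Derivation k K K) (f : K), D' f = D' P.unif * D f)
    {w : Fin g → K} :
    (genericTangent k γ).mkQ w ∈ (normalBundle γ).stalk P ↔ ∃ α β : K, ∀ i,
      P.unif ^ H P * w i + α * scaled γ H P i + β * D (scaled γ H P i) ∈ P.ring := by
  have hspan : ∀ c : Fin g → P.ring, ∑ i, c i • (genericTangent k γ).mkQ (Pi.single i 1) =
      (genericTangent k γ).mkQ fun i => (c i : K) := fun c => by
    have : ∀ i, c i • (genericTangent k γ).mkQ (Pi.single i 1) =
        (genericTangent k γ).mkQ (Pi.single i (c i : K)) := fun i => by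
      change (c i : K) • (genericTangent k γ).mkQ (Pi.single i 1) = _
      rw [← map_smul, ← Pi.single_smul, smul_eq_mul, mul_one]
    simp only [this]
    rw [← map_sum, Finset.univ_sum_single]
  constructor
  · intro h
    have h1 := h (P.unif ^ H P) ((hγ.scaled_smul_mem_iff hg).2 (P.unif_zpow_mem_fil _))
    obtain ⟨c, hc⟩ := (Submodule.mem_span_range_iff_exists_fun _).1 h1
    rw [hspan, ← map_smul, ← sub_eq_zero, ← map_sub, Submodule.mkQ_apply,
      Submodule.Quotient.mk_eq_zero, mem_genericTangent_iff (H := H) hDu] at hc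
    obtain ⟨α, β, h⟩ := hc
    refine ⟨α, β, fun i => ?_⟩
    have := h i
    simp only [Pi.sub_apply, Pi.smul_apply, smul_eq_mul] at this
    rw [add_assoc, ← this, add_sub_cancel]
    exact (c i).2
  · rintro ⟨α, β, h⟩ a ha
    rw [hγ.scaled_smul_mem_iff hg] at ha
    have hb : P.unif ^ (-H P) * a ∈ P.ring := P.unif_zpow_neg_mul_mem_ring ha
    refine (Submodule.mem_span_range_iff_exists_fun _).2
      ⟨fun i => ⟨_, mul_mem hb (h i)⟩, ?_⟩
    rw [hspan, ← map_smul, ← sub_eq_zero, ← map_sub, Submodule.mkQ_apply,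
      Submodule.Quotient.mk_eq_zero, mem_genericTangent_iff (H := H) hDu]
    refine ⟨P.unif ^ (-H P) * a * α, P.unif ^ (-H P) * a * β, fun i => ?_⟩
    simp only [Pi.sub_apply, Pi.smul_apply, smul_eq_mul]
    have hu : P.unif ^ (-H P) * P.unif ^ H P = 1 := by
      rw [← zpow_add₀ P.unif_ne_zero, neg_add_cancel, zpow_zero]
    linear_combination a * w i * hu

variable [hG : Fact (HasGenus k K 1)] {n : ℕ} {p : Fin n → Place k K}

/-- The local form of the splitting into the line bundles `𝒪(H + 2 p j)`. The constant vector
towards `p j` belongs to the regular frame at `P` when `p j ≠ P`; when `p j = P`, it is modulo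
tangent vectors the square of the uniformizer times a frame vector
(`Place.sub_unif_mul_derivation`). Independence of the reductions of the frame then shows that
regularity holds coefficient by coefficient. -/
theorem sum_constNormal_mem_iff (hp : Function.Injective p) (hng : n + 3 ≤ g) {P : Place k K}
    {v : Fin n → K} :
    ∑ j, v j • constNormal γ (pointVec γ H (p j)) ∈ (normalBundle γ).stalk P ↔
      ∀ j, v j ∈ P.fil (-(H + Finsupp.single (p j) 2 : Place k K →₀ ℤ) P) := by
  classical
  obtain ⟨D, hD, hDr, hDu⟩ := P.exists_derivation
  obtain ⟨hring, hdual⟩ := hγ.exists_dual_frame hp hng hD hDr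
  have hw : ∑ j, v j • constNormal γ (pointVec γ H (p j)) =
      (genericTangent k γ).mkQ fun i => ∑ j, v j * algebraMap k K (pointVec γ H (p j) i) := by
    simp only [constNormal, ← map_smul, ← map_sum]
    congr 1
    funext i
    simp
  rw [hw, hγ.mkQ_mem_normalBundle_iff (by omega) hDu]
  obtain ⟨c, d, d', hcoef, hc⟩ : ∃ c d d' : Fin n → K, (∀ j i, algebraMap k K (pointVec γ H (p j) i) =
      c j * frame γ H p P D (.inl j) i + d j * scaled γ H P i + d' j * D (scaled γ H P i)) ∧
      ∀ j, P.unif ^ H P * v j * c j ∈ P.ring ↔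
        v j ∈ P.fil (-(H + Finsupp.single (p j) 2 : Place k K →₀ ℤ) P) := by
    refine ⟨fun j => if p j = P then P.unif ^ (2 : ℤ) else 1, fun j => if p j = P then 1 else 0,
      fun j => if p j = P then -P.unif else 0, fun j i => ?_, fun j => ?_⟩
    · by_cases hj : p j = P
      · simp only [if_pos hj, frame, Sum.elim_inl]
        have := P.sub_unif_mul_derivation hD (scaled γ H P i)
        rw [res_scaled] at this
        rw [hj, zpow_ofNat]
        linear_combination -this
      · simp only [if_neg hj, frame, Sum.elim_inl]
        ring
    · rw [← P.mem_fil_zero, Finsupp.add_apply]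
      dsimp only
      by_cases hj : p j = P
      · rw [if_pos hj, hj, Finsupp.single_eq_same, mul_right_comm, ← zpow_add₀ P.unif_ne_zero,
          P.unif_zpow_mul_mem_fil_iff, zero_sub]
      · rw [if_neg hj, Finsupp.single_eq_of_ne (by exact Ne.symm hj), mul_one,
          P.unif_zpow_mul_mem_fil_iff, zero_sub, add_zero]
  simp only [← hc]
  have hexp : ∀ (α β : K) i, P.unif ^ H P * ∑ j, v j * algebraMap k K (pointVec γ H (p j) i) +
      α * scaled γ H P i + β * D (scaled γ H P i) =
      ∑ j, P.unif ^ H P * v j * c j * frame γ H p P D (.inl j) i +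
        ((α + ∑ j, P.unif ^ H P * v j * d j) * scaled γ H P i +
        (β + ∑ j, P.unif ^ H P * v j * d' j) * D (scaled γ H P i)) := by
    intro α β i
    have : P.unif ^ H P * ∑ j, v j * algebraMap k K (pointVec γ H (p j) i) =
        ∑ j, P.unif ^ H P * v j * c j * frame γ H p P D (.inl j) i +
        (∑ j, P.unif ^ H P * v j * d j) * scaled γ H P i +
        (∑ j, P.unif ^ H P * v j * d' j) * D (scaled γ H P i) := by
      rw [Finset.mul_sum, Finset.sum_mul, Finset.sum_mul, ← Finset.sum_add_distrib,
        ← Finset.sum_add_distrib]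
      refine Finset.sum_congr rfl fun j _ => ?_
      rw [hcoef]
      ring
    rw [this]
    ring
  constructor
  · rintro ⟨α, β, h⟩ j
    refine P.mem_ring_of_combination hring hdual (a := Sum.elim (fun j => P.unif ^ H P * v j * c j)
      ![α + ∑ j, P.unif ^ H P * v j * d j, β + ∑ j, P.unif ^ H P * v j * d' j]) (fun i => ?_) (.inl j)
    have := h i
    rw [hexp] at this
    rw [Fintype.sum_sum_type, Fin.sum_univ_two]
    exact this
  · intro h
    refine ⟨-∑ j, P.unif ^ H P * v j * d j, -∑ j, P.unif ^ H P * v j * d' j, fun i => ?_⟩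
    rw [hexp, neg_add_cancel, neg_add_cancel, zero_mul, zero_mul, add_zero, add_zero]
    exact sum_mem fun j _ => mul_mem (h j) (hring _ _)

/-- A relation stays one after multiplication by any negative power of the uniformizer, so by the
splitting its coefficients vanish to every order. -/
theorem linearIndependent_constNormal (hp : Function.Injective p) (hng : n + 3 ≤ g) :
    LinearIndependent K fun j => constNormal γ (pointVec γ H (p j)) := by
  rw [Fintype.linearIndependent_iff]
  intro v hv j
  obtain ⟨P⟩ : Nonempty (Place k K) := (Place.infinite k K).nonempty
  by_contra h0
  have key : ∀ N : ℤ, P.unif ^ N * v j ∈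
      P.fil (-(H + Finsupp.single (p j) 2 : Place k K →₀ ℤ) P) := fun N => by
    refine (hγ.sum_constNormal_mem_iff hp hng (P := P) (v := fun j => P.unif ^ N * v j)).1 ?_ j
    simp only [mul_smul]
    rw [← Finset.smul_sum, hv, smul_zero]
    exact zero_mem _
  have := key (-(H + Finsupp.single (p j) 2 : Place k K →₀ ℤ) P - P.ord (v j) - 1)
  rw [P.unif_zpow_mul_mem_fil_iff, P.mem_fil_of_ne h0] at this
  omega

theorem linearIndependent_pointVec (hp : Function.Injective p) (hng : n + 3 ≤ g) :
    LinearIndependent k fun j => pointVec γ H (p j) := by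
  have h1 := (hγ.linearIndependent_constNormal hp hng).restrict_scalars
    (R := k) (by
      intro a b h
      simpa [Algebra.smul_def] using h)
  exact LinearIndependent.of_comp (constNormalₗ γ) h1

theorem pointAt_eq (hg : 2 ≤ g) (P : Place k K) :
    pointAt γ P = Submodule.span k {pointVec γ H P} := by
  ext v
  rw [Submodule.mem_span_singleton]
  constructor
  · rintro ⟨w, hw, h⟩
    obtain ⟨a, rfl⟩ := Submodule.mem_span_singleton.1 hw
    simp only [Pi.smul_apply, smul_eq_mul] at h
    have hmem : ∀ i, a * γ i - algebraMap k K (v i) ∈ P.fil 1 := fun i => P.mem_fil_one.2 (h i)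
    have ha : a ∈ P.fil (H P) := (hγ.scaled_smul_mem_iff hg).1 fun i => by
      have := add_mem (P.fil_anti zero_le_one (hmem i)) (P.algebraMap_mem_fil (v i))
      rwa [sub_add_cancel, P.mem_fil_zero] at this
    refine ⟨P.res (P.unif ^ (-H P) * a), funext fun i => ?_⟩
    have hu : P.unif ^ (-H P) * P.unif ^ H P = 1 := by
      rw [← zpow_add₀ P.unif_ne_zero, neg_add_cancel, zpow_zero]
    rw [Pi.smul_apply, smul_eq_mul, ← res_scaled,
      ← P.res_mul (P.unif_zpow_neg_mul_mem_ring ha) (hγ.scaled_mem P i), scaled]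
    refine P.res_eq_of ?_
    convert hmem i using 1
    linear_combination a * γ i * hu
  · rintro ⟨c, rfl⟩
    refine ⟨algebraMap k K c • scaled γ H P, Submodule.smul_mem _ _ ?_, fun i => ?_⟩
    · exact Submodule.smul_mem _ _ (Submodule.mem_span_singleton_self γ)
    · rw [← P.mem_fil_one, Pi.smul_apply, Pi.smul_apply, smul_eq_mul, smul_eq_mul, map_mul,
        ← mul_sub, ← res_scaled]
      simpa using P.mul_mem_fil (P.algebraMap_mem_fil c) (P.sub_res_mem (hγ.scaled_mem P i))

end IsEmbedding

/-- An embedded curve with a quasi-transverse secant space, and an enumeration of the points of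
intersection. -/
structure IsSecant {n : ℕ} (γ : Fin g → K) (H : Place k K →₀ ℤ) (Λ : Submodule k (Fin g → k))
    (p : Fin n → Place k K) : Prop where
  embedding : IsEmbedding γ H
  le : n + 3 ≤ g
  injective : Function.Injective p
  range_eq : Set.range p = secantPoints γ Λ
  span_eq : Submodule.span k (Set.range fun j => pointVec γ H (p j)) = Λ

theorem IsEllipticNormalCurve.exists_isSecant {n : ℕ} {Λ : Submodule k (Fin g → k)}
    (hE : IsEllipticNormalCurve k γ) (hng : n + 3 ≤ g) (hΛ : IsQuasiTransverseSecant γ n Λ)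
    [hG : Fact (HasGenus k K 1)] :
    ∃ (H : Place k K →₀ ℤ) (p : Fin n → Place k K), IsSecant γ H Λ p := by
  obtain ⟨-, -, L, hL, hdeg, hli, hspan⟩ := hE
  obtain ⟨H, rfl⟩ := hL.exists_div
  rw [deg_lineBundle] at hdeg
  rw [globalSections_lineBundle] at hspan
  have hγ : IsEmbedding γ H := ⟨hli, hspan, hdeg⟩
  have := hΛ.finite.to_subtype
  have hcard : Nat.card (secantPoints γ Λ) = n := hΛ.ncard_eq
  let e := (Finite.equivFinOfCardEq hcard).symm
  have hinj : Function.Injective fun j => (e j : Place k K) :=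
    Subtype.val_injective.comp e.injective
  refine ⟨H, fun j => e j, hγ, hng, hinj, ?_, ?_⟩
  · rw [← Function.comp_def Subtype.val e, Set.range_comp, e.range_eq_univ, Set.image_univ,
      Subtype.range_val]
  · apply Submodule.eq_of_le_of_finrank_eq
    · rw [Submodule.span_le]
      rintro _ ⟨j, rfl⟩
      have : pointAt γ (e j).1 ≤ Λ := (e j).2
      rw [hγ.pointAt_eq (by omega)] at this
      exact this (Submodule.mem_span_singleton_self _)
    · rw [finrank_span_eq_card (hγ.linearIndependent_pointVec hinj hng), Fintype.card_fin,
        hΛ.finrank_eq]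

end Pointing
end

/-! ### Positive modifications in adapted bases. -/

noncomputable section
namespace Pointing
open Module
set_option linter.unusedSectionVars false

variable {k K : Type*} [Field k] [Field K] [Algebra k K] [hK : Fact (IsFunctionFieldOfCurve k K)]
  [IsAlgClosed k]
variable {V : Type*} [AddCommGroup V] [Module K V] {ι : Type*} [Fintype ι] [DecidableEq ι]

namespace Place
variable (P : Place k K)

/-- The basis `b` with the `j`-th vector divided by the `μ j`-th power of the uniformizer. -/
def scaledBasis (b : Basis ι K V) (μ : ι → ℤ) : Basis ι K V :=
  b.unitsSMul fun j => Units.mk0 (P.unif ^ (-μ j)) (zpow_ne_zero _ P.unif_ne_zero)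

theorem scaledBasis_apply (b : Basis ι K V) (μ : ι → ℤ) (j : ι) :
    P.scaledBasis b μ j = P.unif ^ (-μ j) • b j := Basis.unitsSMul_apply _

theorem scaledBasis_zero (b : Basis ι K V) : P.scaledBasis b 0 = b := by
  ext j; rw [scaledBasis_apply, Pi.zero_apply, neg_zero, zpow_zero, one_smul]

theorem mem_lat_scaledBasis {b : Basis ι K V} {μ : ι → ℤ} {v : V} :
    v ∈ P.lat (P.scaledBasis b μ) ↔ ∀ j, b.repr v j ∈ P.fil (-μ j) := by
  rw [P.mem_lat]
  refine forall_congr' fun j => ?_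
  rw [scaledBasis, Basis.repr_unitsSMul, Units.smul_def, Units.val_inv_eq_inv_val, Units.val_mk0,
    ← zpow_neg, neg_neg, ← P.mem_fil_zero, smul_eq_mul, P.unif_zpow_mul_mem_fil_iff, zero_sub]

theorem ord_det_scaledBasis (b c : Basis ι K V) (μ : ι → ℤ) :
    P.ord (b.det (P.scaledBasis c μ)) = P.ord (b.det c) - ∑ j, μ j := by
  rw [← P.ord_det_add b c, scaledBasis, Basis.det_unitsSMul_self]
  have : ∀ s : Finset ι, P.ord (∏ i ∈ s, (P.unif ^ (-μ i))) = - ∑ i ∈ s, μ i := fun s => by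
    rw [← Finset.sum_neg_distrib, ← P.ord_unif_zpow (∑ i ∈ s, -μ i)]
    congr 1
    induction s using Finset.induction_on with
    | empty => simp
    | insert a s ha ih => rw [Finset.prod_insert ha, Finset.sum_insert ha, zpow_add₀ P.unif_ne_zero, ih]
  simp only [Units.val_mk0, this]
  ring

end Place

/-- Replacing one vector of a basis by a combination with constant coefficients. -/
theorem exists_basis_update (e : Basis ι K V) (c : ι → k) {i : ι} (hc : c i ≠ 0) :
    ∃ e' : Basis ι K V, e' i = ∑ j, algebraMap k K (c j) • e j ∧ (∀ j ≠ i, e' j = e j) ∧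
      e.det e' = algebraMap k K (c i) := by
  have hdet : e.det (Function.update e i (∑ j, algebraMap k K (c j) • e j)) =
      algebraMap k K (c i) := by
    rw [AlternatingMap.map_update_sum, Finset.sum_eq_single i]
    · rw [AlternatingMap.map_update_smul, Function.update_eq_self, Basis.det_self, smul_eq_mul,
        mul_one]
    · intro j _ hj
      rw [AlternatingMap.map_update_smul, AlternatingMap.map_update_self _ _ (Ne.symm hj), smul_zero]
    · simp
  have hunit : IsUnit (e.det (Function.update e i (∑ j, algebraMap k K (c j) • e j))) := by
    rw [hdet, isUnit_iff_ne_zero]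
    simpa using hc
  obtain ⟨hli, hsp⟩ := e.is_basis_iff_det.2 hunit
  refine ⟨Basis.mk hli hsp.ge, ?_, fun j hj => ?_, ?_⟩
  · rw [Basis.mk_apply, Function.update_self]
  · rw [Basis.mk_apply, Function.update_of_ne hj]
  · rw [Basis.coe_mk, hdet]

/-- The new vector replaces one for which the allowed pole `μ i` is smallest, so it lies in the
lattice with this pole. As the determinant of the change is a nonzero constant, the lattice is
unchanged. -/
theorem Place.lat_scaledBasis_update (P : Place k K) {e e' : Basis ι K V} {c : ι → k} {i : ι}
    (h1 : e' i = ∑ j, algebraMap k K (c j) • e j) (h2 : ∀ j ≠ i, e' j = e j)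
    (h3 : e.det e' = algebraMap k K (c i)) {μ : ι → ℤ} (hμ : ∀ j, μ i ≤ μ j) :
    P.lat (P.scaledBasis e μ) = P.lat (P.scaledBasis e' μ) := by
  have := Module.Finite.of_basis e
  refine (P.lat_eq_of_le ?_ ?_).symm
  · rw [Place.lat, Submodule.span_le]
    rintro _ ⟨j, rfl⟩
    rw [P.scaledBasis_apply]
    refine P.mem_lat_scaledBasis.2 fun l => ?_
    by_cases hj : j = i
    · rw [hj, h1, map_smul, Finsupp.smul_apply, e.repr_sum_self, smul_eq_mul]
      have := P.mul_mem_fil (P.unif_zpow_mem_fil (-μ i)) (P.algebraMap_mem_fil (c l))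
      exact P.fil_anti (by have := hμ l; omega) this
    · rw [h2 j hj, map_smul, Finsupp.smul_apply, e.repr_self, smul_eq_mul]
      by_cases hl : j = l
      · rw [hl, Finsupp.single_eq_same, mul_one]
        exact P.unif_zpow_mem_fil _
      · rw [Finsupp.single_eq_of_ne (by exact Ne.symm hl), mul_zero]
        exact zero_mem _
  · have h4 := P.ord_det_add (P.scaledBasis e μ) e (P.scaledBasis e' μ)
    have h5 := P.ord_det_add e (P.scaledBasis e μ) e
    have h6 : P.ord (algebraMap k K (c i)) = 0 := P.ord_algebraMap _
    rw [P.ord_det_scaledBasis, P.ord_det_self] at h5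
    rw [P.ord_det_scaledBasis, h3, h6] at h4
    omega

namespace Stalks

theorem negModification_stalk {B : Stalks k K V} {D : Set (Place k K)}
    {F : Place k K → Submodule K V} {P : Place k K} (hP : P ∈ D) {b : Basis ι K V} {μ : ι → ℤ}
    (hB : B.stalk P = P.lat (P.scaledBasis b μ)) {i : ι} (hF : F P = Submodule.span K {b i}) :
    (B.negModification D F).stalk P =
      P.lat (P.scaledBasis b fun j => if j = i then μ i else μ j - 1) := by
  classical
  have hmax : IsLocalRing.maximalIdeal P.ring • P.lat (P.scaledBasis b μ) =
      P.lat (P.scaledBasis b fun j => μ j - 1) := by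
    apply le_antisymm
    · rw [Submodule.smul_le]
      intro m hm v hv
      refine P.mem_lat_scaledBasis.2 fun j => ?_
      have := P.mul_mem_fil ((P.mem_maximalIdeal_iff _).1 hm) (P.mem_lat_scaledBasis.1 hv j)
      change b.repr ((m : K) • v) j ∈ _
      rw [map_smul, Finsupp.smul_apply, smul_eq_mul]
      convert this using 2
      ring
    · intro v hv
      have h1 : P.unif⁻¹ • v ∈ P.lat (P.scaledBasis b μ) := P.mem_lat_scaledBasis.2 fun j => by
        have := P.mem_lat_scaledBasis.1 hv j
        rw [map_smul, Finsupp.smul_apply, smul_eq_mul, ← zpow_neg_one, P.unif_zpow_mul_mem_fil_iff]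
        convert this using 2
        ring
      have h2 := Submodule.smul_mem_smul ((P.mem_maximalIdeal_iff ⟨_, P.unif_mem_ring⟩).2
        P.unif_mem_fil) h1
      change P.unif • P.unif⁻¹ • v ∈ _ at h2
      rwa [smul_inv_smul₀ P.unif_ne_zero] at h2
  rw [negModification]
  dsimp only
  rw [if_pos hP, hB, hmax, hF]
  apply le_antisymm
  · refine sup_le ?_ ?_
    · rintro v ⟨h1, h2⟩
      obtain ⟨a, rfl⟩ := Submodule.mem_span_singleton.1 h1
      refine P.mem_lat_scaledBasis.2 fun j => ?_
      have := P.mem_lat_scaledBasis.1 h2 j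
      split_ifs with hj
      · rwa [hj] at this ⊢
      · rw [map_smul, Finsupp.smul_apply, b.repr_self, Finsupp.single_eq_of_ne (by exact hj),
          smul_zero]
        exact zero_mem _
    · intro v hv
      refine P.mem_lat_scaledBasis.2 fun j => P.fil_anti ?_ (P.mem_lat_scaledBasis.1 hv j)
      split_ifs with hj
      · rw [hj]; omega
      · exact le_rfl
  · intro v hv
    have hv' := P.mem_lat_scaledBasis.1 hv
    rw [← add_sub_cancel (b.repr v i • b i) v]
    refine Submodule.add_mem_sup ⟨Submodule.mem_span_singleton.2 ⟨_, rfl⟩, ?_⟩ ?_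
    · refine P.mem_lat_scaledBasis.2 fun j => ?_
      rw [map_smul, Finsupp.smul_apply, b.repr_self]
      by_cases hj : j = i
      · have := hv' j
        rw [if_pos hj] at this
        rw [hj] at this ⊢
        rw [Finsupp.single_eq_same, smul_eq_mul, mul_one]
        exact this
      · rw [Finsupp.single_eq_of_ne (by exact hj), smul_zero]
        exact zero_mem _
    · refine P.mem_lat_scaledBasis.2 fun j => ?_
      rw [map_sub, Finsupp.sub_apply, map_smul, Finsupp.smul_apply, b.repr_self]
      by_cases hj : j = i
      · rw [hj, Finsupp.single_eq_same, smul_eq_mul, mul_one, sub_self]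
        exact zero_mem _
      · rw [Finsupp.single_eq_of_ne (by exact hj), smul_zero, sub_zero]
        have := hv' j
        rwa [if_neg hj] at this

/-- The negative modification lowers all exponents but the `i`-th, and the twist raises all of them,
so one additional pole is allowed along `b i`. -/
theorem posModification_stalk {B : Stalks k K V} {D : Set (Place k K)}
    {F : Place k K → Submodule K V} {P : Place k K} (hP : P ∈ D) {b : Basis ι K V} {μ : ι → ℤ}
    (hB : B.stalk P = P.lat (P.scaledBasis b μ)) {i : ι} (hF : F P = Submodule.span K {b i}) :
    (B.posModification D F).stalk P = P.lat (P.scaledBasis b (μ + Pi.single i 1)) := by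
  classical
  ext v
  have h0 : v ∈ (B.posModification D F).stalk P ↔ ∀ m ∈ IsLocalRing.maximalIdeal P.ring,
      m • v ∈ (B.negModification D F).stalk P := by
    rw [posModification, twist]
    dsimp only
    rw [if_pos hP]
    rfl
  have h1 : ∀ j, -(μ + Pi.single i 1 : ι → ℤ) j + 1 = -(if j = i then μ i else μ j - 1) :=
    fun j => by
      rw [Pi.add_apply, Pi.single_apply]
      split_ifs with h
      · rw [h]; ring
      · ring
  rw [h0, negModification_stalk hP hB hF, P.mem_lat_scaledBasis]
  constructor
  · intro h j
    have := P.mem_lat_scaledBasis.1 (h ⟨_, P.unif_mem_ring⟩ ((P.mem_maximalIdeal_iff _).2 P.unif_mem_fil)) j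
    change b.repr (P.unif • v) j ∈ _ at this
    rwa [map_smul, Finsupp.smul_apply, smul_eq_mul, ← h1, P.mul_unif_mem_fil_succ] at this
  · intro h m hm
    refine P.mem_lat_scaledBasis.2 fun j => ?_
    change b.repr ((m : K) • v) j ∈ _
    rw [map_smul, Finsupp.smul_apply, smul_eq_mul, ← h1, add_comm]
    exact P.mul_mem_fil ((P.mem_maximalIdeal_iff _).1 hm) (h j)

omit hK [IsAlgClosed k] in
theorem posModification_of_notMem {B : Stalks k K V} {D : Set (Place k K)}
    {F : Place k K → Submodule K V} {P : Place k K} (hP : P ∉ D) :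
    (B.posModification D F).stalk P = B.stalk P := by
  rw [posModification, twist]
  dsimp only
  rw [if_neg hP, negModification]
  dsimp only
  rw [if_neg hP]

end Stalks
end Pointing
end

/-! ### Modifications of a split bundle, their degree and their dual. -/

noncomputable section
namespace Pointing
open Module
set_option linter.unusedSectionVars false

variable {k K : Type*} [Field k] [Field K] [Algebra k K] [hK : Fact (IsFunctionFieldOfCurve k K)]
  [IsAlgClosed k]
variable {V : Type*} [AddCommGroup V] [Module K V] {ι κ : Type*} [Fintype ι] [DecidableEq ι]
  [Fintype κ] [DecidableEq κ]

/-- `X` arises from the direct sum of the line bundles with divisors `H + e j` by positive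
modifications at the points `r l` towards the vectors with constant coordinates `a l`, whose
order of vanishing along the direct sum is that of `H`. -/
structure IsModification (X : Stalks k K V) (b : Basis ι K V) (H : Place k K →₀ ℤ)
    (e : ι → Place k K →₀ ℤ) (r : κ → Place k K) (a : κ → ι → k) : Prop where
  injective : Function.Injective r
  nonneg : ∀ j, 0 ≤ e j
  stalk_eq : ∀ P ∉ Set.range r, X.stalk P = P.lat (P.scaledBasis b fun j => (H + e j) P)
  stalk_eq_of_mem : ∀ l, ∃ (b' : Basis ι K V) (i : ι),
    X.stalk (r l) =
      (r l).lat ((r l).scaledBasis b' ((fun j => (H + e j) (r l)) + Pi.single i 1)) ∧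
    a l i ≠ 0 ∧ b' i = ∑ j, algebraMap k K (a l j) • b j ∧ (∀ j ≠ i, b' j = b j) ∧
    b.det b' = algebraMap k K (a l i) ∧ e i (r l) = 0

namespace IsModification
variable {X : Stalks k K V} {b : Basis ι K V} {H : Place k K →₀ ℤ} {e : ι → Place k K →₀ ℤ}
  {r : κ → Place k K} {a : κ → ι → k} (h : IsModification X b H e r a)
include h

theorem isVectorBundle : X.IsVectorBundle := by
  refine Stalks.isVectorBundle_of b (fun P => ?_) ?_
  · by_cases hP : P ∈ Set.range r
    · obtain ⟨l, rfl⟩ := hP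
      obtain ⟨b', i, h1, -⟩ := h.stalk_eq_of_mem l
      rw [h1]; exact (r l).isLattice_lat _
    · rw [h.stalk_eq P hP]; exact P.isLattice_lat _
  · refine (((Set.finite_iUnion fun j => (H + e j).hasFiniteSupport)).union
      (Set.finite_range r)).subset fun P hP => ?_
    rw [Set.mem_ofPred_eq] at hP
    by_contra hcon
    rw [Set.mem_union, Set.mem_iUnion, not_or] at hcon
    refine hP ((h.stalk_eq P hcon.2).trans ?_)
    have : (fun j => (H + e j) P) = 0 := by
      funext j
      by_contra h0
      exact hcon.1 ⟨j, h0⟩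
    rw [this, P.scaledBasis_zero]

theorem degAt_eq (P : Place k K) : X.degAt b P =
    (∑ j, (H + e j) + ∑ l, Finsupp.single (r l) 1 : Place k K →₀ ℤ) P := by
  rw [Finsupp.add_apply, Finsupp.finsetSum_apply, Finsupp.finsetSum_apply]
  by_cases hP : P ∈ Set.range r
  · obtain ⟨l, rfl⟩ := hP
    obtain ⟨b', i, h1, -, -, -, h2, -⟩ := h.stalk_eq_of_mem l
    have h6 : (r l).ord (algebraMap k K (a l i)) = 0 := (r l).ord_algebraMap _
    rw [Stalks.degAt_eq h1, (r l).ord_det_scaledBasis, h2, h6, Finset.sum_eq_single l]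
    · simp [Finset.sum_add_distrib]
    · intro l' _ hl'
      exact Finsupp.single_eq_of_ne (by exact fun h' => hl' (h.injective h'.symm))
    · simp
  · rw [Stalks.degAt_eq (h.stalk_eq P hP), P.ord_det_scaledBasis, P.ord_det_self]
    rw [Finset.sum_eq_zero (s := Finset.univ) (f := fun l => (Finsupp.single (r l) (1 : ℤ)) P)]
    · simp
    · intro l _
      exact Finsupp.single_eq_of_ne (by exact fun h' => hP ⟨l, h'.symm⟩)

theorem deg_eq [Fact (HasGenus k K 1)] [FiniteDimensional K V] :
    X.deg = Fintype.card ι * H.degree + ∑ j, (e j).degree + Fintype.card κ := by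
  rw [h.isVectorBundle.deg_eq b, finsum_congr h.degAt_eq, finsum_eq_degree]
  simp [Finset.sum_add_distrib]

theorem smul_mem_stalk (P : Place k K) (j : ι) : P.unif ^ (-(H + e j) P) • b j ∈ X.stalk P := by
  have hmem : P.unif ^ (-(H + e j) P) • b j ∈ P.lat (P.scaledBasis b fun j => (H + e j) P) := by
    have := P.scaledBasis_apply b (fun j => (H + e j) P) j
    rw [← this]
    exact Submodule.subset_span ⟨j, rfl⟩
  by_cases hP : P ∈ Set.range r
  · obtain ⟨l, rfl⟩ := hP
    obtain ⟨b', i, h1, -, h3, h4, h5, h6⟩ := h.stalk_eq_of_mem l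
    rw [(r l).lat_scaledBasis_update h3 h4 h5 (fun j => by
      have := h.nonneg j (r l)
      rw [Finsupp.coe_zero, Pi.zero_apply] at this
      simp only [Finsupp.add_apply, h6]
      omega)] at hmem
    rw [h1]
    refine (r l).mem_lat_scaledBasis.2 fun j' =>
      (r l).fil_anti ?_ ((r l).mem_lat_scaledBasis.1 hmem j')
    rw [Pi.add_apply, Pi.single_apply]
    split_ifs <;> omega
  · rw [h.stalk_eq P hP]; exact hmem

theorem smul_sum_mem_stalk (l : κ) :
    (r l).unif ^ (-(H (r l) + 1)) • ∑ j, algebraMap k K (a l j) • b j ∈ X.stalk (r l) := by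
  obtain ⟨b', i, h1, -, h3, -, -, h6⟩ := h.stalk_eq_of_mem l
  rw [h1, ← h3]
  have := (r l).scaledBasis_apply b' ((fun j => (H + e j) (r l)) + Pi.single i 1) i
  rw [Pi.add_apply, Pi.single_eq_same, Finsupp.add_apply, h6, add_zero] at this
  rw [← this]
  exact Submodule.subset_span ⟨i, rfl⟩

/-- Functionals are tested on the local generators: the scaled basis vectors give the orders of
vanishing along `e j`, and the direction with the additional pole at `r l` gives the linear
condition there. -/
theorem dual_mem_sections {D : Place k K →₀ ℤ} {φ : Dual K V}
    (hφ : ∀ P : Place k K, φ ∈ (X.dual.twistDiv (H + D)).stalk P) :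
    (fun j => φ (b j)) ∈ ((condBundle e r a).twistDiv D).sections := by
  refine mem_sections_condBundle.2 ⟨fun j P => ?_, fun l => ?_⟩
  · have := hφ P _ (h.smul_mem_stalk P j)
    rw [LinearMap.restrictScalars_apply, LinearMap.lsmul_apply, LinearMap.smul_apply, map_smul,
      smul_smul, ← zpow_add₀ P.unif_ne_zero, smul_eq_mul, ← P.mem_fil_zero,
      P.unif_zpow_mul_mem_fil_iff] at this
    convert this using 2
    simp only [Finsupp.add_apply, Finsupp.sub_apply]
    ring
  · have := hφ (r l) _ (h.smul_sum_mem_stalk l)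
    rw [LinearMap.restrictScalars_apply, LinearMap.lsmul_apply, LinearMap.smul_apply, map_smul,
      smul_smul, ← zpow_add₀ (r l).unif_ne_zero, smul_eq_mul, ← (r l).mem_fil_zero,
      (r l).unif_zpow_mul_mem_fil_iff] at this
    have e1 : ∑ j, a l j • φ (b j) = φ (∑ j, algebraMap k K (a l j) • b j) := by
      rw [map_sum]
      refine Finset.sum_congr rfl fun j _ => ?_
      rw [map_smul, smul_eq_mul, Algebra.smul_def]
    rw [e1]
    convert this using 2
    simp only [Finsupp.add_apply]
    ring

variable [Module k V] [IsScalarTower k K V] in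
theorem isStable [Fact (HasGenus k K 1)] [FiniteDimensional K V] [Nonempty ι] {N : ℤ}
    (hdeg : X.deg = Fintype.card ι * (H.degree + N) + 1) {z : Place k K} (hz : z ∉ Set.range r)
    (hHz : H z = 0) (hez : ∀ j, e j z = 0) {D : Place k K →₀ ℤ} (hD : D.degree = N + 2)
    (hDz : D z = 0) {S : Finset (Place k K)} (hS : S.Nonempty) (hSz : ∀ d ∈ S, d ≠ z)
    (hinj : ∀ φ : S → ι → K,
        (∀ d : S, φ d ∈ ((condBundle e r a).twistDiv (D - Finsupp.single d.1 1)).sections) →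
        (∀ d d' j, z.res (φ d j) = z.res (φ d' j)) → ∀ d, φ d = 0) : X.IsStable := by
  classical
  have := hS.to_subtype
  refine h.isVectorBundle.isStable_of_dual b Fintype.card_pos hdeg (z := z) ?_
    (fun d : S => H + (D - Finsupp.single d.1 1)) (fun d => ?_) (fun d => ?_) fun φ hφ hval d => ?_
  · rw [h.stalk_eq z hz]
    have : (fun j => (H + e j) z) = 0 := by
      funext j
      rw [Finsupp.add_apply, hHz, hez]; rfl
    rw [this, z.scaledBasis_zero]
  · rw [map_add, map_sub, Finsupp.degree_single, hD]; ring
  · rw [Finsupp.add_apply, Finsupp.sub_apply, hHz, hDz,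
      Finsupp.single_eq_of_ne (by exact (hSz d.1 d.2).symm)]
    ring
  · have := hinj (fun d j => φ d (b j)) (fun d => h.dual_mem_sections (hφ d)) hval d
    exact b.ext fun j => congrFun this j

theorem slope_eq [Fact (HasGenus k K 1)] [FiniteDimensional K V] [Nonempty ι] {N : ℤ}
    (hdeg : X.deg = Fintype.card ι * N + 1) : X.slope = N + 1 / (Fintype.card ι : ℚ) := by
  have : (Fintype.card ι : ℚ) ≠ 0 := by simp
  rw [Stalks.slope, hdeg, Module.finrank_eq_card_basis b]
  push_cast
  field_simp

end IsModification
end Pointing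
end

/-! ### The pointing bundle of a secant space and its modification. -/

noncomputable section
namespace Pointing
open Module
set_option linter.unusedSectionVars false

variable {k K : Type*} [Field k] [Field K] [Algebra k K] [hK : Fact (IsFunctionFieldOfCurve k K)]
variable [IsAlgClosed k] {g n : ℕ} {γ : Fin g → K} {H : Place k K →₀ ℤ}
  {Λ : Submodule k (Fin g → k)} {p : Fin n → Place k K} [hG : Fact (HasGenus k K 1)]

namespace IsSecant
variable (hs : IsSecant γ H Λ p)
include hs

theorem span_constNormal :
    Submodule.span K (Set.range fun j => constNormal γ (pointVec γ H (p j))) = pointingSpace γ Λ := by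
  rw [← hs.span_eq, pointingSpace_span, ← Set.range_comp]
  rfl

/-- The basis of the pointing space given by the directions towards the points of the secant
space on the curve. -/
def basis : Basis (Fin n) K (pointingSpace γ Λ) :=
  (Basis.span (hs.embedding.linearIndependent_constNormal hs.injective hs.le)).map
    (LinearEquiv.ofEq _ _ hs.span_constNormal)

theorem basis_apply (j : Fin n) :
    (hs.basis j : NormalSpace k γ) = constNormal γ (pointVec γ H (p j)) := by
  rw [basis, Basis.map_apply, LinearEquiv.coe_ofEq_apply, Basis.span_apply]

theorem pointingBundle_stalk (P : Place k K) : (pointingBundle γ Λ).stalk P =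
    P.lat (P.scaledBasis hs.basis fun j => (H + Finsupp.single (p j) 2 : Place k K →₀ ℤ) P) := by
  ext w
  rw [P.mem_lat_scaledBasis, ← hs.embedding.sum_constNormal_mem_iff hs.injective hs.le]
  have : (w : NormalSpace k γ) =
      ∑ j, hs.basis.repr w j • constNormal γ (pointVec γ H (p j)) := by
    conv_lhs => rw [← hs.basis.sum_repr w]
    rw [Submodule.coe_sum]
    refine Finset.sum_congr rfl fun j _ => ?_
    rw [Submodule.coe_smul, hs.basis_apply]
  rw [← this]
  rfl

theorem comap_pointingSpace (c : Fin n → k) :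
    (pointingSpace γ (Submodule.span k {∑ j, c j • pointVec γ H (p j)})).comap
      (pointingSpace γ Λ).subtype =
      Submodule.span K {∑ j, algebraMap k K (c j) • hs.basis j} := by
  have h1 : ((∑ j, algebraMap k K (c j) • hs.basis j : pointingSpace γ Λ) : NormalSpace k γ) =
      constNormal γ (∑ j, c j • pointVec γ H (p j)) := by
    rw [← constNormalₗ_apply, map_sum, Submodule.coe_sum]
    refine Finset.sum_congr rfl fun j _ => ?_
    rw [Submodule.coe_smul, hs.basis_apply, map_smul, algebraMap_smul, constNormalₗ_apply]
  ext w
  rw [Submodule.mem_comap, pointingSpace_span, Set.image_singleton, ← h1,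
    Submodule.mem_span_singleton, Submodule.mem_span_singleton]
  refine exists_congr fun a => ?_
  rw [← Submodule.coe_smul, Submodule.subtype_apply, Subtype.ext_iff]

/-- A tangent direction at `p l` has a nonzero coordinate at some `j ≠ l`. The summand belonging to
`j` has no additional twist at `p l`, so the direction may replace this basis vector; without such a
`j` the pointing direction would vanish doubly there. -/
theorem isModification {y : Place k K} (hy : ∀ j, p j ≠ y) {x : Place k K → Fin g → k}
    {q : Fin g → k} {c : Fin n → Fin n → k} {d : Fin n → k}
    (hx : ∀ l, x (p l) = ∑ j, c l j • pointVec γ H (p j)) (hc : ∀ l, ∃ j ≠ l, c l j ≠ 0)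
    (hq : q = ∑ j, d j • pointVec γ H (p j)) (hd : ∃ j, d j ≠ 0) :
    IsModification (modifiedPointingBundle γ Λ x y q) hs.basis H
      (fun j => Finsupp.single (p j) 2) (fun l : Option (Fin n) => l.elim y p)
      (fun l : Option (Fin n) => l.elim d c) where
  injective := by
    rintro (_ | l) (_ | l') h
    · rfl
    · exact absurd h.symm (hy l')
    · exact absurd h (hy l)
    · exact congrArg some (hs.injective h)
  nonneg j := by simp
  stalk_eq P hP := by
    have h1 : P ∉ ({y} : Set (Place k K)) := fun h => hP ⟨none, h.symm⟩
    have h2 : P ∉ secantPoints γ Λ := by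
      rw [← hs.range_eq]
      rintro ⟨l, hl⟩
      exact hP ⟨some l, hl⟩
    rw [modifiedPointingBundle, Stalks.posModification_of_notMem h1,
      Stalks.posModification_of_notMem h2, hs.pointingBundle_stalk]
  stalk_eq_of_mem := by
    rintro (_ | l)
    · obtain ⟨i, hi⟩ := hd
      obtain ⟨b', h1, h2, h3⟩ := exists_basis_update hs.basis d hi
      have h0 : ∀ j, (Finsupp.single (p j) 2 : Place k K →₀ ℤ) y = 0 := fun j =>
        Finsupp.single_eq_of_ne (by exact (hy j).symm)
      have h4 : y ∉ secantPoints γ Λ := by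
        rw [← hs.range_eq]
        rintro ⟨l, hl⟩
        exact hy l hl
      refine ⟨b', i, ?_, hi, h1, h2, h3, h0 i⟩
      rw [modifiedPointingBundle]
      refine Stalks.posModification_stalk (Set.mem_singleton y) ?_ ?_
      · rw [Stalks.posModification_of_notMem h4, hs.pointingBundle_stalk]
        refine y.lat_scaledBasis_update h1 h2 h3 fun j => ?_
        rw [Finsupp.add_apply, Finsupp.add_apply, h0, h0]
      · rw [h1, hq, hs.comap_pointingSpace]
    · obtain ⟨i, hil, hi⟩ := hc l
      obtain ⟨b', h1, h2, h3⟩ := exists_basis_update hs.basis (c l) hi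
      have h0 : (Finsupp.single (p i) 2 : Place k K →₀ ℤ) (p l) = 0 :=
        Finsupp.single_eq_of_ne (by exact fun h => hil (hs.injective h).symm)
      have h4 : p l ∉ ({y} : Set (Place k K)) := hy l
      have h5 : p l ∈ secantPoints γ Λ := by
        rw [← hs.range_eq]
        exact ⟨l, rfl⟩
      refine ⟨b', i, ?_, hi, h1, h2, h3, h0⟩
      change (modifiedPointingBundle γ Λ x y q).stalk (p l) = _
      rw [modifiedPointingBundle, Stalks.posModification_of_notMem h4]
      refine Stalks.posModification_stalk h5 ?_ ?_
      · rw [hs.pointingBundle_stalk]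
        refine (p l).lat_scaledBasis_update h1 h2 h3 fun j => ?_
        rw [Finsupp.add_apply, Finsupp.add_apply, h0]
        have : 0 ≤ (Finsupp.single (p j) 2 : Place k K →₀ ℤ) (p l) :=
          (by simp : (0 : Place k K →₀ ℤ) ≤ Finsupp.single (p j) 2) (p l)
        omega
      · rw [h1, hx, hs.comap_pointingSpace]

theorem isStable_and_slope (hn : 2 ≤ n) {y : Place k K} (hy : ∀ j, p j ≠ y)
    {x : Place k K → Fin g → k} {q : Fin g → k} {c : Fin n → Fin n → k} {d : Fin n → k}
    (hx : ∀ l, x (p l) = ∑ j, c l j • pointVec γ H (p j)) (hc : ∀ l, ∃ j ≠ l, c l j ≠ 0)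
    (hq : q = ∑ j, d j • pointVec γ H (p j)) (hd : ∃ j, d j ≠ 0)
    {z : Place k K} (hzp : ∀ j, p j ≠ z) (hzy : y ≠ z) (hHz : H z = 0)
    {B : Place k K →₀ ℤ} (hB : B.degree = 5) (hBz : B z = 0) {S : Finset (Place k K)}
    (hS : S.Nonempty) (hSz : ∀ s ∈ S, s ≠ z)
    (hinj : ∀ φ : S → Fin n → K,
      (∀ (s : S) j, φ s j ∈ rrSpace (B - Finsupp.single s.1 1 - Finsupp.single (p j) 2)) →
      (∀ (s : S) l, ∑ j, c l j • φ s j ∈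
        (p l).fil (1 - (B - Finsupp.single s.1 1 : Place k K →₀ ℤ) (p l))) →
      (∀ s : S, ∑ j, d j • φ s j ∈ y.fil (1 - (B - Finsupp.single s.1 1 : Place k K →₀ ℤ) y)) →
      (∀ s s' j, z.res (φ s j) = z.res (φ s' j)) → ∀ s, φ s = 0) :
    (modifiedPointingBundle γ Λ x y q).IsStable ∧
      (modifiedPointingBundle γ Λ x y q).slope = (g : ℚ) + 3 + 1 / (n : ℚ) := by
  have h := hs.isModification hy hx hc hq hd
  have : NeZero n := ⟨by omega⟩
  -- The splitting contributes `n g + 2 n`, the modifications at the secant points `n`, and the one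
  -- at `y` adds `1`.
  have hdeg : (modifiedPointingBundle γ Λ x y q).deg =
      Fintype.card (Fin n) * (H.degree + 3) + 1 := by
    rw [h.deg_eq]
    simp only [Finsupp.degree_single, Finset.sum_const, Finset.card_univ, Fintype.card_option,
      Fintype.card_fin]
    push_cast
    ring
  refine ⟨h.isStable hdeg (z := z) ?_ hHz (fun j => ?_) hB hBz hS hSz fun φ hφ hval => ?_, ?_⟩
  · rintro ⟨_ | l, hl⟩
    · exact hzy hl
    · exact hzp l hl
  · exact Finsupp.single_eq_of_ne (by exact (hzp j).symm)
  · have hφ' := fun s => mem_sections_condBundle.1 (hφ s)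
    exact hinj φ (fun s => (hφ' s).1) (fun s l => (hφ' s).2 (some l)) (fun s => (hφ' s).2 none) hval
  · rw [h.slope_eq hdeg, hs.embedding.degree_eq, Fintype.card_fin]
    push_cast
    ring

end IsSecant
end Pointing
end

/-! ### Polynomial conditions, and rational curves through the points of the secant space. -/

noncomputable section
namespace Pointing
open Module
set_option linter.unusedSectionVars false

section Polynomial
variable {k : Type*} [Field k] {σ T : Type*} {co : T → σ → k}

/-- `f` is a polynomial in the coordinates `co`. -/
def IsPolynomialIn (co : T → σ → k) (f : T → k) : Prop :=
  ∃ F : MvPolynomial σ k, ∀ t, MvPolynomial.eval (co t) F = f t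

namespace IsPolynomialIn
variable {f f' : T → k}

theorem const (c : k) : IsPolynomialIn co fun _ => c :=
  ⟨MvPolynomial.C c, fun _ => MvPolynomial.eval_C c⟩

theorem coord (i : σ) : IsPolynomialIn co fun t => co t i :=
  ⟨MvPolynomial.X i, fun _ => MvPolynomial.eval_X i⟩

theorem mul (h : IsPolynomialIn co f) (h' : IsPolynomialIn co f') :
    IsPolynomialIn co fun t => f t * f' t := by
  obtain ⟨F, hF⟩ := h
  obtain ⟨F', hF'⟩ := h'
  exact ⟨F * F', fun t => by rw [map_mul, hF, hF']⟩

theorem pow (h : IsPolynomialIn co f) (m : ℕ) : IsPolynomialIn co fun t => f t ^ m := by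
  obtain ⟨F, hF⟩ := h
  exact ⟨F ^ m, fun t => by rw [map_pow, hF]⟩

theorem sum {ι : Type*} {s : Finset ι} {f : ι → T → k} (h : ∀ i ∈ s, IsPolynomialIn co (f i)) :
    IsPolynomialIn co fun t => ∑ i ∈ s, f i t := by
  choose! F hF using h
  exact ⟨∑ i ∈ s, F i, fun t => by
    rw [map_sum]; exact Finset.sum_congr rfl fun i hi => hF i hi t⟩

theorem prod {ι : Type*} {s : Finset ι} {f : ι → T → k} (h : ∀ i ∈ s, IsPolynomialIn co (f i)) :
    IsPolynomialIn co fun t => ∏ i ∈ s, f i t := by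
  choose! F hF using h
  exact ⟨∏ i ∈ s, F i, fun t => by
    rw [map_prod]; exact Finset.prod_congr rfl fun i hi => hF i hi t⟩

theorem det {ι : Type*} [Fintype ι] [DecidableEq ι] {M : T → Matrix ι ι k}
    (h : ∀ i j, IsPolynomialIn co fun t => M t i j) : IsPolynomialIn co fun t => (M t).det := by
  simp only [Matrix.det_apply']
  exact sum fun τ _ => (const _).mul (prod fun i _ => h _ _)

theorem adjugate {ι : Type*} [Fintype ι] [DecidableEq ι] {M : T → Matrix ι ι k}
    (h : ∀ i j, IsPolynomialIn co fun t => M t i j) (i j : ι) :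
    IsPolynomialIn co fun t => (M t).adjugate i j := by
  simp only [Matrix.adjugate_apply]
  refine det fun i' j' => ?_
  by_cases hi : i' = j
  · subst hi
    simp only [Matrix.updateRow_self]
    exact const _
  · simp only [Matrix.updateRow_ne hi]
    exact h i' j'

/-- Injectivity of a linear map is an open condition. -/
theorem exists_injective {U ι : Type*} [Fintype ι] [AddCommGroup U] [Module k U]
    [FiniteDimensional k U] {Φ : T → U →ₗ[k] (ι → k)}
    (hΦ : ∀ u i, IsPolynomialIn co fun t => Φ t u i) {t₀ : T} (h₀ : Function.Injective (Φ t₀)) :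
    ∃ f : T → k, IsPolynomialIn co f ∧ f t₀ ≠ 0 ∧ ∀ t, f t ≠ 0 → Function.Injective (Φ t) := by
  classical
  -- A fixed left inverse `C` at `t₀` turns injectivity into the nonvanishing of the determinant of
  -- `C ∘ₗ Φ t`, which is polynomial and equals `1` at `t₀`.
  obtain ⟨C, hC⟩ := (Φ t₀).exists_leftInverse_of_injective (LinearMap.ker_eq_bot.2 h₀)
  let b := finBasis k U
  refine ⟨fun t => LinearMap.det (C ∘ₗ Φ t), ?_, ?_, fun t ht => ?_⟩
  · simp only [← LinearMap.det_toMatrix b]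
    refine det fun i j => ?_
    have : ∀ t, LinearMap.toMatrix b b (C ∘ₗ Φ t) i j =
        ∑ m, Φ t (b j) m * b.repr (C (Pi.single m 1)) i := fun t => by
      rw [LinearMap.toMatrix_apply, LinearMap.comp_apply, LinearMap.pi_apply_eq_sum_univ C, map_sum,
        Finsupp.finsetSum_apply]
      refine Finset.sum_congr rfl fun m _ => ?_
      rw [map_smul, Finsupp.smul_apply, smul_eq_mul]
      have : (fun j => if m = j then 1 else 0 : ι → k) = Pi.single m 1 := by
        funext i'
        rw [Pi.single_apply]
        exact if_congr eq_comm rfl rfl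
      rw [this]
    simp only [this]
    exact sum fun m _ => (hΦ _ _).mul (const _)
  · dsimp only
    rw [hC, LinearMap.det_id]
    exact one_ne_zero
  · have hinj : Function.Injective (C ∘ₗ Φ t) :=
      (LinearMap.equivOfDetNeZero _ ht).injective
    rw [LinearMap.coe_comp] at hinj
    exact hinj.of_comp

end IsPolynomialIn
end Polynomial

section Curve
variable {k : Type*} [Field k] {g n : ℕ}

/-- The partial derivative of `curveValue` with respect to the first parameter. -/
def curveDeriv (a : Fin n → Fin g → k) (s : Fin 2 → k) : Fin g → k :=
  ∑ j : Fin n, (((j : ℕ) : k) * s 0 ^ ((j : ℕ) - 1) * s 1 ^ (n - 1 - (j : ℕ))) • a j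

theorem curveDeriv_smul (a : Fin n → Fin g → k) (c : k) (s : Fin 2 → k) :
    curveDeriv a (c • s) = c ^ (n - 2) • curveDeriv a s := by
  rw [curveDeriv, curveDeriv, Finset.smul_sum]
  refine Finset.sum_congr rfl fun j _ => ?_
  rw [smul_smul, Pi.smul_apply, Pi.smul_apply, smul_eq_mul, smul_eq_mul, mul_pow, mul_pow]
  congr 1
  -- For `j = 0` the truncated exponent is harmless, since the coefficient is zero.
  rcases Nat.eq_zero_or_pos (j : ℕ) with h | h
  · rw [h]; simp
  · have : c ^ (n - 2) = c ^ ((j : ℕ) - 1) * c ^ (n - 1 - (j : ℕ)) := by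
      rw [← pow_add]; congr 1; omega
    rw [this]; ring

/-- Euler's relation expresses the second partial derivative, times `s 1`, by the value and the
first one. It holds in every characteristic. -/
theorem curveTangent_eq (a : Fin n → Fin g → k) {s : Fin 2 → k} (hs : s 1 ≠ 0) :
    curveTangent a s = Submodule.span k {curveValue a s, curveDeriv a s} := by
  have heuler : s 1 • ∑ j : Fin n, (((n - 1 - (j : ℕ) : ℕ) : k) * s 0 ^ (j : ℕ) *
      s 1 ^ (n - 1 - (j : ℕ) - 1)) • a j =
      ((n - 1 : ℕ) : k) • curveValue a s - s 0 • curveDeriv a s := by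
    rw [curveValue, curveDeriv, Finset.smul_sum, Finset.smul_sum, Finset.smul_sum,
      ← Finset.sum_sub_distrib]
    refine Finset.sum_congr rfl fun j _ => ?_
    rw [smul_smul, smul_smul, smul_smul, ← sub_smul]
    congr 1
    have h1 : ((n - 1 : ℕ) : k) = ((n - 1 - (j : ℕ) : ℕ) : k) + ((j : ℕ) : k) := by
      rw [← Nat.cast_add]; congr 1; omega
    have h2 : ((n - 1 - (j : ℕ) : ℕ) : k) * (s 1 * s 1 ^ (n - 1 - (j : ℕ) - 1)) =
        ((n - 1 - (j : ℕ) : ℕ) : k) * s 1 ^ (n - 1 - (j : ℕ)) := by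
      rcases Nat.eq_zero_or_pos (n - 1 - (j : ℕ)) with h | h
      · rw [h]; simp
      · rw [← pow_succ', Nat.sub_add_cancel h]
    have h3 : ((j : ℕ) : k) * (s 0 * s 0 ^ ((j : ℕ) - 1)) = ((j : ℕ) : k) * s 0 ^ (j : ℕ) := by
      rcases Nat.eq_zero_or_pos (j : ℕ) with h | h
      · rw [h]; simp
      · rw [← pow_succ', Nat.sub_add_cancel h]
    rw [h1]
    linear_combination s 0 ^ (j : ℕ) * h2 + s 1 ^ (n - 1 - (j : ℕ)) * h3
  rw [curveTangent]
  apply le_antisymm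
  · rw [Submodule.span_le]
    have h1 : curveValue a s ∈ Submodule.span k {curveValue a s, curveDeriv a s} :=
      Submodule.subset_span (by simp)
    have h2 : curveDeriv a s ∈ Submodule.span k {curveValue a s, curveDeriv a s} :=
      Submodule.subset_span (by simp)
    rintro _ (rfl | rfl | rfl)
    · exact h1
    · exact h2
    · have := Submodule.smul_mem _ (s 1)⁻¹ (sub_mem (Submodule.smul_mem _ ((n - 1 : ℕ) : k) h1)
        (Submodule.smul_mem _ (s 0) h2))
      rwa [← heuler, inv_smul_smul₀ hs] at this
  · refine Submodule.span_mono ?_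
    rintro _ (rfl | rfl)
    · exact Or.inl rfl
    · exact Or.inr (Or.inl rfl)

/-- A curve of degree `n - 1`, its coefficients written in a basis `ε` of the space that it spans,
with the dual coordinates `L`. -/
structure IsCurveFrame (ε : Fin n → Fin g → k) (L : Fin n → (Fin g → k) →ₗ[k] k) : Prop where
  dual : ∀ j l, L j (ε l) = if j = l then 1 else 0

namespace IsCurveFrame
variable {ε : Fin n → Fin g → k} {L : Fin n → (Fin g → k) →ₗ[k] k} (h : IsCurveFrame ε L)

/-- The matrix of coordinates of the coefficients of a curve. -/
def _root_.Pointing.coordMatrix (L : Fin n → (Fin g → k) →ₗ[k] k) (a : Fin n → Fin g → k) :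
    Matrix (Fin n) (Fin n) k := Matrix.of fun j i => L j (a i)

theorem _root_.Pointing.apply_curveValue (a : Fin n → Fin g → k) (s : Fin 2 → k) (j : Fin n) :
    L j (curveValue a s) =
      (coordMatrix L a).mulVec (fun i => s 0 ^ (i : ℕ) * s 1 ^ (n - 1 - (i : ℕ))) j := by
  rw [curveValue, map_sum, Matrix.mulVec, dotProduct]
  refine Finset.sum_congr rfl fun i _ => ?_
  rw [map_smul, smul_eq_mul, mul_comm]
  rfl

theorem _root_.Pointing.apply_curveDeriv (a : Fin n → Fin g → k) (s : Fin 2 → k) (j : Fin n) :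
    L j (curveDeriv a s) = (coordMatrix L a).mulVec
      (fun i => ((i : ℕ) : k) * s 0 ^ ((i : ℕ) - 1) * s 1 ^ (n - 1 - (i : ℕ))) j := by
  rw [curveDeriv, map_sum, Matrix.mulVec, dotProduct]
  refine Finset.sum_congr rfl fun i _ => ?_
  rw [map_smul, smul_eq_mul, mul_comm]
  rfl

include h

theorem eq_sum {v : Fin g → k} (hv : v ∈ Submodule.span k (Set.range ε)) :
    v = ∑ j, L j v • ε j := by
  obtain ⟨c, rfl⟩ := (Submodule.mem_span_range_iff_exists_fun k).1 hv
  refine Finset.sum_congr rfl fun j _ => ?_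
  congr 1
  rw [map_sum, Finset.sum_eq_single j]
  · rw [map_smul, h.dual, if_pos rfl, smul_eq_mul, mul_one]
  · intro l _ hl
    rw [map_smul, h.dual, if_neg (Ne.symm hl), smul_zero]
  · simp

/-- The coordinate matrix times the matrix of monomials at the `n` parameters is diagonal and
invertible: a curve of degree `n - 1` through `n` independent points spans. -/
theorem det_ne_zero {a : Fin n → Fin g → k}
    (hc : ∀ l, ∃ s, ∃ c : k, c ≠ 0 ∧ curveValue a s = c • ε l) : (coordMatrix L a).det ≠ 0 := by
  choose s c hc0 hs using hc
  have h1 : coordMatrix L a * Matrix.of (fun (i l : Fin n) => s l 0 ^ (i : ℕ) * s l 1 ^ (n - 1 - (i : ℕ))) =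
      Matrix.diagonal c := by
    ext j l
    have := apply_curveValue (L := L) a (s l) j
    rw [hs, map_smul, h.dual] at this
    rw [Matrix.mul_apply, Matrix.diagonal_apply]
    refine Eq.trans this.symm ?_
    rw [smul_eq_mul, mul_ite, mul_one, mul_zero]
    by_cases hjl : j = l
    · rw [if_pos hjl, if_pos hjl, hjl]
    · rw [if_neg hjl, if_neg hjl]
  intro h0
  have h2 := congrArg Matrix.det h1
  rw [Matrix.det_mul, h0, zero_mul, Matrix.det_diagonal] at h2
  exact Finset.prod_ne_zero_iff.2 (fun l _ => hc0 l) h2.symm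

end IsCurveFrame

/-- The parameter (up to a factor) at which the curve passes through the `l`-th basis vector. -/
def secantParameter (hn : 2 ≤ n) (L : Fin n → (Fin g → k) →ₗ[k] k) (a : Fin n → Fin g → k)
    (l : Fin n) : Fin 2 → k :=
  ![(coordMatrix L a).adjugate ⟨1, by omega⟩ l, (coordMatrix L a).adjugate ⟨0, by omega⟩ l]

namespace IsCurveFrame
variable {ε : Fin n → Fin g → k} {L : Fin n → (Fin g → k) →ₗ[k] k} (h : IsCurveFrame ε L)
include h

/-- By Cramer's rule the monomials of `s` are proportional to the `l`-th column of the adjugate. Its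
entries `1` and `0` give `s 0 * s 1 ^ (n - 2)` and `s 1 ^ (n - 1)`, a multiple of `s`. So the
parameter of the curve at a secant point is polynomial in the coefficients, up to a factor. -/
theorem exists_secantParameter_eq (hn : 2 ≤ n) {a : Fin n → Fin g → k}
    (hdet : (coordMatrix L a).det ≠ 0) {l : Fin n} {s : Fin 2 → k} {c : k} (hc : c ≠ 0)
    (hs : curveValue a s = c • ε l) : (s 1 ≠ 0 ↔ secantParameter hn L a l 1 ≠ 0) ∧
    (s 1 ≠ 0 → ∃ μ : k, μ ≠ 0 ∧ secantParameter hn L a l = μ • s) := by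
  set A := coordMatrix L a with hA
  have h1 : A.mulVec (fun i : Fin n => s 0 ^ (i : ℕ) * s 1 ^ (n - 1 - (i : ℕ))) = Pi.single l c := by
    funext j
    rw [← apply_curveValue, hs, map_smul, h.dual, Pi.single_apply, smul_eq_mul, mul_ite, mul_one,
      mul_zero]
  have h2 : ∀ i : Fin n, A.det * (s 0 ^ (i : ℕ) * s 1 ^ (n - 1 - (i : ℕ))) = c * A.adjugate i l := by
    intro i
    have := congrFun (congrArg A.adjugate.mulVec h1) i
    rw [Matrix.mulVec_mulVec, Matrix.adjugate_mul, Matrix.smul_mulVec, Matrix.one_mulVec,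
      Pi.smul_apply, smul_eq_mul, Matrix.mulVec_single] at this
    simpa [mul_comm] using this
  have e1 : secantParameter hn L a l 1 = A.det * c⁻¹ * s 1 ^ (n - 1) := by
    have := h2 ⟨0, by omega⟩
    simp only [pow_zero, one_mul, Nat.sub_zero] at this
    change A.adjugate ⟨0, _⟩ l = _
    field_simp
    linear_combination -this
  have e0 : secantParameter hn L a l 0 = A.det * c⁻¹ * (s 0 * s 1 ^ (n - 2)) := by
    have := h2 ⟨1, by omega⟩
    simp only [pow_one, Nat.sub_sub] at this
    change A.adjugate ⟨1, _⟩ l = _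
    field_simp
    linear_combination -this
  have hdc : A.det * c⁻¹ ≠ 0 := mul_ne_zero hdet (inv_ne_zero hc)
  refine ⟨?_, fun hs1 => ⟨A.det * c⁻¹ * s 1 ^ (n - 2), mul_ne_zero hdc (pow_ne_zero _ hs1), ?_⟩⟩
  · rw [e1]
    constructor
    · intro hs1; exact mul_ne_zero hdc (pow_ne_zero _ hs1)
    · intro h0 hs1
      rw [hs1, zero_pow (by omega), mul_zero] at h0
      exact h0 rfl
  · funext i
    fin_cases i
    · change secantParameter hn L a l 0 = _ * s 0
      rw [e0]; ring
    · change secantParameter hn L a l 1 = _ * s 1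
      rw [e1, show n - 1 = n - 2 + 1 by omega, pow_succ]; ring

/-- The derivative is not a multiple of the value. -/
theorem curveDeriv_notMem (hn : 2 ≤ n) {a : Fin n → Fin g → k} (hdet : (coordMatrix L a).det ≠ 0)
    {s : Fin 2 → k} (hs : s 1 ≠ 0) :
    curveDeriv a s ∉ Submodule.span k {curveValue a s} := by
  intro hmem
  obtain ⟨c, hc⟩ := Submodule.mem_span_singleton.1 hmem
  have h1 : (coordMatrix L a).mulVec
      (c • (fun i : Fin n => s 0 ^ (i : ℕ) * s 1 ^ (n - 1 - (i : ℕ)))) =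
      (coordMatrix L a).mulVec
      (fun i : Fin n => ((i : ℕ) : k) * s 0 ^ ((i : ℕ) - 1) * s 1 ^ (n - 1 - (i : ℕ))) := by
    funext j
    rw [← apply_curveDeriv, ← hc, Matrix.mulVec_smul, Pi.smul_apply, ← apply_curveValue, map_smul]
  have h2 := Matrix.mulVec_injective_of_isUnit
    ((Matrix.isUnit_iff_isUnit_det _).2 hdet.isUnit) h1
  -- The coefficient at `0` shows that the factor `c` is zero, and the one at `1` then contradicts
  -- `s 1 ≠ 0`; these two entries carry the factors `0` and `1`, so the characteristic plays no
  -- role.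
  have e0 := congrFun h2 ⟨0, by omega⟩
  have e1 := congrFun h2 ⟨1, by omega⟩
  simp [hs] at e0
  simp [e0] at e1
  exact pow_ne_zero _ hs e1.symm

theorem curveValue_ne_zero {a : Fin n → Fin g → k} (hn : 2 ≤ n)
    (hdet : (coordMatrix L a).det ≠ 0) {s : Fin 2 → k} (hs : s ≠ 0) : curveValue a s ≠ 0 := by
  intro h0
  have h1 : (coordMatrix L a).mulVec
      (fun i : Fin n => s 0 ^ (i : ℕ) * s 1 ^ (n - 1 - (i : ℕ))) = (coordMatrix L a).mulVec 0 := by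
    funext j
    rw [← apply_curveValue, h0, map_zero, Matrix.mulVec_zero, Pi.zero_apply]
  have h2 := Matrix.mulVec_injective_of_isUnit
    ((Matrix.isUnit_iff_isUnit_det _).2 hdet.isUnit) h1
  have e0 := congrFun h2 ⟨0, by omega⟩
  have e1 := congrFun h2 ⟨n - 1, by omega⟩
  simp only [pow_zero, one_mul, Nat.sub_zero, Pi.zero_apply, Nat.sub_self, mul_one] at e0 e1
  apply hs
  funext i
  fin_cases i
  · exact eq_zero_of_pow_eq_zero e1
  · exact eq_zero_of_pow_eq_zero e0

end IsCurveFrame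

section Interpolation
open Polynomial

/-- The product of the linear factors of all nodes except one. -/
def nodalFactor (τ : Fin n → k) (l : Fin n) : k[X] := ∏ m ∈ Finset.univ.erase l, (X - C (τ m))

theorem natDegree_nodalFactor_lt (τ : Fin n → k) (l : Fin n) : (nodalFactor τ l).natDegree < n := by
  refine (natDegree_prod_le _ _).trans_lt ?_
  simp only [natDegree_X_sub_C, Finset.sum_const, smul_eq_mul, mul_one,
    Finset.card_erase_of_mem (Finset.mem_univ l), Finset.card_univ, Fintype.card_fin]
  have := l.2
  omega

theorem eval_nodalFactor (τ : Fin n → k) (l : Fin n) (t : k) :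
    (nodalFactor τ l).eval t = ∏ m ∈ Finset.univ.erase l, (t - τ m) := by
  simp [nodalFactor, eval_prod]

theorem eval_nodalFactor_of_ne (τ : Fin n → k) {j l : Fin n} (h : j ≠ l) :
    (nodalFactor τ j).eval (τ l) = 0 := by
  rw [eval_nodalFactor]
  exact Finset.prod_eq_zero (Finset.mem_erase.2 ⟨h.symm, Finset.mem_univ l⟩) (sub_self _)

theorem eval_nodalFactor_eq {τ : Fin n → k} {t : k} (ht : ∀ j, t ≠ τ j) (l : Fin n) :
    (nodalFactor τ l).eval t = (∏ m, (t - τ m)) * (t - τ l)⁻¹ := by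
  rw [eval_nodalFactor, ← Finset.mul_prod_erase _ _ (Finset.mem_univ l), mul_comm, ← mul_assoc,
    inv_mul_cancel₀ (sub_ne_zero.2 (ht l)), one_mul]

theorem eval_nodalFactor_self_ne_zero {τ : Fin n → k} (hτ : Function.Injective τ) (l : Fin n) :
    (nodalFactor τ l).eval (τ l) ≠ 0 := by
  rw [eval_nodalFactor]
  exact Finset.prod_ne_zero_iff.2 fun m hm =>
    sub_ne_zero.2 fun h => (Finset.mem_erase.1 hm).1 (hτ h.symm)

/-- Apart from the factor depending on `l` only, the tangent direction of the interpolating curve at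
its `l`-th point has the Cauchy coefficients as coordinates. -/
theorem eval_derivative_nodalFactor {τ : Fin n → k} (hτ : Function.Injective τ) {j l : Fin n}
    (h : j ≠ l) : (derivative (nodalFactor τ j)).eval (τ l) =
      (nodalFactor τ l).eval (τ l) * (τ l - τ j)⁻¹ := by
  have h1 : nodalFactor τ j = (X - C (τ l)) * ∏ m ∈ (Finset.univ.erase j).erase l, (X - C (τ m)) :=
    (Finset.mul_prod_erase _ _ (Finset.mem_erase.2 ⟨h.symm, Finset.mem_univ l⟩)).symm
  have h2 : nodalFactor τ l = (X - C (τ j)) * ∏ m ∈ (Finset.univ.erase j).erase l, (X - C (τ m)) := by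
    rw [Finset.erase_right_comm]
    exact (Finset.mul_prod_erase _ _ (Finset.mem_erase.2 ⟨h, Finset.mem_univ j⟩)).symm
  have h3 : τ l - τ j ≠ 0 := sub_ne_zero.2 fun h' => h (hτ h'.symm)
  rw [h1, h2, derivative_mul, derivative_X_sub_C]
  simp only [eval_add, eval_mul, eval_sub, eval_X, eval_C, sub_self, zero_mul, add_zero,
    one_mul]
  field_simp

/-- The coefficients of the curve that passes through `ε l` at the parameter `τ l`. -/
def interpolatingCurve (τ : Fin n → k) (ε : Fin n → Fin g → k) (i : Fin n) : Fin g → k :=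
  ∑ l, (nodalFactor τ l).coeff i • ε l

theorem curveValue_interpolatingCurve (τ : Fin n → k) (ε : Fin n → Fin g → k) (t : k) :
    curveValue (interpolatingCurve τ ε) ![t, 1] = ∑ l, (nodalFactor τ l).eval t • ε l := by
  simp only [curveValue, interpolatingCurve, Finset.smul_sum, smul_smul]
  rw [Finset.sum_comm]
  refine Finset.sum_congr rfl fun l _ => ?_
  rw [← Finset.sum_smul, eval_eq_sum_range' (natDegree_nodalFactor_lt τ l), Finset.sum_range]
  congr 1
  refine Finset.sum_congr rfl fun i _ => ?_
  simp [mul_comm]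

theorem curveDeriv_interpolatingCurve (τ : Fin n → k) (ε : Fin n → Fin g → k) (t : k) :
    curveDeriv (interpolatingCurve τ ε) ![t, 1] =
      ∑ l, (derivative (nodalFactor τ l)).eval t • ε l := by
  simp only [curveDeriv, interpolatingCurve, Finset.smul_sum, smul_smul]
  rw [Finset.sum_comm]
  refine Finset.sum_congr rfl fun l _ => ?_
  rw [← Finset.sum_smul, derivative_eval,
    sum_over_range' _ (by simp) n (natDegree_nodalFactor_lt τ l), Finset.sum_range]
  congr 1
  refine Finset.sum_congr rfl fun i _ => ?_
  simp only [Matrix.cons_val_zero, Matrix.cons_val_one, one_pow, mul_one]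
  ring

end Interpolation
end Curve
end Pointing
end

/-! ### Rigidity, the finite form of the dual condition, and its openness. -/

noncomputable section
namespace Pointing
open Module
set_option linter.unusedSectionVars false

variable {k K : Type*} [Field k] [Field K] [Algebra k K] [hK : Fact (IsFunctionFieldOfCurve k K)]
variable [IsAlgClosed k] {g n : ℕ} {γ : Fin g → K} {H : Place k K →₀ ℤ} {p : Fin n → Place k K}

/-- Families of tuples of functions that satisfy the dual conditions of the modified pointing
bundle, and take a common value at `z`, vanish. -/
def IsRigid (B : Place k K →₀ ℤ) (S : Finset (Place k K)) (p : Fin n → Place k K) (z y : Place k K)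
    (c : Fin n → Fin n → k) (d : Fin n → k) : Prop :=
  ∀ φ : S → Fin n → K,
    (∀ (s : S) j, φ s j ∈ rrSpace (B - Finsupp.single s.1 1 - Finsupp.single (p j) 2)) →
    (∀ (s : S) l, ∑ j, c l j • φ s j ∈
      (p l).fil (1 - (B - Finsupp.single s.1 1 : Place k K →₀ ℤ) (p l))) →
    (∀ s : S, ∑ j, d j • φ s j ∈ y.fil (1 - (B - Finsupp.single s.1 1 : Place k K →₀ ℤ) y)) →
    (∀ s s' j, z.res (φ s j) = z.res (φ s' j)) → ∀ s, φ s = 0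

variable {B : Place k K →₀ ℤ} {S : Finset (Place k K)} {z y : Place k K}

/-- Each condition matters only up to a factor. Diagonal entries are irrelevant because `φ l`
vanishes doubly at `p l`; the tangent vectors are thus needed only modulo the points of tangency. -/
theorem IsRigid.rescale {c c' : Fin n → Fin n → k} {d d' : Fin n → k} (h : IsRigid B S p z y c d)
    (hc : ∀ l, ∃ t : k, t ≠ 0 ∧ ∀ j ≠ l, c' l j = t * c l j)
    (hd : ∃ t : k, t ≠ 0 ∧ ∀ j, d' j = t * d j) : IsRigid B S p z y c' d' := by
  intro φ h1 h2 h3 h4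
  refine h φ h1 (fun s l => ?_) (fun s => ?_) h4
  · obtain ⟨t, ht, hct⟩ := hc l
    rw [← (p l).smul_mem_fil_iff ht]
    have h5 : φ s l ∈ (p l).fil (1 - (B - Finsupp.single s.1 1 : Place k K →₀ ℤ) (p l)) := by
      refine (p l).fil_anti ?_ (h1 s l (p l))
      rw [Finsupp.sub_apply _ (Finsupp.single (p l) 2), Finsupp.single_eq_same]
      omega
    have h6 := sub_mem (h2 s l) ((p l).smul_mem_fil (c' l l - t * c l l) h5)
    have e : ∑ j, c' l j • φ s j - (c' l l - t * c l l) • φ s l = t • ∑ j, c l j • φ s j := by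
      rw [Finset.smul_sum, ← Finset.add_sum_erase _ _ (Finset.mem_univ l),
        ← Finset.add_sum_erase Finset.univ (fun j => t • c l j • φ s j) (Finset.mem_univ l)]
      have : ∑ j ∈ Finset.univ.erase l, c' l j • φ s j =
          ∑ j ∈ Finset.univ.erase l, t • c l j • φ s j :=
        Finset.sum_congr rfl fun j hj => by rw [hct j (Finset.ne_of_mem_erase hj), mul_smul]
      rw [this, sub_smul, mul_smul]
      abel
    rwa [e] at h6
  · obtain ⟨t, ht, hdt⟩ := hd
    have := h3 s
    simp only [hdt, mul_smul] at this
    rwa [← Finset.smul_sum, y.smul_mem_fil_iff ht] at this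

variable [hG : Fact (HasGenus k K 1)]

/-- The special Cauchy configuration has no section in any twist of degree three, so
`exists_finset_common_value` provides the finite set of twists. -/
theorem exists_isRigid (hn : 2 ≤ n) (hp : Function.Injective p) (hy : ∀ j, p j ≠ y)
    (hzp : ∀ j, p j ≠ z) (hzy : y ≠ z) (hB : B.degree = 5) (hBz : B z = 0)
    {T : Set (Place k K)} (hT : T.Finite) (hzT : z ∈ T) :
    ∃ (τ : Fin n → k) (σ : k) (S : Finset (Place k K)), Function.Injective τ ∧ (∀ j, σ ≠ τ j) ∧
      S.Nonempty ∧ (∀ d ∈ S, d ∉ T) ∧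
      IsRigid B S p z y (fun l j => (τ l - τ j)⁻¹) (fun j => (σ - τ j)⁻¹) := by
  obtain ⟨τ, σ, hτ, hσ, hstab⟩ := exists_stable_parameters hn hp hy
  obtain ⟨S, hS, hST, hinj⟩ := exists_finset_common_value
    (e := fun j : Fin n => Finsupp.single (p j) 2) (r := fun l : Option (Fin n) => l.elim y p)
    (a := fun l : Option (Fin n) => l.elim (fun j => (σ - τ j)⁻¹) fun l j => (τ l - τ j)⁻¹)
    (fun j => by simp) (z := z) (by rintro (_ | l); exacts [hzy, hzp l])
    (fun j => Finsupp.single_eq_of_ne (by exact (hzp j).symm))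
    (fun D hD => (Submodule.eq_bot_iff _).2 fun φ hφ => by
      obtain ⟨h1, h2⟩ := mem_sections_condBundle.1 hφ
      exact hstab D hD φ h1 (fun l => h2 (some l)) (h2 none)) hB hBz hT hzT
  refine ⟨τ, σ, S, hτ, hσ, hS, hST, fun φ h1 h2 h3 h4 => ?_⟩
  refine hinj φ (fun s => mem_sections_condBundle.2 ⟨h1 s, ?_⟩) h4
  rintro (_ | l)
  exacts [h3 s, h2 s l]

section Open
variable {T σ : Type*} {co : T → σ → k}

theorem IsEmbedding.exists_forms (hγ : IsEmbedding γ H) :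
    ∃ ζ : rrSpace H →ₗ[k] (Fin g → k), ∀ f, ∑ i, ζ f i • γ i = f.1 := by
  let b := (Basis.span hγ.linearIndependent).map (LinearEquiv.ofEq _ _ hγ.span_eq)
  have hb : ∀ i, (b i : K) = γ i := fun i => by
    rw [Basis.map_apply, LinearEquiv.coe_ofEq_apply, Basis.span_apply]
  refine ⟨b.equivFun, fun f => ?_⟩
  conv_rhs => rw [← b.sum_equivFun f]
  rw [Submodule.coe_sum]
  refine Finset.sum_congr rfl fun i _ => ?_
  rw [Submodule.coe_smul, hb]
  rfl

/-- The functions range over a fixed finite-dimensional space. The conditions at the `p l` and at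
`z` use fixed leading coefficients, and the condition at the moving point `y` is linear in its
coordinates, because functions in `ℒ(H)` are linear forms on the curve. -/
theorem IsRigid.exists_open (hγ : IsEmbedding γ H) (hBH : B ≤ H) (hBz : B z = 0)
    (hSz : z ∉ S) {c : T → Fin n → Fin n → k} {d : T → Fin n → k} {v : T → Fin g → k}
    (hc : ∀ l j, IsPolynomialIn co fun t => c t l j) (hd : ∀ j, IsPolynomialIn co fun t => d t j)
    (hv : ∀ i, IsPolynomialIn co fun t => v t i) {t₀ : T} (hv₀ : v t₀ = pointVec γ H y)
    (hBy : B y = H y) (hSy : y ∉ S) (h₀ : IsRigid B S p z y (c t₀) (d t₀)) :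
    ∃ f : T → k, IsPolynomialIn co f ∧ f t₀ ≠ 0 ∧ ∀ (t : T) (y : Place k K) (x : k), f t ≠ 0 →
      x ≠ 0 → v t = x • pointVec γ H y → B y = H y → y ∉ S → IsRigid B S p z y (c t) (d t) := by
  classical
  have hfin := fun D : Place k K →₀ ℤ => finiteDimensional_rrSpace D
  obtain ⟨ζ, hζ⟩ := hγ.exists_forms
  obtain ⟨D, hD⟩ : ∃ D : S → Place k K →₀ ℤ, ∀ s, D s = B - Finsupp.single s.1 1 := ⟨_, fun _ => rfl⟩
  have hDB : ∀ s, D s ≤ B := fun s => by rw [hD]; simp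
  have hle : ∀ s j, rrSpace (D s - Finsupp.single (p j) 2) ≤ rrSpace (D s) := fun s j =>
    rrSpace_mono (by simp)
  have hleH : ∀ s j, rrSpace (D s - Finsupp.single (p j) 2) ≤ rrSpace H := fun s j =>
    (hle s j).trans (rrSpace_mono ((hDB s).trans hBH))
  let U := ∀ (s : S) (j : Fin n), rrSpace (D s - Finsupp.single (p j) 2)
  let pr : ∀ s j, U →ₗ[k] rrSpace (D s - Finsupp.single (p j) 2) := fun s j =>
    LinearMap.proj (φ := fun j => rrSpace (D s - Finsupp.single (p j) 2)) j ∘ₗ LinearMap.proj s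
  let E : Place k K → S → Fin n → U →ₗ[k] k := fun P s j =>
    evAt (D s) P ∘ₗ Submodule.inclusion (hle s j) ∘ₗ pr s j
  let G : S → Fin n → Fin g → U →ₗ[k] k := fun s j i =>
    LinearMap.proj i ∘ₗ ζ ∘ₗ Submodule.inclusion (hleH s j) ∘ₗ pr s j
  have hE : ∀ P s j (u : U), E P s j u = P.lead (-D s P) (u s j) := fun P s j u => by
    rw [Place.lead, neg_neg]; rfl
  have hGs : ∀ s j (u : U), ∑ i, G s j i u • γ i = u s j := fun s j u =>
    hζ (Submodule.inclusion (hleH s j) (u s j))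
  -- The three blocks are the conditions at the points `p l`, the condition at `y`, and the equality
  -- of the values at `z`.
  let Φ : T → U →ₗ[k] ((S × Fin n) ⊕ S ⊕ (S × S × Fin n) → k) := fun t => LinearMap.pi
    (Sum.elim (fun sl => ∑ j, c t sl.2 j • E (p sl.2) sl.1 j)
      (Sum.elim (fun s => ∑ j, d t j • ∑ i, v t i • G s j i)
        fun ssj => E z ssj.1 ssj.2.2 - E z ssj.2.1 ssj.2.2))
  have hΦ : ∀ (t : T) (y : Place k K) (x : k), x ≠ 0 → v t = x • pointVec γ H y → B y = H y → y ∉ S →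
      ∀ u : U, Φ t u = 0 ↔
        (∀ (s : S) l, ∑ j, c t l j • (u s j : K) ∈ (p l).fil (1 - D s (p l))) ∧
        (∀ s : S, ∑ j, d t j • (u s j : K) ∈ y.fil (1 - D s y)) ∧
        (∀ s s' j, z.res (u s j : K) = z.res (u s' j : K)) := by
    intro t y x hx hvt hBy hSy u
    rw [funext_iff, Sum.forall, Sum.forall, Prod.forall, Prod.forall]
    have hmem : ∀ (P : Place k K) s j, (u s j : K) ∈ P.fil (-D s P) := fun P s j => hle s j (u s j).2 P
    refine and_congr (forall₂_congr fun s l => ?_) (and_congr (forall_congr' fun s => ?_) ?_)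
    · rw [sub_eq_neg_add, (p l).sum_smul_mem_fil_iff (hmem (p l) s)]
      simp only [Φ, LinearMap.pi_apply, Sum.elim_inl, LinearMap.sum_apply, LinearMap.smul_apply, hE,
        smul_eq_mul, Pi.zero_apply]
    -- The twists agree with `H` at `y`, so the leading coefficient there is the value of the linear
    -- form at the point of the curve.
    · have hDy : D s y = H y := by
        rw [hD, Finsupp.sub_apply, hBy, Finsupp.single_eq_of_ne (by exact fun h => hSy (h ▸ s.2)),
          sub_zero]
      have e1 : ∑ j, d t j • (u s j : K) = ∑ i, (∑ j, d t j * G s j i u) • γ i := by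
        simp only [← hGs, Finset.smul_sum, Finset.sum_smul, mul_smul]
        rw [Finset.sum_comm]
      have e2 : Φ t u (Sum.inr (Sum.inl s)) =
          x * ∑ i, (∑ j, d t j * G s j i u) * pointVec γ H y i := by
        simp only [Φ, LinearMap.pi_apply, Sum.elim_inl, Sum.elim_inr, LinearMap.sum_apply,
          LinearMap.smul_apply, hvt, Pi.smul_apply, smul_eq_mul, Finset.mul_sum, Finset.sum_mul]
        rw [Finset.sum_comm]
        refine Finset.sum_congr rfl fun i _ => Finset.sum_congr rfl fun j _ => ?_
        ring
      rw [e1, e2, hDy, sub_eq_neg_add, ← hγ.dot_pointVec_eq_zero_iff, Pi.zero_apply, mul_eq_zero,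
        or_iff_right hx]
    · simp only [Prod.forall]
      refine forall₃_congr fun s s' j => ?_
      have hz0 : ∀ s, D s z = 0 := fun s => by
        rw [hD, Finsupp.sub_apply, hBz, Finsupp.single_eq_of_ne (by exact fun h => hSz (h ▸ s.2)),
          sub_zero]
      simp only [Φ, LinearMap.pi_apply, Sum.elim_inr, LinearMap.sub_apply, hE, hz0, Place.lead,
        neg_zero, zpow_zero, one_mul, Pi.zero_apply, sub_eq_zero]
  have hiff : ∀ (t : T) (y : Place k K) (x : k), x ≠ 0 → v t = x • pointVec γ H y → B y = H y →
      y ∉ S → (Function.Injective (Φ t) ↔ IsRigid B S p z y (c t) (d t)) := by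
    intro t y x hx hvt hBy hSy
    rw [injective_iff_map_eq_zero]
    simp only [hΦ t y x hx hvt hBy hSy]
    simp only [IsRigid, ← hD]
    constructor
    · intro h φ h1 h2 h3 h4 s
      have := h (fun s j => ⟨φ s j, h1 s j⟩) ⟨h2, h3, h4⟩
      funext j
      exact congrArg Subtype.val (congrFun (congrFun this s) j)
    · intro h u ⟨h2, h3, h4⟩
      funext s j
      exact Subtype.ext (congrFun (h (fun s j => u s j) (fun s j => (u s j).2) h2 h3 h4 s) j)
  obtain ⟨f, hf, hf0, hfi⟩ := IsPolynomialIn.exists_injective (co := co) (Φ := Φ) (fun u i => by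
    rcases i with ⟨s, l⟩ | s | ⟨s, s', j⟩
    · simp only [Φ, LinearMap.pi_apply, Sum.elim_inl, LinearMap.sum_apply, LinearMap.smul_apply,
        smul_eq_mul]
      exact .sum fun j _ => (hc l j).mul (.const _)
    · simp only [Φ, LinearMap.pi_apply, Sum.elim_inl, Sum.elim_inr, LinearMap.sum_apply,
        LinearMap.smul_apply, smul_eq_mul]
      exact .sum fun j _ => (hd j).mul (.sum fun i _ => (hv i).mul (.const _))
    · simp only [Φ, LinearMap.pi_apply, Sum.elim_inr]
      exact .const _)
    (t₀ := t₀) ((hiff t₀ y 1 one_ne_zero (by rw [hv₀, one_smul]) hBy hSy).2 h₀)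
  exact ⟨f, hf, hf0, fun t y x hft hx hvt hBy hSy => (hiff t y x hx hvt hBy hSy).1 (hfi t hft)⟩

end Open

/-- A linear form that vanishes at one point of the curve, and not at another one. -/
theorem IsEmbedding.exists_separating_form (hγ : IsEmbedding γ H) (hg : 3 ≤ g) {P Q : Place k K}
    (h : P ≠ Q) : ∃ ℓ : Fin g → k, ∑ i, ℓ i * pointVec γ H P i = 0 ∧
      ∑ i, ℓ i * pointVec γ H Q i ≠ 0 := by
  classical
  by_contra! hcon
  have hle : rrSpace (H - Finsupp.single P 1) ≤
      rrSpace (H - Finsupp.single P 1 - Finsupp.single Q 1) := by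
    intro f hf
    obtain ⟨h1, h2⟩ := mem_rrSpace_sub_single.1 hf
    obtain ⟨ℓ, rfl⟩ := hγ.exists_form h1
    refine mem_rrSpace_sub_single.2 ⟨hf, ?_⟩
    have := hcon ℓ ((hγ.dot_pointVec_eq_zero_iff P ℓ).2 h2)
    rw [Finsupp.sub_apply, Finsupp.single_eq_of_ne (by exact h.symm), sub_zero]
    exact (hγ.dot_pointVec_eq_zero_iff Q ℓ).1 this
  have := finiteDimensional_rrSpace (H - Finsupp.single P 1 - Finsupp.single Q 1)
  have h1 := Submodule.finrank_mono hle
  have h2 := finrank_rrSpace (D := H - Finsupp.single P 1) (by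
    rw [map_sub, Finsupp.degree_single, hγ.degree_eq]; omega)
  have h3 := finrank_rrSpace (D := H - Finsupp.single P 1 - Finsupp.single Q 1) (by
    rw [map_sub, map_sub, Finsupp.degree_single, Finsupp.degree_single, hγ.degree_eq]; omega)
  rw [map_sub, Finsupp.degree_single, hγ.degree_eq] at h2
  rw [map_sub, map_sub, Finsupp.degree_single, Finsupp.degree_single, hγ.degree_eq] at h3
  omega

end Pointing
end

/-! ### Tangent points of the rational curve and the conclusion. -/

noncomputable section
namespace Pointing
open Module
set_option linter.unusedSectionVars false

variable {k K : Type*} [Field k] [Field K] [Algebra k K] [hK : Fact (IsFunctionFieldOfCurve k K)]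
variable [IsAlgClosed k] {g n : ℕ} {γ : Fin g → K} {H : Place k K →₀ ℤ}
  {Λ : Submodule k (Fin g → k)} {p : Fin n → Place k K} [hG : Fact (HasGenus k K 1)]

theorem exists_isCurveFrame {ε : Fin n → Fin g → k} (hε : LinearIndependent k ε) :
    ∃ L, IsCurveFrame ε L := by
  obtain ⟨C, hC⟩ := (Fintype.linearCombination k ε).exists_leftInverse_of_injective
    (LinearMap.ker_eq_bot.2 (linearIndependent_iff_injective_fintypeLinearCombination.1 hε))
  refine ⟨fun j => LinearMap.proj j ∘ₗ C, ⟨fun j l => ?_⟩⟩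
  have := LinearMap.congr_fun hC (Pi.single l 1)
  rw [LinearMap.comp_apply, Fintype.linearCombination_apply_single, one_smul, LinearMap.id_apply] at this
  rw [LinearMap.comp_apply, this, LinearMap.proj_apply, Pi.single_apply]

namespace IsSecant
variable (hs : IsSecant γ H Λ p) {L : Fin n → (Fin g → k) →ₗ[k] k}
  {a : Fin n → Fin g → k}

theorem pointAt_eq (hs : IsSecant γ H Λ p) (P : Place k K) :
    pointAt γ P = Submodule.span k {pointVec γ H P} :=
  hs.embedding.pointAt_eq (by have := hs.le; omega) P

theorem eq_smul_of_mem_pointAt (hs : IsSecant γ H Λ p) {P : Place k K} {v : Fin g → k}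
    (hv : v ∈ pointAt γ P) (hv0 : v ≠ 0) : ∃ c : k, c ≠ 0 ∧ v = c • pointVec γ H P := by
  rw [hs.pointAt_eq] at hv
  obtain ⟨c, rfl⟩ := Submodule.mem_span_singleton.1 hv
  exact ⟨c, fun h => hv0 (by rw [h, zero_smul]), rfl⟩

theorem mem_secantPoints (hs : IsSecant γ H Λ p) (l : Fin n) : p l ∈ secantPoints γ Λ := by
  rw [← hs.range_eq]; exact ⟨l, rfl⟩

theorem exists_value_eq (hs : IsSecant γ H Λ p) (ha : IsRationalCurveThrough γ Λ a) (l : Fin n) :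
    ∃ s : Fin 2 → k, ∃ c : k, c ≠ 0 ∧ curveValue a s = c • pointVec γ H (p l) := by
  obtain ⟨s, h0, h1⟩ := ha.2 _ (hs.mem_secantPoints l)
  exact ⟨s, hs.eq_smul_of_mem_pointAt h1 h0⟩

variable (hn : 2 ≤ n) (hL : IsCurveFrame (fun j => pointVec γ H (p j)) L)
  (ha : IsRationalCurveThrough γ Λ a)
include hs hL ha

theorem exists_isTangentPoint {l : Fin n} (hl : secantParameter hn L a l 1 ≠ 0) :
    ∃ x, IsTangentPoint γ a (p l) x := by
  have hdet := hL.det_ne_zero (hs.exists_value_eq ha)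
  obtain ⟨s, h0, h1⟩ := ha.2 _ (hs.mem_secantPoints l)
  obtain ⟨c, hc, hsc⟩ := hs.eq_smul_of_mem_pointAt h1 h0
  have hs1 := (hL.exists_secantParameter_eq hn hdet hc hsc).1.2 hl
  refine ⟨curveDeriv a s, s, h0, h1, ?_, fun hmem => hL.curveDeriv_notMem hn hdet hs1 ?_⟩
  · rw [curveTangent_eq a hs1]
    exact Submodule.subset_span (by simp)
  · rw [hs.pointAt_eq] at hmem
    rwa [hsc, Submodule.span_singleton_smul_eq hc.isUnit]

/-- A tangent point is a combination of the value and the derivative of the curve. The value has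
only an `l`-th coordinate, so the other coordinates are proportional to those of the derivative,
with a nonzero factor. Hence the choice of the point does not matter. -/
theorem exists_smul_deriv {l : Fin n} (hl : secantParameter hn L a l 1 ≠ 0) {x : Fin g → k}
    (hx : IsTangentPoint γ a (p l) x) : x ∈ Λ ∧ (∃ j ≠ l, L j x ≠ 0) ∧ ∃ t : k, t ≠ 0 ∧
      ∀ j ≠ l, L j x = t * L j (curveDeriv a (secantParameter hn L a l)) := by
  have hdet := hL.det_ne_zero (hs.exists_value_eq ha)
  obtain ⟨s, h0, h1, h2, h3⟩ := hx
  obtain ⟨c, hc, hsc⟩ := hs.eq_smul_of_mem_pointAt h1 h0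
  obtain ⟨h4, h5⟩ := hL.exists_secantParameter_eq hn hdet hc hsc
  have hs1 := h4.2 hl
  obtain ⟨μ, hμ, hμs⟩ := h5 hs1
  rw [curveTangent_eq a hs1] at h2
  obtain ⟨A, A', rfl⟩ := Submodule.mem_span_pair.1 h2
  have hxΛ : A • curveValue a s + A' • curveDeriv a s ∈ Λ :=
    add_mem (Submodule.smul_mem _ _ (sum_mem fun j _ => Submodule.smul_mem _ _ (ha.1 j)))
      (Submodule.smul_mem _ _ (sum_mem fun j _ => Submodule.smul_mem _ _ (ha.1 j)))
  refine ⟨hxΛ, ?_, A' * (μ ^ (n - 2))⁻¹, ?_, fun j hj => ?_⟩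
  · by_contra! hcon
    apply h3
    rw [← hs.span_eq] at hxΛ
    rw [hL.eq_sum hxΛ, Finset.sum_eq_single l (fun j _ hj => by rw [hcon j hj, zero_smul])
      (by simp), hs.pointAt_eq]
    exact Submodule.smul_mem _ _ (Submodule.mem_span_singleton_self _)
  · refine mul_ne_zero (fun h => h3 ?_) (inv_ne_zero (pow_ne_zero _ hμ))
    rw [h, zero_smul, add_zero]
    exact Submodule.smul_mem _ _ h1
  · rw [hμs, curveDeriv_smul, map_add, map_smul, map_smul, map_smul, hsc, map_smul, hL.dual,
      if_neg hj]
    simp only [smul_eq_mul, mul_zero, zero_add]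
    rw [mul_assoc, inv_mul_cancel_left₀ (pow_ne_zero _ hμ)]

omit ha

theorem isRationalCurveThrough_interpolatingCurve {τ : Fin n → k} (hτ : Function.Injective τ) :
    IsRationalCurveThrough γ Λ (interpolatingCurve τ fun j => pointVec γ H (p j)) ∧
    ∀ l, curveValue (interpolatingCurve τ fun j => pointVec γ H (p j)) ![τ l, 1] =
      (nodalFactor τ l).eval (τ l) • pointVec γ H (p l) := by
  have hval : ∀ l, curveValue (interpolatingCurve τ fun j => pointVec γ H (p j)) ![τ l, 1] =
      (nodalFactor τ l).eval (τ l) • pointVec γ H (p l) := fun l => by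
    rw [curveValue_interpolatingCurve, Finset.sum_eq_single l]
    · intro j _ hj
      rw [eval_nodalFactor_of_ne τ hj, zero_smul]
    · simp
  refine ⟨⟨fun i => ?_, fun P hP => ?_⟩, hval⟩
  · rw [← hs.span_eq]
    exact sum_mem fun j _ => Submodule.smul_mem _ _ (Submodule.subset_span ⟨j, rfl⟩)
  · rw [← hs.range_eq] at hP
    obtain ⟨l, rfl⟩ := hP
    refine ⟨![τ l, 1], ?_, ?_⟩
    · have : (![τ l, 1] : Fin 2 → k) ≠ 0 := fun h => one_ne_zero (congrFun h 1)
      have hne : pointVec γ H (p l) ≠ 0 :=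
        hs.embedding.pointVec_ne_zero (by have := hs.le; omega) _
      rw [hval]
      exact smul_ne_zero (eval_nodalFactor_self_ne_zero hτ l) hne
    · rw [hval, hs.pointAt_eq]
      exact Submodule.smul_mem _ _ (Submodule.mem_span_singleton_self _)

/-- The interpolating curve realizes the Cauchy coefficients up to the factors allowed by
`IsRigid.rescale`, and it meets the secant points at finite parameters. -/
theorem isRigid_interpolatingCurve {τ : Fin n → k} (hτ : Function.Injective τ) {σ : k}
    (hσ : ∀ j, σ ≠ τ j) {B : Place k K →₀ ℤ} {S : Finset (Place k K)} {z y : Place k K}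
    (h : IsRigid B S p z y (fun l j => (τ l - τ j)⁻¹) fun j => (σ - τ j)⁻¹) :
    (∀ l, secantParameter hn L (interpolatingCurve τ fun j => pointVec γ H (p j)) l 1 ≠ 0) ∧
    IsRigid B S p z y
      (fun l j => L j (curveDeriv (interpolatingCurve τ fun j => pointVec γ H (p j))
        (secantParameter hn L (interpolatingCurve τ fun j => pointVec γ H (p j)) l)))
      fun j => L j (curveValue (interpolatingCurve τ fun j => pointVec γ H (p j)) ![σ, 1]) := by
  obtain ⟨ha, hval⟩ := hs.isRationalCurveThrough_interpolatingCurve hL hτ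
  have hdet := hL.det_ne_zero (hs.exists_value_eq ha)
  have hone : ∀ t : k, (![t, 1] : Fin 2 → k) 1 ≠ 0 := fun t => one_ne_zero
  have hpar := fun l => hL.exists_secantParameter_eq hn hdet
    (eval_nodalFactor_self_ne_zero hτ l) (hval l)
  have hLsum : ∀ (c : Fin n → k) j, L j (∑ l, c l • pointVec γ H (p l)) = c j := fun c j => by
    rw [map_sum, Finset.sum_eq_single j]
    · rw [map_smul, hL.dual, if_pos rfl, smul_eq_mul, mul_one]
    · intro l _ hl
      rw [map_smul, hL.dual, if_neg (Ne.symm hl), smul_zero]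
    · simp
  refine ⟨fun l => (hpar l).1.1 (hone _), h.rescale (fun l => ?_) ⟨∏ m, (σ - τ m), ?_, fun j => ?_⟩⟩
  · obtain ⟨μ, hμ, hμs⟩ := (hpar l).2 (hone _)
    refine ⟨μ ^ (n - 2) * (nodalFactor τ l).eval (τ l),
      mul_ne_zero (pow_ne_zero _ hμ) (eval_nodalFactor_self_ne_zero hτ l), fun j hj => ?_⟩
    rw [hμs, curveDeriv_smul, map_smul, curveDeriv_interpolatingCurve, hLsum,
      eval_derivative_nodalFactor hτ hj, smul_eq_mul, mul_assoc]
  · exact Finset.prod_ne_zero_iff.2 fun m _ => sub_ne_zero.2 (hσ m)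
  · rw [curveValue_interpolatingCurve, hLsum, eval_nodalFactor_eq hσ]

omit hL

theorem exists_open_isStable (hn : 2 ≤ n) :
    ∃ F : MvPolynomial ((Fin n × Fin g) ⊕ Fin 2 ⊕ Fin g) k,
      (∃ (a : Fin n → Fin g → k) (s : Fin 2 → k) (y : Place k K) (v : Fin g → k),
        IsConfiguration γ Λ a s y v ∧ MvPolynomial.eval (configCoords a s v) F ≠ 0) ∧
      ∀ (a : Fin n → Fin g → k) (s : Fin 2 → k) (y : Place k K) (v : Fin g → k),
        IsConfiguration γ Λ a s y v → MvPolynomial.eval (configCoords a s v) F ≠ 0 →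
        (∃ x : Place k K → Fin g → k, ∀ P ∈ secantPoints γ Λ, IsTangentPoint γ a P (x P)) ∧
        ∀ x : Place k K → Fin g → k, (∀ P ∈ secantPoints γ Λ, IsTangentPoint γ a P (x P)) →
          (modifiedPointingBundle γ Λ x y (curveValue a s)).IsStable ∧
          (modifiedPointingBundle γ Λ x y (curveValue a s)).slope =
            (g : ℚ) + 3 + 1 / (n : ℚ) := by
  classical
  have hγ := hs.embedding
  have hng := hs.le
  obtain ⟨L, hL⟩ := exists_isCurveFrame (hγ.linearIndependent_pointVec hs.injective hs.le)
  have := Place.infinite k K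
  obtain ⟨y₀, hy₀⟩ := (Set.finite_range p).infinite_compl.nonempty
  obtain ⟨z, hz⟩ := (((Set.finite_range p).union (Set.finite_singleton y₀)).union
    H.hasFiniteSupport).infinite_compl.nonempty
  obtain ⟨o, ho⟩ := (Set.toFinite {y₀, z}).infinite_compl.nonempty
  simp only [Set.mem_compl_iff, Set.mem_union, Set.mem_singleton_iff, not_or, Set.mem_range,
    not_exists, Function.mem_support, not_not, Set.mem_insert_iff] at hy₀ hz ho
  obtain ⟨⟨hzp, hzy⟩, hHz⟩ := hz
  -- The divisor has degree five, lies below `H` because `g ≥ n + 3 ≥ 5`, and differs from `H` only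
  -- at the auxiliary point `o`, so that the condition at a general `y` remains linear in its
  -- coordinates.
  obtain ⟨B, hBdef⟩ : ∃ B, B = H - Finsupp.single o ((g : ℤ) - 5) := ⟨_, rfl⟩
  have hB : B.degree = 5 := by
    rw [hBdef, map_sub, Finsupp.degree_single, hγ.degree_eq]; ring
  have hBo : ∀ P : Place k K, P ≠ o → B P = H P := fun P hP => by
    rw [hBdef, Finsupp.sub_apply, Finsupp.single_eq_of_ne (by exact hP), sub_zero]
  have hBz : B z = 0 := by rw [hBo z (Ne.symm ho.2), hHz]
  have hBH : B ≤ H := by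
    rw [hBdef, sub_le_self_iff, Finsupp.single_nonneg]; omega
  obtain ⟨τ, σ, S, hτ, hσ, hS, hST, hrigid⟩ := exists_isRigid hn hs.injective hy₀ hzp
    (Ne.symm hzy) hB hBz (Set.toFinite {y₀, z}) (by simp)
  have hSz : z ∉ S := fun h => hST z h (by simp)
  have hSy : y₀ ∉ S := fun h => hST y₀ h (by simp)
  obtain ⟨hpar₀, hrigid₀⟩ := hs.isRigid_interpolatingCurve hn hL hτ hσ hrigid
  let T := (Fin n → Fin g → k) × (Fin 2 → k) × (Fin g → k)
  let co : T → (Fin n × Fin g) ⊕ Fin 2 ⊕ Fin g → k := fun t => configCoords t.1 t.2.1 t.2.2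
  let t₀ : T := (interpolatingCurve τ fun j => pointVec γ H (p j), ![σ, 1], pointVec γ H y₀)
  have hmat : ∀ j i, IsPolynomialIn co fun t => coordMatrix L t.1 j i := fun j i => by
    have : ∀ t : T, coordMatrix L t.1 j i = ∑ x, co t (.inl (i, x)) * L j (Pi.single x 1) := fun t => by
      change L j (t.1 i) = _
      conv_lhs => rw [← Finset.univ_sum_single (t.1 i), map_sum]
      refine Finset.sum_congr rfl fun x _ => ?_
      rw [← mul_one (t.1 i x), ← smul_eq_mul, Pi.single_smul, map_smul, smul_eq_mul]
      rfl
    simp only [this]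
    exact .sum fun x _ => (IsPolynomialIn.coord _).mul (.const _)
  have hpar : ∀ l i, IsPolynomialIn co fun t => secantParameter hn L t.1 l i := fun l i => by
    fin_cases i
    · exact IsPolynomialIn.adjugate hmat _ _
    · exact IsPolynomialIn.adjugate hmat _ _
  have hparam : ∀ i, IsPolynomialIn co fun t => t.2.1 i := fun i =>
    IsPolynomialIn.coord (co := co) (Sum.inr (Sum.inl i))
  have hpoint : ∀ i, IsPolynomialIn co fun t => t.2.2 i := fun i =>
    IsPolynomialIn.coord (co := co) (Sum.inr (Sum.inr i))
  obtain ⟨f, hf, hf₀, hfr⟩ := IsRigid.exists_open (co := co) hγ hBH hBz hSz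
    (c := fun t l j => L j (curveDeriv t.1 (secantParameter hn L t.1 l)))
    (d := fun t j => L j (curveValue t.1 t.2.1)) (v := fun t => t.2.2)
    (fun l j => by
      simp only [apply_curveDeriv, Matrix.mulVec, dotProduct]
      exact .sum fun i _ => (hmat j i).mul
        (((IsPolynomialIn.const _).mul ((hpar l 0).pow _)).mul ((hpar l 1).pow _)))
    (fun j => by
      simp only [apply_curveValue, Matrix.mulVec, dotProduct]
      exact .sum fun i _ => (hmat j i).mul
        (((hparam 0).pow _).mul ((hparam 1).pow _)))
    hpoint (t₀ := t₀) rfl (hBo y₀ (Ne.symm ho.1)) hSy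
    hrigid₀
  -- These are the finitely many positions that `y` has to avoid. Each is excluded by a linear form
  -- that vanishes there and not at `y₀`.
  obtain ⟨X, hX⟩ : ∃ X, X = insert z (insert o (S ∪ Finset.univ.image p)) := ⟨_, rfl⟩
  have hX₀ : ∀ P : X, P.1 ≠ y₀ := by
    rintro ⟨P, hP⟩ rfl
    rw [hX] at hP
    simp only [Finset.mem_insert, Finset.mem_union, Finset.mem_image, Finset.mem_univ,
      true_and] at hP
    rcases hP with h | h | h | ⟨j, h⟩
    exacts [hzy h.symm, ho.1 h.symm, hSy h, hy₀ j h]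
  choose ℓ hℓ hℓ₀ using fun P : X => hγ.exists_separating_form (by omega) (hX₀ P)
  -- The open set is given by rigidity, by finite parameters of the curve at the secant points, and
  -- by the avoidance of the special positions of `y`.
  have hpoly : IsPolynomialIn co fun t => f t * ((∏ l, secantParameter hn L t.1 l 1) *
      ∏ P : X, ∑ i, ℓ P i * t.2.2 i) :=
    hf.mul ((IsPolynomialIn.prod fun l _ => hpar l 1).mul
      (.prod fun P _ => .sum fun i _ => (IsPolynomialIn.const _).mul (hpoint i)))
  obtain ⟨F, hF⟩ := hpoly
  refine ⟨F, ⟨t₀.1, t₀.2.1, y₀, t₀.2.2, ⟨?_, ?_, ?_, ?_⟩, ?_⟩, fun a s y v hconf hFne => ?_⟩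
  · exact (hs.isRationalCurveThrough_interpolatingCurve hL hτ).1
  · exact fun h => one_ne_zero (congrFun h 1)
  · rw [hs.pointAt_eq]; exact Submodule.mem_span_singleton_self _
  · exact hγ.pointVec_ne_zero (by omega) _
  · have := hF t₀
    rw [show MvPolynomial.eval (configCoords t₀.1 t₀.2.1 t₀.2.2) F = _ from this]
    exact mul_ne_zero hf₀ (mul_ne_zero (Finset.prod_ne_zero_iff.2 fun l _ => hpar₀ l)
      (Finset.prod_ne_zero_iff.2 fun P _ => hℓ₀ P))
  rw [show MvPolynomial.eval (configCoords a s v) F = _ from hF (a, s, v)] at hFne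
  have hfne := left_ne_zero_of_mul hFne
  have hpne := Finset.prod_ne_zero_iff.1 (left_ne_zero_of_mul (right_ne_zero_of_mul hFne))
  have hℓne := Finset.prod_ne_zero_iff.1 (right_ne_zero_of_mul (right_ne_zero_of_mul hFne))
  have ha := hconf.curve
  have hl : ∀ l, secantParameter hn L a l 1 ≠ 0 := fun l => hpne l (Finset.mem_univ l)
  have hdet := hL.det_ne_zero (hs.exists_value_eq ha)
  obtain ⟨c, hc, hvc⟩ := hs.eq_smul_of_mem_pointAt hconf.point_mem hconf.point_ne
  have hyX : y ∉ X := fun hyX => hℓne ⟨y, hyX⟩ (Finset.mem_univ _) (by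
    dsimp only
    rw [hvc]
    simp only [Pi.smul_apply, smul_eq_mul, mul_left_comm _ c]
    rw [← Finset.mul_sum, hℓ ⟨y, hyX⟩, mul_zero])
  rw [hX] at hyX
  simp only [Finset.mem_insert, Finset.mem_union, Finset.mem_image, Finset.mem_univ, true_and,
    not_or, not_exists] at hyX
  obtain ⟨hyz, hyo, hyS, hyp⟩ := hyX
  refine ⟨?_, fun x hx => ?_⟩
  · have : ∀ P ∈ secantPoints γ Λ, ∃ x, IsTangentPoint γ a P x := by
      rw [← hs.range_eq]
      rintro _ ⟨l, rfl⟩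
      exact hs.exists_isTangentPoint hn hL ha (hl l)
    choose! x hx using this
    exact ⟨x, hx⟩
  · have hx' := fun l => hs.exists_smul_deriv hn hL ha (hl l) (hx _ (hs.mem_secantPoints l))
    have hqΛ : curveValue a s ∈ Submodule.span k (Set.range fun j => pointVec γ H (p j)) := by
      rw [hs.span_eq]
      exact sum_mem fun j _ => Submodule.smul_mem _ _ (ha.1 j)
    refine hs.isStable_and_slope hn hyp (c := fun l j => L j (x (p l)))
      (d := fun j => L j (curveValue a s)) (fun l => ?_) (fun l => (hx' l).2.1) (hL.eq_sum hqΛ) ?_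
      hzp hyz hHz hB hBz hS (fun s hs h => hSz (h ▸ hs)) ?_
    · exact hL.eq_sum (by rw [hs.span_eq]; exact (hx' l).1)
    · by_contra! hcon
      refine hL.curveValue_ne_zero hn hdet hconf.parameter_ne ?_
      rw [hL.eq_sum hqΛ]
      simp [hcon]
    -- Rigidity is known for the derivatives at the polynomial parameters; rescaling transfers it to
    -- the arbitrary tangent points `x`.
    · exact (hfr (a, s, v) y c hfne hc hvc (hBo y hyo) hyS).rescale (fun l => (hx' l).2.2)
        ⟨1, one_ne_zero, fun j => (one_mul _).symm⟩

end IsSecant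
end Pointing
end

theorem lemma4p4 {k K : Type*} [Field k] [IsAlgClosed k] [Field K] [Algebra k K] (g n : ℕ)
    (γ : Fin g → K) (hE : Pointing.IsEllipticNormalCurve k γ) (hn : 2 ≤ n) (hng : n + 3 ≤ g)
    (Λ : Submodule k (Fin g → k)) (hΛ : Pointing.IsQuasiTransverseSecant γ n Λ) :
    -- a nonempty Zariski-open subset of the (irreducible) space of all triples `(R, q, y)`
    ∃ F : MvPolynomial ((Fin n × Fin g) ⊕ Fin 2 ⊕ Fin g) k,
      (∃ (a : Fin n → Fin g → k) (s : Fin 2 → k) (y : Pointing.Place k K) (v : Fin g → k),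
        Pointing.IsConfiguration γ Λ a s y v ∧
          MvPolynomial.eval (Pointing.configCoords a s v) F ≠ 0) ∧
      ∀ (a : Fin n → Fin g → k) (s : Fin 2 → k) (y : Pointing.Place k K) (v : Fin g → k),
        Pointing.IsConfiguration γ Λ a s y v →
        MvPolynomial.eval (Pointing.configCoords a s v) F ≠ 0 →
        -- the tangent points of `R` at `E ∩ Λ` exist, and any choice of them may be used
        (∃ x : Pointing.Place k K → Fin g → k,
          ∀ P ∈ Pointing.secantPoints γ Λ, Pointing.IsTangentPoint γ a P (x P)) ∧
        ∀ x : Pointing.Place k K → Fin g → k,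
          (∀ P ∈ Pointing.secantPoints γ Λ, Pointing.IsTangentPoint γ a P (x P)) →
          (Pointing.modifiedPointingBundle γ Λ x y (Pointing.curveValue a s)).IsStable ∧
          (Pointing.modifiedPointingBundle γ Λ x y (Pointing.curveValue a s)).slope =
            (g : ℚ) + 3 + 1 / (n : ℚ) := by
  have hK : Fact (Pointing.IsFunctionFieldOfCurve k K) := ⟨hE.1⟩
  have hG : Fact (Pointing.HasGenus k K 1) := ⟨hE.2.1⟩
  obtain ⟨H, p, hs⟩ := hE.exists_isSecant hng hΛ
  exact hs.exists_open_isStable hn
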